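/- **Conventions.** Let $\gamma=(\gamma_1,\dots,\gamma_\ell)$ be a strong composition (finite sequence of positive integers) of $d$. For a weak composition $\alpha\in\mathbb{Z}_{\ge0}^n$ let $\alpha^+$ be the strong composition obtained by deleting zeros, $\mathrm{sort}(\alpha)$ the partition obtained by sorting the positive parts decreasingly, $\lambda'$ the conjugate of $\lambda$, and $\le$ the dominance order on partitions of $d$. *Multiline queues.* A multiline queue of shape $\lambda$ on $n$ columns is a tuple $M=(B_1,\dots,B_L)$, $L=\lambda_1$, of subsets of $\{1,\dots,n\}$ (rows, from bottom to top) with $|B_r|=\lambda'_r$; its weight is $x^M=\prod_r\prod_{b\in B_r}x_b$. The Ferrari–Martin algorithm labels the balls: for $r=L,\dots,2$ every unlabelled ball of row $r$ gets the label $r$; then the balls of row $r$, from the largest label to the smallest and from left to right among equal labels, are paired one at a time with the first unlabelled ball weakly to the right in row $r-1$, cyclically, which takes the same label; finally the unlabelled balls of row $1$ get the label $1$. Then $\mathrm{type}(M)\in\mathbb{Z}_{\ge0}^n$ lists the labels in row $1$ ($0$ for an empty site), $\mathrm{strtype}(M)=\mathrm{type}(M)^+$, and $\mathrm{maj}(M)$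 is the sum of $\ell-r+1$ over all balls, with label $\ell$ in row $r$, whose pairing to row $r-1$ wraps around. $M$ is nonwrapping if $\mathrm{maj}(M)=0$. For a weak composition $\alpha$, the Demazure atom $\mathcal{A}_\alpha(x_1,\dots,x_n)$ is $\sum x^M$ over the nonwrapping multiline queues $M$ of shape $\mathrm{sort}(\alpha)$ with $\mathrm{type}(M)=\alpha$; the quasisymmetric Schur function is $QS_\tau=\sum_{\alpha^+=\tau}\mathcal{A}_\alpha$. The straight multiline queue $M_\tau$ has balls in column $c$ exactly in rows $1,\dots,\tau_c$ (further columns being empty). *Quasisymmetric Macdonald polynomials.* $G_\gamma(x_1,\dots,x_n;q,t)=\sum_{\alpha\in\mathbb{Z}_{\ge0}^n,\ \alpha^+=\gamma}f_\alpha$, where $f_\alpha=E^{\sigma}_{\mathrm{inc}(\alpha)}$ is the ASEP polynomial: $\sigma\in S_n$ is the stable sorting permutation with $\alpha_{\sigma(1)}\le\dots\le\alpha_{\sigma(n)}$, $\mathrm{inc}(\alpha)=(\alpha_{\sigma(1)},\dots,\alpha_{\sigma(n)})$, and $E^\sigma_\mu$ is the permuted-basement Macdonald polynomial $$E^\sigma_\mu(x_1,\dots,x_n;q,t)=\sum_{f}x^f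 q^{\mathrm{maj}(f)}t^{\mathrm{coinv}(f)}\prod_{u:\,f(u)\neq f(d(u))}\frac{1-t}{1-q^{\mathrm{leg}(u)+1}t^{\mathrm{arm}(u)+1}},$$ summed over the non-attacking fillings $f$, with entries in $\{1,\dots,n\}$, of the diagram with $\mu_i$ boxes in column $i$ above a basement (row $0$) with entries $\sigma(1),\dots,\sigma(n)$. Here $d(u)$ is the box below $u$; boxes attack if they are in the same row, or in adjacent rows with the upper one strictly to the right, and non-attacking means that attacking boxes have different entries; for $u$ in column $i$ and row $r$, $\mathrm{leg}(u)=\mu_i-r$, and the arm of $u$ consists of the boxes of row $r$ in columns $i'>i$ with $\mu_{i'}\le\mu_i$ and the boxes of row $r-1$ (basement included) in columns $i'<i$ with $\mu_{i'}<\mu_i$; $\mathrm{maj}(f)=\sum_{f(u)>f(d(u))}(\mathrm{leg}(u)+1)$; and $\mathrm{coinv}(f)$ is the number of pairs of a box $u$ and a box $v$ of its arm such that $f(u),f(v),f(d(u))$ is, up to cyclic rotation, strictly increasing. *Collapsing.* For adjacent rows $i,i+1$ of an array of balls, read the columns from left to right, a ball in row $i+1$ as "(" before a ball in row $i$ as ")",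 and match brackets; let $e_i^\star$ move all unmatched balls of row $i+1$ down to row $i$. Starting from $M_1=M$, put $M_{i+1}=e_1^\star\cdots e_{i-1}^\star e_i^\star M_i$ (with $e_i^\star$ applied first), and $\rho_N(M)=M_L$. The recording tableau $\rho_Q(M)$ starts from one row of $|B_1|$ entries $1$; in the step from $M_i$ to $M_{i+1}$ one appends entries $i+1$: to row $j\le i$ as many as row $j$ gains balls, and to row $i+1$ as many as row $i+1$ of $M_{i+1}$ has balls. The map $\rho=(\rho_N,\rho_Q)$ is a bijection from the multiline queues of shape $\lambda$ on a fixed number of columns onto the pairs $(N,Q)$ of a nonwrapping multiline queue $N$ of some shape $\mu\le\lambda$ on as many columns and a $Q\in\mathrm{SSYT}(\mu',\lambda')$, where $\mathrm{SSYT}(\mu',\lambda')$ is the set of semistandard tableaux of shape $\mu'$ and content $\lambda'$. Let $\mathrm{charge}$ be the Lascoux–Schützenberger charge statistic. **Theorem.** For every strong composition $\gamma$ of $d$ and every $n\ge0$, $$G_\gamma(x_1,\dots,x_n;q,0)=\sum_{\tau:\ \mathrm{sort}(\tau)\le\mathrm{sort}(\gamma)}K_{\gamma,\tau}(q)\,QS_\tau(x_1,\dots,x_n),$$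 summed over strong compositions $\tau$ of $d$, where $$K_{\gamma,\tau}(q)=\sum_{\substack{Q\in\mathrm{SSYT}(\mathrm{sort}(\tau)',\,\mathrm{sort}(\gamma)')\\ \mathrm{strtype}(\rho^{-1}(M_\tau,Q))=\gamma}}q^{\mathrm{charge}(Q)}\in\mathbb{Z}_{\ge0}[q],$$ and for each $\tau$ the multiline queues $M_\tau$ and $\rho^{-1}(M_\tau,Q)$ may be taken on any number of columns that is at least the number of parts of $\tau$. In particular, $G_\gamma(X;q,0)$ expands in the quasisymmetric Schur functions with coefficients in $\mathbb{Z}_{\ge0}[q]$ that do not depend on $n$. -/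

import Mathlib

namespace QuasiMac

/-! ## Compositions and partitions

Partitions are Young diagrams: `rowLen i` is the part `λ_{i+1}`, `colLen r` is the part `λ'_{r+1}`
of the conjugate, `transpose` is conjugation. Strong compositions are Mathlib's `Composition d`;
weak compositions with `n` parts are functions `Fin n → ℕ`. -/

/-- The partition obtained by sorting the positive parts of a finite sequence in weakly decreasing
order (zero parts contribute no cells). -/
def sortDiagram (l : List ℕ) : YoungDiagram :=
  YoungDiagram.ofRowLens (l.mergeSort (· ≥ ·)) List.sortedGE_mergeSort

/-- The compression of a weak composition: delete the zeros. -/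
def compress {n : ℕ} (α : Fin n → ℕ) : List ℕ :=
  (List.ofFn α).filter (· ≠ 0)

/-- Dominance order `μ ≤ lam` for partitions of the same size. -/
def Dominated (μ lam : YoungDiagram) : Prop :=
  μ.card = lam.card ∧
    ∀ k : ℕ, ∑ i ∈ Finset.range k, μ.rowLen i ≤ ∑ i ∈ Finset.range k, lam.rowLen i

/-- The weak compositions `α` with `n` parts whose compression is `γ`. -/
def weakLifts (n : ℕ) {d : ℕ} (γ : Composition d) : Finset (Fin n → ℕ) :=
  ((Finset.univ : Finset (Fin n)).piAntidiag d).filter fun α => compress α = γ.blocks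

/-! ## Multiline queues

A (generalized) multiline queue on `n` columns is given by its rows, from bottom to top; `M r` is
the set of columns containing a ball in row number `r + 1`. -/

/-- Generalized multiline queues on `n` columns. -/
abbrev GMLQ (n : ℕ) : Type := ℕ → Finset (Fin n)

/-- Multiline queues of shape `(lam, n)`: row number `r + 1` has `lam'_{r+1}` balls. In particular
all rows above row number `L = lam_1 = lam.rowLen 0` are empty. -/
def MLQ (lam : YoungDiagram) (n : ℕ) : Set (GMLQ n) :=
  {M | ∀ r, (M r).card = lam.colLen r}

theorem MLQ_finite (lam : YoungDiagram) (n : ℕ) : (MLQ lam n).Finite := by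
  have h0 : ∀ r, lam.rowLen 0 ≤ r → lam.colLen r = 0 := by
    intro r hr
    by_contra h
    have h1 : (0, r) ∈ lam := YoungDiagram.mem_iff_lt_colLen.2 (Nat.pos_of_ne_zero h)
    have h2 := YoungDiagram.mem_iff_lt_rowLen.1 h1
    omega
  refine Set.Finite.of_finite_image
    (f := fun M : GMLQ n => fun r : Fin (lam.rowLen 0) => M r) (Set.toFinite _) ?_
  intro M hM M' hM' h
  funext r
  by_cases hr : r < lam.rowLen 0
  · exact congrFun h ⟨r, hr⟩
  · have h1 := h0 r (by omega)
    have e1 : M r = ∅ := Finset.card_eq_zero.1 ((hM r).trans h1)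
    have e2 : M' r = ∅ := Finset.card_eq_zero.1 ((hM' r).trans h1)
    rw [e1, e2]

section FerrariMartin

variable {n : ℕ}

/-- The order in which the balls of a labelled row are paired: from the largest label `L` to the
smallest, and from left to right among balls with the same label (label `0` is an empty site). -/
def pairOrder (L : ℕ) (lab : Fin n → ℕ) : List (Fin n) :=
  (List.range L).reverse.flatMap fun k => (List.finRange n).filter fun c => lab c = k + 1

/-- The first ball of the row `B`, not in the list `used`, found weakly to the right of column `c`,
wrapping around from the last column to the first. -/
def firstFree (B : Finset (Fin n)) (used : List (Fin n)) (c : Fin n) : Option (Fin n) :=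
  ((List.finRange n).rotate c).find? fun e => e ∈ B ∧ e ∉ used

/-- The Ferrari--Martin pairings from a row with labels `lab` to the row `B` below it, as pairs
(column of the upper ball, column of the lower ball). -/
def pairings (L : ℕ) (lab : Fin n → ℕ) (B : Finset (Fin n)) : List (Fin n × Fin n) :=
  (pairOrder L lab).foldl
    (fun ps c =>
      match firstFree B (ps.map Prod.snd) c with
      | some e => ps ++ [(c, e)]
      | none => ps) []

/-- Labels of the row `M r` (row number `r + 1`) when it and the `k - 1` rows above it are taken
into account. A ball paired from above gets the label of the ball paired to it; a ball that is not
paired from above gets its row number; an empty site gets `0`. -/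
def rowLabels (L : ℕ) (M : GMLQ n) : ℕ → ℕ → Fin n → ℕ
  | 0, _ => fun _ => 0
  | k + 1, r => fun e =>
      if e ∈ M r then
        match (pairings L (rowLabels L M k (r + 1)) (M r)).find? (fun p => p.2 = e) with
        | some p => rowLabels L M k (r + 1) p.1
        | none => r + 1
      else 0

/-- The labelling `L_M` of a multiline queue with rows numbered `1, …, L`: the labels of row number
`r + 1`. -/
def fmLabel (L : ℕ) (M : GMLQ n) (r : ℕ) : Fin n → ℕ :=
  rowLabels L M (L - r) r

/-- The type: the labels of the bottom row. -/
def mlqType (L : ℕ) (M : GMLQ n) : Fin n → ℕ :=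
  fmLabel L M 0

/-- The strong type. -/
def strType (L : ℕ) (M : GMLQ n) : List ℕ :=
  compress (mlqType L M)

/-- The major index: a ball with label `ℓ` in row number `r + 2` which wraps when paired to row
number `r + 1` contributes `ℓ - (r + 2) + 1`. -/
def mlqMaj (L : ℕ) (M : GMLQ n) : ℕ :=
  ∑ r ∈ Finset.range (L - 1),
    (((pairings L (fmLabel L M (r + 1)) (M r)).filter fun p => p.2 < p.1).map
      fun p => fmLabel L M (r + 1) p.1 - (r + 1)).sum

end FerrariMartin

/-- `NMLQ[α]`: nonwrapping multiline queues (major index zero) of type `α`. -/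
def NMLQ {n : ℕ} (α : Fin n → ℕ) : Set (GMLQ n) :=
  {M | M ∈ MLQ (sortDiagram (List.ofFn α)) n ∧
    mlqMaj ((sortDiagram (List.ofFn α)).rowLen 0) M = 0 ∧
    mlqType ((sortDiagram (List.ofFn α)).rowLen 0) M = α}

theorem NMLQ_finite {n : ℕ} (α : Fin n → ℕ) : (NMLQ α).Finite :=
  (MLQ_finite _ _).subset fun _ h => h.1

/-- The monomial `x^M` of a multiline queue with `L` rows. -/
noncomputable def mlqMonomial (F : Type*) [CommSemiring F] {n : ℕ} (L : ℕ) (M : GMLQ n) :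
    MvPolynomial (Fin n) F :=
  ∏ r ∈ Finset.range L, ∏ b ∈ M r, MvPolynomial.X b

/-- The Demazure atom `𝒜_α(x_1, …, x_n)`. -/
noncomputable def demazureAtom (F : Type*) [CommSemiring F] {n : ℕ} (α : Fin n → ℕ) :
    MvPolynomial (Fin n) F :=
  ∑ M ∈ (NMLQ_finite α).toFinset, mlqMonomial F ((sortDiagram (List.ofFn α)).rowLen 0) M

/-- The quasisymmetric Schur function `QS_γ(x_1, …, x_n)`. -/
noncomputable def quasiSchur (F : Type*) [CommSemiring F] (n : ℕ) {d : ℕ} (γ : Composition d) :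
    MvPolynomial (Fin n) F :=
  ∑ α ∈ weakLifts n γ, demazureAtom F α

/-! ## Permuted-basement Macdonald polynomials

The diagram of `μ : Fin n → ℕ` has `μ i` boxes in column `i`, columns from left to right, with rows
numbered from bottom to top starting with `1`; row `0` is the basement, filled with
`σ 0, …, σ (n - 1)`. A filling `f` has the entry `f i j` in column `i`, row number `j + 1`. -/

section Fillings

variable {n : ℕ} {μ : Fin n → ℕ}

/-- Fillings of the diagram of `μ` with entries in `Fin n`. -/
abbrev Filling (μ : Fin n → ℕ) : Type := (i : Fin n) → Fin (μ i) → Fin n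

/-- The entry of the augmented filling in column `i` and row number `j` (with `j ≤ μ i`); row `0` is
the basement. -/
def augmented (σ : Equiv.Perm (Fin n)) (f : Filling μ) (i : Fin n) : ℕ → Fin n
  | 0 => σ i
  | j + 1 => if h : j < μ i then f i ⟨j, h⟩ else σ i

/-- Attacking boxes have different entries. Two boxes attack each other if they are in the same row,
or if they are in adjacent rows with the upper box strictly to the right of the lower box. -/
def NonAttacking (σ : Equiv.Perm (Fin n)) (f : Filling μ) : Prop :=
  (∀ i i' : Fin n, i ≠ i' → ∀ j < μ i, j < μ i' →
    augmented σ f i (j + 1) ≠ augmented σ f i' (j + 1)) ∧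
  (∀ i' i : Fin n, i' < i → ∀ j < μ i, j ≤ μ i' →
    augmented σ f i (j + 1) ≠ augmented σ f i' j)

/-- The leg of the box in column `i`, row number `j + 1`. -/
def leg (μ : Fin n → ℕ) (i : Fin n) (j : ℕ) : ℕ := μ i - (j + 1)

/-- Arm boxes in the same row as the box `(i, j + 1)`: to its right, in columns weakly shorter. -/
def armRight (μ : Fin n → ℕ) (i : Fin n) (j : ℕ) : Finset (Fin n) :=
  Finset.univ.filter fun i' => i < i' ∧ j < μ i' ∧ μ i' ≤ μ i

/-- Arm boxes in the row below the box `(i, j + 1)`: to its left, in columns strictly shorter. -/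
def armLeft (μ : Fin n → ℕ) (i : Fin n) (j : ℕ) : Finset (Fin n) :=
  Finset.univ.filter fun i' => i' < i ∧ j ≤ μ i' ∧ μ i' < μ i

/-- The arm of the box in column `i`, row number `j + 1`. -/
def arm (μ : Fin n → ℕ) (i : Fin n) (j : ℕ) : ℕ := (armRight μ i j).card + (armLeft μ i j).card

/-- The entries `a, b, c` are cyclically strictly increasing. -/
def Cyc (a b c : Fin n) : Prop := (a < b ∧ b < c) ∨ (b < c ∧ c < a) ∨ (c < a ∧ a < b)

instance (a b c : Fin n) : Decidable (Cyc a b c) := by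
  unfold Cyc; infer_instance

/-- The major index of a filling: the sum of `leg + 1` over the descents, the boxes whose entry is
larger than the one directly below. -/
def fillMaj (σ : Equiv.Perm (Fin n)) (f : Filling μ) : ℕ :=
  ∑ i : Fin n, ∑ j ∈ Finset.range (μ i),
    if augmented σ f i j < augmented σ f i (j + 1) then leg μ i j + 1 else 0

/-- The number of coinversion triples: a triple consists of a box `u`, the box directly below it,
and a box `v` of the arm of `u`. -/
def coinv (σ : Equiv.Perm (Fin n)) (f : Filling μ) : ℕ :=
  ∑ i : Fin n, ∑ j ∈ Finset.range (μ i),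
    (((armRight μ i j).filter fun i' =>
        Cyc (augmented σ f i (j + 1)) (augmented σ f i' (j + 1)) (augmented σ f i j)).card +
      ((armLeft μ i j).filter fun i' =>
        Cyc (augmented σ f i (j + 1)) (augmented σ f i' j) (augmented σ f i j)).card)

/-- The coefficient in `q, t` attached to a filling. The denominators `1 - q^a t^b` have `b ≥ 1`, so
that they are equal to `1` at `t = 0`. -/
def fillWeight {F : Type*} [Field F] (q t : F) (σ : Equiv.Perm (Fin n)) (f : Filling μ) : F :=
  q ^ fillMaj σ f * t ^ coinv σ f *
    ∏ i : Fin n, ∏ j ∈ Finset.range (μ i),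
      if augmented σ f i (j + 1) ≠ augmented σ f i j then
        (1 - t) / (1 - q ^ (leg μ i j + 1) * t ^ (arm μ i j + 1))
      else 1

end Fillings

open Classical in
/-- The permuted-basement Macdonald polynomial `E_μ^σ(x_1, …, x_n; q, t)`, for parameters `q, t` in
a field. -/
noncomputable def permutedBasement {F : Type*} [Field F] (q t : F) {n : ℕ} (μ : Fin n → ℕ)
    (σ : Equiv.Perm (Fin n)) : MvPolynomial (Fin n) F :=
  ∑ f : Filling μ with NonAttacking σ f,
    MvPolynomial.C (fillWeight q t σ f) * ∏ i : Fin n, ∏ j : Fin (μ i), MvPolynomial.X (f i j)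

/-- The ASEP polynomial `f_α = E_{inc(α)}^σ`, where `inc(α) = α ∘ σ` is weakly increasing. -/
noncomputable def asepPoly {F : Type*} [Field F] (q t : F) {n : ℕ} (α : Fin n → ℕ) :
    MvPolynomial (Fin n) F :=
  permutedBasement q t (α ∘ Tuple.sort α) (Tuple.sort α)

/-- The quasisymmetric Macdonald polynomial `G_γ(x_1, …, x_n; q, t)`. -/
noncomputable def quasiMacdonald {F : Type*} [Field F] (q t : F) (n : ℕ) {d : ℕ}
    (γ : Composition d) : MvPolynomial (Fin n) F :=
  ∑ α ∈ weakLifts n γ, asepPoly q t α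

/-! ## Semistandard tableaux and charge -/

/-- Semistandard tableaux of shape `μ` with positive entries and content `ν`: the entry `k + 1`
occurs `ν_{k+1}` times. -/
def ssytSet (μ ν : YoungDiagram) : Set (SemistandardYoungTableau μ) :=
  {T | (∀ c ∈ μ.cells, 0 < T c.1 c.2) ∧
    ∀ k : ℕ, (μ.cells.filter fun c => T c.1 c.2 = k + 1).card = ν.rowLen k}

theorem ssytSet_finite (μ ν : YoungDiagram) : (ssytSet μ ν).Finite := by
  have hb : ∀ T ∈ ssytSet μ ν, ∀ c ∈ μ.cells, T c.1 c.2 ≤ ν.colLen 0 := by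
    intro T hT c hc
    have hpos := hT.1 c hc
    have hk := hT.2 (T c.1 c.2 - 1)
    have hmem : c ∈ μ.cells.filter fun c' => T c'.1 c'.2 = T c.1 c.2 - 1 + 1 :=
      Finset.mem_filter.2 ⟨hc, by omega⟩
    have h1 : 0 < ν.rowLen (T c.1 c.2 - 1) := by
      rw [← hk]
      exact Finset.card_pos.2 ⟨c, hmem⟩
    have h2 := YoungDiagram.mem_iff_lt_colLen.1 (YoungDiagram.mem_iff_lt_rowLen.2 h1)
    omega
  refine Set.Finite.of_finite_image
    (f := fun T : SemistandardYoungTableau μ => fun c : μ.cells =>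
      (Fin.ofNat (ν.colLen 0 + 1) (T c.1.1 c.1.2))) (Set.toFinite _) ?_
  intro T hT T' hT' h
  ext i j
  by_cases hc : (i, j) ∈ μ
  · have h1 := congrArg Fin.val (congrFun h ⟨(i, j), hc⟩)
    have b1 : T i j ≤ ν.colLen 0 := hb T hT (i, j) hc
    have b2 : T' i j ≤ ν.colLen 0 := hb T' hT' (i, j) hc
    simp only [Fin.ofNat] at h1
    rwa [Nat.mod_eq_of_lt (by omega), Nat.mod_eq_of_lt (by omega)] at h1
  · rw [T.zeros hc, T'.zeros hc]

/-- The finite set `SSYT(μ, ν)`. -/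
noncomputable def SSYT (μ ν : YoungDiagram) : Finset (SemistandardYoungTableau μ) :=
  (ssytSet_finite μ ν).toFinset

/-- The reading word of a filling of `μ`: each row from right to left, starting with the row of the
smallest entries (the first, and longest, row). -/
def readingWord (μ : YoungDiagram) (T : ℕ → ℕ → ℕ) : List ℕ :=
  (List.range (μ.colLen 0)).flatMap fun i => ((List.range (μ.rowLen i)).map (T i)).reverse

/-- Extraction of one standard subword from a word, given as the list `w` of its remaining letters
`(letter, position)` in increasing order of position. We look for the letter `k`, at the first
position `≥ p` if there is one, and otherwise, going back to the beginning of the word and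
increasing the index by one, at the first position; this goes on with `k + 1` to the right of the
chosen letter until the required letter does not occur. The result is the sum of the indices of the
chosen letters and the word without them. -/
def chargeRound : ℕ → List (ℕ × ℕ) → ℕ → ℕ → ℕ → ℕ × List (ℕ × ℕ)
  | 0, w, _, _, _ => (0, w)
  | fuel + 1, w, k, p, idx =>
      match w.find? (fun a => a.1 = k ∧ p ≤ a.2) with
      | some a =>
          let s := chargeRound fuel (w.erase a) (k + 1) (a.2 + 1) idx
          (idx + s.1, s.2)
      | none =>
          match w.find? (fun a => a.1 = k) with
          | some a =>
              let s := chargeRound fuel (w.erase a) (k + 1) (a.2 + 1) (idx + 1)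
              (idx + 1 + s.1, s.2)
          | none => (0, w)

/-- Sum of the charges of the standard subwords, extracted one after the other. -/
def chargeAux : ℕ → List (ℕ × ℕ) → ℕ
  | 0, _ => 0
  | fuel + 1, w =>
      let s := chargeRound w.length w 1 0 0
      s.1 + chargeAux fuel s.2

/-- The Lascoux--Schützenberger charge of a word whose content is a partition. -/
def wordCharge (w : List ℕ) : ℕ := chargeAux w.length w.zipIdx

/-- The charge of a semistandard tableau. -/
def charge {μ : YoungDiagram} (T : SemistandardYoungTableau μ) : ℕ :=
  wordCharge (readingWord μ T)

/-! ## The collapsing map -/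

section Collapse

variable {n : ℕ}

/-- The balls of `upper` which are unmatched in the bracket word of two adjacent rows: columns are
scanned from left to right; within a column the ball of `upper`, an opening bracket, is read before
the ball of `lower`, a closing bracket. The list is the stack of currently unmatched opening
brackets. -/
def unmatchedUpper (lower upper : Finset (Fin n)) : List (Fin n) :=
  (List.finRange n).foldl
    (fun stack c =>
      let s := if c ∈ upper then c :: stack else stack
      if c ∈ lower then s.tail else s) []

/-- The operator dropping all unmatched balls of row number `i + 2` to row number `i + 1`. -/
def drop (i : ℕ) (M : GMLQ n) : GMLQ n := fun r =>
  if r = i then M i ∪ (unmatchedUpper (M i) (M (i + 1))).toFinset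
  else if r = i + 1 then M (i + 1) \ (unmatchedUpper (M i) (M (i + 1))).toFinset
  else M r

/-- The composition of dropping operators, first from row number `k + 1` to `k`, then from `k` to
`k - 1`, …, and last from `2` to `1`. -/
def sweep : ℕ → GMLQ n → GMLQ n
  | 0, M => M
  | k + 1, M => sweep k (drop k M)

/-- The intermediate multiline queue `M_{k+1}` of the collapsing procedure. -/
def collapseStep (M : GMLQ n) : ℕ → GMLQ n
  | 0 => M
  | k + 1 => sweep (k + 1) (collapseStep M k)

/-- The rows of the intermediate recording tableau `Q_{k+1}`; the list with index `j` is row number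
`j + 1`. -/
def recordStep (M : GMLQ n) : ℕ → ℕ → List ℕ
  | 0, j => if j = 0 then List.replicate (M 0).card 1 else []
  | k + 1, j =>
      recordStep M k j ++
        List.replicate
          (if j < k + 1 then (collapseStep M (k + 1) j).card - (collapseStep M k j).card
            else if j = k + 1 then (collapseStep M (k + 1) j).card else 0)
          (k + 2)

/-- `ρ_N(M)` for a multiline queue with `L` rows. -/
def rhoN (L : ℕ) (M : GMLQ n) : GMLQ n := collapseStep M (L - 1)

/-- `ρ_Q(M)` for a multiline queue with `L` rows, as a function of (row, column), equal to `0`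
outside the shape. -/
def rhoQ (L : ℕ) (M : GMLQ n) (i j : ℕ) : ℕ := (recordStep M (L - 1) i).getD j 0

/-- The straight multiline queue `M_τ` on `N` columns: column `c` has balls exactly in the rows
numbered `1, …, τ_c`, and columns after the last part of `τ` are empty. -/
def straight (N : ℕ) (τ : List ℕ) : GMLQ N := fun r =>
  Finset.univ.filter fun c : Fin N => r < τ.getD c 0

end Collapse

open Classical in
/-- The quasisymmetric Kostka--Foulkes polynomial `K_{γ,τ}(q)`, with multiline queues drawn on `N`
columns (for `N` at least the number of parts of `τ`): the charge generating function of the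
`Q ∈ SSYT(sort(τ)', sort(γ)')` such that the multiline queue `M = ρ⁻¹(M_τ, Q)` of shape `sort(γ)`
has strong type `γ`. -/
noncomputable def quasiKostka (N : ℕ) {d : ℕ} (γ τ : Composition d) : Polynomial ℕ :=
  ∑ Q ∈ SSYT (sortDiagram τ.blocks).transpose (sortDiagram γ.blocks).transpose with
    ∃ M ∈ MLQ (sortDiagram γ.blocks) N,
      rhoN ((sortDiagram γ.blocks).rowLen 0) M = straight N τ.blocks ∧
      (∀ i j, rhoQ ((sortDiagram γ.blocks).rowLen 0) M i j = Q i j) ∧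
      strType ((sortDiagram γ.blocks).rowLen 0) M = γ.blocks,
    Polynomial.X ^ charge Q

end QuasiMac

namespace QuasiMac

/-! ## Bracketing of two sets -/

/-! At `t = 0` all denominators become `1` and only the fillings without coinversions survive
(`fillWeight_zero`). The columns of such a filling trace the paths of the balls of a multiline queue
under the Ferrari–Martin pairing (`rowsGood_iff`, `exists_rowsGood`), descents being wrappings.
Hence `G_γ(x;q,0)` is the sum of `q^maj(M) x^M` over the multiline queues of strong type `γ`
(`asepPoly_zero`, `quasiMacdonald_zero`). Collapsing `M ↦ (N, Q)` is a bijection that moves balls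
only inside columns, so it preserves `x^M`. The expansion therefore follows from two facts: `maj(M)
= charge(Q)`, and the strong type of `M` depends only on `Q` and on the strong type of `N`. By the
second one the queues `N` of strong type `τ` may be summed to `QS_τ`, while the condition on `Q` is
tested on `M_τ`, on any number of columns.

Both facts come from a double crystal structure on arrays of balls. Bracketing two adjacent rows
gives operators that lower or raise one unmatched ball; bracketing two adjacent columns gives
operators that move one ball sideways; the two kinds commute (`fCol_onRows_eP`, `fCol_onRows_fP`).
Collapsing and labelling both belong to the rows. A drop is a maximal power of the lowering operator
(`iterate_eP_of_card_le`). The balls with label above `k` are obtained from row `k` by exchanges of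
adjacent rows, that is, by the reflections of the crystal, and the number of wrappings is the
maximal excess of the bracketing; this is seen by viewing a pairing as a cyclic queue
(`IsQueue.swapP_eq`, `IsQueue.eps_eq`). Column operators lead every array to a column-highest one
(`exists_colHigh`), which is the array of a tableau, and this tableau is the recording tableau `Q`
(`arrOf_patt`, `collA_arrOf`).

For the charge: `maj` is invariant under column operators (`majA_fWord`), so it depends only on `Q`
and may be computed on any array with recording tableau `Q`, for instance on the one whose columns
are the reversed positions of the reading word of `Q`. There `maj` pairs greedily from row `k` down
to the bottom, whereas charge extracts subwords greedily from the letter `1` upwards. A greedy chain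
minimizes the total number of wrappings (`sum_le_of_isQueue`), so the two totals agree
(`sum_eps_labAt_eq`).

For the strong type: when one more row is collapsed, each set of balls with large labels arises from
sets of the next stage by deleting the rightmost elements of a difference, the number deleted being
dictated by `Q` (`cut_lab`). Going backwards from `N`, these sets are thus determined by relative
order and cardinality alone, and an order isomorphism between the occupied columns of two collapsed
queues carries over to the original queues (`image_lab_collA`, `image_lab`). -/

/-- The excess of `U` over `V` weakly to the right of `x`. -/
def exc (U V : Finset ℕ) (x : ℕ) : ℤ :=
  ((U.filter fun y => x ≤ y).card : ℤ) - ((V.filter fun y => x ≤ y).card : ℤ)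

theorem card_filter_ge_step (U : Finset ℕ) (x : ℕ) :
    ((U.filter fun y => x ≤ y).card : ℤ) =
      ((U.filter fun y => x + 1 ≤ y).card : ℤ) + if x ∈ U then 1 else 0 := by
  by_cases hx : x ∈ U
  · have : (U.filter fun y => x ≤ y) = insert x (U.filter fun y => x + 1 ≤ y) := by
      ext y
      simp only [Finset.mem_filter, Finset.mem_insert]
      constructor
      · rintro ⟨h1, h2⟩
        by_cases h : y = x
        · exact Or.inl h
        · exact Or.inr ⟨h1, by omega⟩
      · rintro (rfl | ⟨h1, h2⟩)
        · exact ⟨hx, le_rfl⟩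
        · exact ⟨h1, by omega⟩
    rw [this, Finset.card_insert_of_notMem (by simp)]
    simp [hx]
  · have : (U.filter fun y => x ≤ y) = (U.filter fun y => x + 1 ≤ y) := by
      refine Finset.filter_congr fun y hy => ?_
      have : y ≠ x := fun h => hx (h ▸ hy)
      omega
    rw [this]
    simp [hx]

theorem exc_step (U V : Finset ℕ) (x : ℕ) :
    exc U V x = exc U V (x + 1) + (if x ∈ U then 1 else 0) - (if x ∈ V then 1 else 0) := by
  unfold exc
  rw [card_filter_ge_step U x, card_filter_ge_step V x]
  ring

theorem exc_zero (U V : Finset ℕ) : exc U V 0 = (U.card : ℤ) - V.card := by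
  simp [exc]

theorem exc_of_bound {U V : Finset ℕ} {x : ℕ} (hU : ∀ y ∈ U, y < x) (hV : ∀ y ∈ V, y < x) :
    exc U V x = 0 := by
  have h1 : (U.filter fun y => x ≤ y) = ∅ :=
    Finset.filter_eq_empty_iff.2 fun y hy => by have := hU y hy; omega
  have h2 : (V.filter fun y => x ≤ y) = ∅ :=
    Finset.filter_eq_empty_iff.2 fun y hy => by have := hV y hy; omega
  simp [exc, h1, h2]

theorem exists_bound (U V : Finset ℕ) : ∃ X, ∀ x, X ≤ x → exc U V x = 0 := by
  refine ⟨(U ∪ V).sup id + 1, fun x hx => exc_of_bound ?_ ?_⟩ <;>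
  · intro y hy
    have : id y ≤ (U ∪ V).sup id := Finset.le_sup (by simp [hy])
    simp only [id] at this
    omega

theorem card_filter_ge_erase {U : Finset ℕ} {p : ℕ} (hp : p ∈ U) (x : ℕ) :
    (((U.erase p).filter fun y => x ≤ y).card : ℤ) =
      ((U.filter fun y => x ≤ y).card : ℤ) - if x ≤ p then 1 else 0 := by
  rw [Finset.filter_erase]
  by_cases h : x ≤ p
  · have hm : p ∈ U.filter fun y => x ≤ y := by simp [hp, h]
    have := Finset.card_erase_add_one hm
    simp only [h, if_true]
    omega
  · rw [Finset.erase_eq_of_notMem (by simp [h])]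
    simp [h]

theorem card_filter_ge_insert {U : Finset ℕ} {p : ℕ} (hp : p ∉ U) (x : ℕ) :
    (((insert p U).filter fun y => x ≤ y).card : ℤ) =
      ((U.filter fun y => x ≤ y).card : ℤ) + if x ≤ p then 1 else 0 := by
  have := card_filter_ge_erase (Finset.mem_insert_self p U) x
  rw [Finset.erase_insert hp] at this
  omega

theorem exc_move {U V : Finset ℕ} {p : ℕ} (h1 : p ∈ U) (h2 : p ∉ V) (x : ℕ) :
    exc (U.erase p) (insert p V) x = exc U V x - if x ≤ p then 2 else 0 := by
  unfold exc
  rw [card_filter_ge_erase h1, card_filter_ge_insert h2]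
  split_ifs <;> ring

/-- The position of the leftmost unmatched element of `U`, where elements of `U` are opening and
elements of `V` closing brackets. -/
def IsTop (U V : Finset ℕ) (p : ℕ) : Prop :=
  (∀ x, p < x → exc U V x < exc U V p) ∧ ∀ x, x < p → exc U V x ≤ exc U V p

/-- The position of the rightmost unmatched element of `V`. -/
def IsBot (U V : Finset ℕ) (p : ℕ) : Prop :=
  p ∈ V ∧ p ∉ U ∧ (∀ x, x ≤ p → exc U V x ≤ exc U V p) ∧
    ∀ x, p < x → exc U V x ≤ exc U V (p + 1)

theorem mem_of_exc_lt {U V : Finset ℕ} {p : ℕ} (h : exc U V (p + 1) < exc U V p) :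
    p ∈ U ∧ p ∉ V := by
  have := exc_step U V p
  by_cases h1 : p ∈ U <;> by_cases h2 : p ∈ V <;> simp [h1, h2] at this ⊢ <;> omega

theorem IsTop.mem {U V : Finset ℕ} {p : ℕ} (h : IsTop U V p) : p ∈ U :=
  (mem_of_exc_lt (h.1 (p + 1) (by omega))).1

theorem IsTop.notMem {U V : Finset ℕ} {p : ℕ} (h : IsTop U V p) : p ∉ V :=
  (mem_of_exc_lt (h.1 (p + 1) (by omega))).2

theorem IsTop.unique {U V : Finset ℕ} {p p' : ℕ} (h : IsTop U V p) (h' : IsTop U V p') :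
    p = p' := by
  rcases lt_trichotomy p p' with hl | hl | hl
  · have := h.1 _ hl; have := h'.2 _ hl; omega
  · exact hl
  · have := h.2 _ hl; have := h'.1 _ hl; omega

/-- Moving `p` lowers the excess by `2` weakly to the left of `p` and nowhere else. The maximum, now
smaller by one, is first attained at `p + 1`, so `p` becomes the rightmost unmatched closing
bracket. This makes `fP` the inverse of `eP`. -/
theorem IsTop.isBot {U V : Finset ℕ} {p : ℕ} (h : IsTop U V p) :
    IsBot (U.erase p) (insert p V) p := by
  refine ⟨by simp, by simp, fun x hx => ?_, fun x hx => ?_⟩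
  · rw [exc_move h.mem h.notMem, exc_move h.mem h.notMem]
    rcases hx.lt_or_eq with hl | rfl
    · have := h.2 x hl
      simp only [hx, if_true, le_refl]; omega
    · simp
  · have h1 := h.1 x hx
    have h2 := h.1 (p + 1) (by omega)
    have h3 := exc_step U V p
    simp only [h.mem, h.notMem, if_true, if_false] at h3
    rw [exc_move h.mem h.notMem, exc_move h.mem h.notMem, if_neg (by omega), if_neg (by omega)]
    omega

theorem IsBot.isTop {U V : Finset ℕ} {p : ℕ} (h : IsBot U V p) :
    IsTop (insert p U) (V.erase p) p := by
  obtain ⟨hV, hU, h1, h2⟩ := h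
  have key : ∀ x, exc (insert p U) (V.erase p) x = exc U V x + if x ≤ p then 2 else 0 := by
    intro x
    unfold exc
    rw [card_filter_ge_erase hV, card_filter_ge_insert hU]
    split_ifs <;> ring
  have h3 := exc_step U V p
  simp only [hV, hU, if_true, if_false] at h3
  refine ⟨fun x hx => ?_, fun x hx => ?_⟩
  · have := h2 x hx
    rw [key, key, if_neg (by omega), if_pos le_rfl]
    omega
  · have := h1 x hx.le
    rw [key, key, if_pos hx.le, if_pos le_rfl]
    omega

theorem IsBot.unique {U V : Finset ℕ} {p p' : ℕ} (h : IsBot U V p) (h' : IsBot U V p') :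
    p = p' := by
  obtain ⟨a1, a2, a3, a4⟩ := h
  obtain ⟨b1, b2, b3, b4⟩ := h'
  have h3 := exc_step U V p
  have h3' := exc_step U V p'
  simp only [a1, a2, b1, b2, if_true, if_false] at h3 h3'
  rcases lt_trichotomy p p' with hl | hl | hl
  · have := a4 (p' + 1) (by omega); have := b3 (p + 1) (by omega); omega
  · exact hl
  · have := b4 (p + 1) (by omega); have := a3 (p' + 1) (by omega); omega

/-- The largest argument where a positive excess is maximal. -/
theorem exists_isTop {U V : Finset ℕ} {x : ℕ} (hx : 0 < exc U V x) : ∃ p, IsTop U V p := by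
  obtain ⟨X, hX⟩ := exists_bound U V
  have hxX : x < X := by
    by_contra h
    rw [hX x (by omega)] at hx
    exact lt_irrefl _ hx
  obtain ⟨y, hy, hmax⟩ := (Finset.range X).exists_max_image (exc U V) ⟨x, by simpa using hxX⟩
  have hpos : 0 < exc U V y := hx.trans_le (hmax x (by simpa using hxX))
  set s := (Finset.range X).filter fun z => exc U V z = exc U V y with hs
  have hne : s.Nonempty := ⟨y, by simp [hs, Finset.mem_range.1 hy]⟩
  have hp := s.max'_mem hne
  set p := s.max' hne with hpd
  simp only [hs, Finset.mem_filter, Finset.mem_range] at hp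
  have hle : ∀ z, exc U V z ≤ exc U V y := fun z => by
    by_cases hz : z < X
    · exact hmax z (by simpa using hz)
    · rw [hX z (by omega)]; exact hpos.le
  refine ⟨p, fun z hz => ?_, fun z _ => ?_⟩
  · rw [hp.2]
    refine lt_of_le_of_ne (hle z) fun he => ?_
    have hzX : z < X := by
      by_contra h
      rw [hX z (by omega)] at he
      omega
    have : z ≤ p := s.le_max' z (by simp [hs, hzX, he])
    omega
  · rw [hp.2]; exact hle z

theorem IsTop.exc_pos {U V : Finset ℕ} {p : ℕ} (h : IsTop U V p) : 0 < exc U V p := by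
  obtain ⟨X, hX⟩ := exists_bound U V
  have := h.1 (max X (p + 1)) (by omega)
  rwa [hX _ (by omega)] at this

theorem exists_isTop_iff {U V : Finset ℕ} : (∃ p, IsTop U V p) ↔ ¬ ∀ x, exc U V x ≤ 0 := by
  constructor
  · rintro ⟨p, hp⟩ h
    have := hp.exc_pos
    have := h p
    omega
  · intro h
    push Not at h
    obtain ⟨x, hx⟩ := h
    exact exists_isTop hx

/-- The rightmost unmatched closing bracket sits immediately before the first point where the excess
is maximal; it is missing exactly when this first point is `0`. -/
theorem exists_isBot_iff {U V : Finset ℕ} :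
    (∃ p, IsBot U V p) ↔ ¬ ∀ x, exc U V x ≤ exc U V 0 := by
  constructor
  · rintro ⟨p, h1, h2, h3, h4⟩ h
    have := h (p + 1)
    have h5 := h3 0 (by omega)
    have h6 := exc_step U V p
    simp only [h1, h2, if_true, if_false] at h6
    omega
  · intro h
    push Not at h
    obtain ⟨x, hx⟩ := h
    obtain ⟨X, hX⟩ := exists_bound U V
    obtain ⟨y, hy, hmax⟩ := (Finset.range (X + x + 1)).exists_max_image (exc U V) ⟨x, by simp⟩
    have hle : ∀ z, exc U V z ≤ exc U V y := fun z => by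
      by_cases hz : z < X + x + 1
      · exact hmax z (by simpa using hz)
      · rw [hX z (by omega), ← hX (X + x) (by omega)]
        exact hmax _ (by simp)
    have hex : ∃ z, exc U V z = exc U V y := ⟨y, rfl⟩
    have hspec := Nat.find_spec hex
    have hmin : ∀ z, z < Nat.find hex → exc U V z < exc U V y := fun z hz =>
      lt_of_le_of_ne (hle z) (Nat.find_min hex hz)
    rcases hq : Nat.find hex with _ | p
    · rw [hq] at hspec
      have := hle x
      omega
    · rw [hq] at hspec hmin
      have h6 := exc_step U V p
      have h7 := hmin p (by omega)
      have hm : p ∈ V ∧ p ∉ U := by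
        by_cases h1 : p ∈ U <;> by_cases h2 : p ∈ V <;> simp [h1, h2] at h6 ⊢ <;> omega
      simp only [hm.1, hm.2, if_true, if_false] at h6
      refine ⟨p, hm.1, hm.2, fun z hz => ?_, fun z _ => ?_⟩
      · have := hmin z (by omega)
        omega
      · rw [hspec]; exact hle z

/-! ### Lowering and raising operators on a pair of sets. -/

open Classical in
/-- Lower the leftmost unmatched element of the upper set, if there is one. -/
noncomputable def eP (s : Finset ℕ × Finset ℕ) : Finset ℕ × Finset ℕ :=
  if h : ∃ p, IsTop s.1 s.2 p then (s.1.erase h.choose, insert h.choose s.2) else s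

open Classical in
/-- Raise the rightmost unmatched element of the lower set, if there is one. -/
noncomputable def fP (s : Finset ℕ × Finset ℕ) : Finset ℕ × Finset ℕ :=
  if h : ∃ p, IsBot s.1 s.2 p then (insert h.choose s.1, s.2.erase h.choose) else s

theorem eP_of_isTop {U V : Finset ℕ} {p : ℕ} (h : IsTop U V p) :
    eP (U, V) = (U.erase p, insert p V) := by
  have hex : ∃ p, IsTop U V p := ⟨p, h⟩
  unfold eP
  rw [dif_pos hex, hex.choose_spec.unique h]

theorem fP_of_isBot {U V : Finset ℕ} {p : ℕ} (h : IsBot U V p) :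
    fP (U, V) = (insert p U, V.erase p) := by
  have hex : ∃ p, IsBot U V p := ⟨p, h⟩
  unfold fP
  rw [dif_pos hex, hex.choose_spec.unique h]

theorem eP_of_le {U V : Finset ℕ} (h : ∀ x, exc U V x ≤ 0) : eP (U, V) = (U, V) := by
  unfold eP
  rw [dif_neg]
  rw [exists_isTop_iff]
  exact fun h' => h' h

theorem fP_of_le {U V : Finset ℕ} (h : ∀ x, exc U V x ≤ exc U V 0) : fP (U, V) = (U, V) := by
  unfold fP
  rw [dif_neg]
  rw [exists_isBot_iff]
  exact fun h' => h' h

theorem fP_eP {U V : Finset ℕ} {p : ℕ} (h : IsTop U V p) : fP (eP (U, V)) = (U, V) := by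
  rw [eP_of_isTop h, fP_of_isBot h.isBot, Finset.insert_erase h.mem, Finset.erase_insert h.notMem]

theorem eP_fP {U V : Finset ℕ} {p : ℕ} (h : IsBot U V p) : eP (fP (U, V)) = (U, V) := by
  rw [fP_of_isBot h, eP_of_isTop h.isTop, Finset.insert_erase h.1, Finset.erase_insert h.2.1]

open Classical in
/-- The unmatched elements of the upper set. -/
noncomputable def un (U V : Finset ℕ) : Finset ℕ :=
  U.filter fun p => ∀ x, p < x → exc U V x < exc U V p

theorem mem_un {U V : Finset ℕ} {p : ℕ} :
    p ∈ un U V ↔ ∀ x, p < x → exc U V x < exc U V p := by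
  simp only [un, Finset.mem_filter, and_iff_right_iff_imp]
  exact fun h => (mem_of_exc_lt (h (p + 1) (by omega))).1

theorem IsTop.mem_un {U V : Finset ℕ} {p : ℕ} (h : IsTop U V p) : p ∈ un U V :=
  QuasiMac.mem_un.2 h.1

theorem IsTop.le_of_mem_un {U V : Finset ℕ} {p x : ℕ} (h : IsTop U V p) (hx : x ∈ un U V) :
    p ≤ x := by
  by_contra hl
  have h1 := QuasiMac.mem_un.1 hx p (by omega)
  have h2 := h.2 x (by omega)
  omega

/-- The excess to the right of `p` does not change, and nothing to the left of `p` was or becomes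
unmatched. -/
theorem IsTop.un_move {U V : Finset ℕ} {p : ℕ} (h : IsTop U V p) :
    un (U.erase p) (insert p V) = (un U V).erase p := by
  ext y
  rw [Finset.mem_erase, QuasiMac.mem_un, QuasiMac.mem_un]
  simp only [exc_move h.mem h.notMem]
  rcases lt_trichotomy y p with hl | rfl | hl
  · constructor
    · intro hy
      have h3 := hy p hl
      have h2 := h.2 y hl
      rw [if_pos le_rfl, if_pos hl.le] at h3
      omega
    · rintro ⟨_, hy⟩
      exact absurd (h.le_of_mem_un (QuasiMac.mem_un.2 hy)) (by omega)
  · simp only [ne_eq, not_true_eq_false, false_and, iff_false]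
    intro hy
    have h3 := hy (y + 1) (by omega)
    have h4 := exc_step U V y
    simp only [h.mem, h.notMem, if_true, if_false] at h4
    rw [if_neg (by omega), if_pos le_rfl] at h3
    omega
  · constructor
    · intro hy
      refine ⟨by omega, fun x hx => ?_⟩
      have := hy x hx
      rwa [if_neg (by omega), if_neg (by omega), sub_zero, sub_zero] at this
    · rintro ⟨_, hy⟩ x hx
      rw [if_neg (by omega), if_neg (by omega), sub_zero, sub_zero]
      exact hy x hx

/-- Lower all unmatched elements. -/
noncomputable def dropP (s : Finset ℕ × Finset ℕ) : Finset ℕ × Finset ℕ :=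
  (s.1 \ un s.1 s.2, s.2 ∪ un s.1 s.2)

theorem un_eq_empty_iff {U V : Finset ℕ} : un U V = ∅ ↔ ∀ x, exc U V x ≤ 0 := by
  constructor
  · intro h
    by_contra h'
    obtain ⟨p, hp⟩ := exists_isTop_iff.2 h'
    have := hp.mem_un
    rw [h] at this
    simp at this
  · intro h
    rw [Finset.eq_empty_iff_forall_notMem]
    intro p hp
    obtain ⟨X, hX⟩ := exists_bound U V
    have := QuasiMac.mem_un.1 hp (max X (p + 1)) (by omega)
    rw [hX _ (by omega)] at this
    have := h p
    omega

/-- Each application moves the leftmost unmatched element and leaves the others unmatched; once none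
is left `eP` is the identity. Any large enough exponent works, which allows one exponent to be used
for two different arrays. -/
theorem iterate_eP_of_card_le (k : ℕ) : ∀ {U V : Finset ℕ}, (un U V).card ≤ k →
    eP^[k] (U, V) = dropP (U, V) := by
  induction k with
  | zero =>
    intro U V h
    have : un U V = ∅ := Finset.card_eq_zero.1 (by omega)
    simp [dropP, this]
  | succ k ih =>
    intro U V h
    rw [Function.iterate_succ_apply]
    by_cases h0 : ∀ x, exc U V x ≤ 0
    · rw [eP_of_le h0, ih]
      rw [un_eq_empty_iff.2 h0]; simp
    · obtain ⟨p, hp⟩ := exists_isTop_iff.2 h0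
      have hm := hp.mem_un
      rw [eP_of_isTop hp, ih]
      · simp only [dropP, hp.un_move]
        ext y
        · simp only [Finset.mem_sdiff, Finset.mem_erase]
          have := hp.mem
          by_cases hy : y = p
          · subst hy; simp [hm]
          · simp [hy]
        · simp only [Finset.mem_union, Finset.mem_insert, Finset.mem_erase]
          by_cases hy : y = p
          · subst hy; simp [hm]
          · simp [hy]
      · rw [hp.un_move, Finset.card_erase_of_mem hm]; omega

/-- The maximal excess: the number of unmatched elements of the upper set. -/
noncomputable def eps (U V : Finset ℕ) : ℕ := sInf {w : ℕ | ∀ x, exc U V x ≤ w}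

theorem exc_le_eps (U V : Finset ℕ) (x : ℕ) : exc U V x ≤ eps U V := by
  have : eps U V ∈ {w : ℕ | ∀ x, exc U V x ≤ w} := by
    refine Nat.sInf_mem ⟨U.card, fun x => ?_⟩
    have : (U.filter fun y => x ≤ y).card ≤ U.card := Finset.card_filter_le _ _
    unfold exc
    omega
  exact this x

theorem eps_le {U V : Finset ℕ} {w : ℕ} (h : ∀ x, exc U V x ≤ w) : eps U V ≤ w := Nat.sInf_le h

theorem eps_eq {U V : Finset ℕ} {w : ℕ} (h : ∀ x, exc U V x ≤ w) {x : ℕ} (hx : exc U V x = w) :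
    eps U V = w := by
  refine le_antisymm (eps_le h) ?_
  have := exc_le_eps U V x
  omega

theorem eps_eq_zero_iff {U V : Finset ℕ} : eps U V = 0 ↔ ∀ x, exc U V x ≤ 0 := by
  constructor
  · intro h x
    have := exc_le_eps U V x
    omega
  · exact fun h => Nat.le_zero.1 (eps_le (by simpa using h))

/-- Exchange the cardinalities of the two sets by moving unmatched elements. -/
noncomputable def swapP (s : Finset ℕ × Finset ℕ) : Finset ℕ × Finset ℕ :=
  fP^[s.2.card - s.1.card] (eP^[s.1.card - s.2.card] s)

theorem exc_sub_of_subset {U V : Finset ℕ} (h : V ⊆ U) (x : ℕ) :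
    exc U V x = ((U \ V).filter fun y => x ≤ y).card := by
  have : ((U.filter fun y => x ≤ y) \ (V.filter fun y => x ≤ y)) =
      ((U \ V).filter fun y => x ≤ y) := by
    ext y; simp only [Finset.mem_sdiff, Finset.mem_filter]; tauto
  rw [← this, Finset.card_sdiff_of_subset (Finset.filter_subset_filter _ h), exc,
    Nat.cast_sub (Finset.card_le_card (Finset.filter_subset_filter _ h))]

/-- An opening bracket is read before a closing one at the same site, so every element of `V` is
matched with itself and the excess just counts `U \ V`. -/
theorem un_of_subset {U V : Finset ℕ} (h : V ⊆ U) : un U V = U \ V := by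
  ext p
  rw [mem_un]
  constructor
  · intro hp
    have := mem_of_exc_lt (hp (p + 1) (by omega))
    simp [this]
  · intro hp x hx
    rw [exc_sub_of_subset h, exc_sub_of_subset h]
    have : p ∈ (U \ V).filter fun y => p ≤ y := by simpa using hp
    exact_mod_cast Finset.card_lt_card ⟨fun y hy => by
      simp only [Finset.mem_filter] at hy ⊢; exact ⟨hy.1, by omega⟩, fun hs => by
      have := hs this
      simp only [Finset.mem_filter] at this
      omega⟩

theorem iterate_eP_of_subset {k : ℕ} {U V : Finset ℕ} (h : V ⊆ U) (hk : U.card = V.card + k) :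
    eP^[k] (U, V) = (V, U) := by
  have hun := un_of_subset h
  rw [iterate_eP_of_card_le]
  · simp only [dropP, hun]
    rw [Finset.sdiff_sdiff_eq_self h, Finset.union_sdiff_of_subset h]
  · rw [hun, Finset.card_sdiff_of_subset h]
    omega

/-- The bound on `k` ensures that each of the `k` lowerings really moves an element; only such
lowerings are undone by `fP`. -/
theorem iterate_fP_iterate_eP (k : ℕ) : ∀ {U V : Finset ℕ}, k ≤ (un U V).card →
    fP^[k] (eP^[k] (U, V)) = (U, V) := by
  induction k with
  | zero => intro U V _; rfl
  | succ k ih =>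
    intro U V h
    have h0 : ¬ ∀ x, exc U V x ≤ 0 := fun h0 => by
      rw [un_eq_empty_iff.2 h0] at h; simp at h
    obtain ⟨p, hp⟩ := exists_isTop_iff.2 h0
    rw [Function.iterate_succ_apply' fP, Function.iterate_succ_apply, eP_of_isTop hp, ih,
      ← eP_of_isTop hp, fP_eP hp]
    rw [hp.un_move, Finset.card_erase_of_mem hp.mem_un]
    omega

theorem iterate_fP_of_subset {k : ℕ} {U V : Finset ℕ} (h : U ⊆ V) (hk : V.card = U.card + k) :
    fP^[k] (U, V) = (V, U) := by
  rw [← iterate_eP_of_subset h hk]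
  refine iterate_fP_iterate_eP k ?_
  rw [un_of_subset h, Finset.card_sdiff_of_subset h]
  omega

/-- Here all of `V \ U` is raised, so the exchange of cardinalities is an exchange of the sets
themselves. -/
theorem swapP_of_subset {U V : Finset ℕ} (h : U ⊆ V) : swapP (U, V) = (V, U) := by
  have := Finset.card_le_card h
  simp only [swapP]
  rw [Nat.sub_eq_zero_of_le this]
  exact iterate_fP_of_subset h (by omega)

/-- If `U₁` is matched inside `V` and `U₂` lies to the right of everything, then exactly `U₂` is
unmatched. -/
theorem un_union {U₁ U₂ V : Finset ℕ} (h1 : ∀ x, exc U₁ V x ≤ 0) (h2 : ∀ y ∈ U₂, ∀ x ∈ V, x < y)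
    (h3 : ∀ y ∈ U₂, ∀ x ∈ U₁, x < y) : un (U₁ ∪ U₂) V = U₂ := by
  have hd : Disjoint U₁ U₂ := Finset.disjoint_left.2 fun x hx hx' => lt_irrefl _ (h3 x hx' x hx)
  have key : ∀ x, exc (U₁ ∪ U₂) V x = exc U₁ V x + (U₂.filter fun y => x ≤ y).card := by
    intro x
    unfold exc
    rw [Finset.filter_union, Finset.card_union_of_disjoint
      (Finset.disjoint_filter_filter hd)]
    push_cast
    ring
  ext p
  rw [mem_un]
  constructor
  · intro hp
    have hm := mem_of_exc_lt (hp (p + 1) (by omega))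
    rcases Finset.mem_union.1 hm.1 with hpU | hpU
    · exfalso
      rcases U₂.eq_empty_or_nonempty with he | hne
      · subst he
        obtain ⟨X, hX⟩ := exists_bound (U₁ ∪ ∅) V
        have h4 := hp (max X (p + 1)) (by omega)
        rw [hX _ (by omega), key] at h4
        have := h1 p
        simp only [Finset.filter_empty, Finset.card_empty] at h4
        omega
      · have hq := U₂.min'_mem hne
        set q := U₂.min' hne
        have h4 := hp q (h3 q hq p hpU)
        rw [key, key] at h4
        have e1 : exc U₁ V q = 0 := exc_of_bound (fun y hy => h3 q hq y hy) fun y hy => h2 q hq y hy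
        have e2 : (U₂.filter fun y => q ≤ y) = U₂ :=
          Finset.filter_true_of_mem fun y hy => U₂.min'_le y hy
        have e3 := Finset.card_filter_le U₂ fun y => p ≤ y
        have := h1 p
        rw [e1, e2] at h4
        omega
    · exact hpU
  · intro hp x hx
    rw [key, key]
    have e1 : exc U₁ V p = 0 := exc_of_bound (fun y hy => h3 p hp y hy) fun y hy => h2 p hp y hy
    have : ((U₂.filter fun y => x ≤ y)).card < ((U₂.filter fun y => p ≤ y)).card := by
      refine Finset.card_lt_card ⟨fun y hy => ?_, fun hs => ?_⟩
      · simp only [Finset.mem_filter] at hy ⊢; exact ⟨hy.1, by omega⟩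
      · have := hs (Finset.mem_filter.2 ⟨hp, le_rfl⟩)
        simp only [Finset.mem_filter] at this
        omega
    have := h1 x
    omega

theorem dropP_union {U₁ U₂ V : Finset ℕ} (h1 : ∀ x, exc U₁ V x ≤ 0)
    (h2 : ∀ y ∈ U₂, ∀ x ∈ V, x < y) (h3 : ∀ y ∈ U₂, ∀ x ∈ U₁, x < y) :
    dropP (U₁ ∪ U₂, V) = (U₁, V ∪ U₂) := by
  have hd : Disjoint U₁ U₂ := Finset.disjoint_left.2 fun x hx hx' => lt_irrefl _ (h3 x hx' x hx)
  simp only [dropP, un_union h1 h2 h3, Finset.union_sdiff_cancel_right hd]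

theorem exc_nonpos_of_subset {U V : Finset ℕ} (h : U ⊆ V) (x : ℕ) : exc U V x ≤ 0 := by
  have := Finset.card_le_card (Finset.filter_subset_filter (fun y => x ≤ y) h)
  unfold exc
  omega

/-! ## Row and column operators on arrays -/

/-- Arrays of balls, given by their rows. -/
abbrev Arr : Type := ℕ → Finset ℕ

/-- Apply an operation on pairs (upper set, lower set) to the rows `i + 1` and `i`. -/
def onRows (g : Finset ℕ × Finset ℕ → Finset ℕ × Finset ℕ) (i : ℕ) (A : Arr) : Arr := fun r =>
  if r = i then (g (A (i + 1), A i)).2 else if r = i + 1 then (g (A (i + 1), A i)).1 else A r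

section onRows

variable (g g' : Finset ℕ × Finset ℕ → Finset ℕ × Finset ℕ) (i : ℕ) (A : Arr)

theorem onRows_lower : onRows g i A i = (g (A (i + 1), A i)).2 := by simp [onRows]

theorem onRows_upper : onRows g i A (i + 1) = (g (A (i + 1), A i)).1 := by simp [onRows]

theorem onRows_of_ne {r : ℕ} (h : r ≠ i) (h' : r ≠ i + 1) : onRows g i A r = A r := by
  simp [onRows, h, h']

theorem onRows_onRows : onRows g i (onRows g' i A) = onRows (g ∘ g') i A := by
  funext r
  by_cases h : r = i
  · subst h; simp [onRows]
  · by_cases h' : r = i + 1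
    · subst h'; simp [onRows]
    · simp [onRows, h, h']

theorem onRows_of_eq (h : g (A (i + 1), A i) = (A (i + 1), A i)) : onRows g i A = A := by
  funext r
  by_cases h1 : r = i
  · subst h1; simp [onRows, h]
  · by_cases h' : r = i + 1
    · subst h'; simp [onRows, h]
    · simp [onRows, h1, h']

theorem onRows_iterate (k : ℕ) : (onRows g i)^[k] A = onRows g^[k] i A := by
  induction k with
  | zero => exact (onRows_of_eq _ _ _ rfl).symm
  | succ k ih => rw [Function.iterate_succ_apply', ih, onRows_onRows, ← Function.iterate_succ']

end onRows

/-- The rows below row `L` that contain a ball in column `j`. -/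
def colSet (L : ℕ) (A : Arr) (j : ℕ) : Finset ℕ := (Finset.range L).filter fun r => j ∈ A r

theorem mem_colSet {L : ℕ} {A : Arr} {j r : ℕ} : r ∈ colSet L A j ↔ r < L ∧ j ∈ A r := by
  simp [colSet]

open Classical in
/-- The column operator moving a ball from column `j` to column `j + 1`. -/
noncomputable def fCol (L j : ℕ) (A : Arr) : Arr := fun r =>
  if IsTop (colSet L A j) (colSet L A (j + 1)) r then insert (j + 1) ((A r).erase j) else A r

open Classical in
/-- The column operator moving a ball from column `j + 1` to column `j`. -/
noncomputable def eCol (L j : ℕ) (A : Arr) : Arr := fun r =>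
  if IsBot (colSet L A j) (colSet L A (j + 1)) r then insert j ((A r).erase (j + 1)) else A r

/-- Two arrays have the same row excess bounds. -/
theorem isTop_congr {U V U' V' : Finset ℕ} {p : ℕ} (h : ∀ x, exc U' V' x = exc U V x) :
    IsTop U' V' p ↔ IsTop U V p := by
  simp only [IsTop, h]

/-! ### Row operators commute with column operators. -/

section Commute

variable {L j i : ℕ} {A : Arr}

theorem fCol_of_le (h : ∀ y, exc (colSet L A j) (colSet L A (j + 1)) y ≤ 0) : fCol L j A = A := by
  funext r
  rw [fCol, if_neg]
  intro hr
  exact exists_isTop_iff.1 ⟨r, hr⟩ h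

theorem fCol_apply_ne {r s : ℕ} (hr : IsTop (colSet L A j) (colSet L A (j + 1)) r) (h : s ≠ r) :
    fCol L j A s = A s := by
  rw [fCol, if_neg]
  exact fun hs => h (hs.unique hr)

theorem fCol_apply_self {r : ℕ} (hr : IsTop (colSet L A j) (colSet L A (j + 1)) r) :
    fCol L j A r = insert (j + 1) ((A r).erase j) := by
  rw [fCol, if_pos hr]

theorem card_filter_shift {U : Finset ℕ} (h1 : j ∈ U) (h2 : j + 1 ∉ U) (x : ℕ) :
    (((insert (j + 1) (U.erase j)).filter fun y => x ≤ y).card : ℤ) =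
      ((U.filter fun y => x ≤ y).card : ℤ) + if x = j + 1 then 1 else 0 := by
  rw [card_filter_ge_insert (by simp [h2]), card_filter_ge_erase h1]
  split_ifs <;> omega

theorem card_filter_shift' {U : Finset ℕ} (h1 : j + 1 ∈ U) (h2 : j ∉ U) (x : ℕ) :
    (((insert j (U.erase (j + 1))).filter fun y => x ≤ y).card : ℤ) =
      ((U.filter fun y => x ≤ y).card : ℤ) - if x = j + 1 then 1 else 0 := by
  rw [card_filter_ge_insert (by simp [h2]), card_filter_ge_erase h1]
  split_ifs <;> omega

/-- A ball passing from column `j` to `j + 1` changes the number of balls weakly to the right of `x`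
for `x = j + 1` only, so the row excess changes at a single point. -/
theorem exc_rows_fCol {r : ℕ} (hr : IsTop (colSet L A j) (colSet L A (j + 1)) r) (x : ℕ) :
    exc (fCol L j A (i + 1)) (fCol L j A i) x = exc (A (i + 1)) (A i) x +
      if x = j + 1 then (if r = i + 1 then 1 else 0) - (if r = i then 1 else 0) else 0 := by
  have hm := mem_colSet.1 hr.mem
  have hn : j + 1 ∉ A r := fun h => hr.notMem (mem_colSet.2 ⟨hm.1, h⟩)
  by_cases h1 : r = i + 1
  · subst h1
    rw [fCol_apply_self hr, fCol_apply_ne hr (by omega), exc, exc, card_filter_shift hm.2 hn]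
    simp
    split_ifs <;> omega
  · by_cases h2 : r = i
    · subst h2
      rw [fCol_apply_self hr, fCol_apply_ne hr (by omega), exc, exc, card_filter_shift hm.2 hn]
      simp
      split_ifs <;> omega
    · rw [fCol_apply_ne hr (Ne.symm h1), fCol_apply_ne hr (Ne.symm h2)]
      simp [h1, h2]

/-- Lowering the ball of row `i + 1` in column `c`. -/
theorem onRows_eP_of_isTop {c : ℕ} (hc : IsTop (A (i + 1)) (A i) c) (r : ℕ) :
    onRows eP i A r = if r = i then insert c (A i) else if r = i + 1 then (A (i + 1)).erase c
      else A r := by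
  rw [onRows, eP_of_isTop hc]

theorem colSet_onRows_eP {c : ℕ} (hc : IsTop (A (i + 1)) (A i) c) (hi : i + 1 < L) (b : ℕ) :
    colSet L (onRows eP i A) b =
      if b = c then insert i ((colSet L A b).erase (i + 1)) else colSet L A b := by
  have h1 := hc.mem
  have h2 := hc.notMem
  ext r
  by_cases hb : b = c
  · subst hb
    rw [if_pos rfl, mem_colSet, onRows_eP_of_isTop hc, Finset.mem_insert, Finset.mem_erase,
      mem_colSet]
    by_cases ha : r = i
    · subst ha; simp; omega
    · by_cases hb' : r = i + 1
      · subst hb'; simp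
      · simp [ha, hb']
  · rw [if_neg hb, mem_colSet, onRows_eP_of_isTop hc, mem_colSet]
    by_cases ha : r = i
    · subst ha; simp [hb]
    · by_cases hb' : r = i + 1
      · subst hb'; simp [hb]
      · simp [ha, hb']

/-- The transpose of `exc_rows_fCol`: a ball falling from row `i + 1` to row `i` affects the column
excess at `i + 1` only. -/
theorem exc_cols_eP {c : ℕ} (hc : IsTop (A (i + 1)) (A i) c) (hi : i + 1 < L) (y : ℕ) :
    exc (colSet L (onRows eP i A) j) (colSet L (onRows eP i A) (j + 1)) y =
      exc (colSet L A j) (colSet L A (j + 1)) y +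
      if y = i + 1 then (if c = j + 1 then 1 else 0) - (if c = j then 1 else 0) else 0 := by
  have h1 : i + 1 ∈ colSet L A c := mem_colSet.2 ⟨hi, hc.mem⟩
  have h2 : i ∉ colSet L A c := fun h => hc.notMem (mem_colSet.1 h).2
  rw [colSet_onRows_eP hc hi, colSet_onRows_eP hc hi]
  by_cases ha : c = j
  · subst ha
    rw [if_pos rfl, if_neg (by omega), exc, exc, card_filter_shift' h1 h2]
    simp
    split_ifs <;> omega
  · by_cases hb : c = j + 1
    · subst hb
      rw [if_neg (by omega), if_pos rfl, exc, exc, card_filter_shift' h1 h2]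
      simp
      split_ifs <;> omega
    · rw [if_neg (Ne.symm ha), if_neg (Ne.symm hb)]
      simp [ha, hb]

/-- The entries of the array at the crossing of the rows `i, i + 1` and the columns `j, j + 1`
control the local variation of both excess functions. -/
theorem exc_local (hi : i + 1 < L) :
    ∃ a b c d : ℤ,
      (a = if j ∈ A (i + 1) then 1 else 0) ∧ (b = if j + 1 ∈ A (i + 1) then 1 else 0) ∧
      (c = if j ∈ A i then 1 else 0) ∧ (d = if j + 1 ∈ A i then 1 else 0) ∧
      0 ≤ a ∧ a ≤ 1 ∧ 0 ≤ b ∧ b ≤ 1 ∧ 0 ≤ c ∧ c ≤ 1 ∧ 0 ≤ d ∧ d ≤ 1 ∧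
      exc (A (i + 1)) (A i) j = exc (A (i + 1)) (A i) (j + 1) + a - c ∧
      exc (A (i + 1)) (A i) (j + 1) = exc (A (i + 1)) (A i) (j + 2) + b - d ∧
      exc (colSet L A j) (colSet L A (j + 1)) i =
        exc (colSet L A j) (colSet L A (j + 1)) (i + 1) + c - d ∧
      exc (colSet L A j) (colSet L A (j + 1)) (i + 1) =
        exc (colSet L A j) (colSet L A (j + 1)) (i + 2) + a - b := by
  have e1 := exc_step (A (i + 1)) (A i) j
  have e2 := exc_step (A (i + 1)) (A i) (j + 1)
  have e3 := exc_step (colSet L A j) (colSet L A (j + 1)) i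
  have e4 := exc_step (colSet L A j) (colSet L A (j + 1)) (i + 1)
  have hi' : i < L := by omega
  simp only [mem_colSet, hi, hi', true_and] at e3 e4
  refine ⟨_, _, _, _, rfl, rfl, rfl, rfl, ?_, ?_, ?_, ?_, ?_, ?_, ?_, ?_, e1, e2, e3, e4⟩ <;>
    split_ifs <;> norm_num

/-- Only the value at `j + 1` changes, and the larger of its old and new values is also attained at
one of the neighbours `j`, `j + 2`: the column inequalities at the moving ball exclude the other
configurations at the crossing of the two rows and two columns. So the maximum is preserved. -/
theorem exc_rows_fCol_le_iff (hi : i + 1 < L) (w : ℤ) :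
    (∀ x, exc (fCol L j A (i + 1)) (fCol L j A i) x ≤ w) ↔
      ∀ x, exc (A (i + 1)) (A i) x ≤ w := by
  by_cases h0 : ∀ y, exc (colSet L A j) (colSet L A (j + 1)) y ≤ 0
  · rw [fCol_of_le h0]
  obtain ⟨r, hr⟩ := exists_isTop_iff.2 h0
  have hm := (mem_colSet.1 hr.mem)
  have hn : j + 1 ∉ A r := fun h => hr.notMem (mem_colSet.2 ⟨hm.1, h⟩)
  have key := exc_rows_fCol (i := i) hr
  obtain ⟨a, b, c, d, ha, hb, hc, hd, a0, a1, b0, b1, c0, c1, d0, d1, e1, e2, e3, e4⟩ :=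
    exc_local (A := A) (j := j) hi
  by_cases h1 : r = i + 1
  · subst h1
    simp only [hm.2, hn, if_true, if_false] at ha hb
    have h2 := hr.2 i (by omega)
    simp only [if_true, show i + 1 ≠ i by omega, if_false] at key
    constructor
    · intro h x
      have := h x
      rw [key] at this
      split_ifs at this <;> omega
    · intro h x
      rw [key]
      by_cases hx : x = j + 1
      · subst hx
        have := h j
        have := h (j + 2)
        simp only [if_true]
        omega
      · have := h x
        simp only [hx, if_false]
        omega
  · by_cases h2 : r = i
    · subst h2
      simp only [hm.2, hn, if_true, if_false] at hc hd
      have h3 := hr.1 (r + 1) (by omega)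
      have h4 := hr.1 (r + 2) (by omega)
      simp only [if_true, h1, if_false] at key
      constructor
      · intro h x
        by_cases hx : x = j + 1
        · subst hx
          have h5 := h j
          have h6 := h (j + 2)
          rw [key] at h5 h6
          simp only [show j ≠ j + 1 by omega, show j + 2 ≠ j + 1 by omega, if_false] at h5 h6
          omega
        · have := h x
          rw [key] at this
          simp only [hx, if_false] at this
          omega
      · intro h x
        rw [key]
        have := h x
        split_ifs <;> omega
    · simp only [key, h1, h2, if_false, sub_zero, ite_self, add_zero]

/-- The argument of `exc_rows_fCol_le_iff` with rows and columns interchanged. -/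
theorem exc_cols_eP_le_iff (hi : i + 1 < L) (w : ℤ) :
    (∀ y, exc (colSet L (onRows eP i A) j) (colSet L (onRows eP i A) (j + 1)) y ≤ w) ↔
      ∀ y, exc (colSet L A j) (colSet L A (j + 1)) y ≤ w := by
  by_cases h0 : ∀ x, exc (A (i + 1)) (A i) x ≤ 0
  · rw [onRows_of_eq _ _ _ (eP_of_le h0)]
  obtain ⟨p, hp⟩ := exists_isTop_iff.2 h0
  have hm := hp.mem
  have hn := hp.notMem
  have key := exc_cols_eP (j := j) hp hi
  obtain ⟨a, b, c, d, ha, hb, hc, hd, a0, a1, b0, b1, c0, c1, d0, d1, e1, e2, e3, e4⟩ :=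
    exc_local (A := A) (j := j) hi
  by_cases h1 : p = j + 1
  · subst h1
    simp only [hm, hn, if_true, if_false] at hb hd
    have h2 := hp.2 j (by omega)
    simp only [if_true, show j + 1 ≠ j by omega, if_false] at key
    constructor
    · intro h x
      have := h x
      rw [key] at this
      split_ifs at this <;> omega
    · intro h x
      rw [key]
      by_cases hx : x = i + 1
      · subst hx
        have := h i
        have := h (i + 2)
        simp only [if_true]
        omega
      · have := h x
        simp only [hx, if_false]
        omega
  · by_cases h2 : p = j
    · subst h2
      simp only [hm, hn, if_true, if_false] at ha hc
      have h3 := hp.1 (p + 1) (by omega)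
      have h4 := hp.1 (p + 2) (by omega)
      simp only [if_true, h1, if_false] at key
      constructor
      · intro h x
        by_cases hx : x = i + 1
        · subst hx
          have h5 := h i
          have h6 := h (i + 2)
          rw [key] at h5 h6
          simp only [show i ≠ i + 1 by omega, show i + 2 ≠ i + 1 by omega, if_false] at h5 h6
          omega
        · have := h x
          rw [key] at this
          simp only [hx, if_false] at this
          omega
      · intro h x
        rw [key]
        have := h x
        split_ifs <;> omega
    · simp only [key, h1, h2, if_false, sub_zero, ite_self, add_zero]

/-- The two excluded configurations are those in which one operator moves the pivot of the other.
Otherwise the only value of the column excess that changes, at `i + 1`, is not the value at `r`, and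
comparison with the values at `i` and `i + 2` keeps it below the maximum. -/
theorem isTop_cols_eP {p r : ℕ} (hi : i + 1 < L) (hp : IsTop (A (i + 1)) (A i) p)
    (hr : IsTop (colSet L A j) (colSet L A (j + 1)) r) (h1 : ¬ (r = i + 1 ∧ p = j))
    (h2 : ¬ (r = i ∧ p = j + 1)) :
    IsTop (colSet L (onRows eP i A) j) (colSet L (onRows eP i A) (j + 1)) r := by
  have hpm := hp.mem
  have hpn := hp.notMem
  have hrm := (mem_colSet.1 hr.mem)
  have hrn : j + 1 ∉ A r := fun h => hr.notMem (mem_colSet.2 ⟨hrm.1, h⟩)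
  have kc := exc_cols_eP (j := j) hp hi
  by_cases q1 : p = j + 1
  · subst q1
    have hri : r ≠ i := fun h => h2 ⟨h, rfl⟩
    have hri' : r ≠ i + 1 := fun h => hrn (h ▸ hpm)
    obtain ⟨a, b, c, d, ha, hb, hc, hd, a0, a1, b0, b1, c0, c1, d0, d1, e1, e2, e3, e4⟩ :=
      exc_local (A := A) (j := j) hi
    simp only [hpm, hpn, if_true, if_false] at hb hd
    simp only [show j + 1 ≠ j by omega, if_true, if_false] at kc
    have p3 := hp.2 j (by omega)
    constructor
    · intro y hy
      rw [kc, kc, if_neg hri']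
      split_ifs with hy'
      · subst hy'
        have r1 := hr.1 i (by omega)
        have r2 := hr.1 (i + 2) (by omega)
        omega
      · have := hr.1 y hy
        omega
    · intro y hy
      rw [kc, kc, if_neg hri']
      split_ifs with hy'
      · subst hy'
        have r1 := hr.2 i (by omega)
        rcases eq_or_ne r (i + 2) with rfl | hne
        · omega
        · have r2 := hr.2 (i + 2) (by omega)
          omega
      · have := hr.2 y hy
        omega
  · by_cases q2 : p = j
    · subst q2
      have hri' : r ≠ i + 1 := fun h => h1 ⟨h, rfl⟩
      simp only [q1, if_true, if_false] at kc
      constructor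
      · intro y hy
        have := hr.1 y hy
        rw [kc, kc, if_neg hri']
        split_ifs <;> omega
      · intro y hy
        have := hr.2 y hy
        rw [kc, kc, if_neg hri']
        split_ifs <;> omega
    · refine (isTop_congr fun y => ?_).2 hr
      simp [kc, q1, q2]

theorem isTop_rows_fCol {p r : ℕ} (hi : i + 1 < L) (hp : IsTop (A (i + 1)) (A i) p)
    (hr : IsTop (colSet L A j) (colSet L A (j + 1)) r) (h1 : ¬ (r = i + 1 ∧ p = j))
    (h2 : ¬ (r = i ∧ p = j + 1)) : IsTop (fCol L j A (i + 1)) (fCol L j A i) p := by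
  have hpm := hp.mem
  have hpn := hp.notMem
  have hrm := (mem_colSet.1 hr.mem)
  have hrn : j + 1 ∉ A r := fun h => hr.notMem (mem_colSet.2 ⟨hrm.1, h⟩)
  have kr := exc_rows_fCol (i := i) hr
  by_cases q1 : r = i + 1
  · subst q1
    have hri : p ≠ j := fun h => h1 ⟨rfl, h⟩
    have hri' : p ≠ j + 1 := fun h => hrn (h ▸ hpm)
    obtain ⟨a, b, c, d, ha, hb, hc, hd, a0, a1, b0, b1, c0, c1, d0, d1, e1, e2, e3, e4⟩ :=
      exc_local (A := A) (j := j) hi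
    simp only [hrm.2, hrn, if_true, if_false] at ha hb
    simp only [show i + 1 ≠ i by omega, if_true, if_false] at kr
    have p3 := hr.2 i (by omega)
    constructor
    · intro y hy
      rw [kr, kr, if_neg hri']
      split_ifs with hy'
      · subst hy'
        have r1 := hp.1 j (by omega)
        have r2 := hp.1 (j + 2) (by omega)
        omega
      · have := hp.1 y hy
        omega
    · intro y hy
      rw [kr, kr, if_neg hri']
      split_ifs with hy'
      · subst hy'
        have r1 := hp.2 j (by omega)
        rcases eq_or_ne p (j + 2) with rfl | hne
        · omega
        · have r2 := hp.2 (j + 2) (by omega)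
          omega
      · have := hp.2 y hy
        omega
  · by_cases q2 : r = i
    · subst q2
      have hri' : p ≠ j + 1 := fun h => h2 ⟨rfl, h⟩
      simp only [q1, if_true, if_false] at kr
      constructor
      · intro y hy
        have := hp.1 y hy
        rw [kr, kr, if_neg hri']
        split_ifs <;> omega
      · intro y hy
        have := hp.2 y hy
        rw [kr, kr, if_neg hri']
        split_ifs <;> omega
    · refine (isTop_congr fun y => ?_).2 hp
      simp [kr, q1, q2]

/-- Both operators want the same ball, in row `i + 1` and column `p`. After either move the pivot of
the other operator follows this ball, which ends in row `i` and column `p + 1` in both orders. -/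
theorem fCol_onRows_eP_corner {p : ℕ} (hi : i + 1 < L) (hp : IsTop (A (i + 1)) (A i) p)
    (hr : IsTop (colSet L A p) (colSet L A (p + 1)) (i + 1)) :
    fCol L p (onRows eP i A) = onRows eP i (fCol L p A) := by
  have hpm := hp.mem
  have hpn := hp.notMem
  have hrm := (mem_colSet.1 hr.mem)
  have hrn : p + 1 ∉ A (i + 1) := fun h => hr.notMem (mem_colSet.2 ⟨hrm.1, h⟩)
  have kr := exc_rows_fCol (i := i) hr
  have kc := exc_cols_eP (j := p) hp hi
  obtain ⟨a, b, c, d, ha, hb, hc, hd, a0, a1, b0, b1, c0, c1, d0, d1, e1, e2, e3, e4⟩ :=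
    exc_local (A := A) (j := p) hi
  simp only [hpm, hpn, hrn, if_true, if_false] at ha hb hc
  have p2 := hp.1 (p + 2) (by omega)
  have r3 := hr.2 i (by omega)
  have hd0 : d = 0 := by omega
  have tc : IsTop (colSet L (onRows eP i A) p) (colSet L (onRows eP i A) (p + 1)) i := by
    simp only [show p ≠ p + 1 by omega, if_true, if_false] at kc
    constructor
    · intro y hy
      rw [kc, kc, if_neg (show i ≠ i + 1 by omega)]
      split_ifs with hy'
      · subst hy'; omega
      · have := hr.1 y (by omega)
        omega
    · intro y hy
      have := hr.2 y (by omega)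
      rw [kc, kc, if_neg (show i ≠ i + 1 by omega), if_neg (by omega)]
      omega
  have tr : IsTop (fCol L p A (i + 1)) (fCol L p A i) (p + 1) := by
    simp only [show i + 1 ≠ i by omega, if_true, if_false] at kr
    constructor
    · intro x hx
      have := hp.1 x (by omega)
      rw [kr, kr, if_neg (by omega), if_pos rfl]
      omega
    · intro x hx
      rw [kr, kr, if_neg (by omega), if_pos rfl]
      rcases eq_or_ne x p with rfl | hx'
      · omega
      · have := hp.2 x (by omega)
        omega
  funext s
  rw [onRows_eP_of_isTop tr]
  by_cases s1 : s = i
  · subst s1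
    rw [fCol_apply_self tc, onRows_eP_of_isTop hp, if_pos rfl, if_pos rfl,
      fCol_apply_ne hr (by omega), Finset.erase_insert hpn]
  · rw [fCol_apply_ne tc s1, onRows_eP_of_isTop hp, if_neg s1, if_neg s1]
    by_cases s2 : s = i + 1
    · rw [if_pos s2, if_pos s2, fCol_apply_self hr, Finset.erase_insert (by simp [hrn])]
    · rw [if_neg s2, if_neg s2, fCol_apply_ne hr s2]

/-- Here two different balls compete for the only empty place of the crossing, in row `r` and column
`j + 1`. Whichever operator acts first fills it and shifts the pivot of the other to the ball in row
`r + 1` and column `j`, whose place is the empty one at the end. -/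
theorem fCol_onRows_eP_corner' {r : ℕ} (hi : r + 1 < L) (hp : IsTop (A (r + 1)) (A r) (j + 1))
    (hr : IsTop (colSet L A j) (colSet L A (j + 1)) r) :
    fCol L j (onRows eP r A) = onRows eP r (fCol L j A) := by
  have hpm := hp.mem
  have hpn := hp.notMem
  have hrm := (mem_colSet.1 hr.mem)
  have kr := exc_rows_fCol (i := r) hr
  have kc := exc_cols_eP (j := j) hp hi
  obtain ⟨a, b, c, d, ha, hb, hc, hd, a0, a1, b0, b1, c0, c1, d0, d1, e1, e2, e3, e4⟩ :=
    exc_local (A := A) (j := j) hi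
  simp only [hpm, hpn, hrm.2, if_true, if_false] at hb hc hd
  have p3 := hp.2 j (by omega)
  have r2 := hr.1 (r + 2) (by omega)
  have ha1 : a = 1 := by omega
  have tc : IsTop (colSet L (onRows eP r A) j) (colSet L (onRows eP r A) (j + 1)) (r + 1) := by
    simp only [show j + 1 ≠ j by omega, if_true, if_false] at kc
    constructor
    · intro y hy
      have := hr.1 y (by omega)
      rw [kc, kc, if_neg (by omega), if_pos rfl]
      omega
    · intro y hy
      rw [kc, kc, if_neg (by omega), if_pos rfl]
      rcases eq_or_ne y r with rfl | hx'
      · omega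
      · have := hr.2 y (by omega)
        omega
  have tr : IsTop (fCol L j A (r + 1)) (fCol L j A r) j := by
    simp only [show r ≠ r + 1 by omega, if_true, if_false] at kr
    constructor
    · intro x hx
      rw [kr, kr, if_neg (show j ≠ j + 1 by omega)]
      split_ifs with hx'
      · subst hx'; omega
      · have := hp.1 x (by omega)
        omega
    · intro x hx
      have := hp.2 x (by omega)
      rw [kr, kr, if_neg (show j ≠ j + 1 by omega), if_neg (by omega)]
      omega
  funext s
  rw [onRows_eP_of_isTop tr]
  by_cases s1 : s = r + 1
  · subst s1
    rw [fCol_apply_self tc, onRows_eP_of_isTop hp, if_neg (by omega), if_pos rfl,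
      if_neg (by omega), if_pos rfl, fCol_apply_ne hr (by omega)]
    ext y
    simp only [Finset.mem_insert, Finset.mem_erase]
    by_cases hy : y = j + 1
    · subst hy; simp [hpm]
    · simp [hy]
  · rw [fCol_apply_ne tc s1, onRows_eP_of_isTop hp, if_neg s1, if_neg s1]
    by_cases s2 : s = r
    · rw [if_pos s2, if_pos s2, fCol_apply_self hr]
      ext y
      simp only [Finset.mem_insert, Finset.mem_erase]
      by_cases hy : y = j
      · subst hy; simp [hrm.2]
      · simp [hy]
    · rw [if_neg s2, if_neg s2, fCol_apply_ne hr s2]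

/-- The column operators commute with lowering a single ball. -/
theorem fCol_onRows_eP (hi : i + 1 < L) :
    fCol L j (onRows eP i A) = onRows eP i (fCol L j A) := by
  by_cases h0 : ∀ x, exc (A (i + 1)) (A i) x ≤ 0
  · rw [onRows_of_eq _ _ _ (eP_of_le h0),
      onRows_of_eq _ _ _ (eP_of_le ((exc_rows_fCol_le_iff hi 0).2 h0))]
  by_cases h0' : ∀ y, exc (colSet L A j) (colSet L A (j + 1)) y ≤ 0
  · rw [fCol_of_le h0', fCol_of_le ((exc_cols_eP_le_iff hi 0).2 h0')]
  obtain ⟨p, hp⟩ := exists_isTop_iff.2 h0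
  obtain ⟨r, hr⟩ := exists_isTop_iff.2 h0'
  by_cases case1 : r = i + 1 ∧ p = j
  · obtain ⟨rfl, rfl⟩ := case1
    exact fCol_onRows_eP_corner hi hp hr
  by_cases case2 : r = i ∧ p = j + 1
  · obtain ⟨rfl, rfl⟩ := case2
    exact fCol_onRows_eP_corner' hi hp hr
  have tc := isTop_cols_eP hi hp hr case1 case2
  have tr := isTop_rows_fCol hi hp hr case1 case2
  funext s
  rw [onRows_eP_of_isTop tr]
  by_cases s1 : s = r
  · subst s1
    rw [fCol_apply_self tc, onRows_eP_of_isTop hp]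
    have hrm := (mem_colSet.1 hr.mem).2
    by_cases q1 : s = i
    · subst q1
      have hpj : p ≠ j := fun h => hp.notMem (h ▸ hrm)
      rw [if_pos rfl, if_pos rfl, fCol_apply_self hr]
      ext y
      simp only [Finset.mem_insert, Finset.mem_erase]
      by_cases hy : y = j
      · subst hy; simp [hpj.symm]
      · simp [hy]; tauto
    · rw [if_neg q1, if_neg q1]
      by_cases q2 : s = i + 1
      · subst q2
        have hpj : j + 1 ≠ p := fun h => hr.notMem (mem_colSet.2 ⟨hi, h ▸ hp.mem⟩)
        rw [if_pos rfl, if_pos rfl, fCol_apply_self hr]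
        ext y
        simp only [Finset.mem_insert, Finset.mem_erase]
        by_cases hy : y = j + 1
        · subst hy; simp [hpj]
        · simp [hy]; tauto
      · rw [if_neg q2, if_neg q2, fCol_apply_self hr]
  · rw [fCol_apply_ne tc s1, onRows_eP_of_isTop hp]
    by_cases q1 : s = i
    · subst q1
      rw [if_pos rfl, if_pos rfl, fCol_apply_ne hr s1]
    · by_cases q2 : s = i + 1
      · subst q2
        rw [if_neg q1, if_neg q1, if_pos rfl, if_pos rfl, fCol_apply_ne hr s1]
      · rw [if_neg q1, if_neg q1, if_neg q2, if_neg q2, fCol_apply_ne hr s1]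

end Commute

/-! ### Maps that commute with all column operators, and invariants. -/

section Commute

variable {L j i : ℕ} {A : Arr}

theorem card_fCol (r : ℕ) : (fCol L j A r).card = (A r).card := by
  by_cases hr : IsTop (colSet L A j) (colSet L A (j + 1)) r
  · have hm := (mem_colSet.1 hr.mem)
    have hn : j + 1 ∉ A r := fun h => hr.notMem (mem_colSet.2 ⟨hm.1, h⟩)
    rw [fCol_apply_self hr, Finset.card_insert_of_notMem (by simp [hn]),
      Finset.card_erase_add_one hm.2]
  · rw [fCol, if_neg hr]

theorem fCol_of_ge {r : ℕ} (h : L ≤ r) : fCol L j A r = A r := by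
  rw [fCol, if_neg]
  intro hr
  have := (mem_colSet.1 hr.mem).1
  omega

theorem exc_zero_fCol : exc (fCol L j A (i + 1)) (fCol L j A i) 0 = exc (A (i + 1)) (A i) 0 := by
  rw [exc_zero, exc_zero, card_fCol, card_fCol]

theorem onRows_fP_onRows_eP (h : ¬ ∀ x, exc (A (i + 1)) (A i) x ≤ 0) :
    onRows fP i (onRows eP i A) = A := by
  obtain ⟨p, hp⟩ := exists_isTop_iff.2 h
  rw [onRows_onRows]
  exact onRows_of_eq _ _ _ (fP_eP hp)

theorem onRows_eP_onRows_fP (h : ¬ ∀ x, exc (A (i + 1)) (A i) x ≤ exc (A (i + 1)) (A i) 0) :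
    onRows eP i (onRows fP i A) = A ∧
      ¬ ∀ x, exc (onRows fP i A (i + 1)) (onRows fP i A i) x ≤ 0 := by
  obtain ⟨p, hp⟩ := exists_isBot_iff.2 h
  constructor
  · rw [onRows_onRows]
    exact onRows_of_eq _ _ _ (eP_fP hp)
  · rw [← exists_isTop_iff]
    rw [onRows_upper, onRows_lower, fP_of_isBot hp]
    exact ⟨p, hp.isTop⟩

/-- Where `fP` moves a ball it is undone by `eP`, so the commutation is inherited; and column
operators do not change whether it moves one, since they preserve both the bounds on the row excess
and its value at `0`. -/
theorem fCol_onRows_fP (hi : i + 1 < L) :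
    fCol L j (onRows fP i A) = onRows fP i (fCol L j A) := by
  by_cases h0 : ∀ x, exc (A (i + 1)) (A i) x ≤ exc (A (i + 1)) (A i) 0
  · rw [onRows_of_eq _ _ _ (fP_of_le h0), onRows_of_eq _ _ _ (fP_of_le _)]
    rw [exc_zero_fCol]
    exact (exc_rows_fCol_le_iff hi _).2 h0
  · obtain ⟨h1, h2⟩ := onRows_eP_onRows_fP h0
    conv_rhs => rw [← h1, fCol_onRows_eP hi]
    rw [onRows_fP_onRows_eP]
    rw [exc_rows_fCol_le_iff hi]
    exact h2

/-- A map on arrays that commutes with all column operators. -/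
def RowComm (L : ℕ) (g : Arr → Arr) : Prop := ∀ j A, fCol L j (g A) = g (fCol L j A)

theorem RowComm.comp {g g' : Arr → Arr} (h : RowComm L g) (h' : RowComm L g') :
    RowComm L (g ∘ g') := fun j A => by
  simp only [Function.comp, h j, h' j]

theorem RowComm.iterate {g : Arr → Arr} (h : RowComm L g) (k : ℕ) : RowComm L g^[k] := by
  induction k with
  | zero => exact fun _ _ => rfl
  | succ k ih => rw [Function.iterate_succ]; exact ih.comp h

theorem rowComm_eP (hi : i + 1 < L) : RowComm L (onRows eP i) := fun _ _ => fCol_onRows_eP hi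

theorem rowComm_fP (hi : i + 1 < L) : RowComm L (onRows fP i) := fun _ _ => fCol_onRows_fP hi

theorem onRows_dropP_eq {k : ℕ} (h : (un (A (i + 1)) (A i)).card ≤ k) :
    onRows dropP i A = (onRows eP i)^[k] A := by
  rw [onRows_iterate]
  unfold onRows
  rw [iterate_eP_of_card_le k h]

theorem rowComm_dropP (hi : i + 1 < L) : RowComm L (onRows dropP i) := by
  intro j A
  -- The two arrays might need different numbers of lowerings; the maximum is an exponent that
  -- serves both.
  rw [onRows_dropP_eq (le_max_left _
    (un (fCol L j A (i + 1)) (fCol L j A i)).card), onRows_dropP_eq (le_max_right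
    (un (A (i + 1)) (A i)).card _)]
  exact (rowComm_eP hi).iterate _ j A

theorem onRows_swapP_eq : onRows swapP i A =
    (onRows fP i)^[(A i).card - (A (i + 1)).card]
      ((onRows eP i)^[(A (i + 1)).card - (A i).card] A) := by
  rw [onRows_iterate, onRows_iterate, onRows_onRows]
  rfl

/-- The exponents in an exchange depend only on the row cardinalities, which column operators
preserve. -/
theorem rowComm_swapP (hi : i + 1 < L) : RowComm L (onRows swapP i) := by
  intro j A
  rw [onRows_swapP_eq, onRows_swapP_eq, card_fCol, card_fCol, (rowComm_fP hi).iterate,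
    (rowComm_eP hi).iterate]

theorem eps_fCol (hi : i + 1 < L) :
    eps (fCol L j A (i + 1)) (fCol L j A i) = eps (A (i + 1)) (A i) := by
  unfold eps
  congr 1
  ext w
  exact exc_rows_fCol_le_iff hi w

/-- A composition of column operators. -/
noncomputable def fWord (L : ℕ) (js : List ℕ) (A : Arr) : Arr := js.foldr (fCol L) A

theorem RowComm.fWord {g : Arr → Arr} (h : RowComm L g) (js : List ℕ) (A : Arr) :
    fWord L js (g A) = g (fWord L js A) := by
  induction js with
  | nil => rfl
  | cons j js ih =>
    simp only [QuasiMac.fWord, List.foldr_cons] at ih ⊢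
    rw [ih, h]

theorem card_fWord (js : List ℕ) (r : ℕ) : (fWord L js A r).card = (A r).card := by
  induction js with
  | nil => rfl
  | cons j js ih => simp only [fWord, List.foldr_cons] at ih ⊢; rw [card_fCol, ih]

theorem fWord_of_ge (js : List ℕ) {r : ℕ} (h : L ≤ r) : fWord L js A r = A r := by
  induction js with
  | nil => rfl
  | cons j js ih => simp only [fWord, List.foldr_cons] at ih ⊢; rw [fCol_of_ge h, ih]

theorem eps_fWord (hi : i + 1 < L) (js : List ℕ) :
    eps (fWord L js A (i + 1)) (fWord L js A i) = eps (A (i + 1)) (A i) := by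
  induction js with
  | nil => rfl
  | cons j js ih => simp only [fWord, List.foldr_cons] at ih ⊢; rw [eps_fCol hi, ih]

theorem fCol_lt {n : ℕ} (hj : j + 1 < n) (h : ∀ r, ∀ x ∈ A r, x < n) (r x : ℕ)
    (hx : x ∈ fCol L j A r) : x < n := by
  rw [fCol] at hx
  split_ifs at hx
  · rcases Finset.mem_insert.1 hx with rfl | hx
    · exact hj
    · exact h r x (Finset.mem_of_mem_erase hx)
  · exact h r x hx

theorem fWord_lt {n : ℕ} {js : List ℕ} (hj : ∀ j ∈ js, j + 1 < n) (h : ∀ r, ∀ x ∈ A r, x < n) :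
    ∀ r, ∀ x ∈ fWord L js A r, x < n := by
  induction js with
  | nil => exact h
  | cons j js ih =>
    simp only [fWord, List.foldr_cons] at ih ⊢
    exact fCol_lt (hj j (by simp)) (ih fun j' hj' => hj j' (by simp [hj']))

/-! ### Column-highest arrays -/

/-- No column operator can move a ball to the left. -/
def ColHigh (L : ℕ) (A : Arr) : Prop :=
  ∀ j y, exc (colSet L A j) (colSet L A (j + 1)) y ≤ exc (colSet L A j) (colSet L A (j + 1)) 0

theorem exc_cols_eP_zero (hi : i + 1 < L) :
    exc (colSet L (onRows eP i A) j) (colSet L (onRows eP i A) (j + 1)) 0 =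
      exc (colSet L A j) (colSet L A (j + 1)) 0 := by
  by_cases h0 : ∀ x, exc (A (i + 1)) (A i) x ≤ 0
  · rw [onRows_of_eq _ _ _ (eP_of_le h0)]
  obtain ⟨p, hp⟩ := exists_isTop_iff.2 h0
  rw [exc_cols_eP hp hi]
  simp

theorem colHigh_eP (hi : i + 1 < L) : ColHigh L (onRows eP i A) ↔ ColHigh L A := by
  refine forall_congr' fun j => ?_
  rw [exc_cols_eP_zero hi, exc_cols_eP_le_iff hi]

theorem colHigh_fP (hi : i + 1 < L) : ColHigh L (onRows fP i A) ↔ ColHigh L A := by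
  by_cases h0 : ∀ x, exc (A (i + 1)) (A i) x ≤ exc (A (i + 1)) (A i) 0
  · rw [onRows_of_eq _ _ _ (fP_of_le h0)]
  · conv_rhs => rw [← (onRows_eP_onRows_fP h0).1, colHigh_eP hi]

theorem card_colSet_eP (hi : i + 1 < L) (b : ℕ) :
    (colSet L (onRows eP i A) b).card = (colSet L A b).card := by
  by_cases h0 : ∀ x, exc (A (i + 1)) (A i) x ≤ 0
  · rw [onRows_of_eq _ _ _ (eP_of_le h0)]
  obtain ⟨p, hp⟩ := exists_isTop_iff.2 h0
  rw [colSet_onRows_eP hp hi]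
  split_ifs with hb
  · subst hb
    have h1 : i + 1 ∈ colSet L A b := mem_colSet.2 ⟨hi, hp.mem⟩
    have h2 : i ∉ colSet L A b := fun h => hp.notMem (mem_colSet.1 h).2
    rw [Finset.card_insert_of_notMem (by simp [h2]), Finset.card_erase_add_one h1]
  · rfl

theorem card_colSet_fP (hi : i + 1 < L) (b : ℕ) :
    (colSet L (onRows fP i A) b).card = (colSet L A b).card := by
  by_cases h0 : ∀ x, exc (A (i + 1)) (A i) x ≤ exc (A (i + 1)) (A i) 0
  · rw [onRows_of_eq _ _ _ (fP_of_le h0)]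
  · conv_rhs => rw [← (onRows_eP_onRows_fP h0).1, card_colSet_eP hi]

theorem iterate_invariant {α β : Type*} {g : α → α} {φ : α → β} (h : ∀ a, φ (g a) = φ a) (k : ℕ)
    (a : α) : φ (g^[k] a) = φ a := by
  induction k with
  | zero => rfl
  | succ k ih => rw [Function.iterate_succ_apply', h, ih]

theorem dropP_invariant {β : Type*} {φ : Arr → β} (h : ∀ A, φ (onRows eP i A) = φ A) :
    φ (onRows dropP i A) = φ A := by
  rw [onRows_dropP_eq le_rfl]
  exact iterate_invariant h _ _

theorem swapP_invariant {β : Type*} {φ : Arr → β} (h : ∀ A, φ (onRows eP i A) = φ A)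
    (h' : ∀ A, φ (onRows fP i A) = φ A) : φ (onRows swapP i A) = φ A := by
  rw [onRows_swapP_eq, iterate_invariant h', iterate_invariant h]

theorem card_colSet_dropP (hi : i + 1 < L) (b : ℕ) :
    (colSet L (onRows dropP i A) b).card = (colSet L A b).card :=
  dropP_invariant (φ := fun A => (colSet L A b).card) fun _ => card_colSet_eP hi b

theorem card_colSet_swapP (hi : i + 1 < L) (b : ℕ) :
    (colSet L (onRows swapP i A) b).card = (colSet L A b).card :=
  swapP_invariant (φ := fun A => (colSet L A b).card) (fun _ => card_colSet_eP hi b)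
    fun _ => card_colSet_fP hi b

theorem colHigh_swapP (hi : i + 1 < L) : ColHigh L (onRows swapP i A) ↔ ColHigh L A :=
  (swapP_invariant (φ := fun A => ColHigh L A) (fun _ => propext (colHigh_eP hi))
    fun _ => propext (colHigh_fP hi)).to_iff

theorem eCol_spec {r : ℕ} (hr : IsBot (colSet L A j) (colSet L A (j + 1)) r) :
    fCol L j (eCol L j A) = A ∧
      eCol L j A = fun s => if s = r then insert j ((A s).erase (j + 1)) else A s := by
  have hm := mem_colSet.1 hr.1
  have hn : j ∉ A r := fun h => hr.2.1 (mem_colSet.2 ⟨hm.1, h⟩)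
  have h2 : eCol L j A = fun s => if s = r then insert j ((A s).erase (j + 1)) else A s := by
    funext s
    unfold eCol
    by_cases hs : s = r
    · subst hs; rw [if_pos hr, if_pos rfl]
    · rw [if_neg hs, if_neg fun h => hs (h.unique hr)]
  refine ⟨?_, h2⟩
  have c1 : colSet L (eCol L j A) j = insert r (colSet L A j) := by
    ext s
    rw [mem_colSet, Finset.mem_insert, mem_colSet, h2]
    by_cases hs : s = r
    · subst hs; simp [hm.1]
    · simp [hs]
  have c2 : colSet L (eCol L j A) (j + 1) = (colSet L A (j + 1)).erase r := by
    ext s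
    rw [mem_colSet, Finset.mem_erase, mem_colSet, h2]
    by_cases hs : s = r
    · subst hs; simp
    · simp [hs]
  have ht : IsTop (colSet L (eCol L j A) j) (colSet L (eCol L j A) (j + 1)) r := by
    rw [c1, c2]; exact hr.isTop
  funext s
  by_cases hs : s = r
  · subst hs
    rw [fCol_apply_self ht, h2]
    simp only [if_true]
    rw [Finset.erase_insert (by simp [hn]), Finset.insert_erase hm.2]
  · rw [fCol_apply_ne ht hs, h2]
    simp [hs]

/-- Every array is obtained from a column-highest one by column operators. -/
theorem exists_colHigh {n : ℕ} (A : Arr) (hA : ∀ r, ∀ x ∈ A r, x < n) :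
    ∃ js A₀, ColHigh L A₀ ∧ A = fWord L js A₀ ∧ (∀ j ∈ js, j + 1 < n) ∧
      ∀ r, ∀ x ∈ A₀ r, x < n := by
  -- Moving a ball to the left decreases the sum of the column numbers of all balls in the first `L`
  -- rows.
  induction h : ∑ r ∈ Finset.range L, ∑ x ∈ A r, x using Nat.strong_induction_on generalizing A with
  | _ N ih =>
    by_cases hc : ColHigh L A
    · exact ⟨[], A, hc, rfl, by simp, hA⟩
    · unfold ColHigh at hc
      push Not at hc
      obtain ⟨j, y, hy⟩ := hc
      obtain ⟨r, hr⟩ := exists_isBot_iff.2 fun h => absurd (h y) (not_le.2 hy)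
      obtain ⟨h1, h2⟩ := eCol_spec hr
      have hm := mem_colSet.1 hr.1
      have hn : j ∉ A r := fun h => hr.2.1 (mem_colSet.2 ⟨hm.1, h⟩)
      have hjn : j + 1 < n := hA r _ hm.2
      have hlt : ∑ r ∈ Finset.range L, ∑ x ∈ eCol L j A r, x < N := by
        rw [← h]
        refine Finset.sum_lt_sum (fun s _ => ?_) ⟨r, by simpa using hm.1, ?_⟩
        · rw [h2]
          by_cases hs : s = r
          · subst hs
            simp only [if_true]
            rw [Finset.sum_insert (by simp [hn]), ← Finset.add_sum_erase _ _ hm.2]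
            omega
          · simp [hs]
        · rw [h2]
          simp only [if_true]
          rw [Finset.sum_insert (by simp [hn]), ← Finset.add_sum_erase _ _ hm.2]
          omega
      obtain ⟨js, A₀, e1, e2, e3, e4⟩ := ih _ hlt (eCol L j A) (by
        intro s x hx
        rw [h2] at hx
        simp only at hx
        split_ifs at hx
        · rcases Finset.mem_insert.1 hx with rfl | hx
          · omega
          · exact hA s x (Finset.mem_of_mem_erase hx)
        · exact hA s x hx) rfl
      refine ⟨j :: js, A₀, e1, ?_, ?_, e4⟩
      · simp only [fWord, List.foldr_cons] at e2 ⊢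
        rw [← e2, h1]
      · intro j' hj'
        rcases List.mem_cons.1 hj' with rfl | hj'
        · exact hjn
        · exact e3 j' hj'

end Commute

/-! ### Collapsing of arrays -/

/-- Apply an operation on pairs to the rows `t + c, t + c - 1`, then to the next lower pair of rows,
and so on down to the rows `t + 1, t`. -/
def chainD (g : Finset ℕ × Finset ℕ → Finset ℕ × Finset ℕ) (t : ℕ) : ℕ → Arr → Arr
  | 0, A => A
  | c + 1, A => chainD g t c (onRows g (t + c) A)

/-- The array after collapsing the rows `0, …, k`. -/
noncomputable def collA (A : Arr) : ℕ → Arr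
  | 0 => A
  | k + 1 => chainD dropP 0 (k + 1) (collA A k)

theorem rowComm_chainD {L t c : ℕ} {g : Finset ℕ × Finset ℕ → Finset ℕ × Finset ℕ}
    (hg : ∀ i, i + 1 < L → RowComm L (onRows g i)) (hk : c = 0 ∨ t + c < L) :
    RowComm L (chainD g t c) := by
  induction c with
  | zero => exact fun _ _ => rfl
  | succ c ih =>
    have h1 := ih (by omega)
    have h2 := hg (t + c) (by omega)
    exact h1.comp h2

theorem fWord_collA {L k : ℕ} (hk : k = 0 ∨ k < L) (js : List ℕ) (A : Arr) :
    fWord L js (collA A k) = collA (fWord L js A) k := by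
  induction k with
  | zero => rfl
  | succ k ih =>
    simp only [collA]
    rw [(rowComm_chainD (fun i => rowComm_dropP) (by omega)).fWord, ih (by omega)]

theorem chainD_of_lt {g : Finset ℕ × Finset ℕ → Finset ℕ × Finset ℕ} {t c r : ℕ} (A : Arr)
    (h : r < t) : chainD g t c A r = A r := by
  induction c generalizing A with
  | zero => rfl
  | succ c ih => rw [chainD, ih, onRows_of_ne _ _ _ (by omega) (by omega)]

theorem chainD_of_gt {g : Finset ℕ × Finset ℕ → Finset ℕ × Finset ℕ} {t c r : ℕ} (A : Arr)
    (h : t + c < r) : chainD g t c A r = A r := by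
  induction c generalizing A with
  | zero => rfl
  | succ c ih => rw [chainD, ih _ (by omega), onRows_of_ne _ _ _ (by omega) (by omega)]

theorem chainD_congr {g : Finset ℕ × Finset ℕ → Finset ℕ × Finset ℕ} {t c : ℕ} {A A' : Arr}
    (h : ∀ r, r ≤ t + c → A r = A' r) {r : ℕ} (hr : r ≤ t + c) :
    chainD g t c A r = chainD g t c A' r := by
  induction c generalizing A A' r with
  | zero => exact h r hr
  | succ c ih =>
    have key : ∀ r, r ≤ t + (c + 1) → onRows g (t + c) A r = onRows g (t + c) A' r := by
      intro s hs
      simp only [onRows, h (t + c + 1) (by omega), h (t + c) (by omega), h s hs]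
    rw [chainD, chainD]
    by_cases hr' : r ≤ t + c
    · exact ih (fun s hs => key s (by omega)) hr'
    · rw [chainD_of_gt _ (by omega), chainD_of_gt _ (by omega)]
      exact key r hr

/-- Triangular arrays of row lengths: `m i a` is the number of entries `≤ i` in row `a` of a
semistandard tableau. -/
structure IsGT (m : ℕ → ℕ → ℕ) : Prop where
  zero : ∀ a, m 0 a = 0
  le : ∀ i a, m i a ≤ m (i + 1) a
  strip : ∀ i a, m (i + 1) (a + 1) ≤ m i a

theorem IsGT.eq_zero {m : ℕ → ℕ → ℕ} (h : IsGT m) {i a : ℕ} (hia : i ≤ a) : m i a = 0 := by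
  induction i generalizing a with
  | zero => exact h.zero a
  | succ i ih =>
    obtain ⟨b, rfl⟩ : ∃ b, a = b + 1 := ⟨a - 1, by omega⟩
    have := h.strip i b
    rw [ih (by omega)] at this
    omega

theorem IsGT.antitone {m : ℕ → ℕ → ℕ} (h : IsGT m) (i : ℕ) : Antitone (m i) :=
  antitone_nat_of_succ_le fun a => by
    rcases i with _ | i
    · rw [h.zero, h.zero]
    · exact (h.strip i a).trans (h.le i a)

/-- The array of a tableau, given by its triangular array `m`, when the cell in row `a` and column
`b` is drawn in column `κ a b`. -/
def arrOf (κ : ℕ → ℕ → ℕ) (m : ℕ → ℕ → ℕ) : Arr := fun i =>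
  (Finset.range (i + 1)).biUnion fun a => (Finset.Ico (m i a) (m (i + 1) a)).image (κ a)

section arrOf

variable {κ m : ℕ → ℕ → ℕ}

/-- Intermediate stages of the sweep that brings in row `k + 1`. -/
def stage (κ m : ℕ → ℕ → ℕ) (A : Arr) (k s : ℕ) : Arr := fun r =>
  if r < s then (Finset.range (m (k + 1) r)).image (κ r)
  else if r = s then (Finset.range (m (k + 2) s)).image (κ s) ∪
    (Finset.range s).biUnion fun a => (Finset.Ico (m (k + 1) a) (m (k + 2) a)).image (κ a)
  else if r ≤ k + 1 then (Finset.range (m (k + 2) r)).image (κ r) else A r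

/-- Row `s + 1` holds its final content and a surplus, the new entries of the tableau rows up to
`s`. Interlacing matches the final content inside row `s`, cell by cell, while the surplus lies to
the right of everything else; hence precisely the surplus falls. -/
theorem dropP_stage (hm : IsGT m) (h1 : ∀ a, StrictMono (κ a)) (h2 : ∀ a b, κ (a + 1) b ≤ κ a b)
    (A : Arr) {k s : ℕ} (hs : s ≤ k) :
    onRows dropP s (stage κ m A k (s + 1)) = stage κ m A k s := by
  have h2' : ∀ b, Antitone fun a => κ a b := fun b => antitone_nat_of_succ_le fun a => h2 a b
  set U₁ := (Finset.range (m (k + 2) (s + 1))).image (κ (s + 1))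
  set U₂ := (Finset.range (s + 1)).biUnion fun a =>
    (Finset.Ico (m (k + 1) a) (m (k + 2) a)).image (κ a)
  set V := (Finset.range (m (k + 1) s)).image (κ s)
  have e1 : stage κ m A k (s + 1) (s + 1) = U₁ ∪ U₂ := by simp [stage, U₁, U₂]
  have e2 : stage κ m A k (s + 1) s = V := by simp [stage, V]
  have hd : dropP (U₁ ∪ U₂, V) = (U₁, V ∪ U₂) := by
    refine dropP_union ?_ ?_ ?_
    · intro x
      have : (U₁.filter fun y => x ≤ y).card ≤ (V.filter fun y => x ≤ y).card := by
        simp only [U₁, V, Finset.filter_image]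
        rw [Finset.card_image_of_injective _ (h1 _).injective,
          Finset.card_image_of_injective _ (h1 _).injective]
        refine Finset.card_le_card fun b hb => ?_
        simp only [Finset.mem_filter, Finset.mem_range] at hb ⊢
        exact ⟨hb.1.trans_le (hm.strip (k + 1) s), hb.2.trans (h2 s b)⟩
      unfold exc
      omega
    · intro y hy x hx
      simp only [U₂, Finset.mem_biUnion, Finset.mem_range, Finset.mem_image, Finset.mem_Ico] at hy
      simp only [V, Finset.mem_image, Finset.mem_range] at hx
      obtain ⟨a, ha, b', hb', rfl⟩ := hy
      obtain ⟨b, hb, rfl⟩ := hx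
      have : m (k + 1) s ≤ m (k + 1) a := hm.antitone _ (by omega)
      exact (h2' b (by omega : a ≤ s)).trans_lt (h1 a (by omega))
    · intro y hy x hx
      simp only [U₂, Finset.mem_biUnion, Finset.mem_range, Finset.mem_image, Finset.mem_Ico] at hy
      simp only [U₁, Finset.mem_image, Finset.mem_range] at hx
      obtain ⟨a, ha, b', hb', rfl⟩ := hy
      obtain ⟨b, hb, rfl⟩ := hx
      have : m (k + 1) s ≤ m (k + 1) a := hm.antitone _ (by omega)
      have : m (k + 2) (s + 1) ≤ m (k + 1) s := hm.strip (k + 1) s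
      exact (h2' b (by omega : a ≤ s + 1)).trans_lt (h1 a (by omega))
  funext r
  by_cases hr : r = s
  · subst hr
    rw [onRows_lower, e1, e2, hd]
    simp only [stage, lt_irrefl, if_false, if_true, V, U₂]
    rw [Finset.range_add_one, Finset.biUnion_insert, ← Finset.union_assoc, ← Finset.image_union]
    congr 2
    ext b
    have : m (k + 1) r ≤ m (k + 2) r := hm.le (k + 1) r
    simp only [Finset.mem_union, Finset.mem_range, Finset.mem_Ico]
    omega
  · by_cases hr' : r = s + 1
    · subst hr'
      rw [onRows_upper, e1, e2, hd]
      simp [stage, U₁, show ¬ (s + 1 < s) by omega, hs]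
    · rw [onRows_of_ne _ _ _ hr hr']
      simp only [stage]
      by_cases h : r < s
      · simp [h, show r < s + 1 by omega]
      · simp [h, hr, hr', show ¬ r < s + 1 by omega]

theorem chainD_stage (hm : IsGT m) (h1 : ∀ a, StrictMono (κ a))
    (h2 : ∀ a b, κ (a + 1) b ≤ κ a b) (A : Arr) {k t c : ℕ} (hs : t + c ≤ k + 1) :
    chainD dropP t c (stage κ m A k (t + c)) = stage κ m A k t := by
  induction c with
  | zero => rfl
  | succ c ih =>
    rw [chainD, ← add_assoc, dropP_stage hm h1 h2 A (by omega), ih (by omega)]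

/-- Collapsing the array of a tableau. -/
theorem collA_arrOf (hm : IsGT m) (h1 : ∀ a, StrictMono (κ a))
    (h2 : ∀ a b, κ (a + 1) b ≤ κ a b) (k r : ℕ) :
    collA (arrOf κ m) k r =
      if r ≤ k then (Finset.range (m (k + 1) r)).image (κ r) else arrOf κ m r := by
  induction k generalizing r with
  | zero =>
    rw [collA]
    split_ifs with h
    · obtain rfl : r = 0 := by omega
      simp [arrOf, hm.zero]
    · rfl
  | succ k ih =>
    have : collA (arrOf κ m) k = stage κ m (arrOf κ m) k (k + 1) := by
      funext r
      rw [ih, stage]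
      by_cases hr : r ≤ k
      · simp [hr, show r < k + 1 by omega]
      · rw [if_neg hr, if_neg (by omega)]
        split_ifs with h3 h4
        · subst h3
          rw [arrOf, Finset.range_add_one, Finset.biUnion_insert, hm.eq_zero (le_refl (k + 1))]
          simp only [Finset.range_eq_Ico]
        · omega
        · rfl
    have h3 := chainD_stage hm h1 h2 (arrOf κ m) (k := k) (t := 0) (c := k + 1) (by omega)
    rw [zero_add] at h3
    rw [collA, this, h3]
    simp only [stage]
    rcases r with _ | r
    · simp
    · simp

end arrOf

/-! ### Column-highest arrays are arrays of tableaux -/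

/-- The number of balls of column `b` in the rows below row `y`. -/
def cnt (A : Arr) (b y : ℕ) : ℕ := ((Finset.range y).filter fun r => b ∈ A r).card

theorem cnt_succ (A : Arr) (b y : ℕ) : cnt A b (y + 1) = cnt A b y + if b ∈ A y then 1 else 0 := by
  unfold cnt
  rw [Finset.range_add_one, Finset.filter_insert]
  split_ifs
  · rw [Finset.card_insert_of_notMem (by simp)]
  · rfl

theorem cnt_mono (A : Arr) (b : ℕ) : Monotone (cnt A b) :=
  monotone_nat_of_le_succ fun y => by rw [cnt_succ]; omega

theorem card_colSet_split {L y : ℕ} (A : Arr) (b : ℕ) (hy : y ≤ L) :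
    (colSet L A b).card = cnt A b y + ((colSet L A b).filter fun r => y ≤ r).card := by
  rw [← Finset.card_filter_add_card_filter_not (s := colSet L A b) (fun r => r < y)]
  congr 1
  · unfold cnt colSet
    rw [Finset.filter_filter]
    congr 1
    ext r
    simp only [Finset.mem_filter, Finset.mem_range]
    constructor
    · rintro ⟨h1, h2, h3⟩; exact ⟨h3, h2⟩
    · rintro ⟨h1, h2⟩; exact ⟨by omega, h2, h1⟩
  · congr 1
    ext r
    simp

/-- Subtracting the excess from row `y` upwards from the total excess leaves the excess below row
`y`: being column-highest is a lattice condition. -/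
theorem ColHigh.cnt_le {L : ℕ} {A : Arr} (h : ColHigh L A) (b : ℕ) {y : ℕ} (hy : y ≤ L) :
    cnt A (b + 1) y ≤ cnt A b y := by
  have h1 := h b y
  rw [exc_zero, exc, card_colSet_split A b hy, card_colSet_split A (b + 1) hy] at h1
  push_cast at h1
  omega

/-- The triangular array of an array of balls on `n` columns. -/
def patt (n : ℕ) (A : Arr) (i a : ℕ) : ℕ := ((Finset.range n).filter fun b => a < cnt A b i).card

theorem filter_range_eq_range {n : ℕ} {p : ℕ → Prop} [DecidablePred p]
    (h : ∀ b, p (b + 1) → p b) :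
    (Finset.range n).filter p = Finset.range ((Finset.range n).filter p).card := by
  induction n with
  | zero => simp
  | succ n ih =>
    rw [Finset.range_add_one, Finset.filter_insert]
    split_ifs with hp
    · have hall : ∀ k, k ≤ n → p k := by
        intro k hk
        induction hk using Nat.decreasingInduction with
        | self => exact hp
        | of_succ k _ ih => exact h k ih
      have : (Finset.range n).filter p = Finset.range n :=
        Finset.filter_true_of_mem fun k hk => hall k (by simp at hk; omega)
      rw [this, Finset.card_insert_of_notMem (by simp), Finset.card_range, Finset.range_add_one]
    · exact ih

section patt

variable {L n : ℕ} {A : Arr}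

theorem ColHigh.cnt_le' (hA : ColHigh L A) (hL : ∀ r, L ≤ r → A r = ∅) (b y : ℕ) : cnt A (b + 1) y ≤ cnt A b y := by
  by_cases hy : y ≤ L
  · exact hA.cnt_le b hy
  · have key : ∀ b k, cnt A b (L + k) = cnt A b L := by
      intro b k
      induction k with
      | zero => rfl
      | succ k ih => rw [← add_assoc, cnt_succ, ih, hL _ (by omega)]; simp
    obtain ⟨k, rfl⟩ := Nat.exists_eq_add_of_le (not_le.1 hy).le
    rw [key, key]
    exact hA.cnt_le b le_rfl

/-- By the lattice condition, the columns with more than `a` balls below row `i` form an initial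
segment, so counting them determines them. -/
theorem lt_patt_iff (hA : ColHigh L A) (hL : ∀ r, L ≤ r → A r = ∅)
    (i a b : ℕ) : b < patt n A i a ↔ b < n ∧ a < cnt A b i := by
  have := filter_range_eq_range (n := n) (p := fun b => a < cnt A b i)
    fun b hb => hb.trans_le (hA.cnt_le' hL b i)
  rw [← Finset.mem_range, patt, ← this]
  simp

theorem isGT_patt : IsGT (patt n A) where
  zero a := by simp [patt, cnt]
  le i a := Finset.card_le_card fun b hb => by
    simp only [Finset.mem_filter] at hb ⊢
    exact ⟨hb.1, hb.2.trans_le (cnt_mono A b (by omega))⟩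
  strip i a := Finset.card_le_card fun b hb => by
    simp only [Finset.mem_filter] at hb ⊢
    refine ⟨hb.1, ?_⟩
    have := hb.2
    rw [cnt_succ] at this
    split_ifs at this <;> omega

theorem cnt_le_self (b y : ℕ) : cnt A b y ≤ y := by
  have := Finset.card_filter_le (Finset.range y) fun r => b ∈ A r
  rwa [Finset.card_range] at this

/-- A ball of row `i` in column `b` with `a = cnt A b i` balls below it in its column is the cell in
row `a` and column `b` of the tableau. -/
theorem arrOf_patt (hA : ColHigh L A) (hL : ∀ r, L ≤ r → A r = ∅)
    (hn : ∀ r, ∀ x ∈ A r, x < n) : arrOf (fun _ b => b) (patt n A) = A := by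
  funext i
  ext b
  simp only [arrOf, Finset.mem_biUnion, Finset.mem_range, Finset.mem_image, Finset.mem_Ico,
    exists_eq_right]
  have key := lt_patt_iff (n := n) hA hL
  constructor
  · rintro ⟨a, _, h1, h2⟩
    rw [key] at h2
    have h3 : ¬ (b < n ∧ a < cnt A b i) := by rw [← key]; omega
    by_contra hb
    have := cnt_succ A b i
    rw [if_neg hb] at this
    exact h3 ⟨h2.1, by omega⟩
  · intro hb
    have := cnt_succ A b i
    rw [if_pos hb] at this
    refine ⟨cnt A b i, ?_, ?_, ?_⟩
    · have := cnt_le_self (A := A) b i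
      omega
    · by_contra h
      have := ((key i (cnt A b i) b).1 (by omega)).2
      omega
    · rw [key]
      exact ⟨hn i b hb, by omega⟩

end patt

/-- The array whose rows are initial intervals. -/
def intervals (μ : ℕ → ℕ) : Arr := fun r => Finset.range (μ r)

theorem strictMono_id' (a : ℕ) : StrictMono ((fun _ b => b : ℕ → ℕ → ℕ) a) := fun _ _ h => h

theorem collA_arrOf_id {m : ℕ → ℕ → ℕ} (hm : IsGT m) (k r : ℕ) :
    collA (arrOf (fun _ b => b) m) k r =
      if r ≤ k then Finset.range (m (k + 1) r) else arrOf (fun _ b => b) m r := by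
  rw [collA_arrOf hm strictMono_id' (fun _ _ => le_rfl)]
  split_ifs
  · simp
  · rfl

/-! ### Chains of exchanges and drops on intervals -/

/-- Every exchange meets a pair of nested rows and interchanges them literally, so row `t + c`
slides down to row `t` and the rows in between move up by one. -/
theorem chainD_swapP_of_subset {t c : ℕ} {A : Arr} (h : ∀ a, a < c → A (t + c) ⊆ A (t + a))
    (r : ℕ) :
    chainD swapP t c A r =
      if r = t then A (t + c) else if t < r ∧ r ≤ t + c then A (r - 1) else A r := by
  induction c generalizing A r with
  | zero =>
    rw [chainD]
    split_ifs with h1 h2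
    · subst h1; rfl
    · omega
    · rfl
  | succ c ih =>
    have hs : swapP (A (t + c + 1), A (t + c)) = (A (t + c), A (t + c + 1)) :=
      swapP_of_subset (h c (by omega))
    have e1 : ∀ s, onRows swapP (t + c) A s = if s = t + c then A (t + c + 1)
        else if s = t + c + 1 then A (t + c) else A s := fun s => by rw [onRows, hs]
    rw [chainD, ih]
    · simp only [e1, if_true]
      by_cases h1 : r = t
      · simp [h1, add_assoc]
      · simp only [h1, if_false]
        by_cases h2 : t < r ∧ r ≤ t + c
        · rw [if_pos h2, if_pos (show t < r ∧ r ≤ t + (c + 1) by omega),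
            if_neg (show r - 1 ≠ t + c by omega), if_neg (show r - 1 ≠ t + c + 1 by omega)]
        · rw [if_neg h2]
          by_cases h3 : r = t + c + 1
          · rw [if_neg (by omega), if_pos h3, if_pos (by omega)]
            congr 1
            omega
          · rw [if_neg h3, if_neg (show r ≠ t + c by omega),
              if_neg (show ¬ (t < r ∧ r ≤ t + (c + 1)) by omega)]
    · intro a ha
      rw [e1, e1, if_pos rfl, if_neg (by omega), if_neg (by omega)]
      exact h a (by omega)

theorem chainD_dropP_intervals {t c : ℕ} {A : Arr} {μ ν : ℕ → ℕ} {base : Finset ℕ}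
    (hA : ∀ a, a < c → A (t + a) = Finset.range (μ a))
    (hc : A (t + c) = base ∪ (Finset.range c).biUnion fun a => Finset.Ico (μ a) (ν a))
    (h1 : ∀ a, a < c → μ a ≤ ν a) (h2 : ∀ a, a + 1 < c → ν (a + 1) ≤ μ a)
    (h3 : ∀ a, a + 1 = c → base ⊆ Finset.range (μ a)) (r : ℕ) :
    chainD dropP t c A r =
      if r < t then A r else if r < t + c then Finset.range (ν (r - t))
      else if r = t + c then base else A r := by
  induction c generalizing A base r with
  | zero =>
    rw [chainD]
    split_ifs with h4 h5 h6
    · rfl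
    · omega
    · rw [h6, hc]; simp
    · rfl
  | succ c ih =>
    have hanti : ∀ a b, a ≤ b → b < c + 1 → μ b ≤ μ a := by
      intro a b hab hb
      induction b, hab using Nat.le_induction with
      | base => exact le_rfl
      | succ b hab ihb =>
        exact ((h1 (b + 1) hb).trans (h2 b hb)).trans (ihb (by omega))
    set U₂ := (Finset.range (c + 1)).biUnion fun a => Finset.Ico (μ a) (ν a) with hU
    have hd : dropP (A (t + c + 1), A (t + c)) = (base, Finset.range (μ c) ∪ U₂) := by
      rw [hA c (by omega), add_assoc, hc]
      have hlow : ∀ y ∈ U₂, μ c ≤ y := by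
        intro y hy
        simp only [hU, Finset.mem_biUnion, Finset.mem_range, Finset.mem_Ico] at hy
        obtain ⟨a, ha, hy⟩ := hy
        exact (hanti a c (by omega) (by omega)).trans hy.1
      refine dropP_union (exc_nonpos_of_subset (h3 c rfl)) ?_ ?_
      · intro y hy x hx
        have := hlow y hy
        simp only [Finset.mem_range] at hx
        omega
      · intro y hy x hx
        have := hlow y hy
        have := Finset.mem_range.1 (h3 c rfl hx)
        omega
    have e1 : ∀ s, onRows dropP (t + c) A s = if s = t + c then Finset.range (μ c) ∪ U₂
        else if s = t + c + 1 then base else A s := fun s => by rw [onRows, hd]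
    -- In the row just reached, the interval `[0, μ c)` and the arriving `[μ c, ν c)` join to the
    -- part that stays; this is the remainder for the next drop.
    rw [chainD, ih (base := Finset.range (ν c))]
    · simp only [e1]
      by_cases h4 : r < t
      · simp only [h4, if_true]
        rw [if_neg (by omega), if_neg (by omega)]
      · simp only [h4, if_false]
        by_cases h5 : r < t + c
        · rw [if_pos h5, if_pos (by omega)]
        · rw [if_neg h5]
          by_cases h6 : r = t + c
          · rw [if_pos h6, if_pos (by omega), h6]; simp
          · rw [if_neg h6, if_neg h6, if_neg (show ¬ r < t + (c + 1) by omega)]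
            rfl
    · intro a ha
      rw [e1, if_neg (by omega), if_neg (by omega), hA a (by omega)]
    · rw [e1, if_pos rfl, hU, Finset.range_add_one, Finset.biUnion_insert, ← Finset.union_assoc]
      congr 1
      ext x
      have := h1 c (by omega)
      simp only [Finset.mem_union, Finset.mem_range, Finset.mem_Ico]
      omega
    · exact fun a ha => h1 a (by omega)
    · exact fun a ha => h2 a (by omega)
    · intro a ha x hx
      subst ha
      have := h2 a (by omega)
      simp only [Finset.mem_range] at hx ⊢
      omega

/-! ### The sets of balls with large labels -/

/-- The columns of the balls of row `0` with label larger than `k`: row `k` is moved down to row `0`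
by exchanges. -/
noncomputable def lab (k : ℕ) (A : Arr) : Finset ℕ := chainD swapP 0 k A 0

/-- Separation of `V` from the rest of `V'` modulo `V''`: the set `V` arises from `V'` by
removing the largest elements of `V' \ V''`. -/
structure Cut (V'' V V' : Finset ℕ) : Prop where
  sub₁ : V'' ⊆ V
  sub₂ : V ⊆ V'
  sep : ∀ x ∈ V', x ∉ V → ∀ y ∈ V, y ∉ V'' → y < x

/-- Two different solutions of equal size each contain an element missing from the other, and the
two separation conditions order these elements in opposite ways. -/
theorem Cut.unique {V'' V V₁ V' : Finset ℕ} (h : Cut V'' V V') (h₁ : Cut V'' V₁ V')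
    (hc : V.card = V₁.card) : V = V₁ := by
  by_contra hne
  have a1 : ¬ V ⊆ V₁ := fun hs => hne (Finset.eq_of_subset_of_card_le hs hc.ge)
  have a2 : ¬ V₁ ⊆ V := fun hs => hne (Finset.eq_of_subset_of_card_le hs hc.le).symm
  obtain ⟨x, hx, hx'⟩ := Finset.not_subset.1 a1
  obtain ⟨y, hy, hy'⟩ := Finset.not_subset.1 a2
  have b1 := h.sep y (h₁.sub₂ hy) hy' x hx fun h' => hx' (h₁.sub₁ h')
  have b2 := h₁.sep x (h.sub₂ hx) hx' y hy fun h' => hy' (h.sub₁ h')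
  omega

theorem Cut.image {V'' V V' : Finset ℕ} (h : Cut V'' V V') {f : ℕ → ℕ}
    (hf : StrictMonoOn f (V' : Set ℕ)) : Cut (V''.image f) (V.image f) (V'.image f) where
  sub₁ := Finset.image_subset_image h.sub₁
  sub₂ := Finset.image_subset_image h.sub₂
  sep := by
    intro x hx hx' y hy hy'
    obtain ⟨a, ha, rfl⟩ := Finset.mem_image.1 hx
    obtain ⟨b, hb, rfl⟩ := Finset.mem_image.1 hy
    refine hf (h.sub₂ hb) ha (h.sep a ha (fun h' => hx' (Finset.mem_image_of_mem f h')) b hb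
      fun h' => hy' (Finset.mem_image_of_mem f h'))

/-- After raising `p` the last maximum of the excess is at `p`, so no unmatched closing bracket can
remain to the right of it. -/
theorem IsBot.next_lt {U V : Finset ℕ} {p p' : ℕ} (h : IsBot U V p)
    (h' : IsBot (insert p U) (V.erase p) p') : p' < p := by
  have ht := h.isTop
  obtain ⟨a1, a2, a3, a4⟩ := h'
  have hne : p' ≠ p := fun e => by simp [e] at a1
  by_contra hl
  have h1 := ht.1 p' (by omega)
  have h2 := a3 p (by omega)
  omega

/-- Elements that are raised later lie further to the left. -/
theorem iterate_fP_sep (k : ℕ) : ∀ (s : Finset ℕ × Finset ℕ),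
    (fP^[k] s).2 ⊆ s.2 ∧ ∀ p, IsBot s.1 s.2 p → ∀ x ∈ s.2, x ∉ (fP^[k] s).2 → x ≤ p := by
  induction k with
  | zero => exact fun s => ⟨subset_rfl, fun p _ x hx hx' => absurd hx hx'⟩
  | succ k ih =>
    rintro ⟨U, V⟩
    rw [Function.iterate_succ_apply]
    by_cases h0 : ∀ x, exc U V x ≤ exc U V 0
    · rw [fP_of_le h0]
      exact ih (U, V)
    · obtain ⟨p, hp⟩ := exists_isBot_iff.2 h0
      rw [fP_of_isBot hp]
      obtain ⟨i1, i2⟩ := ih (insert p U, V.erase p)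
      refine ⟨i1.trans (Finset.erase_subset _ _), fun p' hp' x hx hx' => ?_⟩
      rw [hp'.unique hp]
      by_cases hxp : x = p
      · exact hxp.le
      · by_cases h1 : ∀ x, exc (insert p U) (V.erase p) x ≤ exc (insert p U) (V.erase p) 0
        · exfalso
          have : ∀ j, fP^[j] (insert p U, V.erase p) = (insert p U, V.erase p) := fun j => by
            induction j with
            | zero => rfl
            | succ j ih => rw [Function.iterate_succ_apply, fP_of_le h1, ih]
          rw [this] at hx'
          exact hx' (Finset.mem_erase.2 ⟨hxp, hx⟩)
        · obtain ⟨p₁, hp₁⟩ := exists_isBot_iff.2 h1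
          have := i2 p₁ hp₁ x (Finset.mem_erase.2 ⟨hxp, hx⟩) hx'
          have := hp.next_lt hp₁
          omega

/-- Elements are raised from right to left, so those among the first `k` lie to the right of those
raised afterwards. -/
theorem cut_iterate_fP (k l : ℕ) : ∀ (s : Finset ℕ × Finset ℕ),
    Cut (fP^[k + l] s).2 (fP^[k] s).2 s.2 := by
  induction k with
  | zero =>
    intro s
    refine ⟨(iterate_fP_sep _ s).1, subset_rfl, fun x hx hx' => absurd hx hx'⟩
  | succ k ih =>
    rintro ⟨U, V⟩
    rw [show k + 1 + l = (k + l) + 1 by omega, Function.iterate_succ_apply,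
      Function.iterate_succ_apply]
    by_cases h0 : ∀ x, exc U V x ≤ exc U V 0
    · rw [fP_of_le h0]
      exact ih (U, V)
    · obtain ⟨p, hp⟩ := exists_isBot_iff.2 h0
      rw [fP_of_isBot hp]
      have hc := ih (insert p U, V.erase p)
      refine ⟨hc.sub₁, hc.sub₂.trans (Finset.erase_subset _ _), fun x hx hx' y hy hy' => ?_⟩
      by_cases hxp : x = p
      · subst hxp
        have hyV := hc.sub₂ hy
        simp only [Finset.mem_erase] at hyV
        have := (iterate_fP_sep (k + l + 1) (U, V)).2 x hp y hyV.2 (by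
          rw [Function.iterate_succ_apply, fP_of_isBot hp]; exact hy')
        omega
      · exact hc.sep x (Finset.mem_erase.2 ⟨hxp, hx⟩) hx' y hy hy'

theorem card_dropP_lower (U V : Finset ℕ) :
    (dropP (U, V)).2.card = V.card + (un U V).card := by
  rw [dropP, Finset.card_union_of_disjoint]
  rw [Finset.disjoint_left]
  intro x hx hx'
  exact (mem_of_exc_lt (mem_un.1 hx' (x + 1) (by omega))).2 hx

/-- The three lower sets are stages of one raising sequence that starts from the dropped pair:
raising as many elements as were dropped gives back `V`, and the exchange raises still further, the
hypothesis ensuring that it does not stop before `V`. -/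
theorem cut_dropP_swapP {U V : Finset ℕ} (h1 : (dropP (U, V)).1.card ≤ V.card) :
    Cut (swapP (dropP (U, V))).2 V (dropP (U, V)).2 := by
  have hc := card_dropP_lower U V
  have e1 : V = (fP^[(un U V).card] (dropP (U, V))).2 := by
    rw [← iterate_eP_of_card_le _ (le_refl (un U V).card), iterate_fP_iterate_eP _ le_rfl]
  have e2 : swapP (dropP (U, V)) = fP^[(un U V).card + (V.card - (dropP (U, V)).1.card)]
      (dropP (U, V)) := by
    rw [swapP, Nat.sub_eq_zero_of_le (show (dropP (U, V)).1.card ≤ (dropP (U, V)).2.card by omega),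
      Function.iterate_zero_apply]
    congr 1
    omega
  have := cut_iterate_fP (un U V).card (V.card - (dropP (U, V)).1.card) (dropP (U, V))
  rw [← e1, ← e2] at this
  exact this

/-! ### How the label sets change when one more row is collapsed. -/

section Pieri

variable {m : ℕ → ℕ → ℕ}

theorem collA_arrOf_eq_stage (hm : IsGT m) (k : ℕ) :
    collA (arrOf (fun _ b => b) m) k =
      stage (fun _ b => b) m (arrOf (fun _ b => b) m) k (k + 1) := by
  funext r
  rw [collA_arrOf_id hm, stage]
  by_cases hr : r ≤ k
  · simp [hr, show r < k + 1 by omega]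
  · rw [if_neg hr, if_neg (by omega)]
    split_ifs with h3 h4
    · subst h3
      rw [arrOf, Finset.range_add_one, Finset.biUnion_insert, hm.eq_zero (le_refl (k + 1))]
      simp only [Finset.range_eq_Ico]
    · omega
    · rfl

theorem range_subset_of_le {a b : ℕ} (h : a ≤ b) : Finset.range a ⊆ Finset.range b :=
  Finset.range_subset_range.2 h

/-- The array of row intervals of the collapsed tableau after moving row `r` to row `0` and row
`r + 1` to row `1`. -/
theorem chainD_chainD_collA (hm : IsGT m) {k r : ℕ} (hr : r ≤ k) (s : ℕ) :
    chainD swapP 1 r (chainD swapP 0 r (collA (arrOf (fun _ b => b) m) (k + 1))) s =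
      if s = 0 then Finset.range (m (k + 2) r) else if s = 1 then Finset.range (m (k + 2) (r + 1))
      else if s ≤ r + 1 then Finset.range (m (k + 2) (s - 2))
      else collA (arrOf (fun _ b => b) m) (k + 1) s := by
  have hT := collA_arrOf_id hm (k + 1)
  set T := collA (arrOf (fun _ b => b) m) (k + 1)
  have hanti := hm.antitone (k + 2)
  have h1 : ∀ s, chainD swapP 0 r T s = if s = 0 then T r else if s ≤ r then T (s - 1) else T s := by
    intro s
    rw [chainD_swapP_of_subset]
    · simp only [zero_add]
      by_cases hs : s = 0
      · simp [hs]
      · simp [hs, Nat.pos_of_ne_zero hs]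
    · intro a ha
      rw [hT, hT, if_pos (by omega), if_pos (by omega)]
      exact range_subset_of_le (hanti (by omega))
  rw [chainD_swapP_of_subset]
  · simp only [h1, hT]
    split_ifs <;> first | omega | rfl | (congr 2; omega)
  · intro a ha
    rw [h1, h1, if_neg (by omega), if_neg (by omega), if_neg (by omega), if_pos (by omega),
      hT, hT, if_pos (by omega), if_pos (by omega)]
    exact range_subset_of_le (hanti (by omega))

theorem chainD_chainD_collA' (hm : IsGT m) {k r : ℕ} (hr : r ≤ k) (s : ℕ) :
    chainD swapP 1 r (chainD swapP 0 (r + 1) (collA (arrOf (fun _ b => b) m) (k + 1))) s =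
      if s = 0 then Finset.range (m (k + 2) (r + 1)) else if s = 1 then Finset.range (m (k + 2) r)
      else if s ≤ r + 1 then Finset.range (m (k + 2) (s - 2))
      else collA (arrOf (fun _ b => b) m) (k + 1) s := by
  have hT := collA_arrOf_id hm (k + 1)
  set T := collA (arrOf (fun _ b => b) m) (k + 1)
  have hanti := hm.antitone (k + 2)
  have h1 : ∀ s, chainD swapP 0 (r + 1) T s =
      if s = 0 then T (r + 1) else if s ≤ r + 1 then T (s - 1) else T s := by
    intro s
    rw [chainD_swapP_of_subset]
    · simp only [zero_add]
      by_cases hs : s = 0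
      · simp [hs]
      · simp [hs, Nat.pos_of_ne_zero hs]
    · intro a ha
      rw [hT, hT, if_pos (by omega), if_pos (by omega)]
      exact range_subset_of_le (hanti (by omega))
  rw [chainD_swapP_of_subset]
  · simp only [h1, hT]
    split_ifs <;> first | omega | rfl | (congr 2; omega)
  · intro a ha
    rw [h1, h1, if_neg (show 1 + r ≠ 0 by omega), if_neg (show 1 + a ≠ 0 by omega),
      if_pos (show 1 + r ≤ r + 1 by omega), if_pos (show 1 + a ≤ r + 1 by omega),
      hT, hT, if_pos (by omega), if_pos (by omega)]
    exact range_subset_of_le (hanti (by omega))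

/-- Both sides bring the rows `r` and `r + 1` to the bottom, in opposite orders; on nested intervals
one exchange of the two lowest rows passes from one order to the other. -/
theorem swapP_chainD_collA (hm : IsGT m) {k r : ℕ} (hr : r ≤ k) :
    onRows swapP 0
      (chainD swapP 1 r (chainD swapP 0 r (collA (arrOf (fun _ b => b) m) (k + 1)))) =
    chainD swapP 1 r (chainD swapP 0 (r + 1) (collA (arrOf (fun _ b => b) m) (k + 1))) := by
  have hsub : Finset.range (m (k + 2) (r + 1)) ⊆ Finset.range (m (k + 2) r) :=
    range_subset_of_le (hm.antitone _ (by omega))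
  funext s
  rw [chainD_chainD_collA' hm hr]
  rcases s with _ | _ | s
  · rw [onRows_lower, chainD_chainD_collA hm hr, chainD_chainD_collA hm hr]
    simp [swapP_of_subset hsub]
  · rw [onRows_upper, chainD_chainD_collA hm hr, chainD_chainD_collA hm hr]
    simp [swapP_of_subset hsub]
  · rw [onRows_of_ne _ _ _ (by omega) (by omega), chainD_chainD_collA hm hr]
    simp

/-- A word in the row operators that leaves the balls of row `r` in row `0` and that is one drop
away from the next stage of collapsing. -/
noncomputable def pieriWord (k r : ℕ) (T : Arr) : Arr :=
  chainD swapP 1 r (chainD dropP 1 r (chainD swapP 0 r (chainD dropP (r + 1) (k - r) T)))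

theorem rowComm_pieriWord {L k r : ℕ} (hk : k + 1 < L) (hr : r ≤ k) :
    RowComm L (pieriWord k r) := by
  have h1 := rowComm_chainD (L := L) (t := 1) (c := r) (fun i => rowComm_swapP (i := i)) (by omega)
  have h2 := rowComm_chainD (L := L) (t := 1) (c := r) (fun i => rowComm_dropP (i := i)) (by omega)
  have h3 := rowComm_chainD (L := L) (t := 0) (c := r) (fun i => rowComm_swapP (i := i)) (by omega)
  have h4 := rowComm_chainD (L := L) (t := r + 1) (c := k - r) (fun i => rowComm_dropP (i := i))
    (by omega)
  exact h1.comp (h2.comp (h3.comp h4))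

theorem pieriWord_zero (k r : ℕ) (T : Arr) : pieriWord k r T 0 = lab r T := by
  rw [pieriWord, chainD_of_lt _ (by omega), chainD_of_lt _ (by omega), lab]
  exact chainD_congr (fun s hs => chainD_of_lt _ (by omega)) (by omega)

/-- A rearrangement of the sweep of row `k + 1`. The sweep is stopped at row `r + 1`; row `r` is
moved to the bottom, and the sweep is continued above it. The new entries of tableau row `r` are
kept back and brought to the second lowest row, so that a single drop in the two lowest rows
completes the sweep. In this way the bottom row shows the same label set before and after collapsing
row `k + 1`. -/
theorem dropP_pieriWord (hm : IsGT m) {k r : ℕ} (hr : r ≤ k) :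
    onRows dropP 0 (pieriWord k r (collA (arrOf (fun _ b => b) m) k)) =
      chainD swapP 1 r (chainD swapP 0 r (collA (arrOf (fun _ b => b) m) (k + 1))) := by
  have hanti1 := hm.antitone (k + 1)
  have hanti2 := hm.antitone (k + 2)
  have hle : ∀ a, m (k + 1) a ≤ m (k + 2) a := hm.le (k + 1)
  have hst : ∀ a, m (k + 2) (a + 1) ≤ m (k + 1) a := hm.strip (k + 1)
  set A := arrOf (fun _ b => b) m with hA
  set X1 := chainD dropP (r + 1) (k - r) (collA A k) with hX1
  have e1 : X1 = stage (fun _ b => b) m A k (r + 1) := by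
    rw [hX1, hA, collA_arrOf_eq_stage hm, ← hA]
    have := chainD_stage hm strictMono_id' (fun _ _ => le_rfl) A (k := k) (t := r + 1)
      (c := k - r) (by omega)
    rwa [show r + 1 + (k - r) = k + 1 by omega] at this
  have r1 : ∀ s, s ≤ r → X1 s = Finset.range (m (k + 1) s) := by
    intro s hs
    rw [e1, stage, if_pos (by omega)]
    simp
  have r2 : X1 (r + 1) = (Finset.range (m (k + 2) (r + 1)) ∪
      Finset.Ico (m (k + 1) r) (m (k + 2) r)) ∪
      (Finset.range r).biUnion fun a => Finset.Ico (m (k + 1) a) (m (k + 2) a) := by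
    rw [e1, stage, if_neg (by omega), if_pos rfl, Finset.range_add_one, Finset.biUnion_insert,
      Finset.union_assoc]
    simp
  have r3 : ∀ s, r + 1 < s → X1 s = collA A (k + 1) s := by
    intro s hs
    rw [e1, stage, if_neg (by omega), if_neg (by omega), hA, collA_arrOf_id hm]
    simp
  -- What remains when the surplus of the tableau rows before `r` has left: the final content of row
  -- `r + 1` and the new entries of row `r`, which have not yet been dropped.
  set base := Finset.range (m (k + 2) (r + 1)) ∪ Finset.Ico (m (k + 1) r) (m (k + 2) r) with hb
  set X2 := chainD swapP 0 r X1 with hX2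
  have e2 : ∀ s, X2 s = if s = 0 then X1 r else if s ≤ r then X1 (s - 1) else X1 s := by
    intro s
    rw [hX2, chainD_swapP_of_subset]
    · simp only [zero_add]
      by_cases hs : s = 0
      · simp [hs]
      · simp [hs, Nat.pos_of_ne_zero hs]
    · intro a ha
      rw [r1 _ (by omega), r1 _ (by omega)]
      exact range_subset_of_le (hanti1 (by omega))
  set X3 := chainD dropP 1 r X2 with hX3
  have e3 : ∀ s, X3 s = if s < 1 then X2 s else if s < 1 + r then
      Finset.range (m (k + 2) (s - 1)) else if s = 1 + r then base else X2 s := by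
    intro s
    rw [hX3, chainD_dropP_intervals (μ := m (k + 1)) (ν := m (k + 2)) (base := base)]
    · intro a ha
      rw [e2, if_neg (by omega), if_pos (by omega), r1 _ (by omega)]
      congr 2
      omega
    · rw [e2, if_neg (by omega), if_neg (by omega), add_comm 1 r, r2]
    · exact fun a _ => hle a
    · exact fun a _ => hst a
    · rintro a rfl x hx
      rw [hb, Finset.mem_union, Finset.mem_range, Finset.mem_Ico] at hx
      rw [Finset.mem_range]
      have h1 := hst a
      have h2 : m (k + 2) (a + 1 + 1) ≤ m (k + 2) (a + 1) := hanti2 (by omega)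
      omega
  have e4 : ∀ s, pieriWord k r (collA A k) s = if s = 1 then base else
      if 1 < s ∧ s ≤ 1 + r then X3 (s - 1) else X3 s := by
    intro s
    have e5 : X3 (1 + r) = base := by
      rw [e3, if_neg (by omega), if_neg (by omega), if_pos rfl]
    rw [pieriWord, ← hX1, ← hX2, ← hX3, chainD_swapP_of_subset, e5]
    intro a ha x hx
    rw [e5, hb, Finset.mem_union, Finset.mem_range, Finset.mem_Ico] at hx
    rw [e3, if_neg (by omega), if_pos (by omega), Finset.mem_range, Nat.add_sub_cancel_left]
    have h1 : m (k + 2) (r + 1) ≤ m (k + 2) a := hanti2 (by omega)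
    have h2 : m (k + 2) r ≤ m (k + 2) a := hanti2 (by omega)
    omega
  have z0 : pieriWord k r (collA A k) 0 = Finset.range (m (k + 1) r) := by
    rw [e4, if_neg (by omega), if_neg (by omega), e3, if_pos (by omega), e2, if_pos rfl,
      r1 _ le_rfl]
  have z1 : pieriWord k r (collA A k) 1 = base := by rw [e4, if_pos rfl]
  have hd : dropP (base, Finset.range (m (k + 1) r)) =
      (Finset.range (m (k + 2) (r + 1)), Finset.range (m (k + 2) r)) := by
    rw [hb, dropP_union]
    · congr 1
      ext x
      have := hle r
      simp only [Finset.mem_union, Finset.mem_range, Finset.mem_Ico]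
      omega
    · exact exc_nonpos_of_subset (range_subset_of_le (hst r))
    · intro y hy x hx
      simp only [Finset.mem_range, Finset.mem_Ico] at hx hy
      omega
    · intro y hy x hx
      have := hst r
      simp only [Finset.mem_range, Finset.mem_Ico] at hx hy
      omega
  funext s
  rw [hA, chainD_chainD_collA hm hr, ← hA]
  rcases s with _ | _ | s
  · rw [onRows_lower, zero_add, z1, z0, hd]; simp
  · rw [onRows_upper, zero_add, z1, z0, hd]; simp
  · rw [onRows_of_ne _ _ _ (by omega) (by omega), e4, if_neg (show s + 1 + 1 ≠ 1 by omega),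
      if_neg (show s + 1 + 1 ≠ 0 by omega), if_neg (show s + 1 + 1 ≠ 1 by omega)]
    by_cases hs : s + 1 + 1 ≤ r + 1
    · rw [if_pos (show 1 < s + 1 + 1 ∧ s + 1 + 1 ≤ 1 + r by omega), if_pos hs, e3,
        if_neg (show ¬ s + 1 + 1 - 1 < 1 by omega), if_pos (by omega)]
      rfl
    · rw [if_neg (show ¬ (1 < s + 1 + 1 ∧ s + 1 + 1 ≤ 1 + r) by omega), if_neg hs, e3,
        if_neg (by omega), if_neg (by omega), if_neg (by omega), e2, if_neg (by omega),
        if_neg (by omega), r3 _ (by omega)]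

/-- How the sets of balls with large labels change when one more row is collapsed. -/
theorem cut_lab (hm : IsGT m) {L k r : ℕ} (hk : k + 1 < L) (hr : r ≤ k) (js : List ℕ) {A : Arr}
    (hA : A = fWord L js (arrOf (fun _ b => b) m)) :
    Cut (lab (r + 1) (collA A (k + 1))) (lab r (collA A k)) (lab r (collA A (k + 1))) ∧
      (lab r (collA A k)).card = m (k + 1) r := by
  set A₀ := arrOf (fun _ b => b) m with hA₀
  have cs : ∀ t c, t + c < L → RowComm L (chainD swapP t c) := fun t c h =>
    rowComm_chainD (fun i => rowComm_swapP (i := i)) (by omega)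
  have hT : collA A k = fWord L js (collA A₀ k) := by rw [hA, fWord_collA (by omega)]
  have hT' : collA A (k + 1) = fWord L js (collA A₀ (k + 1)) := by
    rw [hA, fWord_collA (by omega)]
  have hZ : pieriWord k r (collA A k) = fWord L js (pieriWord k r (collA A₀ k)) := by
    rw [hT, (rowComm_pieriWord hk hr).fWord]
  -- This identity and the next one are known for intervals; both sides commute with the column word
  -- `js`, so they hold for `A`.
  have hW : onRows dropP 0 (pieriWord k r (collA A k)) =
      chainD swapP 1 r (chainD swapP 0 r (collA A (k + 1))) := by
    rw [hZ, ← (rowComm_dropP (by omega)).fWord, dropP_pieriWord hm hr,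
      (cs 1 r (by omega)).fWord, (cs 0 r (by omega)).fWord, hT']
  have hW' : onRows swapP 0 (chainD swapP 1 r (chainD swapP 0 r (collA A (k + 1)))) =
      chainD swapP 1 r (chainD swapP 0 (r + 1) (collA A (k + 1))) := by
    rw [hT', ← (cs 0 r (by omega)).fWord, ← (cs 1 r (by omega)).fWord,
      ← (rowComm_swapP (by omega)).fWord, swapP_chainD_collA hm hr, (cs 1 r (by omega)).fWord,
      (cs 0 (r + 1) (by omega)).fWord]
  have hcard : (lab r (collA A k)).card = m (k + 1) r := by
    rw [hT, lab, ← (cs 0 r (by omega)).fWord, card_fWord, chainD_swapP_of_subset]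
    · rw [if_pos rfl, zero_add, hA₀, collA_arrOf_id hm, if_pos hr, Finset.card_range]
    · intro a ha
      rw [zero_add, zero_add, hA₀, collA_arrOf_id hm, collA_arrOf_id hm, if_pos (by omega),
        if_pos (by omega)]
      exact range_subset_of_le (hm.antitone _ (by omega))
  refine ⟨?_, hcard⟩
  -- The bottom row of `Z` is the label set before the step. A drop turns it into the label set for
  -- `r` after the step, and a further exchange into the one for `r + 1`; this is the situation of
  -- `cut_dropP_swapP`.
  set Z := pieriWord k r (collA A k)
  have z0 : Z 0 = lab r (collA A k) := pieriWord_zero _ _ _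
  have d0 : (dropP (Z 1, Z 0)).2 = lab r (collA A (k + 1)) := by
    have := congrFun hW 0
    rwa [onRows_lower, chainD_of_lt _ (by omega)] at this
  have d1 : (dropP (Z 1, Z 0)).1 =
      chainD swapP 1 r (chainD swapP 0 r (collA A (k + 1))) 1 := by
    rw [← hW]; exact (onRows_upper dropP 0 Z).symm
  have c1 : (dropP (Z 1, Z 0)).1.card = m (k + 2) (r + 1) := by
    rw [d1, hT', ← (cs 0 r (by omega)).fWord, ← (cs 1 r (by omega)).fWord, card_fWord,
      chainD_chainD_collA hm hr]
    simp
  have s0 : (swapP (dropP (Z 1, Z 0))).2 = lab (r + 1) (collA A (k + 1)) := by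
    have h3 := congrFun hW' 0
    rw [onRows_lower, zero_add, ← d1, chainD_of_lt (r := 0) _ (Nat.zero_lt_one),
      chainD_of_lt (r := 0) _ (Nat.zero_lt_one)] at h3
    rw [show chainD swapP 0 r (collA A (k + 1)) 0 = (dropP (Z 1, Z 0)).2 from d0.symm] at h3
    exact h3
  rw [← s0, ← d0, ← z0]
  refine cut_dropP_swapP ?_
  rw [c1, z0, hcard]
  exact hm.strip (k + 1) r

/-- If the balls with large labels correspond after collapsing, they correspond before. -/
theorem image_lab_collA (hm : IsGT m) {L : ℕ} (js js' : List ℕ) {A A' : Arr}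
    (hA : A = fWord L js (arrOf (fun _ b => b) m)) (hA' : A' = fWord L js' (arrOf (fun _ b => b) m))
    {f : ℕ → ℕ} {K : ℕ} (hK : K < L) (hf : StrictMonoOn f (lab 0 (collA A K) : Set ℕ))
    (h : ∀ r, r ≤ K → (lab r (collA A K)).image f = lab r (collA A' K)) (k : ℕ) (hk : k ≤ K) :
    lab 0 (collA A k) ⊆ lab 0 (collA A K) ∧
      ∀ r, r ≤ k → (lab r (collA A k)).image f = lab r (collA A' k) := by
  induction hk using Nat.decreasingInduction with
  | self => exact ⟨subset_rfl, h⟩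
  | of_succ k hk ih =>
    obtain ⟨i1, i2⟩ := ih
    have hsub : ∀ r, r ≤ k + 1 → lab r (collA A (k + 1)) ⊆ lab 0 (collA A K) := by
      intro r hr
      induction r with
      | zero => exact i1
      | succ r ihr =>
        have := (cut_lab hm (by omega : k + 1 < L) (by omega : r ≤ k) js hA).1
        exact (this.sub₁.trans this.sub₂).trans (ihr (by omega))
    refine ⟨((cut_lab hm (by omega : k + 1 < L) (by omega : 0 ≤ k) js hA).1.sub₂).trans i1,
      fun r hr => ?_⟩
    obtain ⟨c1, n1⟩ := cut_lab hm (by omega : k + 1 < L) hr js hA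
    obtain ⟨c2, n2⟩ := cut_lab hm (by omega : k + 1 < L) hr js' hA'
    have hf' : StrictMonoOn f (lab r (collA A (k + 1)) : Set ℕ) :=
      hf.mono (by exact_mod_cast hsub r (by omega))
    -- Both the image of the earlier set and the corresponding set for `A'` are cuts between the
    -- same two sets, and their common size is read off from `m`; so they coincide.
    have c3 := c1.image hf'
    rw [i2 r (by omega), i2 (r + 1) (by omega)] at c3
    refine c3.unique c2 ?_
    rw [Finset.card_image_of_injOn, n1, n2]
    exact (hf'.injOn).mono (by exact_mod_cast c1.sub₂)

end Pieri

theorem colHigh_chainD_swapP {L t c : ℕ} {A : Arr} (h : c = 0 ∨ t + c < L) :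
    ColHigh L (chainD swapP t c A) ↔ ColHigh L A := by
  induction c generalizing A with
  | zero => rfl
  | succ c ih => rw [chainD, ih (by omega), colHigh_swapP (by omega)]

theorem card_colSet_chainD_swapP {L t c b : ℕ} {A : Arr} (h : c = 0 ∨ t + c < L) :
    (colSet L (chainD swapP t c A) b).card = (colSet L A b).card := by
  induction c generalizing A with
  | zero => rfl
  | succ c ih => rw [chainD, ih (by omega), card_colSet_swapP (by omega)]

/-- For a column-highest array the result of collapsing depends only on the numbers of balls in the
columns. In particular exchanges of rows, which preserve these numbers and column-highestness, do
not change it. -/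
theorem collA_of_colHigh {L n : ℕ} {A : Arr} (hA : ColHigh L A) (hL : ∀ r, L ≤ r → A r = ∅)
    (hn : ∀ r, ∀ x ∈ A r, x < n) (r : ℕ) :
    collA A (L - 1) r =
      if r < L then (Finset.range n).filter fun b => r < (colSet L A b).card else ∅ := by
  rcases L with _ | L
  · rw [if_neg (by omega)]
    exact hL r (by omega)
  · have hm := isGT_patt (n := n) (A := A)
    have e := arrOf_patt hA hL hn
    have h1 := collA_arrOf_id hm (k := L) (r := r)
    rw [e] at h1
    rw [Nat.add_sub_cancel, h1]
    by_cases hr : r ≤ L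
    · rw [if_pos hr, if_pos (by omega)]
      ext b
      rw [Finset.mem_range, lt_patt_iff hA hL]
      rw [Finset.mem_filter, Finset.mem_range]
      exact Iff.rfl
    · rw [if_neg hr, if_neg (by omega), hL r (by omega)]

theorem chainD_lt {n t c : ℕ} {A : Arr} {L : ℕ} (hc : c = 0 ∨ t + c < L)
    (hn : ∀ r, ∀ x ∈ A r, x < n) (hL : ∀ r, L ≤ r → A r = ∅) :
    (∀ r, ∀ x ∈ chainD swapP t c A r, x < n) ∧ ∀ r, L ≤ r → chainD swapP t c A r = ∅ := by
  have hL' : ∀ r, L ≤ r → chainD swapP t c A r = ∅ := by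
    intro r hr
    rcases hc with rfl | hc
    · exact hL r hr
    · rw [chainD_of_gt _ (by omega), hL r hr]
  refine ⟨fun r x hx => ?_, hL'⟩
  by_contra hx'
  have h1 : r < L := by
    by_contra h
    rw [hL' r (by omega)] at hx
    simp at hx
  have h2 : 0 < (colSet L (chainD swapP t c A) x).card :=
    Finset.card_pos.2 ⟨r, mem_colSet.2 ⟨h1, hx⟩⟩
  rw [card_colSet_chainD_swapP hc] at h2
  obtain ⟨s, hs⟩ := Finset.card_pos.1 h2
  exact hx' (hn s x (mem_colSet.1 hs).2)

/-- The labels of an array are determined by its recording data and the labels of the collapsed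
array, up to an order preserving relabelling of the columns. -/
theorem image_lab {L n : ℕ} {A₀ A A' : Arr} (hA₀ : ColHigh L A₀) (hL : ∀ r, L ≤ r → A₀ r = ∅)
    (hn : ∀ r, ∀ x ∈ A₀ r, x < n) (js js' : List ℕ) (hA : A = fWord L js A₀)
    (hA' : A' = fWord L js' A₀) {f : ℕ → ℕ}
    (hf : StrictMonoOn f (lab 0 (collA A (L - 1)) : Set ℕ))
    (h : ∀ r, r < L → (lab r (collA A (L - 1))).image f = lab r (collA A' (L - 1)))
    (q : ℕ) (hq : q < L) :
    lab q A ⊆ lab 0 (collA A (L - 1)) ∧ (lab q A).image f = lab q A' := by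
  -- Exchanging row `q` down to the bottom turns the label set for `q` into the bottom row of an
  -- array with the same collapse. It then suffices to know bottom rows, which is stage `0` of
  -- `image_lab_collA`.
  set B₀ := chainD swapP 0 q A₀ with hB₀
  have hc : q = 0 ∨ 0 + q < L := by omega
  obtain ⟨bn, bL⟩ := chainD_lt hc hn hL
  have bH : ColHigh L B₀ := (colHigh_chainD_swapP hc).2 hA₀
  have hm := isGT_patt (n := n) (A := B₀)
  have e := arrOf_patt bH bL bn
  have hcoll : collA B₀ (L - 1) = collA A₀ (L - 1) := by
    funext r
    rw [collA_of_colHigh bH bL bn, collA_of_colHigh hA₀ hL hn]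
    simp only [hB₀, card_colSet_chainD_swapP hc]
  have cs : RowComm L (chainD swapP 0 q) := rowComm_chainD (fun i => rowComm_swapP (i := i)) hc
  have e1 : chainD swapP 0 q A = fWord L js B₀ := by rw [hA, ← cs.fWord]
  have e2 : chainD swapP 0 q A' = fWord L js' B₀ := by rw [hA', ← cs.fWord]
  have hL1 : L - 1 = 0 ∨ L - 1 < L := by omega
  have k1 : collA (fWord L js B₀) (L - 1) = collA A (L - 1) := by
    rw [← fWord_collA hL1, hcoll, hA, fWord_collA hL1]
  have k2 : collA (fWord L js' B₀) (L - 1) = collA A' (L - 1) := by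
    rw [← fWord_collA hL1, hcoll, hA', fWord_collA hL1]
  have := image_lab_collA hm js js' (A := fWord L js B₀) (A' := fWord L js' B₀) (by rw [e])
    (by rw [e]) (f := f) (K := L - 1) (by omega) (by rwa [k1])
    (fun r hr => by rw [k1, k2]; exact h r (by omega)) 0 (by omega)
  rw [← e1, ← e2] at this
  refine ⟨?_, this.2 0 le_rfl⟩
  have h3 := this.1
  rw [e1, k1, ← e1] at h3
  exact h3

/-! ### Cyclic queues -/

/-- A periodic queue on the sites `0, …, n - 1`: arrivals at the sites of `U`, possible services at
the sites of `V`, services used at the sites of `D`. The queue length before the site `x` is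
`q x`, and `w` customers wait at the cut between the last and the first site. -/
structure IsQueue (n : ℕ) (U V D : Finset ℕ) (w : ℕ) (q : ℕ → ℕ) : Prop where
  ltU : ∀ x ∈ U, x < n
  ltV : ∀ x ∈ V, x < n
  sub : D ⊆ V
  start : q 0 = w
  last_eq : q n = w
  step : ∀ x, x < n → q (x + 1) + (if x ∈ D then 1 else 0) = q x + (if x ∈ U then 1 else 0)
  idle : ∀ x ∈ V, x ∉ D → q x = 0 ∧ x ∉ U
  zero : ∃ x, x ≤ n ∧ q x = 0

section IsQueue

variable {n : ℕ} {U V D : Finset ℕ} {w : ℕ} {q : ℕ → ℕ}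

theorem IsQueue.exc_eq (h : IsQueue n U V D w q) {x : ℕ} (hx : x ≤ n) :
    exc U D x = (w : ℤ) - q x := by
  induction hx using Nat.decreasingInduction with
  | self => rw [exc_of_bound h.ltU fun y hy => h.ltV y (h.sub hy), h.last_eq]; ring
  | of_succ k hk ih =>
    have h1 := h.step k hk
    rw [exc_step, ih]
    split_ifs at h1 ⊢ <;> omega

theorem IsQueue.exc_le (h : IsQueue n U V D w q) (x : ℕ) : exc U D x ≤ w := by
  by_cases hx : x ≤ n
  · rw [h.exc_eq hx]; omega
  · rw [exc_of_bound (fun y hy => by have := h.ltU y hy; omega)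
      fun y hy => by have := h.ltV y (h.sub hy); omega]
    omega

theorem IsQueue.card_eq (h : IsQueue n U V D w q) : D.card = U.card := by
  have h1 := h.exc_eq (Nat.zero_le n)
  rw [exc_zero, h.start] at h1
  omega

theorem IsQueue.card_le (h : IsQueue n U V D w q) : U.card ≤ V.card :=
  h.card_eq ▸ Finset.card_le_card h.sub

theorem card_filter_union {F G : Finset ℕ} (h : Disjoint F G) (x : ℕ) :
    ((F ∪ G).filter fun y => x ≤ y).card =
      (F.filter fun y => x ≤ y).card + (G.filter fun y => x ≤ y).card := by
  rw [Finset.filter_union, Finset.card_union_of_disjoint (Finset.disjoint_filter_filter h)]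

/-- At an idle service the queue is empty, so the excess of `U` over `D` has its maximal value `w`
there. Hence, when a final segment `F` of the idle services has been raised, its smallest element is
the one that `eP` would lower; adding the elements of `F` from right to left is therefore the action
of `fP`. -/
theorem IsQueue.iterate_fP (h : IsQueue n U V D w q) (F : Finset ℕ) (hF : F ⊆ V \ D)
    (hsep : ∀ x ∈ V \ D, x ∉ F → ∀ y ∈ F, x < y) :
    fP^[F.card] (U, V) = (U ∪ F, V \ F) := by
  induction hc : F.card generalizing F with
  | zero => simp [Finset.card_eq_zero.1 hc]
  | succ c ih =>
    have hne : F.Nonempty := Finset.card_pos.1 (by omega)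
    set p := F.min' hne with hp
    have hpF : p ∈ F := F.min'_mem hne
    have hpl : ∀ y ∈ F, p ≤ y := fun y hy => F.min'_le y hy
    have hdU : Disjoint U F := Finset.disjoint_left.2 fun x hxU hxF => by
      have := Finset.mem_sdiff.1 (hF hxF)
      exact (h.idle x this.1 this.2).2 hxU
    have hV : V \ F = D ∪ ((V \ D) \ F) := by
      ext x
      simp only [Finset.mem_sdiff, Finset.mem_union]
      constructor
      · tauto
      · rintro (hx | hx)
        · exact ⟨h.sub hx, fun hxF => (Finset.mem_sdiff.1 (hF hxF)).2 hx⟩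
        · exact ⟨hx.1.1, hx.2⟩
    have hdD : Disjoint D ((V \ D) \ F) := Finset.disjoint_left.2 fun x hx hx' => by
      simp only [Finset.mem_sdiff] at hx'
      exact hx'.1.2 hx
    have key : ∀ x, exc (U ∪ F) (V \ F) x = exc U D x + (F.filter fun y => x ≤ y).card -
        (((V \ D) \ F).filter fun y => x ≤ y).card := by
      intro x
      rw [hV, exc, exc, card_filter_union hdU, card_filter_union hdD]
      push_cast
      ring
    have hpm := Finset.mem_sdiff.1 (hF hpF)
    have hqp := (h.idle p hpm.1 hpm.2).1
    have vp : exc (U ∪ F) (V \ F) p = w + F.card := by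
      rw [key, h.exc_eq (h.ltV p hpm.1).le, hqp, Finset.filter_true_of_mem hpl,
        Finset.filter_false_of_mem (s := (V \ D) \ F)]
      · simp
      · intro x hx
        have := hsep x (Finset.mem_sdiff.1 hx).1 (Finset.mem_sdiff.1 hx).2 p hpF
        omega
    have htop : IsTop (U ∪ F) (V \ F) p := by
      constructor
      · intro x hx
        rw [vp, key]
        have h1 := h.exc_le x
        have h2 : (F.filter fun y => x ≤ y).card < F.card :=
          Finset.card_lt_card ⟨Finset.filter_subset _ _, fun hs => by
            have := (Finset.mem_filter.1 (hs hpF)).2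
            omega⟩
        omega
      · intro x hx
        rw [vp, key]
        have h1 := h.exc_le x
        have h2 := Finset.card_filter_le F fun y => x ≤ y
        omega
    have e1 := eP_of_isTop htop
    have hpU : p ∉ U := (h.idle p hpm.1 hpm.2).2
    have e2 : eP (U ∪ F, V \ F) = (U ∪ F.erase p, V \ F.erase p) := by
      rw [e1]
      congr 1
      · ext x
        simp only [Finset.mem_erase, Finset.mem_union]
        by_cases hx : x = p
        · subst hx; simp [hpU]
        · simp [hx]
      · ext x
        simp only [Finset.mem_insert, Finset.mem_sdiff, Finset.mem_erase]
        by_cases hx : x = p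
        · subst hx; simp [hpm.1]
        · simp [hx]
    have hce : (F.erase p).card = c := by rw [Finset.card_erase_of_mem hpF]; omega
    have i1 := ih (F.erase p) ((Finset.erase_subset _ _).trans hF) (by
      intro x hx hxF y hy
      have hy' := Finset.mem_erase.1 hy
      by_cases hxp : x = p
      · have := hpl y hy'.2
        have := hy'.1
        omega
      · exact hsep x hx (fun h' => hxF (Finset.mem_erase.2 ⟨hxp, h'⟩)) y hy'.2) hce
    rw [Function.iterate_succ_apply', i1, ← e2]
    exact fP_eP htop

/-- There are as many services used as arrivals, so the exchange raises exactly the idle services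
and leaves the used ones. -/
theorem IsQueue.swapP_eq (h : IsQueue n U V D w q) : (swapP (U, V)).2 = D := by
  have h1 := h.iterate_fP (V \ D) subset_rfl fun x hx hx' => absurd hx hx'
  have h2 : (V \ D).card = V.card - U.card := by
    rw [Finset.card_sdiff_of_subset h.sub, h.card_eq]
  rw [swapP, Nat.sub_eq_zero_of_le h.card_le, Function.iterate_zero_apply, ← h2, h1]
  exact Finset.sdiff_sdiff_eq_self h.sub

/-- The maximum is attained just to the right of the last idle service, where the queue is empty and
all later services are used; if no service is idle, at any point where the queue is empty. -/
theorem IsQueue.eps_eq (h : IsQueue n U V D w q) : eps U V = w := by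
  have hV : V = D ∪ (V \ D) := (Finset.union_sdiff_of_subset h.sub).symm
  have key : ∀ x, exc U V x = exc U D x - ((V \ D).filter fun y => x ≤ y).card := by
    intro x
    conv_lhs => rw [hV]
    rw [exc, exc, card_filter_union Finset.disjoint_sdiff]
    push_cast
    ring
  have hle : ∀ x, exc U V x ≤ w := fun x => by
    rw [key]
    have := h.exc_le x
    omega
  rcases (V \ D).eq_empty_or_nonempty with he | hne
  · obtain ⟨x, hx, hq⟩ := h.zero
    refine QuasiMac.eps_eq hle (x := x) ?_
    rw [key, he, h.exc_eq hx, hq]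
    simp
  · set p := (V \ D).max' hne
    have hpm := Finset.mem_sdiff.1 ((V \ D).max'_mem hne)
    have hp := h.idle p hpm.1 hpm.2
    have hpn := h.ltV p hpm.1
    have hs := h.step p hpn
    rw [if_neg hpm.2, if_neg hp.2, hp.1] at hs
    refine QuasiMac.eps_eq hle (x := p + 1) ?_
    rw [key, h.exc_eq (by omega), Finset.filter_false_of_mem]
    · simp; omega
    · intro y hy
      have := (V \ D).le_max' y hy
      omega

theorem isQueue_empty (hV : ∀ x ∈ V, x < n) : IsQueue n ∅ V ∅ 0 fun _ => 0 where
  ltU := by simp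
  ltV := hV
  sub := by simp
  start := rfl
  last_eq := rfl
  step := by simp
  idle := by simp
  zero := ⟨0, by omega, rfl⟩

/-- Adding one customer, who is served at the first free site. -/
theorem IsQueue.insert (h : IsQueue n U V D w q) {u d : ℕ} (hu : u < n) (huU : u ∉ U) (hd : d ∈ V)
    (hdD : d ∉ D)
    (hfirst : ∀ x ∈ V, x ∉ D → if u ≤ d then u ≤ x → d ≤ x else x < u ∧ d ≤ x) :
    ∃ q', IsQueue n (insert u U) V (insert d D) (w + if d < u then 1 else 0) q' := by
  have hdn := h.ltV d hd
  obtain ⟨hqd, hdU⟩ := h.idle d hd hdD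
  -- The new customer lengthens the queue by one along the cyclic arc from `u` to `d`.
  refine ⟨fun x => q x + if (if u ≤ d then u < x ∧ x ≤ d else u < x ∨ x ≤ d) then 1 else 0,
    ?_, h.ltV, ?_, ?_, ?_, ?_, ?_, ?_⟩
  · intro x hx
    rcases Finset.mem_insert.1 hx with rfl | hx
    · exact hu
    · exact h.ltU x hx
  · intro x hx
    rcases Finset.mem_insert.1 hx with rfl | hx
    · exact hd
    · exact h.sub hx
  · show q 0 + _ = _
    rw [h.start]
    split_ifs <;> omega
  · show q n + _ = _
    rw [h.last_eq]
    split_ifs <;> omega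
  · intro x hx
    have h1 := h.step x hx
    simp only [Finset.mem_insert]
    by_cases e1 : x = u
    · subst e1
      simp only [huU, if_false] at h1
      by_cases e2 : x = d
      · subst e2
        simp only [hdD, if_false] at h1
        simp; omega
      · simp only [e2, true_or, false_or, if_true]
        split_ifs at h1 ⊢ <;> omega
    · by_cases e2 : x = d
      · subst e2
        simp only [hdD, hdU, if_false] at h1
        simp only [e1, hdU, true_or, or_self, if_true, if_false]
        split_ifs <;> omega
      · simp only [e1, e2, false_or]
        split_ifs at h1 ⊢ <;> omega
  · intro x hx hxD
    rw [Finset.mem_insert, not_or] at hxD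
    obtain ⟨i1, i2⟩ := h.idle x hx hxD.2
    have h2 := hfirst x hx hxD.2
    have hxd := hxD.1
    refine ⟨?_, ?_⟩
    · show q x + _ = 0
      rw [i1]
      split_ifs at h2 ⊢ <;> omega
    · rw [Finset.mem_insert, not_or]
      refine ⟨?_, i2⟩
      rintro rfl
      split_ifs at h2 <;> omega
  -- The site `d` was idle, so the old queue is empty just after it, and the new customer leaves
  -- there.
  · refine ⟨d + 1, by omega, ?_⟩
    have hs := h.step d hdn
    rw [if_neg hdD, if_neg hdU, hqd] at hs
    show q (d + 1) + _ = 0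
    split_ifs <;> omega

end IsQueue

theorem chainD_succ_bottom (g : Finset ℕ × Finset ℕ → Finset ℕ × Finset ℕ) (t c : ℕ) (A : Arr) :
    chainD g t (c + 1) A = onRows g t (chainD g (t + 1) c A) := by
  induction c generalizing A with
  | zero => rfl
  | succ c ih =>
    rw [chainD, ih, chainD]
    congr 3
    omega

/-- The columns of the balls of row `r` with label larger than `k`. -/
noncomputable def labAt (A : Arr) (k r : ℕ) : Finset ℕ := chainD swapP r (k - r) A r

theorem labAt_zero (A : Arr) (k : ℕ) : labAt A k 0 = lab k A := rfl

theorem labAt_self (A : Arr) (k : ℕ) : labAt A k k = A k := by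
  rw [labAt, Nat.sub_self]; rfl

theorem labAt_of_lt (A : Arr) {k r : ℕ} (h : r < k) :
    labAt A k r = (swapP (labAt A k (r + 1), A r)).2 := by
  obtain ⟨c, rfl⟩ : ∃ c, k = r + 1 + c := ⟨k - (r + 1), by omega⟩
  rw [labAt, labAt, show r + 1 + c - r = c + 1 by omega, show r + 1 + c - (r + 1) = c by omega,
    chainD_succ_bottom, onRows_lower, chainD_of_lt A (r := r) (by omega)]

/-- The major index of an array with `L` rows. -/
noncomputable def majA (L : ℕ) (A : Arr) : ℕ :=
  ∑ r ∈ Finset.range (L - 1), ∑ k ∈ Finset.Ico (r + 1) L, eps (labAt A k (r + 1)) (A r)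

theorem chainD_apply_bottom (A : Arr) {k r : ℕ} :
    chainD swapP (r + 1) (k - (r + 1)) A r = A r := chainD_of_lt A (by omega)

/-- Label sets are produced by exchanges, and the maximal excess between two rows is invariant under
column operators. Exchanges above row `r` leave row `r` alone, so the two sets compared are adjacent
rows of one array. -/
theorem majA_fWord {L : ℕ} (js : List ℕ) (A : Arr) : majA L (fWord L js A) = majA L A := by
  unfold majA
  refine Finset.sum_congr rfl fun r hr => Finset.sum_congr rfl fun k hk => ?_
  rw [Finset.mem_range] at hr
  rw [Finset.mem_Ico] at hk
  have cs : RowComm L (chainD swapP (r + 1) (k - (r + 1))) :=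
    rowComm_chainD (fun i => rowComm_swapP (i := i)) (by omega)
  rw [labAt, labAt, ← chainD_apply_bottom (fWord L js A) (k := k), ← cs.fWord,
    eps_fWord (by omega), chainD_apply_bottom A]

/-! ### The Ferrari–Martin pairings as cyclic queues. -/

section Link

variable {n : ℕ}

/-- The array of a generalized multiline queue. -/
def toArr (M : GMLQ n) : Arr := fun r => (M r).map Fin.valEmbedding

theorem mem_toArr {M : GMLQ n} {r : ℕ} {e : Fin n} : (e : ℕ) ∈ toArr M r ↔ e ∈ M r := by
  simp [toArr, Fin.val_inj]

theorem toArr_lt (M : GMLQ n) (r x : ℕ) (h : x ∈ toArr M r) : x < n := by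
  obtain ⟨e, _, rfl⟩ := Finset.mem_map.1 h
  exact e.2

theorem card_toArr (M : GMLQ n) (r : ℕ) : (toArr M r).card = (M r).card := Finset.card_map _

theorem toArr_injective : Function.Injective (toArr (n := n)) := fun _ _ h =>
  funext fun r => Finset.map_injective _ (congrFun h r)

/-- The cyclic distance from column `c` rightwards to column `x`. -/
theorem rotate_index {c x : Fin n} :
    ((if c ≤ x then (x : ℕ) - c else x + n - c) + c) % n = x := by
  have h1 := c.2
  have h2 := x.2
  split_ifs with h
  · rw [Nat.sub_add_cancel h, Nat.mod_eq_of_lt h2]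
  · rw [Nat.sub_add_cancel (by omega), Nat.add_mod_right, Nat.mod_eq_of_lt h2]

/-- The index of a column in the rotated list is its cyclic distance from `c`, so the first hit is
the nearest free site. -/
theorem firstFree_some {B : Finset (Fin n)} {used : List (Fin n)} {c e : Fin n}
    (h : firstFree B used c = some e) :
    e ∈ B ∧ e ∉ used ∧ ∀ x ∈ B, x ∉ used → if c ≤ e then c ≤ x → e ≤ x else x < c ∧ e ≤ x := by
  rw [firstFree, List.find?_eq_some_iff_getElem] at h
  obtain ⟨h1, i, hi, hie, hlt⟩ := h
  simp only [decide_eq_true_eq] at h1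
  refine ⟨h1.1, h1.2, fun x hxB hxu => ?_⟩
  have hle : i ≤ if c ≤ x then (x : ℕ) - c else x + n - c := by
    by_contra hc
    have := hlt _ (lt_of_not_ge hc)
    simp only [List.getElem_rotate, List.length_finRange, rotate_index, List.getElem_finRange,
      Fin.cast_mk, Fin.eta] at this
    simp [hxB, hxu] at this
  simp only [List.length_rotate, List.length_finRange] at hi
  rw [List.getElem_rotate] at hie
  simp only [List.length_finRange, List.getElem_finRange, Fin.cast_mk] at hie
  have hev : (i + c) % n = e := congrArg Fin.val hie
  have h1 := c.2
  have h2 := x.2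
  have h3 := e.2
  have hcase : i + c = e ∨ i + c = e + n := by
    rcases lt_or_ge (i + c) n with h' | h'
    · left; rwa [Nat.mod_eq_of_lt h'] at hev
    · right
      rw [Nat.mod_eq_sub_mod h', Nat.mod_eq_of_lt (by omega)] at hev
      omega
  simp only [Fin.le_def, Fin.lt_def] at hle ⊢
  split_ifs at hle ⊢ <;> omega

theorem firstFree_none {B : Finset (Fin n)} {used : List (Fin n)} {c : Fin n}
    (h : firstFree B used c = none) : ∀ x ∈ B, x ∈ used := by
  rw [firstFree, List.find?_eq_none] at h
  intro x hx
  have := h x (by simp)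
  simpa [hx] using this

/-- One step of the pairing procedure. -/
def pstep (B : Finset (Fin n)) (ps : List (Fin n × Fin n)) (c : Fin n) : List (Fin n × Fin n) :=
  match firstFree B (ps.map Prod.snd) c with
  | some e => ps ++ [(c, e)]
  | none => ps

theorem pairings_eq (L : ℕ) (lab : Fin n → ℕ) (B : Finset (Fin n)) :
    pairings L lab B = (pairOrder L lab).foldl (pstep B) [] := rfl

/-- The set of column numbers in a list. -/
def colsOf (os : List (Fin n)) : Finset ℕ := (os.map Fin.val).toFinset

theorem mem_colsOf {os : List (Fin n)} {c : Fin n} : (c : ℕ) ∈ colsOf os ↔ c ∈ os := by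
  simp [colsOf, Fin.val_inj]

/-- Every newly paired ball is a customer served at the first free site, so `IsQueue.insert` keeps
the queue going. The order of the balls does not matter: the set of partners and the number of
wrappings depend only on the set of paired balls. The bound on the length guarantees that a free
site is always found. -/
theorem foldl_pstep (B : Finset (Fin n)) (os : List (Fin n)) (hos : os.Nodup)
    (hlen : os.length ≤ B.card) :
    (os.foldl (pstep B) []).map Prod.fst = os ∧
    ((os.foldl (pstep B) []).map Prod.snd).Nodup ∧
    ∃ q, IsQueue n (colsOf os) (B.map Fin.valEmbedding)
      (colsOf ((os.foldl (pstep B) []).map Prod.snd))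
      ((os.foldl (pstep B) []).countP fun p => p.2 < p.1) q := by
  induction os using List.reverseRecOn with
  | nil =>
    refine ⟨rfl, by simp, fun _ => 0, ?_⟩
    simpa [colsOf] using isQueue_empty (n := n) (V := B.map Fin.valEmbedding) (by simp)
  | append_singleton os c ih =>
    rw [List.length_append, List.length_singleton] at hlen
    have hnd := List.nodup_append.1 hos
    obtain ⟨i1, i2, q, i3⟩ := ih hnd.1 (by omega)
    rw [List.foldl_append, List.foldl_cons, List.foldl_nil]
    set ps := os.foldl (pstep B) [] with hps
    have hc : c ∉ os := fun hc => hnd.2.2 c hc c (by simp) rfl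
    rw [pstep]
    cases hf : firstFree B (ps.map Prod.snd) c with
    | none =>
      exfalso
      have h1 := firstFree_none hf
      have h2 : B ⊆ (ps.map Prod.snd).toFinset := fun x hx => List.mem_toFinset.2 (h1 x hx)
      have h3 := Finset.card_le_card h2
      rw [List.toFinset_card_of_nodup i2, List.length_map] at h3
      have h4 := congrArg List.length i1
      rw [List.length_map] at h4
      omega
    | some e =>
      obtain ⟨h1, h2, h3⟩ := firstFree_some hf
      refine ⟨by simp [i1], ?_, ?_⟩
      · simp only [List.map_append, List.map_cons, List.map_nil]
        exact List.nodup_append.2 ⟨i2, by simp, by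
          rintro a ha b hb rfl
          rw [List.mem_singleton.1 hb] at ha
          exact h2 ha⟩
      · have hq := i3.insert (u := c) (d := e) c.2 (by rwa [mem_colsOf])
          (by simpa [Fin.val_inj] using h1) (by rwa [mem_colsOf]) (by
            intro x hx hxD
            obtain ⟨x, hx', rfl⟩ := Finset.mem_map.1 hx
            have := h3 x hx' (by simpa [mem_colsOf] using hxD)
            simpa only [Fin.le_def, Fin.lt_def, Fin.valEmbedding_apply] using this)
        have e1 : colsOf (os ++ [c]) = insert (c : ℕ) (colsOf os) := by
          ext x; simp [colsOf]
        have e2 : colsOf ((ps ++ [(c, e)]).map Prod.snd) = insert (e : ℕ) (colsOf (ps.map Prod.snd)) := by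
          ext x; simp [colsOf]
        have e3 : [(c, e)].countP (fun p => p.2 < p.1) = if (e : ℕ) < c then 1 else 0 := by
          rw [List.countP_singleton]
          simp only [decide_eq_true_eq, Fin.lt_def]
        rw [e1, e2, List.countP_append, e3]
        exact hq

theorem mem_pairOrder {L : ℕ} {lab : Fin n → ℕ} {c : Fin n} :
    c ∈ pairOrder L lab ↔ 0 < lab c ∧ lab c ≤ L := by
  simp only [pairOrder, List.mem_flatMap, List.mem_reverse, List.mem_range, List.mem_filter,
    List.mem_finRange, true_and, decide_eq_true_eq]
  constructor
  · rintro ⟨a, h1, h2⟩; omega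
  · rintro ⟨h1, h2⟩; exact ⟨lab c - 1, by omega, by omega⟩

theorem nodup_pairOrder (L : ℕ) (lab : Fin n → ℕ) : (pairOrder L lab).Nodup := by
  rw [pairOrder, List.nodup_flatMap]
  refine ⟨fun k _ => (List.nodup_finRange n).filter _, ?_⟩
  refine List.Nodup.pairwise_of_forall_ne (List.nodup_reverse.2 List.nodup_range) ?_
  intro a _ b _ hab c hc hc'
  simp only [List.mem_filter, decide_eq_true_eq] at hc hc'
  omega

/-- Large labels are paired first, so for each threshold the balls above it are paired without any
influence of the others. -/
theorem pairOrder_split (L : ℕ) (lab : Fin n → ℕ) (k : ℕ) :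
    ∃ os₁ os₂, pairOrder L lab = os₁ ++ os₂ ∧ (∀ c ∈ os₁, k < lab c) ∧ ∀ c ∈ os₂, lab c ≤ k := by
  rcases le_total k L with hk | hk
  · obtain ⟨j, rfl⟩ := Nat.exists_eq_add_of_le hk
    refine ⟨_, _, by rw [pairOrder, List.range_add, List.reverse_append, List.flatMap_append], ?_, ?_⟩
    · intro c hc
      simp only [List.mem_flatMap, List.mem_reverse, List.mem_map, List.mem_filter,
        decide_eq_true_eq] at hc
      obtain ⟨_, ⟨a, _, rfl⟩, _, h⟩ := hc
      omega
    · intro c hc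
      simp only [List.mem_flatMap, List.mem_reverse, List.mem_range, List.mem_filter,
        decide_eq_true_eq] at hc
      obtain ⟨a, h1, _, h⟩ := hc
      omega
  · exact ⟨[], _, rfl, by simp, fun c hc => ((mem_pairOrder.1 hc).2).trans hk⟩

theorem foldl_pstep_extends (B : Finset (Fin n)) (os : List (Fin n)) (ps : List (Fin n × Fin n)) :
    ∃ ps', os.foldl (pstep B) ps = ps ++ ps' ∧ ∀ p ∈ ps', p.1 ∈ os := by
  induction os generalizing ps with
  | nil => exact ⟨[], by simp, by simp⟩
  | cons c os ih =>
    obtain ⟨ps', h1, h2⟩ := ih (pstep B ps c)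
    rw [List.foldl_cons, h1]
    unfold pstep
    split
    · rename_i e _
      refine ⟨(c, e) :: ps', by simp, ?_⟩
      intro p hp
      rcases List.mem_cons.1 hp with rfl | hp
      · simp
      · exact List.mem_cons_of_mem _ (h2 p hp)
    · exact ⟨ps', rfl, fun p hp => List.mem_cons_of_mem _ (h2 p hp)⟩

theorem length_pairOrder {L : ℕ} {lab : Fin n → ℕ} (hlab : ∀ c, lab c ≤ L) :
    (pairOrder L lab).length = (Finset.univ.filter fun c => lab c ≠ 0).card := by
  rw [← List.toFinset_card_of_nodup (nodup_pairOrder L lab)]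
  congr 1
  ext c
  simp [mem_pairOrder, hlab c, Nat.pos_iff_ne_zero]

/-- The pairings from the balls with label larger than `k` form a queue. -/
theorem pairings_isQueue {L : ℕ} {lab : Fin n → ℕ} (hlab : ∀ c, lab c ≤ L) {B : Finset (Fin n)}
    (hB : (Finset.univ.filter fun c => lab c ≠ 0).card ≤ B.card) (k : ℕ) :
    ∃ q, IsQueue n ((Finset.univ.filter fun c => k < lab c).map Fin.valEmbedding)
      (B.map Fin.valEmbedding)
      (colsOf (((pairings L lab B).filter fun p => k < lab p.1).map Prod.snd))
      (((pairings L lab B).filter fun p => k < lab p.1).countP fun p => p.2 < p.1) q := by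
  obtain ⟨os₁, os₂, h0, h1, h2⟩ := pairOrder_split L lab k
  have hnd := nodup_pairOrder L lab
  have hl := length_pairOrder hlab
  rw [h0] at hnd hl
  rw [List.length_append] at hl
  obtain ⟨i1, i2, q, i3⟩ := foldl_pstep B os₁ (List.nodup_append.1 hnd).1 (by omega)
  rw [pairings_eq, h0, List.foldl_append]
  set ps := os₁.foldl (pstep B) [] with hps
  obtain ⟨ps', h3, h4⟩ := foldl_pstep_extends B os₂ ps
  rw [h3, List.filter_append, List.filter_eq_self.2, List.filter_eq_nil_iff.2, List.append_nil]
  · refine ⟨q, ?_⟩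
    convert i3 using 1
    ext x
    simp only [Finset.mem_map, Finset.mem_filter, Finset.mem_univ, true_and, colsOf,
      List.mem_toFinset, List.mem_map, Fin.valEmbedding_apply]
    constructor
    · rintro ⟨c, hc, rfl⟩
      refine ⟨c, ?_, rfl⟩
      have : c ∈ os₁ ++ os₂ := h0 ▸ mem_pairOrder.2 ⟨by omega, hlab c⟩
      rcases List.mem_append.1 this with h | h
      · exact h
      · have := h2 c h; omega
    · rintro ⟨c, hc, rfl⟩
      exact ⟨c, h1 c hc, rfl⟩
  · intro p hp
    have := h2 _ (h4 p hp)
    simp; omega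
  · intro p hp
    have : p.1 ∈ os₁ := by rw [← i1]; exact List.mem_map_of_mem hp
    simpa using h1 _ this

theorem pairings_nodup {L : ℕ} {lab : Fin n → ℕ} (hlab : ∀ c, lab c ≤ L) {B : Finset (Fin n)}
    (hB : (Finset.univ.filter fun c => lab c ≠ 0).card ≤ B.card) :
    (pairings L lab B).map Prod.fst = pairOrder L lab ∧ ((pairings L lab B).map Prod.snd).Nodup := by
  have h := foldl_pstep B _ (nodup_pairOrder L lab) (by rw [length_pairOrder hlab]; exact hB)
  exact ⟨h.1, h.2.1⟩

end Link

/-! ### Labels and major index in terms of exchanges. -/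

section Link

variable {n : ℕ}

/-- Induction from the top row. For `k > r`, the balls of row `r` with label above `k` are the
partners of those of row `r + 1`, that is, the used services of a queue, and one exchange finds
them; for `k = r` they form the whole row. -/
theorem rowLabels_spec {L : ℕ} {M : GMLQ n} (hM : ∀ r, (M (r + 1)).card ≤ (M r).card)
    (hL : ∀ r, L ≤ r → M r = ∅) (j : ℕ) : ∀ r, r + j = L →
    (∀ e, rowLabels L M j r e ≠ 0 ↔ e ∈ M r) ∧
    (∀ e ∈ M r, r < rowLabels L M j r e ∧ rowLabels L M j r e ≤ L) ∧
    ∀ k, r ≤ k → k < L →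
      (Finset.univ.filter fun e => k < rowLabels L M j r e).map Fin.valEmbedding =
        labAt (toArr M) k r := by
  induction j with
  | zero =>
    intro r hr
    have hr' := hL r (by omega)
    exact ⟨by simp [rowLabels, hr'], by simp [hr'], fun k h1 h2 => by omega⟩
  | succ j ih =>
    intro r hr
    obtain ⟨i1, i2, i3⟩ := ih (r + 1) (by omega)
    set lab := rowLabels L M j (r + 1) with hlab
    have hle : ∀ c, lab c ≤ L := fun c => by
      by_cases hc : c ∈ M (r + 1)
      · exact (i2 c hc).2
      · rw [← i1, not_not] at hc; omega
    have hB : (Finset.univ.filter fun c => lab c ≠ 0).card ≤ (M r).card := by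
      refine le_trans (Finset.card_le_card fun c hc => ?_) (hM r)
      rw [Finset.mem_filter] at hc
      exact (i1 c).1 hc.2
    obtain ⟨hfst, hnd⟩ := pairings_nodup hle hB
    have hval : ∀ p ∈ pairings L lab (M r), r + 1 < lab p.1 ∧ lab p.1 ≤ L := by
      intro p hp
      have : p.1 ∈ pairOrder L lab := hfst ▸ List.mem_map_of_mem hp
      have h1 := (i1 p.1).1 (by have := (mem_pairOrder.1 this).1; omega)
      exact i2 _ h1
    have hpin : ∀ e ∈ M r, (∃ p ∈ pairings L lab (M r), p.2 = e ∧
        rowLabels L M (j + 1) r e = lab p.1) ∨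
        (rowLabels L M (j + 1) r e = r + 1 ∧ ∀ p ∈ pairings L lab (M r), p.2 ≠ e) := by
      intro e he
      rw [rowLabels]
      simp only [he, if_true]
      cases hf : (pairings L lab (M r)).find? fun p => p.2 = e with
      | none =>
        right
        refine ⟨rfl, fun p hp => ?_⟩
        simpa using List.find?_eq_none.1 hf p hp
      | some p =>
        left
        exact ⟨p, List.mem_of_find?_eq_some hf, by simpa using List.find?_some hf, rfl⟩
    have hnot : ∀ e, e ∉ M r → rowLabels L M (j + 1) r e = 0 := fun e he => by
      rw [rowLabels]; simp [he]
    have hrange : ∀ e ∈ M r, r < rowLabels L M (j + 1) r e ∧ rowLabels L M (j + 1) r e ≤ L := by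
      intro e he
      rcases hpin e he with ⟨p, hp, _, h⟩ | ⟨h, _⟩
      · have := hval p hp; omega
      · omega
    refine ⟨fun e => ⟨fun h => ?_, fun h => ?_⟩, hrange, fun k hk hkL => ?_⟩
    · by_contra he; exact h (hnot e he)
    · have := (hrange e h).1; omega
    · rcases hk.eq_or_lt with rfl | hk
      · rw [labAt_self, toArr]
        congr 1
        ext e
        simp only [Finset.mem_filter, Finset.mem_univ, true_and]
        constructor
        · intro h; by_contra he; have := hnot e he; omega
        · exact fun h => (hrange e h).1
      · obtain ⟨q, hq⟩ := pairings_isQueue hle hB k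
        rw [labAt_of_lt _ hk, ← i3 k (by omega) hkL]
        rw [show toArr M r = (M r).map Fin.valEmbedding from rfl, hq.swapP_eq]
        ext x
        simp only [Finset.mem_map, Finset.mem_filter, Finset.mem_univ, true_and, colsOf,
          List.mem_toFinset, List.mem_map, Fin.valEmbedding_apply]
        constructor
        · rintro ⟨e, he, rfl⟩
          have heM : e ∈ M r := by by_contra h; have := hnot e h; omega
          rcases hpin e heM with ⟨p, hp, rfl, h⟩ | ⟨h, _⟩
          · exact ⟨p.2, ⟨p, by simp; exact ⟨hp, by omega⟩, rfl⟩, rfl⟩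
          · omega
        · rintro ⟨e, ⟨p, hp, rfl⟩, rfl⟩
          rw [List.mem_filter, decide_eq_true_eq] at hp
          have hmem : p.2 ∈ M r := by
            have : (p.2 : ℕ) ∈ (M r).map Fin.valEmbedding := hq.sub (by
              rw [mem_colsOf]
              exact List.mem_map_of_mem (by simp; exact hp))
            simpa [Fin.val_inj] using this
          refine ⟨p.2, ?_, rfl⟩
          rcases hpin p.2 hmem with ⟨p', hp', h', h⟩ | ⟨_, h⟩
          · have : p' = p := List.inj_on_of_nodup_map hnd hp' hp.1 h'
            subst this
            omega
          · exact absurd rfl (h p hp.1)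

section

variable {L : ℕ} {M : GMLQ n}

theorem fmLabel_ne_zero (hM : ∀ r, (M (r + 1)).card ≤ (M r).card)
    (hL : ∀ r, L ≤ r → M r = ∅) {r : ℕ} (hr : r ≤ L) (e : Fin n) :
    fmLabel L M r e ≠ 0 ↔ e ∈ M r :=
  (rowLabels_spec hM hL (L - r) r (by omega)).1 e

theorem fmLabel_range (hM : ∀ r, (M (r + 1)).card ≤ (M r).card)
    (hL : ∀ r, L ≤ r → M r = ∅) {r : ℕ} (hr : r ≤ L) {e : Fin n} (he : e ∈ M r) :
    r < fmLabel L M r e ∧ fmLabel L M r e ≤ L :=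
  (rowLabels_spec hM hL (L - r) r (by omega)).2.1 e he

theorem fmLabel_le (hM : ∀ r, (M (r + 1)).card ≤ (M r).card)
    (hL : ∀ r, L ≤ r → M r = ∅) {r : ℕ} (hr : r ≤ L) (e : Fin n) : fmLabel L M r e ≤ L := by
  by_cases he : e ∈ M r
  · exact (fmLabel_range hM hL hr he).2
  · rw [← fmLabel_ne_zero hM hL hr, not_not] at he; omega

theorem lt_fmLabel (hM : ∀ r, (M (r + 1)).card ≤ (M r).card)
    (hL : ∀ r, L ≤ r → M r = ∅) {r k : ℕ} (hr : r ≤ k) (hk : k < L) (e : Fin n) :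
    k < fmLabel L M r e ↔ (e : ℕ) ∈ labAt (toArr M) k r := by
  rw [← (rowLabels_spec hM hL (L - r) r (by omega)).2.2 k hr hk]
  simp [fmLabel, Fin.val_inj]

/-- The contribution of a wrapping ball with label `ℓ` is the number of thresholds `k` with `r + 1 ≤
k < ℓ`. Thus the major index counts, for all thresholds, the wrappings among the balls with label
above `k`, and each such number is a maximal excess. -/
theorem mlqMaj_eq (hM : ∀ r, (M (r + 1)).card ≤ (M r).card)
    (hL : ∀ r, L ≤ r → M r = ∅) : mlqMaj L M = majA L (toArr M) := by
  unfold mlqMaj majA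
  refine Finset.sum_congr rfl fun r hr => ?_
  rw [Finset.mem_range] at hr
  obtain ⟨i1, i2, i3⟩ := rowLabels_spec hM hL (L - (r + 1)) (r + 1) (by omega)
  change ∀ k, _ → _ → (Finset.univ.filter fun e => k < fmLabel L M (r + 1) e).map _ = _ at i3
  set lab := fmLabel L M (r + 1) with hlab
  have hle : ∀ c, lab c ≤ L := fmLabel_le hM hL (by omega)
  have hB : (Finset.univ.filter fun c => lab c ≠ 0).card ≤ (M r).card := by
    refine le_trans (Finset.card_le_card fun c hc => ?_) (hM r)
    rw [Finset.mem_filter] at hc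
    exact (i1 c).1 hc.2
  have h1 : ∀ k ∈ Finset.Ico (r + 1) L, eps (labAt (toArr M) k (r + 1)) (toArr M r) =
      ((pairings L lab (M r)).filter fun p => p.2 < p.1).countP fun p => k < lab p.1 := by
    intro k hk
    rw [Finset.mem_Ico] at hk
    obtain ⟨q, hq⟩ := pairings_isQueue hle hB k
    rw [← i3 k hk.1 hk.2, show toArr M r = (M r).map Fin.valEmbedding from rfl, hq.eps_eq,
      List.countP_filter, List.countP_filter]
    congr 1
    funext p
    exact Bool.and_comm _ _
  rw [Finset.sum_congr rfl h1]
  generalize (pairings L lab (M r)).filter (fun p => p.2 < p.1) = ps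
  induction ps with
  | nil => simp
  | cons p ps ih =>
    simp only [List.map_cons, List.sum_cons, ih, List.countP_cons, Finset.sum_add_distrib,
      decide_eq_true_eq]
    rw [add_comm, add_right_inj, ← Finset.card_filter]
    have : (Finset.Ico (r + 1) L).filter (fun k => k < lab p.1) = Finset.Ico (r + 1) (lab p.1) := by
      ext k
      have := hle p.1
      simp only [Finset.mem_filter, Finset.mem_Ico]
      omega
    rw [this, Nat.card_Ico]

end

/-! ### Collapsing -/

/-- The scan for unmatched opening brackets. -/
def stackStep (U V : Finset ℕ) (stack : List ℕ) (c : ℕ) : List ℕ :=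
  if c ∈ V then (if c ∈ U then c :: stack else stack).tail else
    if c ∈ U then c :: stack else stack

/-- The excess grows by one along the stack. -/
def StackExc (U V : Finset ℕ) : ℤ → List ℕ → Prop
  | _, [] => True
  | v, p :: s => exc U V p = v + 1 ∧ StackExc U V (v + 1) s

theorem StackExc.lt {U V : Finset ℕ} : ∀ {v : ℤ} {s : List ℕ}, StackExc U V v s →
    ∀ p ∈ s, v < exc U V p
  | _, [], _, p, hp => by simp at hp
  | v, p :: s, h, p', hp => by
    rcases List.mem_cons.1 hp with rfl | hp
    · have := h.1; omega
    · have := StackExc.lt h.2 p' hp; omega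

/-- Along the stack the excess takes the values `exc U V c + 1`, `exc U V c + 2`, and so on. A
closing bracket raises the current excess by one, so it is the head, and only the head, that stops
exceeding all later values. -/
theorem stack_spec (U V : Finset ℕ) (c : ℕ) :
    StackExc U V (exc U V c) ((List.range c).foldl (stackStep U V) []) ∧
    ∀ p, p ∈ (List.range c).foldl (stackStep U V) [] ↔
      p < c ∧ ∀ x, p < x → x ≤ c → exc U V x < exc U V p := by
  induction c with
  | zero => exact ⟨trivial, by simp⟩
  | succ c ih =>
    rw [List.range_succ, List.foldl_append, List.foldl_cons, List.foldl_nil]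
    set s := (List.range c).foldl (stackStep U V) []
    obtain ⟨h1, h2⟩ := ih
    have hs := exc_step U V c
    have hlt := h1.lt
    by_cases hU : c ∈ U <;> by_cases hV : c ∈ V <;>
      simp only [hU, hV, if_true, if_false, stackStep, List.tail_cons] at hs ⊢
    · have hs' : exc U V (c + 1) = exc U V c := by omega
      rw [hs']
      refine ⟨h1, fun p => ?_⟩
      rw [h2]
      constructor
      · rintro ⟨a, b⟩
        refine ⟨by omega, fun x hx hx' => ?_⟩
        rcases Nat.lt_or_ge c x with h | h
        · rw [show x = c + 1 by omega, hs']; exact b c a le_rfl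
        · exact b x hx h
      · rintro ⟨a, b⟩
        refine ⟨?_, fun x hx hx' => b x hx (by omega)⟩
        by_contra hc
        have hpc : p = c := by omega
        subst hpc
        have := b (p + 1) (by omega) le_rfl
        omega
    · have hs' : exc U V (c + 1) = exc U V c - 1 := by omega
      rw [hs']
      refine ⟨⟨by omega, by rwa [sub_add_cancel]⟩, fun p => ?_⟩
      rw [List.mem_cons, h2]
      constructor
      · rintro (rfl | ⟨a, b⟩)
        · refine ⟨by omega, fun x hx hx' => ?_⟩
          rw [show x = p + 1 by omega]; omega
        · refine ⟨by omega, fun x hx hx' => ?_⟩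
          rcases Nat.lt_or_ge c x with h | h
          · rw [show x = c + 1 by omega, hs']; have := b c a le_rfl; omega
          · exact b x hx h
      · rintro ⟨a, b⟩
        by_cases hpc : p = c
        · exact Or.inl hpc
        · exact Or.inr ⟨by omega, fun x hx hx' => b x hx (by omega)⟩
    · have hs' : exc U V (c + 1) = exc U V c + 1 := by omega
      rw [hs']
      cases hc : s with
      | nil =>
        refine ⟨trivial, fun p => ⟨fun h => by simp at h, ?_⟩⟩
        rintro ⟨a, b⟩
        exfalso
        have b1 := b (c + 1) (by omega) le_rfl
        have hpc : p ≠ c := by rintro rfl; omega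
        have : p ∈ s := (h2 p).2 ⟨by omega, fun x hx hx' => b x hx (by omega)⟩
        rw [hc] at this
        simp at this
      | cons p0 s' =>
        rw [hc] at h1 h2
        rw [List.tail_cons]
        refine ⟨h1.2, fun p => ⟨fun h => ?_, ?_⟩⟩
        · obtain ⟨a, b⟩ := (h2 p).1 (List.mem_cons_of_mem _ h)
          refine ⟨by omega, fun x hx hx' => ?_⟩
          rcases Nat.lt_or_ge c x with h' | h'
          · rw [show x = c + 1 by omega, hs']; exact h1.2.lt p h
          · exact b x hx h'
        · rintro ⟨a, b⟩
          have b1 := b (c + 1) (by omega) le_rfl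
          have hpc : p ≠ c := by rintro rfl; omega
          rcases List.mem_cons.1 ((h2 p).2 ⟨by omega, fun x hx hx' => b x hx (by omega)⟩) with
            rfl | h
          · have := h1.1; omega
          · exact h
    · have hs' : exc U V (c + 1) = exc U V c := by omega
      rw [hs']
      refine ⟨h1, fun p => ?_⟩
      rw [h2]
      constructor
      · rintro ⟨a, b⟩
        refine ⟨by omega, fun x hx hx' => ?_⟩
        rcases Nat.lt_or_ge c x with h | h
        · rw [show x = c + 1 by omega, hs']; exact b c a le_rfl
        · exact b x hx h
      · rintro ⟨a, b⟩
        refine ⟨?_, fun x hx hx' => b x hx (by omega)⟩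
        by_contra hc
        have hpc : p = c := by omega
        subst hpc
        have := b (p + 1) (by omega) le_rfl
        omega

theorem unmatchedUpper_toFinset (B B' : Finset (Fin n)) :
    (unmatchedUpper B B').toFinset.map Fin.valEmbedding =
      un (B'.map Fin.valEmbedding) (B.map Fin.valEmbedding) := by
  set U := B'.map Fin.valEmbedding with hU
  set V := B.map Fin.valEmbedding with hV
  have key : ∀ (l : List (Fin n)) (s : List (Fin n)),
      (l.foldl (fun stack c =>
        let s := if c ∈ B' then c :: stack else stack
        if c ∈ B then s.tail else s) s).map Fin.val =
      (l.map Fin.val).foldl (stackStep U V) (s.map Fin.val) := by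
    intro l
    induction l with
    | nil => intro s; rfl
    | cons c l ih =>
      intro s
      rw [List.foldl_cons, ih, List.map_cons, List.foldl_cons]
      congr 1
      have h1 : (c : ℕ) ∈ U ↔ c ∈ B' := by simp [hU, Fin.val_inj]
      have h2 : (c : ℕ) ∈ V ↔ c ∈ B := by simp [hV, Fin.val_inj]
      simp only [stackStep, h1, h2]
      split_ifs <;> simp [List.map_tail]
  have hk := key (List.finRange n) []
  rw [List.map_coe_finRange_eq_range, List.map_nil] at hk
  obtain ⟨_, h2⟩ := stack_spec U V n
  rw [← hk] at h2
  have hUn : ∀ y ∈ U, y < n := by simp [hU]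
  have hVn : ∀ y ∈ V, y < n := by simp [hV]
  ext p
  rw [mem_un]
  have : p ∈ (unmatchedUpper B B').toFinset.map Fin.valEmbedding ↔
      p ∈ (unmatchedUpper B B').map Fin.val := by simp
  rw [this]
  refine (h2 p).trans ⟨fun h x hx => ?_, fun h => ?_⟩
  · rcases le_total x n with hx' | hx'
    · exact h.2 x hx hx'
    · rw [exc_of_bound (fun y hy => (hUn y hy).trans_le hx') fun y hy => (hVn y hy).trans_le hx']
      have := h.2 n h.1 le_rfl
      rwa [exc_of_bound hUn hVn] at this
  · refine ⟨?_, fun x hx _ => h x hx⟩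
    by_contra hp
    have hp : n ≤ p := not_lt.1 hp
    have := h (p + 1) (by omega)
    rw [exc_of_bound (fun y hy => (hUn y hy).trans_le hp) fun y hy => (hVn y hy).trans_le hp,
      exc_of_bound (fun y hy => (hUn y hy).trans_le (by omega))
        fun y hy => (hVn y hy).trans_le (by omega)] at this
    omega

theorem toArr_drop (i : ℕ) (M : GMLQ n) : toArr (drop i M) = onRows dropP i (toArr M) := by
  have h := unmatchedUpper_toFinset (M i) (M (i + 1))
  funext r
  by_cases h1 : r = i
  · subst h1
    rw [onRows_lower, dropP]
    simp only [toArr, drop, if_true]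
    rw [← h, Finset.map_union]
  · by_cases h2 : r = i + 1
    · subst h2
      rw [onRows_upper, dropP]
      simp only [toArr, drop, if_true, h1, if_false]
      rw [← h]
      ext x
      simp only [Finset.mem_map, Finset.mem_sdiff]
      constructor
      · rintro ⟨a, ⟨ha, ha'⟩, rfl⟩
        refine ⟨⟨a, ha, rfl⟩, ?_⟩
        rintro ⟨b, hb, hab⟩
        exact ha' (Fin.val_injective hab ▸ hb)
      · rintro ⟨⟨a, ha, rfl⟩, h'⟩
        exact ⟨a, ⟨ha, fun hb => h' ⟨a, hb, rfl⟩⟩, rfl⟩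
    · rw [onRows_of_ne _ _ _ h1 h2]
      simp only [toArr, drop, h1, h2, if_false]

theorem toArr_sweep (k : ℕ) (M : GMLQ n) : toArr (sweep k M) = chainD dropP 0 k (toArr M) := by
  induction k generalizing M with
  | zero => rfl
  | succ k ih => rw [sweep, ih, toArr_drop, chainD, Nat.zero_add]

theorem toArr_collapseStep (M : GMLQ n) (k : ℕ) : toArr (collapseStep M k) = collA (toArr M) k := by
  induction k with
  | zero => rfl
  | succ k ih => rw [collapseStep, toArr_sweep, ih, collA]

end Link

/-! ### Optimality of queues -/

theorem exc_add_exc (U V W : Finset ℕ) (x : ℕ) : exc U V x + exc V W x = exc U W x := by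
  unfold exc; ring

theorem eps_triangle (U V W : Finset ℕ) : eps U W ≤ eps U V + eps V W :=
  eps_le fun x => by
    have h1 := exc_le_eps U V x
    have h2 := exc_le_eps V W x
    have := exc_add_exc U V W x
    push_cast
    omega

section IsQueue

variable {n : ℕ} {U V D : Finset ℕ} {w : ℕ} {q : ℕ → ℕ}

theorem IsQueue.eps_used (h : IsQueue n U V D w q) : eps U D = w := by
  obtain ⟨x, hx, hq⟩ := h.zero
  exact QuasiMac.eps_eq h.exc_le (x := x) (by rw [h.exc_eq hx, hq]; simp)

theorem exc_le_exc_of_imp {S : Finset ℕ} {x y : ℕ} (hyx : y ≤ x)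
    (h : ∀ z, y ≤ z → z < x → z ∈ S → z ∈ D) : exc D S x ≤ exc D S y := by
  induction hyx using Nat.decreasingInduction with
  | self => exact le_rfl
  | of_succ k hk ih =>
    refine (ih fun z hz => h z (by omega)).trans ?_
    rw [exc_step D S k]
    have := h k le_rfl hk
    split_ifs <;> simp_all

/-- An idle service leaves an empty queue just behind it, so there is none between the last empty
point before `x` and `x`. -/
theorem IsQueue.exists_last_zero (h : IsQueue n U V D w q) {x : ℕ} (hx : x ≤ n)
    (h0 : ∃ y ≤ x, q y = 0) :
    ∃ y ≤ x, q y = 0 ∧ ∀ z, y ≤ z → z < x → z ∈ V → z ∈ D := by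
  obtain ⟨y, ⟨hyx, hy⟩, hmax⟩ : ∃ y, (y ≤ x ∧ q y = 0) ∧ ∀ z, z ≤ x → q z = 0 → z ≤ y := by
    obtain ⟨y0, hy0⟩ := h0
    have hne : ((Finset.range (x + 1)).filter fun z => q z = 0).Nonempty :=
      ⟨y0, by simp; omega⟩
    refine ⟨Finset.max' _ hne, ?_, fun z hz hz' => ?_⟩
    swap
    · refine Finset.le_max' _ z ?_
      rw [Finset.mem_filter, Finset.mem_range]
      exact ⟨by omega, hz'⟩
    · have := Finset.max'_mem _ hne
      rw [Finset.mem_filter, Finset.mem_range] at this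
      exact ⟨by omega, this.2⟩
  refine ⟨y, hyx, hy, fun z hz hzx hzV => ?_⟩
  by_contra hzD
  obtain ⟨h1, h2⟩ := h.idle z hzV hzD
  have hs := h.step z (by omega)
  rw [if_neg hzD, if_neg h2, h1] at hs
  have := hmax (z + 1) hzx (by omega)
  omega

/-- Optimality of one greedy step. The excess of `U` over `S` is that of `U` over `D` plus that of
`D` over `S`, and the first summand equals `w` wherever the queue is empty. The second is maximal at
such a point: going left from `x` to the last empty point, `D` uses every service that `S` uses. If
there is no empty point to the left of `x`, the search continues cyclically from the end. -/
theorem IsQueue.add_eps_le (h : IsQueue n U V D w q) {S : Finset ℕ} (hS : S ⊆ V)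
    (hc : S.card = U.card) : w + eps D S ≤ eps U S := by
  suffices hx : ∀ x, exc D S x ≤ (eps U S : ℤ) - w by
    have hw := hx 0
    rw [exc_zero, hc, h.card_eq, sub_self] at hw
    have : eps D S ≤ eps U S - w := eps_le fun x => by have := hx x; omega
    omega
  intro x
  suffices hy : ∃ y ≤ n, q y = 0 ∧ exc D S x ≤ exc D S y by
    obtain ⟨y, hyn, hq, hle⟩ := hy
    have h1 := exc_le_eps U S y
    rw [← exc_add_exc U D S, h.exc_eq hyn, hq] at h1
    push_cast at h1
    omega
  have hD0 : exc D S 0 = 0 := by rw [exc_zero, hc, h.card_eq, sub_self]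
  have hDn : ∀ x, n ≤ x → exc D S x = 0 := fun x hx =>
    exc_of_bound (fun y hy => (h.ltV y (h.sub hy)).trans_le hx)
      fun y hy => (h.ltV y (hS hy)).trans_le hx
  by_cases hx : x ≤ n ∧ ∃ y ≤ x, q y = 0
  · obtain ⟨y, h1, h2, h3⟩ := h.exists_last_zero hx.1 hx.2
    exact ⟨y, h1.trans hx.1, h2, exc_le_exc_of_imp h1 fun z hz hz' hzS => h3 z hz hz' (hS hzS)⟩
  · have hx0 : exc D S x ≤ 0 := by
      rcases le_total n x with hn | hn
      · exact (hDn x hn).le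
      · rw [← hD0]
        refine exc_le_exc_of_imp (Nat.zero_le x) fun z _ hz hzS => ?_
        by_contra hzD
        exact hx ⟨hn, z, by omega, (h.idle z (hS hzS) hzD).1⟩
    obtain ⟨y, h1, h2, h3⟩ := h.exists_last_zero le_rfl h.zero
    refine ⟨y, h1, h2, hx0.trans ?_⟩
    rw [← hDn n le_rfl]
    exact exc_le_exc_of_imp h1 fun z hz hz' hzS => h3 z hz hz' (hS hzS)

/-- A chain of queues minimizes the total number of wrappings. -/
theorem sum_le_of_isQueue {n k : ℕ} {T S V : ℕ → Finset ℕ} {w : ℕ → ℕ}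
    (hT : ∀ i < k, ∃ q, IsQueue n (T i) (V (i + 1)) (T (i + 1)) (w i) q)
    (hS : ∀ i < k, S (i + 1) ⊆ V (i + 1)) (hc : ∀ i ≤ k, (S i).card = (T 0).card) :
    ∑ i ∈ Finset.range k, w i ≤
      eps (T 0) (S 0) + ∑ i ∈ Finset.range k, eps (S i) (S (i + 1)) := by
  induction k generalizing T S V w with
  | zero => simp
  | succ k ih =>
    obtain ⟨q, hq⟩ := hT 0 (by omega)
    have h1 := ih (T := fun i => T (i + 1)) (S := fun i => S (i + 1)) (V := fun i => V (i + 1))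
      (w := fun i => w (i + 1)) (fun i hi => hT (i + 1) (by omega))
      (fun i hi => hS (i + 1) (by omega))
      (fun i hi => by rw [hc (i + 1) (by omega), hq.card_eq])
    -- The first greedy wrappings together with the cost of passing from `T 1` to `S 1` are at most
    -- the cost from `T 0` to `S 1`, which is bounded by going through `S 0`. The remaining steps
    -- are the shifted chains.
    have h2 := hq.add_eps_le (hS 0 (by omega)) (hc 1 (by omega))
    have h3 := eps_triangle (T 0) (S 0) (S 1)
    rw [Finset.sum_range_succ', Finset.sum_range_succ']
    simp only [Nat.zero_add] at h1 h2 h3 ⊢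
    omega

end IsQueue

theorem map_subtype_val_eq {n : ℕ} {U : Finset ℕ} (hU : ∀ x ∈ U, x < n) :
    ((Finset.univ : Finset (Fin n)).filter fun c : Fin n => (c : ℕ) ∈ U).map Fin.valEmbedding = U := by
  ext x
  simp only [Finset.mem_map, Finset.mem_filter, Finset.mem_univ, true_and, Fin.valEmbedding_apply]
  exact ⟨fun ⟨c, h, e⟩ => e ▸ h, fun h => ⟨⟨x, hU x h⟩, h, rfl⟩⟩

/-- The pairing procedure, run in an arbitrary order, produces a queue, and its data are forced by
`IsQueue.swapP_eq` and `IsQueue.eps_eq`. -/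
theorem exists_isQueue {n : ℕ} {U V : Finset ℕ} (hU : ∀ x ∈ U, x < n) (hV : ∀ x ∈ V, x < n)
    (h : U.card ≤ V.card) : ∃ q, IsQueue n U V (swapP (U, V)).2 (eps U V) q := by
  set B := (Finset.univ : Finset (Fin n)).filter fun c : Fin n => (c : ℕ) ∈ V with hB
  set B' := (Finset.univ : Finset (Fin n)).filter fun c : Fin n => (c : ℕ) ∈ U with hB'
  have eV := map_subtype_val_eq hV
  have eU := map_subtype_val_eq hU
  have cV : B.card = V.card := by conv_rhs => rw [← eV, Finset.card_map]
  have cU : B'.card = U.card := by conv_rhs => rw [← eU, Finset.card_map]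
  obtain ⟨_, _, q, hq⟩ := foldl_pstep B B'.toList B'.nodup_toList (by
    rw [Finset.length_toList]; omega)
  have e1 : colsOf B'.toList = U := by
    conv_rhs => rw [← eU]
    ext x
    simp only [colsOf, List.mem_toFinset, List.mem_map, Finset.mem_toList, Finset.mem_map,
      Fin.valEmbedding_apply, hB']
  rw [e1, eV] at hq
  have h1 := hq.swapP_eq
  have h2 := hq.eps_eq
  exact ⟨q, by rw [h1, h2]; exact hq⟩

/-! ### Reversal of the columns -/

/-- Reversal of the sites `0, …, n - 1`. -/
def revS (n : ℕ) (U : Finset ℕ) : Finset ℕ := U.image fun x => n - 1 - x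

section rev

variable {n : ℕ} {U D : Finset ℕ}

theorem card_filter_revS (hU : ∀ x ∈ U, x < n) {x : ℕ} (hx : x ≤ n) :
    ((revS n U).filter fun y => x ≤ y).card + (U.filter fun y => n - x ≤ y).card = U.card := by
  have h1 : ((revS n U).filter fun y => x ≤ y).card = (U.filter fun y => ¬ n - x ≤ y).card := by
    rw [revS, Finset.filter_image, Finset.card_image_of_injOn]
    · congr 1
      ext y
      simp only [Finset.mem_filter]
      refine and_congr_right fun hy => ?_
      have := hU y hy
      omega
    · intro a ha b hb hab
      have h1 := hU a (Finset.mem_filter.1 ha).1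
      have h2 := hU b (Finset.mem_filter.1 hb).1
      have hab : n - 1 - a = n - 1 - b := hab
      omega
  rw [h1, add_comm]
  exact Finset.card_filter_add_card_filter_not fun y => n - x ≤ y

theorem card_revS (hU : ∀ x ∈ U, x < n) : (revS n U).card = U.card := by
  have h := card_filter_revS hU (Nat.zero_le n)
  rwa [Finset.filter_true_of_mem (by simp), Finset.filter_false_of_mem (s := U), Finset.card_empty,
    add_zero] at h
  intro y hy
  have := hU y hy
  omega

theorem revS_lt (hU : ∀ x ∈ U, x < n) : ∀ x ∈ revS n U, x < n := by
  intro x hx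
  obtain ⟨y, hy, rfl⟩ := Finset.mem_image.1 hx
  have := hU y hy
  omega

theorem revS_revS (hU : ∀ x ∈ U, x < n) : revS n (revS n U) = U := by
  rw [revS, revS, Finset.image_image]
  conv_rhs => rw [← Finset.image_id (s := U)]
  refine Finset.image_congr fun x hx => ?_
  have := hU x hx
  simp only [Function.comp, id]
  omega

theorem revS_subset (h : U ⊆ D) : revS n U ⊆ revS n D := Finset.image_subset_image h

/-- For sets of equal size, the excess of `U` over `D` on an initial segment is the excess of `D`
over `U` on the complementary final segment: reversal interchanges the roles of the brackets. -/
theorem eps_revS_le (hU : ∀ x ∈ U, x < n) (hD : ∀ x ∈ D, x < n) (hc : U.card = D.card) :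
    eps (revS n U) (revS n D) ≤ eps D U := by
  refine eps_le fun x => ?_
  rcases le_total x n with hx | hx
  · have h1 := card_filter_revS hU hx
    have h2 := card_filter_revS hD hx
    have h3 := exc_le_eps D U (n - x)
    unfold exc at h3 ⊢
    omega
  · rw [exc_of_bound (fun y hy => (revS_lt hU y hy).trans_le hx)
      fun y hy => (revS_lt hD y hy).trans_le hx]
    omega

theorem eps_revS (hU : ∀ x ∈ U, x < n) (hD : ∀ x ∈ D, x < n) (hc : U.card = D.card) :
    eps (revS n U) (revS n D) = eps D U := by
  refine le_antisymm (eps_revS_le hU hD hc) ?_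
  have := eps_revS_le (revS_lt hD) (revS_lt hU) (by rw [card_revS hU, card_revS hD, hc])
  rwa [revS_revS hU, revS_revS hD] at this

end rev

/-- The sites of the balls of row `r` which are paired from row `k` form a subset of row `r`, with as
many elements as row `k`, obtained by queues. -/
theorem labAt_isQueue {n k : ℕ} {A : Arr} (hA : ∀ r, ∀ x ∈ A r, x < n)
    (hc : ∀ r, (A (r + 1)).card ≤ (A r).card) {r : ℕ} (hr : r ≤ k) :
    labAt A k r ⊆ A r ∧ (labAt A k r).card = (A k).card ∧
    ∀ s, s + 1 = r → ∃ q, IsQueue n (labAt A k r) (A s) (labAt A k s) (eps (labAt A k r) (A s)) q := by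
  induction hr using Nat.decreasingInduction with
  | self =>
    refine ⟨by rw [labAt_self], by rw [labAt_self], ?_⟩
    rintro s rfl
    rw [labAt_self, labAt_of_lt A (by omega : s < s + 1), labAt_self]
    exact exists_isQueue (hA _) (hA _) (hc s)
  | of_succ r hr ih =>
    obtain ⟨h1, h2, h3⟩ := ih
    obtain ⟨q, hq⟩ := h3 r rfl
    have hcard : (labAt A k r).card = (A k).card := by rw [hq.card_eq, h2]
    refine ⟨hq.sub, hcard, ?_⟩
    rintro s rfl
    rw [labAt_of_lt A (by omega : s < k)]
    refine exists_isQueue (fun x hx => hA _ x (hq.sub hx)) (hA _) ?_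
    exact (Finset.card_le_card hq.sub).trans (hc s)

/-- Comparison of the two greedy chains between row `0` and row `k`. -/
theorem sum_eps_labAt_eq {n k : ℕ} {A : Arr} (hA : ∀ r, ∀ x ∈ A r, x < n)
    (hc : ∀ r, (A (r + 1)).card ≤ (A r).card) {S : ℕ → Finset ℕ} {w : ℕ → ℕ}
    (hS : ∀ r < k, ∃ q, IsQueue n (S r) (revS n (A (r + 1))) (S (r + 1)) (w r) q)
    (h0 : S 0 ⊆ revS n (A 0)) (hcard : (S 0).card = (A k).card)
    (hleft : ∀ x ∈ S 0, ∀ y ∈ revS n (A 0), y ∉ S 0 → x < y) :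
    ∑ r ∈ Finset.range k, w r = ∑ r ∈ Finset.range k, eps (labAt A k (r + 1)) (A r) := by
  have hSc : ∀ r ≤ k, (S r).card = (A k).card ∧ S r ⊆ revS n (A r) := by
    intro r hr
    induction r with
    | zero => exact ⟨hcard, h0⟩
    | succ r ih =>
      obtain ⟨q, hq⟩ := hS r (by omega)
      exact ⟨by rw [hq.card_eq, (ih (by omega)).1], hq.sub⟩
  have hSn : ∀ r ≤ k, ∀ x ∈ S r, x < n := fun r hr x hx => revS_lt (hA r) x ((hSc r hr).2 hx)
  have hTn : ∀ r ≤ k, ∀ x ∈ labAt A k r, x < n := fun r hr x hx =>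
    hA r x ((labAt_isQueue hA hc hr).1 hx)
  -- The two chains share one end: both contain the whole row `k`.
  have hlabk : revS n (labAt A k k) = S k := by
    rw [labAt_self]
    refine (Finset.eq_of_subset_of_card_le (hSc k le_rfl).2 ?_).symm
    rw [(hSc k le_rfl).1, card_revS (hA k)]
  apply le_antisymm
  · have h1 := sum_le_of_isQueue (k := k) (T := S) (S := fun r => revS n (labAt A k r))
      (V := fun r => revS n (A r)) hS (fun r hr => revS_subset (labAt_isQueue hA hc hr).1)
      (fun r hr => by rw [card_revS (hTn r hr), (labAt_isQueue hA hc hr).2.1, hcard])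
    -- At the other end they need not agree, but `S 0` consists of the leftmost elements of the
    -- reversed row `0`, so passing from it to any set of the same size there costs no wrapping.
    have h2 : eps (S 0) (revS n (labAt A k 0)) = 0 := by
      rw [eps_eq_zero_iff]
      intro x
      have hT := labAt_isQueue hA hc (Nat.zero_le k)
      have hcT : (revS n (labAt A k 0)).card = (S 0).card := by
        rw [card_revS (hTn 0 (by omega)), hT.2.1, hcard]
      have hsub : revS n (labAt A k 0) ⊆ revS n (A 0) := revS_subset hT.1
      set T := revS n (labAt A k 0)
      unfold exc
      by_cases hx : ∃ y ∈ S 0, x ≤ y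
      · obtain ⟨y, hy, hxy⟩ := hx
        have hle : (T.filter fun z => ¬ x ≤ z).card ≤ ((S 0).filter fun z => ¬ x ≤ z).card := by
          refine Finset.card_le_card fun z hz => ?_
          rw [Finset.mem_filter] at hz ⊢
          refine ⟨?_, hz.2⟩
          by_contra hzS
          have := hleft y hy z (hsub hz.1) hzS
          omega
        have a1 := Finset.card_filter_add_card_filter_not (s := T) fun z => x ≤ z
        have a2 := Finset.card_filter_add_card_filter_not (s := S 0) fun z => x ≤ z
        omega
      · rw [Finset.filter_false_of_mem (s := S 0) fun y hy h => hx ⟨y, hy, h⟩]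
        simp
    rw [h2, zero_add] at h1
    refine h1.trans (Finset.sum_le_sum fun r hr => ?_)
    rw [Finset.mem_range] at hr
    obtain ⟨q, hq⟩ := (labAt_isQueue hA hc (show r + 1 ≤ k by omega)).2.2 r rfl
    rw [eps_revS (hTn r (by omega)) (hTn (r + 1) (by omega)) hq.card_eq, hq.eps_used]
  -- Now the labelling chain is the greedy one, read from row `k` downwards, and the reversed chain
  -- `S` is its competitor.
  · have h1 := sum_le_of_isQueue (n := n) (k := k) (T := fun i => labAt A k (k - i))
      (S := fun i => revS n (S (k - i))) (V := fun i => A (k - i))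
      (w := fun i => eps (labAt A k (k - i)) (A (k - (i + 1))))
      (fun i hi => (labAt_isQueue hA hc (by omega)).2.2 (k - (i + 1)) (by omega))
      (fun i hi => by
        have := revS_subset (n := n) (hSc (k - (i + 1)) (by omega)).2
        rwa [revS_revS (hA _)] at this)
      (fun i hi => by
        rw [card_revS (hSn _ (by omega)), (hSc (k - i) (by omega)).1]
        exact ((labAt_isQueue hA hc (by omega)).2.1).symm)
    simp only [Nat.sub_zero] at h1
    have h2 : eps (labAt A k k) (revS n (S k)) = 0 := by
      rw [← hlabk, revS_revS (hTn k le_rfl), eps_eq_zero_iff]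
      exact fun x => (exc_nonpos_of_subset subset_rfl x)
    rw [h2, zero_add] at h1
    rw [← Finset.sum_range_reflect (fun r => eps (labAt A k (r + 1)) (A r)),
      ← Finset.sum_range_reflect w]
    refine le_trans (le_of_eq (Finset.sum_congr rfl fun i hi => ?_))
      (h1.trans (le_of_eq (Finset.sum_congr rfl fun i hi => ?_)))
    · rw [Finset.mem_range] at hi
      rw [show k - 1 - i + 1 = k - i by omega, show k - 1 - i = k - (i + 1) by omega]
    · rw [Finset.mem_range] at hi
      obtain ⟨q, hq⟩ := hS (k - (i + 1)) (by omega)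
      rw [show k - (i + 1) + 1 = k - i by omega] at hq
      rw [eps_revS (hSn _ (by omega)) (hSn _ (by omega)) hq.card_eq, hq.eps_used,
        show k - 1 - i = k - (i + 1) by omega]

/-! ### Charge -/

/-- The first element of `R` at a site `≥ p` if there is one, and else the first element. -/
noncomputable def pick (R : Finset ℕ) (p : ℕ) : ℕ :=
  if ∃ x ∈ R, p ≤ x then sInf {x | x ∈ R ∧ p ≤ x} else sInf {x | x ∈ R}

theorem pick_spec {R : Finset ℕ} (hR : R.Nonempty) (p : ℕ) : pick R p ∈ R ∧
    ((p ≤ pick R p ∧ ∀ x ∈ R, p ≤ x → pick R p ≤ x) ∨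
      ((∀ x ∈ R, x < p) ∧ ∀ x ∈ R, pick R p ≤ x)) := by
  unfold pick
  split_ifs with h
  · obtain ⟨x, hx⟩ := h
    have h1 : sInf {x | x ∈ R ∧ p ≤ x} ∈ {x | x ∈ R ∧ p ≤ x} := Nat.sInf_mem ⟨x, hx⟩
    exact ⟨h1.1, Or.inl ⟨h1.2, fun y hy hy' => Nat.sInf_le ⟨hy, hy'⟩⟩⟩
  · obtain ⟨x, hx⟩ := hR
    have h1 : sInf {x | x ∈ R} ∈ {x | x ∈ R} := Nat.sInf_mem ⟨x, hx⟩
    refine ⟨h1, Or.inr ⟨fun y hy => ?_, fun y hy => Nat.sInf_le hy⟩⟩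
    by_contra hc
    exact h ⟨y, hy, not_lt.1 hc⟩

/-- The positions of the standard subword extracted from the sets `R r` of the positions of the
letters `r + 1`. -/
noncomputable def posOf (R : ℕ → Finset ℕ) : ℕ → ℕ
  | 0 => pick (R 0) 0
  | r + 1 => pick (R (r + 1)) (posOf R r + 1)

/-- The remaining positions. -/
noncomputable def nextR (R : ℕ → Finset ℕ) (r : ℕ) : Finset ℕ := (R r).erase (posOf R r)

/-- Indicator of a wrapping between the letters `r + 1` and `r + 2`. -/
noncomputable def wrapOf (R : ℕ → Finset ℕ) (r : ℕ) : ℕ :=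
  if posOf R (r + 1) < posOf R r then 1 else 0

/-- The positions of a letter. -/
def letterPos (w : List (ℕ × ℕ)) (k : ℕ) : Finset ℕ :=
  ((w.filter fun a => a.1 = k).map Prod.snd).toFinset

theorem mem_letterPos {w : List (ℕ × ℕ)} {k p : ℕ} : p ∈ letterPos w k ↔ (k, p) ∈ w := by
  simp only [letterPos, List.mem_toFinset, List.mem_map, List.mem_filter, decide_eq_true_eq]
  constructor
  · rintro ⟨⟨a, b⟩, ⟨h1, rfl⟩, rfl⟩; exact h1
  · intro h; exact ⟨(k, p), ⟨h, rfl⟩, rfl⟩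

theorem find_sorted {w : List (ℕ × ℕ)} (hw : w.Pairwise fun a b => a.2 < b.2)
    {P : ℕ × ℕ → Bool} {a : ℕ × ℕ} (h : w.find? P = some a) :
    a ∈ w ∧ P a ∧ ∀ b ∈ w, P b → a.2 ≤ b.2 := by
  obtain ⟨h1, as, bs, rfl, h2⟩ := List.find?_eq_some_iff_append.1 h
  refine ⟨by simp, h1, fun b hb hPb => ?_⟩
  rcases List.mem_append.1 hb with hb | hb
  · have := h2 b hb
    simp [hPb] at this
  · rcases List.mem_cons.1 hb with rfl | hb
    · exact le_rfl
    · have := (List.pairwise_append.1 hw).2.1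
      exact ((List.pairwise_cons.1 this).1 b hb).le

theorem letterPos_erase {w : List (ℕ × ℕ)} (hw : w.Pairwise fun a b => a.2 < b.2) {k p : ℕ} (i : ℕ) :
    letterPos (w.erase (k, p)) i = if i = k then (letterPos w i).erase p else letterPos w i := by
  have hnd : w.Nodup := hw.imp fun {a b} h e => by rw [e] at h; omega
  ext x
  rw [mem_letterPos, hnd.mem_erase_iff]
  split_ifs with h
  · subst h
    rw [Finset.mem_erase, mem_letterPos]
    simp
  · rw [mem_letterPos]
    simp [h]

theorem pick_eq_of_least {R : Finset ℕ} {p x : ℕ} (hx : x ∈ R) (hp : p ≤ x)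
    (h : ∀ y ∈ R, p ≤ y → x ≤ y) : pick R p = x := by
  obtain ⟨h1, ⟨h2, h3⟩ | ⟨h2, h3⟩⟩ := pick_spec ⟨x, hx⟩ p
  · exact le_antisymm (h3 x hx hp) (h _ h1 h2)
  · have := h2 x hx; omega

theorem pick_eq_of_wrap {R : Finset ℕ} {p x : ℕ} (hx : x ∈ R) (hp : ∀ y ∈ R, y < p)
    (h : ∀ y ∈ R, x ≤ y) : pick R p = x := by
  obtain ⟨h1, ⟨h2, h3⟩ | ⟨h2, h3⟩⟩ := pick_spec ⟨x, hx⟩ p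
  · have := hp _ h1; omega
  · exact le_antisymm (h3 x hx) (h _ h1)

/-- Extraction of a standard subword, from the letter `k + 1` on. -/
theorem chargeRound_spec (fuel : ℕ) : ∀ (w : List (ℕ × ℕ)) (k p idx h : ℕ) (pos : ℕ → ℕ),
    w.Pairwise (fun a b => a.2 < b.2) → k ≤ h → h ≤ k + fuel →
    (∀ i, k ≤ i → i < h → (letterPos w (i + 1)).Nonempty) →
    letterPos w (h + 1) = ∅ →
    pos k = pick (letterPos w (k + 1)) p →
    (∀ i, k ≤ i → pos (i + 1) = pick (letterPos w (i + 2)) (pos i + 1)) →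
    (chargeRound fuel w (k + 1) p idx).1 =
      ∑ i ∈ Finset.Ico k h, (idx + (if pos k < p then 1 else 0) +
        ∑ s ∈ Finset.Ico k i, if pos (s + 1) < pos s + 1 then 1 else 0) ∧
    (chargeRound fuel w (k + 1) p idx).2.Sublist w ∧
    ∀ i, letterPos (chargeRound fuel w (k + 1) p idx).2 (i + 1) =
      if k ≤ i ∧ i < h then (letterPos w (i + 1)).erase (pos i) else letterPos w (i + 1) := by
  induction fuel with
  | zero =>
    intro w k p idx h pos hw h1 h2 h3 h4 h5 h6
    have : h = k := by omega
    subst this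
    refine ⟨by simp [chargeRound], List.Sublist.refl _, fun i => ?_⟩
    rw [if_neg (by omega)]
    rfl
  | succ fuel ih =>
    intro w k p idx h pos hw h1 h2 h3 h4 h5 h6
    -- The two branches that find a letter continue in the same way and differ only in the index
    -- passed on.
    have hstep : ∀ (a : ℕ × ℕ) (idx' : ℕ), a ∈ w → a = (k + 1, pos k) → k < h →
        idx' = idx + (if pos k < p then 1 else 0) →
        (idx' + (chargeRound fuel (w.erase a) (k + 1 + 1) (a.2 + 1) idx').1 =
          ∑ i ∈ Finset.Ico k h, (idx + (if pos k < p then 1 else 0) +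
            ∑ s ∈ Finset.Ico k i, if pos (s + 1) < pos s + 1 then 1 else 0)) ∧
        (chargeRound fuel (w.erase a) (k + 1 + 1) (a.2 + 1) idx').2.Sublist w ∧
        ∀ i, letterPos (chargeRound fuel (w.erase a) (k + 1 + 1) (a.2 + 1) idx').2 (i + 1) =
          if k ≤ i ∧ i < h then (letterPos w (i + 1)).erase (pos i) else letterPos w (i + 1) := by
      intro a idx' ha hak hkh hidx
      subst hak
      have hlp : ∀ i, k + 1 ≤ i → letterPos (w.erase (k + 1, pos k)) (i + 1) =
          letterPos w (i + 1) := fun i hi => by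
        rw [letterPos_erase hw, if_neg (by omega)]
      obtain ⟨i1, i2, i3⟩ := ih (w.erase (k + 1, pos k)) (k + 1) (pos k + 1) idx' h pos
        (hw.sublist List.erase_sublist) (by omega) (by omega)
        (fun i hi hi' => by rw [hlp i hi]; exact h3 i (by omega) hi')
        (by rw [hlp h (by omega)]; exact h4)
        (by rw [hlp (k + 1) le_rfl]; exact h6 k le_rfl)
        (fun i hi => by rw [hlp (i + 1) (by omega)]; exact h6 i (by omega))
      refine ⟨?_, i2.trans List.erase_sublist, fun i => ?_⟩
      · rw [i1, Finset.sum_eq_sum_Ico_succ_bot hkh, ← hidx, Finset.Ico_self, Finset.sum_empty,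
          add_zero]
        congr 1
        refine Finset.sum_congr rfl fun i hi => ?_
        rw [Finset.mem_Ico] at hi
        rw [Finset.sum_eq_sum_Ico_succ_bot (show k < i by omega), add_assoc]
      · rw [i3, letterPos_erase hw]
        by_cases hik : i = k
        · subst hik
          rw [if_neg (by omega), if_pos rfl, if_pos ⟨le_rfl, hkh⟩]
        · rw [if_neg (show ¬ i + 1 = k + 1 by omega)]
          by_cases hi : k ≤ i ∧ i < h
          · rw [if_pos hi, if_pos (by omega)]
          · rw [if_neg hi, if_neg (by omega)]
    rw [chargeRound]
    cases hf : w.find? fun a => a.1 = k + 1 ∧ p ≤ a.2 with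
    | some a =>
      obtain ⟨g1, g2, g3⟩ := find_sorted hw hf
      simp only [decide_eq_true_eq] at g2 g3
      obtain ⟨l, x⟩ := a
      obtain ⟨rfl, hx⟩ : l = k + 1 ∧ p ≤ x := g2
      have hpos : pos k = x := by
        rw [h5]
        exact pick_eq_of_least (mem_letterPos.2 g1) hx fun y hy hy' =>
          g3 (k + 1, y) (mem_letterPos.1 hy) ⟨rfl, hy'⟩
      have hkh : k < h := by
        by_contra hc
        have : h = k := by omega
        rw [this] at h4
        have := mem_letterPos.2 g1
        rw [h4] at this
        simp at this
      exact hstep (k + 1, x) idx g1 (by rw [hpos]) hkh (by rw [if_neg (by omega), add_zero])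
    | none =>
      have hn : ∀ y ∈ letterPos w (k + 1), y < p := by
        intro y hy
        have := List.find?_eq_none.1 hf _ (mem_letterPos.1 hy)
        simpa using this
      simp only
      cases hf' : w.find? fun a => a.1 = k + 1 with
      | some a =>
        obtain ⟨g1, g2, g3⟩ := find_sorted hw hf'
        simp only [decide_eq_true_eq] at g2 g3
        obtain ⟨l, x⟩ := a
        obtain rfl : l = k + 1 := g2
        have hpos : pos k = x := by
          rw [h5]
          exact pick_eq_of_wrap (mem_letterPos.2 g1) hn fun y hy =>
            g3 (k + 1, y) (mem_letterPos.1 hy) rfl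
        have hkh : k < h := by
          by_contra hc
          have : h = k := by omega
          rw [this] at h4
          have := mem_letterPos.2 g1
          rw [h4] at this
          simp at this
        have := hn x (mem_letterPos.2 g1)
        exact hstep (k + 1, x) (idx + 1) g1 (by rw [hpos]) hkh (by rw [if_pos (by omega)])
      | none =>
        have hE : letterPos w (k + 1) = ∅ := by
          rw [Finset.eq_empty_iff_forall_notMem]
          intro y hy
          have := List.find?_eq_none.1 hf' _ (mem_letterPos.1 hy)
          simp at this
        have : h = k := by
          by_contra hc
          have := h3 k le_rfl (by omega)
          rw [hE] at this
          simp at this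
        subst this
        refine ⟨by simp, List.Sublist.refl _, fun i => ?_⟩
        rw [if_neg (by omega)]

/-- Position sets of the letters of a word whose content is a partition with at most `L` parts. -/
structure IsPosSets (L : ℕ) (R : ℕ → Finset ℕ) : Prop where
  empty : ∀ r, L ≤ r → R r = ∅
  card : ∀ r, (R (r + 1)).card ≤ (R r).card
  disj : ∀ r s, r ≠ s → Disjoint (R r) (R s)

theorem posOf_mem {R : ℕ → Finset ℕ} {r : ℕ} (h : (R r).Nonempty) : posOf R r ∈ R r := by
  cases r with
  | zero => exact (pick_spec h _).1
  | succ r => exact (pick_spec h _).1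

theorem card_nextR (R : ℕ → Finset ℕ) (r : ℕ) : (nextR R r).card = (R r).card - 1 := by
  rcases (R r).eq_empty_or_nonempty with h | h
  · simp [nextR, h]
  · exact Finset.card_erase_of_mem (posOf_mem h)

theorem IsPosSets.nextR {L : ℕ} {R : ℕ → Finset ℕ} (h : IsPosSets L R) : IsPosSets L (nextR R) where
  empty r hr := by simp [QuasiMac.nextR, h.empty r hr]
  card r := by rw [card_nextR, card_nextR]; have := h.card r; omega
  disj r s hrs := (h.disj r s hrs).mono (Finset.erase_subset _ _) (Finset.erase_subset _ _)

theorem IsPosSets.iterate {L : ℕ} {R : ℕ → Finset ℕ} (h : IsPosSets L R) (j : ℕ) :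
    IsPosSets L (QuasiMac.nextR^[j] R) := by
  induction j with
  | zero => exact h
  | succ j ih => rw [Function.iterate_succ_apply']; exact ih.nextR

theorem card_iterate_nextR (R : ℕ → Finset ℕ) (j r : ℕ) :
    (nextR^[j] R r).card = (R r).card - j := by
  induction j with
  | zero => simp
  | succ j ih => rw [Function.iterate_succ_apply', card_nextR, ih]; omega

theorem IsPosSets.antitone {L : ℕ} {R : ℕ → Finset ℕ} (h : IsPosSets L R) :
    Antitone fun r => (R r).card := antitone_nat_of_succ_le h.card

/-- Different letters occupy different positions, so the weak and the strict form of the wrapping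
condition agree. -/
theorem posOf_ne {L : ℕ} {R : ℕ → Finset ℕ} (h : IsPosSets L R) {r : ℕ} (hr : (R (r + 1)).Nonempty) :
    posOf R (r + 1) ≠ posOf R r := by
  have h0 : (R r).Nonempty := Finset.card_pos.1 ((Finset.card_pos.2 hr).trans_le (h.card r))
  intro e
  have h1 := posOf_mem hr
  rw [e] at h1
  exact Finset.disjoint_left.1 (h.disj r (r + 1) (by omega)) (posOf_mem h0) h1

/-- The index of the letter `k + 1` of a standard subword is the number of wrappings met on the way
from the letter `1` to it. -/
theorem chargeRound_eq {L : ℕ} {w : List (ℕ × ℕ)} (hw : w.Pairwise fun a b => a.2 < b.2)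
    (hR : IsPosSets L fun r => letterPos w (r + 1)) :
    (chargeRound w.length w 1 0 0).1 =
      ∑ k ∈ (Finset.range L).filter (fun k => (letterPos w (k + 1)).Nonempty),
        ∑ r ∈ Finset.range k, wrapOf (fun r => letterPos w (r + 1)) r ∧
    (chargeRound w.length w 1 0 0).2.Sublist w ∧
    (fun r => letterPos (chargeRound w.length w 1 0 0).2 (r + 1)) =
      nextR fun r => letterPos w (r + 1) := by
  set R := fun r => letterPos w (r + 1) with hRdef
  have hex : ∃ h, R h = ∅ := ⟨L, hR.empty L le_rfl⟩
  classical
  set h := Nat.find hex with hh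
  have hh0 : R h = ∅ := Nat.find_spec hex
  have hne : ∀ i, i < h → (R i).Nonempty := fun i hi =>
    Finset.nonempty_iff_ne_empty.2 (Nat.find_min hex hi)
  have hge : ∀ i, h ≤ i → R i = ∅ := fun i hi => by
    have := hR.antitone hi
    simp only [hh0, Finset.card_empty, Nat.le_zero] at this
    exact Finset.card_eq_zero.1 this
  have hhL : h ≤ L := Nat.find_min' hex (hR.empty L le_rfl)
  -- The extracted positions are distinct, so the length of the word is enough fuel.
  have hlen : h ≤ w.length := by
    have h1 : (Finset.range h).image (posOf R) ⊆ (w.map Prod.snd).toFinset := by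
      intro x hx
      obtain ⟨r, hr, rfl⟩ := Finset.mem_image.1 hx
      have hm : posOf R r ∈ letterPos w (r + 1) := posOf_mem (hne r (Finset.mem_range.1 hr))
      rw [List.mem_toFinset]
      exact List.mem_map.2 ⟨_, mem_letterPos.1 hm, rfl⟩
    have h2 := Finset.card_le_card h1
    rw [Finset.card_image_of_injOn, Finset.card_range] at h2
    · exact h2.trans ((List.toFinset_card_le _).trans (by rw [List.length_map]))
    · intro r hr s hs e
      simp only [Finset.coe_range, Set.mem_Iio] at hr hs
      by_contra hrs
      have h3 := posOf_mem (hne r hr)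
      rw [show posOf R r = posOf R s from e] at h3
      exact Finset.disjoint_left.1 (hR.disj r s hrs) h3 (posOf_mem (hne s hs))
  obtain ⟨g1, g2, g3⟩ := chargeRound_spec w.length w 0 0 0 h (posOf R) hw (Nat.zero_le _) (by omega)
    (fun i _ hi => hne i hi) hh0 rfl (fun i _ => rfl)
  refine ⟨?_, g2, ?_⟩
  · rw [Nat.zero_add] at g1
    rw [g1]
    have hset : (Finset.range L).filter (fun k => (R k).Nonempty) = Finset.Ico 0 h := by
      ext k
      simp only [Finset.mem_filter, Finset.mem_range, Finset.mem_Ico, Nat.zero_le, true_and]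
      constructor
      · rintro ⟨_, hk⟩
        by_contra hc
        rw [hge k (by omega)] at hk
        simp at hk
      · intro hk; exact ⟨by omega, hne k hk⟩
    rw [hset]
    refine Finset.sum_congr rfl fun k hk => ?_
    rw [Finset.mem_Ico] at hk
    rw [if_neg (by omega), add_zero, zero_add, ← Nat.Ico_zero_eq_range]
    refine Finset.sum_congr rfl fun r hr => ?_
    rw [Finset.mem_Ico] at hr
    have := posOf_ne hR (hne (r + 1) (by omega))
    unfold wrapOf
    split_ifs <;> omega
  · funext i
    rw [Nat.zero_add] at g3
    rw [g3]
    by_cases hi : i < h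
    · rw [if_pos ⟨Nat.zero_le _, hi⟩]; rfl
    · rw [if_neg (by omega)]
      have := hge i (by omega)
      simp only [nextR]
      change R i = (R i).erase _
      rw [this]; simp

/-- The letter `k + 1` takes part in as many rounds as it has occurrences, namely the first ones;
the charge is then summed letter by letter instead of round by round. -/
theorem chargeAux_eq {L : ℕ} (fuel : ℕ) : ∀ {w : List (ℕ × ℕ)},
    w.Pairwise (fun a b => a.2 < b.2) → (IsPosSets L fun r => letterPos w (r + 1)) →
    chargeAux fuel w = ∑ k ∈ Finset.range L, ∑ j ∈ Finset.range (min fuel (letterPos w (k + 1)).card),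
      ∑ r ∈ Finset.range k, wrapOf (nextR^[j] fun r => letterPos w (r + 1)) r := by
  induction fuel with
  | zero => intro w _ _; simp [chargeAux]
  | succ fuel ih =>
    intro w hw hR
    obtain ⟨h1, h2, h3⟩ := chargeRound_eq hw hR
    rw [chargeAux, ih (hw.sublist h2) (by rw [h3]; exact hR.nextR), h1, h3, Finset.sum_filter,
      ← Finset.sum_add_distrib]
    refine Finset.sum_congr rfl fun k _ => ?_
    have hc : (letterPos (chargeRound w.length w 1 0 0).2 (k + 1)).card =
        (letterPos w (k + 1)).card - 1 := by
      rw [congrFun h3 k, card_nextR]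
    rw [hc]
    by_cases hne : (letterPos w (k + 1)).Nonempty
    · have hpos := Finset.card_pos.2 hne
      rw [if_pos hne, show min (fuel + 1) (letterPos w (k + 1)).card =
        min fuel ((letterPos w (k + 1)).card - 1) + 1 by omega, Finset.sum_range_succ', add_comm]
      rfl
    · rw [if_neg hne, Finset.not_nonempty_iff_eq_empty.1 hne]
      simp

/-- The first rounds of the extraction are queues from each letter to the next one. -/
theorem nextR_isQueue {L n : ℕ} {R : ℕ → Finset ℕ} (hR : IsPosSets L R)
    (hn : ∀ r, ∀ x ∈ R r, x < n) (r J : ℕ) (hJ : J ≤ (R (r + 1)).card) :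
    ∃ q, IsQueue n (R r \ nextR^[J] R r) (R (r + 1)) (R (r + 1) \ nextR^[J] R (r + 1))
      (∑ j ∈ Finset.range J, wrapOf (nextR^[j] R) r) q := by
  induction J with
  | zero =>
    refine ⟨fun _ => 0, ?_⟩
    simpa using isQueue_empty (n := n) (hn (r + 1))
  | succ J ih =>
    obtain ⟨q, hq⟩ := ih (by omega)
    have hRJ := hR.iterate J
    have hsub : ∀ s, nextR^[J] R s ⊆ R s := by
      intro s
      clear hq ih hJ hRJ
      induction J with
      | zero => exact subset_rfl
      | succ J ih => rw [Function.iterate_succ_apply']; exact (Finset.erase_subset _ _).trans ih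
    set R' := nextR^[J] R with hR'
    have hne : (R' (r + 1)).Nonempty := Finset.card_pos.1 (by rw [hR', card_iterate_nextR]; omega)
    have hne0 : (R' r).Nonempty :=
      Finset.card_pos.1 ((Finset.card_pos.2 hne).trans_le (hRJ.card r))
    have hu := posOf_mem hne0
    have hd := posOf_mem hne
    have hdisj := Finset.disjoint_left.1 (hRJ.disj r (r + 1) (by omega))
    have key : ∀ s, posOf R' s ∈ R' s → R s \ nextR R' s = insert (posOf R' s) (R s \ R' s) := by
      intro s hs
      ext x
      simp only [nextR, Finset.mem_sdiff, Finset.mem_erase, Finset.mem_insert]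
      by_cases hx : x = posOf R' s
      · subst hx; simp [hsub s hs]
      · simp [hx]
    obtain ⟨q', hq'⟩ := hq.insert (u := posOf R' r) (d := posOf R' (r + 1)) (hn r _ (hsub r hu))
      (by simp [hu]) (hsub _ hd) (by simp [hd]) (by
        intro x hx hxD
        have hxR : x ∈ R' (r + 1) := by
          by_contra h; exact hxD (Finset.mem_sdiff.2 ⟨hx, h⟩)
        have hxu : x ≠ posOf R' r := fun e => hdisj hu (e ▸ hxR)
        have hdu : posOf R' (r + 1) ≠ posOf R' r := posOf_ne hRJ hne
        have hs := pick_spec hne (posOf R' r + 1)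
        change posOf R' (r + 1) ∈ _ ∧ ((_ ≤ posOf R' (r + 1) ∧ ∀ x ∈ _, _ → posOf R' (r + 1) ≤ x) ∨
          _ ∧ ∀ x ∈ _, posOf R' (r + 1) ≤ x) at hs
        obtain ⟨_, ⟨h2, h3⟩ | ⟨h2, h3⟩⟩ := hs
        · rw [if_pos (by omega)]
          intro hle
          exact h3 x hxR (by omega)
        · have := h2 _ hd
          rw [if_neg (by omega)]
          have := h2 x hxR
          exact ⟨by omega, h3 x hxR⟩)
    refine ⟨q', ?_⟩
    rw [Function.iterate_succ_apply', ← hR', key r hu, key (r + 1) hd, Finset.sum_range_succ]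
    exact hq'

/-- The leftmost occurrences of the first letter are extracted first. -/
theorem nextR_zero_lt {R : ℕ → Finset ℕ} (J : ℕ) : nextR^[J] R 0 ⊆ R 0 ∧
    ∀ x ∈ R 0 \ nextR^[J] R 0, ∀ y ∈ nextR^[J] R 0, x < y := by
  induction J with
  | zero => simp
  | succ J ih =>
    rw [Function.iterate_succ_apply']
    set R' := nextR^[J] R with hR'
    refine ⟨(Finset.erase_subset _ _).trans ih.1, fun x hx y hy => ?_⟩
    simp only [nextR, Finset.mem_sdiff, Finset.mem_erase] at hx hy
    by_cases hxR : x ∈ R' 0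
    · have hxp : x = posOf R' 0 := by by_contra h; exact hx.2 ⟨h, hxR⟩
      have hs := pick_spec ⟨x, hxR⟩ 0
      have : x ≤ y := by
        rw [hxp]
        obtain ⟨_, ⟨_, h3⟩ | ⟨_, h3⟩⟩ := hs
        · exact h3 y hy.2 (Nat.zero_le _)
        · exact h3 y hy.2
      have hne := hy.1
      omega
    · exact ih.2 x (Finset.mem_sdiff.2 ⟨hx.1, hxR⟩) y hy.2

/-- The charge of a word as a major index: the columns are the positions, from right to left. -/
theorem chargeAux_eq_majA {L n fuel : ℕ} {A : Arr} {w : List (ℕ × ℕ)}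
    (hw : w.Pairwise fun a b => a.2 < b.2) (hfuel : w.length ≤ fuel)
    (hpos : ∀ r, letterPos w (r + 1) = revS n (A r)) (hA : ∀ r, ∀ x ∈ A r, x < n)
    (hc : ∀ r, (A (r + 1)).card ≤ (A r).card) (hL : ∀ r, L ≤ r → A r = ∅) :
    chargeAux fuel w = majA L A := by
  have hnd : (w.map Prod.snd).Nodup := List.pairwise_map.2 (hw.imp fun h => h.ne)
  set R := fun r => letterPos w (r + 1) with hRdef
  have hRn : ∀ r, ∀ x ∈ R r, x < n := fun r x hx => by
    simp only [hRdef, hpos] at hx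
    exact revS_lt (hA r) x hx
  have hcard : ∀ r, (R r).card = (A r).card := fun r => by
    simp only [hRdef, hpos]; exact card_revS (hA r)
  have hR : IsPosSets L R := by
    refine ⟨fun r hr => ?_, fun r => by rw [hcard, hcard]; exact hc r, fun r s hrs => ?_⟩
    · simp only [hRdef, hpos, hL r hr]; rfl
    · rw [Finset.disjoint_left]
      intro x h1 h2
      have h1 := mem_letterPos.1 h1
      have h2 := mem_letterPos.1 h2
      have := List.inj_on_of_nodup_map hnd h1 h2 rfl
      simp at this
      omega
  rw [chargeAux_eq fuel hw hR]
  have hmaj : majA L A = ∑ k ∈ Finset.range L, ∑ r ∈ Finset.range k,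
      eps (labAt A k (r + 1)) (A r) := by
    unfold majA
    refine Finset.sum_comm' fun r k => ?_
    simp only [Finset.mem_range, Finset.mem_Ico]
    omega
  rw [hmaj]
  refine Finset.sum_congr rfl fun k _ => ?_
  have hmin : min fuel (letterPos w (k + 1)).card = (R k).card := by
    refine min_eq_right (le_trans (List.toFinset_card_le _) ?_)
    rw [List.length_map]
    exact (List.length_filter_le _ _).trans hfuel
  rw [hmin, Finset.sum_comm]
  obtain ⟨z1, z2⟩ := nextR_zero_lt (R := R) (R k).card
  -- For fixed `k`, the rounds that reach the letter `k + 1` form a chain of queues from the first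
  -- letter upwards. It starts with the leftmost occurrences of that letter, and it is compared with
  -- the chain of balls with label above `k`.
  refine sum_eps_labAt_eq (S := fun r => R r \ nextR^[(R k).card] R r) hA hc ?_ ?_ ?_ ?_
  · intro r hr
    rw [← hpos (r + 1)]
    exact nextR_isQueue hR hRn r _ (hR.antitone (by omega))
  · rw [← hpos 0]; exact Finset.sdiff_subset
  · rw [Finset.card_sdiff_of_subset z1, card_iterate_nextR, ← hcard]
    have := hR.antitone (Nat.zero_le k)
    simp only at this
    omega
  · intro x hx y hy hy'
    rw [← hpos 0] at hy
    refine z2 x hx y ?_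
    by_contra h
    exact hy' (Finset.mem_sdiff.2 ⟨hy, h⟩)

/-! ### Arrays with given recording data -/

section pattern

variable {L n : ℕ} {A : Arr} {m m' : ℕ → ℕ → ℕ}

/-- The array of a triangular array with the columns of the tableau. -/
abbrev arrId (m : ℕ → ℕ → ℕ) : Arr := arrOf (fun _ b => b) m

/-- `m` is the recording data of the array `A` with `L` rows. -/
structure Records (L : ℕ) (A : Arr) (m : ℕ → ℕ → ℕ) : Prop where
  gt : IsGT m
  stable : ∀ i, L ≤ i → m i = m L
  card : ∀ k, k < L → ∀ r, r ≤ k → (collA A k r).card = m (k + 1) r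

theorem Records.unique (h : Records L A m) (h' : Records L A m') : m = m' := by
  have key : ∀ i, i ≤ L → m i = m' i := by
    intro i hi
    rcases i with _ | i
    · funext a; rw [h.gt.zero, h'.gt.zero]
    · funext a
      rcases le_or_gt a i with ha | ha
      · rw [← h.card i (by omega) a ha, h'.card i (by omega) a ha]
      · rw [h.gt.eq_zero (by omega), h'.gt.eq_zero (by omega)]
  funext i
  rcases le_total i L with hi | hi
  · exact key i hi
  · rw [h.stable i hi, h'.stable i hi, key L le_rfl]

theorem records_arrOf {κ : ℕ → ℕ → ℕ} (hm : IsGT m) (hs : ∀ i, L ≤ i → m i = m L)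
    (h1 : ∀ a, StrictMono (κ a)) (h2 : ∀ a b, κ (a + 1) b ≤ κ a b) : Records L (arrOf κ m) m where
  gt := hm
  stable := hs
  card k _ r hr := by
    rw [collA_arrOf hm h1 h2, if_pos hr, Finset.card_image_of_injective _ (h1 r).injective,
      Finset.card_range]

theorem records_arrId (hm : IsGT m) (hs : ∀ i, L ≤ i → m i = m L) : Records L (arrId m) m :=
  records_arrOf hm hs strictMono_id' fun _ _ => le_rfl

theorem Records.fWord (h : Records L A m) (js : List ℕ) : Records L (fWord L js A) m where
  gt := h.gt
  stable := h.stable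
  card k hk r hr := by rw [← fWord_collA (Or.inr hk), card_fWord, h.card k hk r hr]

theorem patt_stable (hL : ∀ r, L ≤ r → A r = ∅) (i : ℕ) (hi : L ≤ i) : patt n A i = patt n A L := by
  have key : ∀ b k, cnt A b (L + k) = cnt A b L := by
    intro b k
    induction k with
    | zero => rfl
    | succ k ih => rw [← add_assoc, cnt_succ, ih, hL _ (by omega)]; simp
  obtain ⟨k, rfl⟩ := Nat.exists_eq_add_of_le hi
  funext a
  simp only [patt, key]

/-- Every array comes from the column-highest array with the same recording data. -/
theorem exists_records (hA : ∀ r, ∀ x ∈ A r, x < n) (hL : ∀ r, L ≤ r → A r = ∅) :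
    ∃ m js, Records L A m ∧ A = QuasiMac.fWord L js (arrId m) ∧ (∀ j ∈ js, j + 1 < n) ∧
      ColHigh L (arrId m) ∧ (∀ r, ∀ x ∈ arrId m r, x < n) ∧ ∀ r, L ≤ r → arrId m r = ∅ := by
  obtain ⟨js, A₀, h1, h2, h3, h4⟩ := exists_colHigh (L := L) A hA
  have h5 : ∀ r, L ≤ r → A₀ r = ∅ := fun r hr => by
    rw [← fWord_of_ge (L := L) (A := A₀) js hr, ← h2]; exact hL r hr
  have e : arrId (patt n A₀) = A₀ := arrOf_patt h1 h5 h4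
  refine ⟨patt n A₀, js, ?_, by rw [e, h2], h3, by rwa [e], by rwa [e], by rwa [e]⟩
  have hr := (records_arrId (L := L) isGT_patt (patt_stable (n := n) h5)).fWord js
  rwa [e, ← h2] at hr

/-- Recording data are unique, so the column-highest array behind `A` is the one built from the
given `m`. -/
theorem Records.exists_fWord (h : Records L A m) (hA : ∀ r, ∀ x ∈ A r, x < n)
    (hL : ∀ r, L ≤ r → A r = ∅) :
    ∃ js, A = QuasiMac.fWord L js (arrId m) ∧ (∀ j ∈ js, j + 1 < n) ∧
      ColHigh L (arrId m) ∧ (∀ r, ∀ x ∈ arrId m r, x < n) ∧ ∀ r, L ≤ r → arrId m r = ∅ := by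
  obtain ⟨m', js, h1, h2⟩ := exists_records hA hL
  rw [h.unique h1]
  exact ⟨js, h2⟩

/-- Since column operators do not change the major index, it may be computed on any array with the
same recording data. This is how the charge of the recording tableau enters. -/
theorem majA_eq_of_records (h : Records L A m) (hA : ∀ r, ∀ x ∈ A r, x < n)
    (hL : ∀ r, L ≤ r → A r = ∅) : majA L A = majA L (arrId m) := by
  obtain ⟨js, h2, _⟩ := h.exists_fWord hA hL
  rw [h2, majA_fWord]

theorem card_arrId (hm : IsGT m) (i : ℕ) :
    (arrId m i).card = ∑ a ∈ Finset.range (i + 1), (m (i + 1) a - m i a) := by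
  rw [arrId, arrOf, Finset.card_biUnion]
  · refine Finset.sum_congr rfl fun a _ => ?_
    rw [Finset.image_id', Nat.card_Ico]
  · have key : ∀ a b, a < b → Disjoint ((Finset.Ico (m i a) (m (i + 1) a)).image fun b => b)
        ((Finset.Ico (m i b) (m (i + 1) b)).image fun b => b) := by
      intro a b hab
      rw [Finset.image_id', Finset.image_id', Finset.disjoint_left]
      intro x hx hx'
      rw [Finset.mem_Ico] at hx hx'
      have h1 := hm.strip i a
      have h2 := hm.antitone (i + 1) (show a + 1 ≤ b by omega)
      omega
    intro a _ b _ hab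
    rcases lt_or_gt_of_ne hab with h | h
    · exact key a b h
    · exact (key b a h).symm

theorem Records.card_row (h : Records L A m) (hA : ∀ r, ∀ x ∈ A r, x < n)
    (hL : ∀ r, L ≤ r → A r = ∅) (i : ℕ) :
    (A i).card = ∑ a ∈ Finset.range (i + 1), (m (i + 1) a - m i a) := by
  obtain ⟨js, h2, _⟩ := h.exists_fWord hA hL
  rw [h2, card_fWord, card_arrId h.gt]

/-- The collapsed array has the rows of the last line of the recording data. -/
theorem Records.collA_arrId (h : Records L A m) (hL : ∀ r, L ≤ r → arrId m r = ∅) :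
    collA (arrId m) (L - 1) = intervals (m L) := by
  funext r
  rw [collA_arrOf_id h.gt]
  by_cases hr : r < L
  · rw [if_pos (by omega), show L - 1 + 1 = L by omega]; rfl
  · have h0 : intervals (m L) r = ∅ := by
      rw [intervals, h.gt.eq_zero (by omega), Finset.range_zero]
    rw [h0]
    split_ifs with h'
    · have hL0 : L = 0 := by omega
      subst hL0
      rw [h.stable (0 - 1 + 1) (by omega), h.gt.zero, Finset.range_zero]
    · exact hL r (by omega)

/-- The operators dropping balls can be inverted by operators on rows. -/
theorem exists_inverse_dropP {i : ℕ} (hi : i + 1 < L) (A : Arr) :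
    ∃ G, RowComm L G ∧ G (onRows dropP i A) = A := by
  refine ⟨(onRows fP i)^[(un (A (i + 1)) (A i)).card], (rowComm_fP hi).iterate _, ?_⟩
  rw [onRows_dropP_eq le_rfl, onRows_iterate, onRows_iterate, onRows_onRows]
  exact onRows_of_eq _ _ _ (iterate_fP_iterate_eP _ le_rfl)

theorem exists_inverse_chainD {c : ℕ} (hc : c < L) (A : Arr) :
    ∃ G, RowComm L G ∧ G (chainD dropP 0 c A) = A := by
  induction c generalizing A with
  | zero => exact ⟨id, fun _ _ => rfl, rfl⟩
  | succ c ih =>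
    obtain ⟨G₁, h1, h2⟩ := exists_inverse_dropP (i := 0 + c) (L := L) (by omega) A
    obtain ⟨G₂, h3, h4⟩ := ih (by omega) (onRows dropP (0 + c) A)
    exact ⟨G₁ ∘ G₂, h1.comp h3, by rw [Function.comp, chainD, h4, h2]⟩

theorem exists_inverse_collA {k : ℕ} (hk : k = 0 ∨ k < L) (A : Arr) :
    ∃ G, RowComm L G ∧ G (collA A k) = A := by
  induction k with
  | zero => exact ⟨id, fun _ _ => rfl, rfl⟩
  | succ k ih =>
    obtain ⟨G₁, h1, h2⟩ := ih (by omega)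
    obtain ⟨G₂, h3, h4⟩ := exists_inverse_chainD (c := k + 1) (L := L) (by omega) (collA A k)
    exact ⟨G₁ ∘ G₂, h1.comp h3, by rw [Function.comp, collA, h4, h2]⟩

/-- An array is determined by its recording data and the collapsed array. -/
theorem Records.eq_of_collA_eq {A' : Arr} (h : Records L A m) (h' : Records L A' m)
    (hA : ∀ r, ∀ x ∈ A r, x < n) (hL : ∀ r, L ≤ r → A r = ∅)
    (hA' : ∀ r, ∀ x ∈ A' r, x < n) (hL' : ∀ r, L ≤ r → A' r = ∅)
    (e : collA A (L - 1) = collA A' (L - 1)) : A = A' := by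
  obtain ⟨js, h2, _⟩ := h.exists_fWord hA hL
  obtain ⟨js', h2', _⟩ := h'.exists_fWord hA' hL'
  have hL1 : L - 1 = 0 ∨ L - 1 < L := by omega
  -- An inverse of collapsing for `arrId m` alone suffices: it commutes with column operators, hence
  -- inverts collapsing on everything reached from `arrId m`.
  obtain ⟨G, g1, g2⟩ := exists_inverse_collA hL1 (arrId m)
  have key : ∀ js, G (collA (QuasiMac.fWord L js (arrId m)) (L - 1)) =
      QuasiMac.fWord L js (arrId m) := fun js => by
    rw [← fWord_collA hL1, ← g1.fWord, g2]
  rw [h2, ← key js, ← h2, e, h2', key js']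

/-- Arrays in which all balls are matched with balls of the row below. -/
def RowHigh (A : Arr) : Prop := ∀ r, eps (A (r + 1)) (A r) = 0

theorem RowHigh.onRows_dropP (h : RowHigh A) (i : ℕ) : onRows dropP i A = A := by
  refine onRows_of_eq _ _ _ ?_
  have := un_eq_empty_iff.2 (eps_eq_zero_iff.1 (h i))
  rw [dropP, this, Finset.sdiff_empty, Finset.union_empty]

theorem RowHigh.collA (h : RowHigh A) (k : ℕ) : collA A k = A := by
  have key : ∀ c, chainD dropP 0 c A = A := by
    intro c
    induction c with
    | zero => rfl
    | succ c ih => rw [chainD, h.onRows_dropP, ih]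
  induction k with
  | zero => rfl
  | succ k ih => rw [QuasiMac.collA, ih, key]

theorem RowHigh.card_le (h : RowHigh A) (r : ℕ) : (A (r + 1)).card ≤ (A r).card := by
  have := (eps_eq_zero_iff.1 (h r)) 0
  rw [exc_zero] at this
  omega

/-- For the column-highest array the collapse consists of nested intervals, which are matched row by
row; the column word that leads to `A` preserves the excess maxima and the cardinalities. -/
theorem Records.rowHigh (h : Records L A m) (hA : ∀ r, ∀ x ∈ A r, x < n)
    (hL : ∀ r, L ≤ r → A r = ∅) :
    RowHigh (QuasiMac.collA A (L - 1)) ∧ (∀ r, (QuasiMac.collA A (L - 1) r).card = m L r) ∧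
      (∀ r, ∀ x ∈ QuasiMac.collA A (L - 1) r, x < n) ∧
      ∀ r, L ≤ r → QuasiMac.collA A (L - 1) r = ∅ := by
  obtain ⟨js, h2, h3, h4, h5, h6⟩ := h.exists_fWord hA hL
  have hL1 : L - 1 = 0 ∨ L - 1 < L := by omega
  have e : QuasiMac.collA A (L - 1) = QuasiMac.fWord L js (intervals (m L)) := by
    rw [h2, ← fWord_collA hL1, h.collA_arrId h6]
  have hcard : ∀ r, (QuasiMac.collA A (L - 1) r).card = m L r := fun r => by
    rw [e, card_fWord]; exact Finset.card_range _
  have hemp : ∀ r, L ≤ r → QuasiMac.collA A (L - 1) r = ∅ := fun r hr =>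
    Finset.card_eq_zero.1 (by rw [hcard, h.gt.eq_zero hr])
  refine ⟨fun r => ?_, hcard, ?_, hemp⟩
  · by_cases hr : r + 1 < L
    · rw [e, eps_fWord hr, eps_eq_zero_iff]
      exact fun x => exc_nonpos_of_subset
        (Finset.range_subset_range.2 (h.gt.antitone L (by omega))) x
    · rw [hemp (r + 1) (by omega), eps_eq_zero_iff]
      exact fun x => exc_nonpos_of_subset (Finset.empty_subset _) x
  · rw [e]
    refine fWord_lt h3 fun r x hx => ?_
    have hx : x ∈ QuasiMac.collA (arrId m) (L - 1) r := by rwa [h.collA_arrId h6]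
    rw [collA_of_colHigh h4 h6 h5] at hx
    split_ifs at hx
    · exact Finset.mem_range.1 (Finset.mem_filter.1 hx).1
    · simp at hx

/-- Every pair of a fully matched array and recording data with the same shape is attained. -/
theorem exists_of_rowHigh {N : Arr} (hN : RowHigh N) (hNn : ∀ r, ∀ x ∈ N r, x < n)
    (hNL : ∀ r, L ≤ r → N r = ∅) (hm : IsGT m) (hs : ∀ i, L ≤ i → m i = m L)
    (hc : ∀ r, (N r).card = m L r) :
    ∃ A, Records L A m ∧ QuasiMac.collA A (L - 1) = N ∧ (∀ r, ∀ x ∈ A r, x < n) ∧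
      ∀ r, L ≤ r → A r = ∅ := by
  obtain ⟨m₁, js, h1, h2, h3, h4, h5, h6⟩ := exists_records hNn hNL
  have hL1 : L - 1 = 0 ∨ L - 1 < L := by omega
  have hN₀ : RowHigh (arrId m₁) := fun r => by
    by_cases hr : r + 1 < L
    · rw [← eps_fWord hr js, ← h2]; exact hN r
    · rw [h6 (r + 1) (by omega), eps_eq_zero_iff]
      exact fun x => exc_nonpos_of_subset (Finset.empty_subset _) x
  -- A fully matched array is its own collapse, so the column-highest array behind `N` consists of
  -- intervals, and these are also the collapse of `arrId m`. The column word leading to `N`,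
  -- applied to `arrId m`, then gives the required array.
  have e1 : arrId m₁ = intervals (m L) := by
    have h7 := h1.collA_arrId h6
    rw [hN₀.collA] at h7
    rw [h7]
    have : m₁ L = m L := funext fun r => by
      rw [← hc r, h2, card_fWord, h7]; exact (Finset.card_range _).symm
    rw [this]
  have hrec := records_arrId hm hs
  have hemp : ∀ r, L ≤ r → arrId m r = ∅ := fun r hr => by
    rw [← Finset.card_eq_zero, card_arrId hm]
    refine Finset.sum_eq_zero fun a _ => ?_
    rw [hs r hr, hs (r + 1) (by omega), Nat.sub_self]
  have hbd : ∀ r, ∀ x ∈ arrId m r, x < n := by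
    intro r x hx
    have hrL : r < L := by
      by_contra h
      rw [hemp r (by omega)] at hx
      simp at hx
    simp only [arrId, arrOf, Finset.image_id', Finset.mem_biUnion, Finset.mem_Ico] at hx
    obtain ⟨a, _, _, hx⟩ := hx
    have h7 : m (r + 1) a ≤ m L a := by
      have : Monotone fun i => m i a := monotone_nat_of_le_succ fun i => hm.le i a
      exact this (by omega)
    have h8 := hm.antitone L (Nat.zero_le a)
    have h9 : x ∈ arrId m₁ 0 := by
      rw [e1]; exact Finset.mem_range.2 (by omega)
    exact h5 0 x h9
  refine ⟨QuasiMac.fWord L js (arrId m), hrec.fWord js, ?_, fWord_lt h3 hbd, fun r hr => ?_⟩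
  · rw [← fWord_collA hL1, hrec.collA_arrId hemp, ← e1, ← h2]
  · rw [fWord_of_ge js hr, hemp r hr]

end pattern

/-! ### Semistandard tableaux and triangular arrays -/

/-- `T` is the semistandard tableau of shape `μ` with entries at most `L` whose triangular array is
`m`. -/
structure IsTab (L : ℕ) (μ : YoungDiagram) (m : ℕ → ℕ → ℕ) (T : ℕ → ℕ → ℕ) : Prop where
  gt : IsGT m
  stable : ∀ i, L ≤ i → m i = m L
  shape : ∀ a, μ.rowLen a = m L a
  outside : ∀ a b, m L a ≤ b → T a b = 0
  le_iff : ∀ a b, b < m L a → ∀ i, T a b ≤ i ↔ b < m i a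

section IsTab

variable {L : ℕ} {μ μ' ν : YoungDiagram} {m m' : ℕ → ℕ → ℕ} {T T' : ℕ → ℕ → ℕ}

theorem IsTab.pos (h : IsTab L μ m T) {a b : ℕ} (hb : b < m L a) : 0 < T a b := by
  by_contra hc
  have := (h.le_iff a b hb 0).1 (by omega)
  rw [h.gt.zero] at this
  omega

theorem IsTab.lt_iff (h : IsTab L μ m T) (i a b : ℕ) : b < m i a ↔ b < m L a ∧ T a b ≤ i := by
  constructor
  · intro hb
    have h1 : b < m L a := by
      rcases le_total L i with hi | hi
      · rwa [← h.stable i hi]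
      · have : Monotone fun i => m i a := monotone_nat_of_le_succ fun i => h.gt.le i a
        exact hb.trans_le (this hi)
    exact ⟨h1, (h.le_iff a b h1 i).2 hb⟩
  · rintro ⟨h1, h2⟩
    exact (h.le_iff a b h1 i).1 h2

theorem IsTab.array_unique (h : IsTab L μ m T) (h' : IsTab L μ' m' T) : m = m' := by
  have h0 : ∀ a b, b < m L a ↔ b < m' L a := by
    intro a b
    have h1 := @IsTab.pos _ _ _ _ h a b
    have h2 := @IsTab.pos _ _ _ _ h' a b
    have h3 := h.outside a b
    have h4 := h'.outside a b
    constructor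
    · intro hb; by_contra hc; have := h1 hb; have := h4 (by omega); omega
    · intro hb; by_contra hc; have := h2 hb; have := h3 (by omega); omega
  funext i a
  refine eq_of_forall_lt_iff fun b => ?_
  rw [h.lt_iff, h'.lt_iff, h0]

theorem IsTab.unique (h : IsTab L μ m T) (h' : IsTab L μ' m T') : T = T' := by
  funext a b
  by_cases hb : b < m L a
  · exact eq_of_forall_ge_iff fun i => by rw [h.le_iff a b hb, h'.le_iff a b hb]
  · rw [h.outside a b (by omega), h'.outside a b (by omega)]

theorem IsTab.card_cells (h : IsTab L μ m T) (i : ℕ) :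
    (μ.cells.filter fun c => T c.1 c.2 = i + 1).card =
      ∑ a ∈ Finset.range (i + 1), (m (i + 1) a - m i a) := by
  have hmem : ∀ a b, (a, b) ∈ μ.cells.filter (fun c => T c.1 c.2 = i + 1) ↔
      m i a ≤ b ∧ b < m (i + 1) a := by
    intro a b
    rw [Finset.mem_filter, YoungDiagram.mem_cells, YoungDiagram.mem_iff_lt_rowLen, h.shape,
      h.lt_iff (i + 1), ← not_lt, h.lt_iff i]
    constructor
    · rintro ⟨h1, h2⟩
      have h2 : T a b = i + 1 := h2
      exact ⟨fun h => by omega, h1, by omega⟩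
    · rintro ⟨h1, h2, h3⟩
      have h4 : ¬ T a b ≤ i := fun h4 => h1 ⟨h2, h4⟩
      exact ⟨h2, show T a b = i + 1 by omega⟩
  rw [Finset.card_eq_sum_card_fiberwise (f := Prod.fst) (t := Finset.range (i + 1))]
  · refine Finset.sum_congr rfl fun a _ => ?_
    rw [← Nat.card_Ico]
    refine Finset.card_bij' (fun c _ => c.2) (fun b _ => (a, b)) ?_ ?_ ?_ ?_
    · rintro ⟨a', b⟩ hc
      rw [Finset.mem_filter, hmem] at hc
      obtain ⟨hc, rfl⟩ := hc
      exact Finset.mem_Ico.2 hc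
    · intro b hb
      rw [Finset.mem_filter, hmem]
      exact ⟨Finset.mem_Ico.1 hb, rfl⟩
    · rintro ⟨a', b⟩ hc
      have := (Finset.mem_filter.1 hc).2
      simp only at this
      rw [this]
    · intro b _; rfl
  · rintro ⟨a, b⟩ hc
    have := ((hmem a b).1 hc).2
    rw [Finset.coe_range, Set.mem_Iio]
    by_contra hca
    have h0 : m (i + 1) a = 0 := h.gt.eq_zero (by simpa using hca)
    omega

/-- The number of entries `≤ i` in row `a`. -/
def gtOf (μ : YoungDiagram) (T : ℕ → ℕ → ℕ) (i a : ℕ) : ℕ :=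
  ((Finset.range (μ.rowLen a)).filter fun b => b < μ.rowLen a ∧ T a b ≤ i).card

theorem lt_gtOf (Q : SemistandardYoungTableau μ) (i a b : ℕ) :
    b < gtOf μ Q i a ↔ b < μ.rowLen a ∧ Q a b ≤ i := by
  have := filter_range_eq_range (n := μ.rowLen a) (p := fun b => b < μ.rowLen a ∧ Q a b ≤ i)
    fun b hb => ⟨by omega, le_trans (Q.row_weak (by omega)
      (YoungDiagram.mem_iff_lt_rowLen.2 hb.1)) hb.2⟩
  rw [← Finset.mem_range, gtOf, ← this, Finset.mem_filter, Finset.mem_range]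
  tauto

theorem entry_le {Q : SemistandardYoungTableau μ} (hQ : Q ∈ ssytSet μ ν) {a b : ℕ}
    (h : b < μ.rowLen a) : Q a b ≤ ν.colLen 0 := by
  have hc : (a, b) ∈ μ.cells := YoungDiagram.mem_iff_lt_rowLen.2 h
  have hpos := hQ.1 _ hc
  simp only at hpos
  have h1 : 0 < ν.rowLen (Q a b - 1) := by
    rw [← hQ.2]
    refine Finset.card_pos.2 ⟨(a, b), Finset.mem_filter.2 ⟨hc, ?_⟩⟩
    show Q a b = _
    omega
  have h2 := YoungDiagram.mem_iff_lt_colLen.1 (YoungDiagram.mem_iff_lt_rowLen.2 h1)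
  omega

theorem isTab_of_mem {Q : SemistandardYoungTableau μ} (hQ : Q ∈ ssytSet μ ν) :
    IsTab (ν.colLen 0) μ (gtOf μ Q) Q := by
  have hL : ∀ i, ν.colLen 0 ≤ i → ∀ a, gtOf μ Q i a = μ.rowLen a := fun i hi a =>
    eq_of_forall_lt_iff fun b => by
      rw [lt_gtOf]
      exact ⟨fun h => h.1, fun h => ⟨h, (entry_le hQ h).trans hi⟩⟩
  refine ⟨⟨fun a => ?_, fun i a => ?_, fun i a => ?_⟩, fun i hi => ?_, fun a => ?_, fun a b hb => ?_,
    fun a b hb i => ?_⟩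
  · by_contra h
    have h1 := (lt_gtOf Q 0 a 0).1 (by omega)
    have := hQ.1 (a, 0) (YoungDiagram.mem_iff_lt_rowLen.2 h1.1)
    simp only at this
    omega
  · exact forall_lt_iff_le.1 fun b hb => by
      rw [lt_gtOf] at hb ⊢
      exact ⟨hb.1, by omega⟩
  · exact forall_lt_iff_le.1 fun b hb => by
      rw [lt_gtOf] at hb ⊢
      have := Q.col_strict (i1 := a) (i2 := a + 1) (j := b) (by omega)
        (YoungDiagram.mem_iff_lt_rowLen.2 hb.1)
      exact ⟨hb.1.trans_le (μ.rowLen_anti a (a + 1) (by omega)), by omega⟩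
  · funext a
    rw [hL i hi, hL _ le_rfl]
  · rw [hL _ le_rfl]
  · rw [hL _ le_rfl] at hb
    exact Q.zeros (by rw [YoungDiagram.mem_iff_lt_rowLen]; omega)
  · rw [hL _ le_rfl] at hb
    rw [lt_gtOf]
    simp [hb]

/-- The tableau with a given triangular array. -/
def IsTab.toSSYT (h : IsTab L μ m T) : SemistandardYoungTableau μ where
  entry := T
  row_weak' := by
    intro i j1 j2 hj hm
    rw [YoungDiagram.mem_iff_lt_rowLen, h.shape] at hm
    rw [h.le_iff i j1 (by omega)]
    exact hj.trans ((h.le_iff i j2 hm _).1 le_rfl)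
  col_strict' := by
    intro i1 i2 j hi hm
    rw [YoungDiagram.mem_iff_lt_rowLen, h.shape] at hm
    have h1 := (h.le_iff i2 j hm _).1 le_rfl
    have hp := h.pos hm
    obtain ⟨t, ht⟩ : ∃ t, T i2 j = t + 1 := ⟨T i2 j - 1, by omega⟩
    rw [ht] at h1
    have h2 := h.gt.antitone (t + 1) (show i1 + 1 ≤ i2 by omega)
    have h3 := h.gt.strip t i1
    have h4 := (h.lt_iff t i1 j).1 (by omega)
    omega
  zeros' := by
    intro i j hm
    rw [YoungDiagram.mem_iff_lt_rowLen, h.shape] at hm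
    exact h.outside i j (by omega)

theorem IsTab.toSSYT_mem (h : IsTab L μ m T)
    (hν : ∀ k, ν.rowLen k = ∑ a ∈ Finset.range (k + 1), (m (k + 1) a - m k a)) :
    h.toSSYT ∈ ssytSet μ ν := by
  refine ⟨fun c hc => ?_, fun k => ?_⟩
  · rw [YoungDiagram.mem_cells, YoungDiagram.mem_iff_lt_rowLen, h.shape] at hc
    exact h.pos hc
  · rw [hν, ← h.card_cells k]
    rfl

/-! ### The charge of a tableau -/

/-- The beginning of a reading word. -/
def readingPrefix (μ : YoungDiagram) (T : ℕ → ℕ → ℕ) (h : ℕ) : List ℕ :=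
  (List.range h).flatMap fun i => ((List.range (μ.rowLen i)).map (T i)).reverse

theorem readingPrefix_spec (μ : YoungDiagram) (T : ℕ → ℕ → ℕ) (h : ℕ) :
    (readingPrefix μ T h).length = ∑ a ∈ Finset.range h, μ.rowLen a ∧
    ∀ k p, (k, p) ∈ (readingPrefix μ T h).zipIdx ↔
      ∃ a < h, ∃ b < μ.rowLen a, T a b = k ∧
        p = (∑ a' ∈ Finset.range a, μ.rowLen a') + (μ.rowLen a - 1 - b) := by
  induction h with
  | zero => simp [readingPrefix]
  | succ h ih =>
    obtain ⟨h1, h2⟩ := ih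
    have e : readingPrefix μ T (h + 1) =
        readingPrefix μ T h ++ ((List.range (μ.rowLen h)).map (T h)).reverse := by
      simp [readingPrefix, List.range_succ]
    refine ⟨by rw [e, List.length_append, h1, Finset.sum_range_succ]; simp, fun k p => ?_⟩
    rw [e, List.zipIdx_append, List.mem_append, h2, h1]
    have h3 : (k, p) ∈ (((List.range (μ.rowLen h)).map (T h)).reverse).zipIdx
        (0 + ∑ a ∈ Finset.range h, μ.rowLen a) ↔ ∃ b < μ.rowLen h, T h b = k ∧
        p = (∑ a' ∈ Finset.range h, μ.rowLen a') + (μ.rowLen h - 1 - b) := by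
      rw [List.mem_zipIdx_iff_le_and_getElem?_sub]
      simp only [zero_add]
      constructor
      · rintro ⟨h4, h5⟩
        obtain ⟨h6, h7⟩ := List.getElem?_eq_some_iff.1 h5
        simp only [List.length_reverse, List.length_map, List.length_range] at h6
        simp only [List.getElem_reverse, List.getElem_map, List.getElem_range, List.length_map,
          List.length_range] at h7
        exact ⟨_, by omega, h7, by omega⟩
      · rintro ⟨b, hb, rfl, rfl⟩
        refine ⟨by omega, ?_⟩
        rw [List.getElem?_eq_some_iff]
        refine ⟨by simp; omega, ?_⟩
        simp only [List.getElem_reverse, List.getElem_map, List.getElem_range, List.length_map,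
          List.length_range]
        congr 1
        omega
    rw [h3]
    constructor
    · rintro (⟨a, ha, h⟩ | h)
      · exact ⟨a, by omega, h⟩
      · exact ⟨_, by omega, h⟩
    · rintro ⟨a, ha, h⟩
      rcases Nat.lt_succ_iff_lt_or_eq.1 ha with ha | rfl
      · exact Or.inl ⟨a, ha, h⟩
      · exact Or.inr h

theorem pairwise_zipIdx (l : List ℕ) (i : ℕ) : (l.zipIdx i).Pairwise fun a b => a.2 < b.2 := by
  induction l generalizing i with
  | nil => simp
  | cons x l ih =>
    rw [List.zipIdx_cons, List.pairwise_cons]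
    refine ⟨fun a ha => ?_, ih _⟩
    have := List.le_snd_of_mem_zipIdx ha
    show i < a.2
    omega

/-- The tableau is drawn so that the rows of balls are the reversed positions of the letters of its
reading word. This array has the recording data of the tableau, so its major index is that of `arrId
m`; on the other hand it is the charge by `chargeAux_eq_majA`. -/
theorem IsTab.charge_eq (h : IsTab L μ m T)
    (hc : ∀ i, ∑ a ∈ Finset.range (i + 2), (m (i + 2) a - m (i + 1) a) ≤
      ∑ a ∈ Finset.range (i + 1), (m (i + 1) a - m i a)) :
    wordCharge (readingWord μ T) = majA L (arrId m) := by
  set st : ℕ → ℕ := fun a => ∑ a' ∈ Finset.range a, μ.rowLen a' with hst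
  set H := μ.colLen 0 with hH
  obtain ⟨w1, w2⟩ := readingPrefix_spec μ T H
  have hstep : ∀ a, st (a + 1) = st a + μ.rowLen a := fun a => Finset.sum_range_succ _ _
  have hmono : Monotone st := monotone_nat_of_le_succ fun a => by rw [hstep]; omega
  have hlenH : ∀ a, 0 < μ.rowLen a → a < H := fun a ha =>
    YoungDiagram.mem_iff_lt_colLen.1 (YoungDiagram.mem_iff_lt_rowLen.2 ha)
  set n := st H with hn
  -- The cell `(a, b)` is read at position `st a + (μ.rowLen a - 1 - b)`; its distance from the last
  -- position `n - 1` is this column number.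
  set κ : ℕ → ℕ → ℕ := fun a b => n - st (a + 1) + b with hκ
  have hrec : Records L (arrOf κ m) m := records_arrOf h.gt h.stable
    (fun a b b' hb => by simp only [hκ]; omega)
    (fun a b => by have := hmono (show a + 1 ≤ a + 1 + 1 by omega); simp only [hκ]; omega)
  have hmem : ∀ r x, x ∈ arrOf κ m r ↔ ∃ a b, b < m L a ∧ T a b = r + 1 ∧ x = κ a b := by
    intro r x
    simp only [arrOf, Finset.mem_biUnion, Finset.mem_range, Finset.mem_image, Finset.mem_Ico]
    constructor
    · rintro ⟨a, _, b, ⟨h1, h2⟩, rfl⟩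
      have h3 := (h.lt_iff (r + 1) a b).1 h2
      have h4 := h.le_iff a b h3.1 r
      exact ⟨a, b, h3.1, by omega, rfl⟩
    · rintro ⟨a, b, h1, h2, rfl⟩
      have h3 := h.le_iff a b h1 r
      have h4 := h.le_iff a b h1 (r + 1)
      refine ⟨a, ?_, b, ⟨by omega, by omega⟩, rfl⟩
      by_contra ha
      have := h.gt.eq_zero (i := r + 1) (a := a) (by omega)
      omega
  have hpos : ∀ a b, b < m L a → st (a + 1) ≤ n ∧ μ.rowLen a = m L a ∧
      st (a + 1) = st a + m L a := by
    intro a b hb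
    have h1 := h.shape a
    exact ⟨hmono (hlenH a (by omega)), h1, by rw [hstep, h1]⟩
  have hA : ∀ r, ∀ x ∈ arrOf κ m r, x < n := by
    intro r x hx
    obtain ⟨a, b, h1, _, rfl⟩ := (hmem r x).1 hx
    obtain ⟨p1, p2, p3⟩ := hpos a b h1
    simp only [hκ]
    omega
  have hL : ∀ r, L ≤ r → arrOf κ m r = ∅ := by
    intro r hr
    rw [Finset.eq_empty_iff_forall_notMem]
    intro x hx
    obtain ⟨a, b, h1, h2, _⟩ := (hmem r x).1 hx
    have := (h.le_iff a b h1 L).2 h1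
    omega
  rw [← majA_eq_of_records hrec hA hL, wordCharge]
  have hcard := hrec.card_row hA hL
  refine chargeAux_eq_majA (n := n) (pairwise_zipIdx _ 0) (by simp) (fun r => ?_) hA
    (fun r => by rw [hcard, hcard]; exact hc r) hL
  ext p
  rw [mem_letterPos]
  refine (w2 (r + 1) p).trans ?_
  simp only [revS, Finset.mem_image, hmem]
  constructor
  · rintro ⟨a, ha, b, hb, h1, rfl⟩
    rw [h.shape] at hb
    obtain ⟨p1, p2, p3⟩ := hpos a b hb
    refine ⟨κ a b, ⟨a, b, hb, h1, rfl⟩, ?_⟩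
    simp only [hκ]
    change _ = st a + _
    omega
  · rintro ⟨x, ⟨a, b, hb, h1, rfl⟩, rfl⟩
    obtain ⟨p1, p2, p3⟩ := hpos a b hb
    refine ⟨a, hlenH a (by omega), b, by omega, h1, ?_⟩
    simp only [hκ]
    change _ = st a + _
    omega

end IsTab

/-! ### The recording tableau -/

section Recording

variable {n L : ℕ} {M : GMLQ n} {m : ℕ → ℕ → ℕ}

theorem recordStep_spec (h : Records L (toArr M) m) (k : ℕ) (hk : k < L) (a : ℕ) :
    (recordStep M k a).length = m (k + 1) a ∧
    ∀ b, b < m (k + 1) a → ∀ i, (recordStep M k a).getD b 0 ≤ i ↔ b < m i a := by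
  have hmono : Monotone fun i => m i a := monotone_nat_of_le_succ fun i => h.gt.le i a
  have hcard : ∀ k, k < L → ∀ r, r ≤ k → (collapseStep M k r).card = m (k + 1) r :=
    fun k hk r hr => by rw [← h.card k hk r hr, ← toArr_collapseStep, card_toArr]
  induction k with
  | zero =>
    rw [recordStep]
    by_cases ha : a = 0
    · subst ha
      have h0 : (M 0).card = m 1 0 := hcard 0 hk 0 le_rfl
      rw [if_pos rfl, h0]
      refine ⟨by simp, fun b hb i => ?_⟩
      rw [List.getD_eq_getElem _ _ (by simpa using hb), List.getElem_replicate]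
      rcases i with _ | i
      · rw [h.gt.zero]; omega
      · have h2 : m (0 + 1) 0 ≤ m (i + 1) 0 := hmono (show 0 + 1 ≤ i + 1 by omega)
        omega
    · rw [if_neg ha, h.gt.eq_zero (by omega)]
      simp
  | succ k ih =>
    obtain ⟨i1, i2⟩ := ih (by omega)
    have hlen : (recordStep M (k + 1) a).length = m (k + 2) a := by
      rw [recordStep, List.length_append, List.length_replicate, i1]
      have : m (k + 1) a ≤ m (k + 2) a := h.gt.le (k + 1) a
      split_ifs with h1 h2
      · rw [hcard (k + 1) hk a (by omega), hcard k (by omega) a (by omega)]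
        exact Nat.add_sub_of_le this
      · rw [hcard (k + 1) hk a (by omega), h.gt.eq_zero (i := k + 1) (a := a) (by omega), zero_add]
      · rw [h.gt.eq_zero (i := k + 1) (a := a) (by omega),
          h.gt.eq_zero (i := k + 2) (a := a) (by omega)]
    refine ⟨hlen, fun b hb i => ?_⟩
    rcases Nat.lt_or_ge b (m (k + 1) a) with hb' | hb'
    · rw [recordStep, List.getD_append _ _ _ _ (by rwa [i1])]
      exact i2 b hb' i
    · rw [List.getD_eq_getElem _ _ (by rwa [hlen])]
      have : (recordStep M (k + 1) a)[b]'(by rwa [hlen]) = k + 2 := by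
        simp only [recordStep]
        rw [List.getElem_append_right (by rwa [i1]), List.getElem_replicate]
      rw [this]
      constructor
      · intro hi
        exact hb.trans_le (hmono hi)
      · intro hi
        by_contra hc
        have := hmono (show i ≤ k + 1 by omega)
        simp only at this
        omega

theorem isTab_rhoQ {μ : YoungDiagram} (h : Records L (toArr M) m) (hL : ∀ r, L ≤ r → M r = ∅)
    (hμ : ∀ a, μ.rowLen a = m L a) : IsTab L μ m (rhoQ L M) := by
  have key : ∀ a, (recordStep M (L - 1) a).length = m L a ∧
      ∀ b, b < m L a → ∀ i, (recordStep M (L - 1) a).getD b 0 ≤ i ↔ b < m i a := by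
    intro a
    -- For `L = 0` the truncated `L - 1` still leaves the initial record, which is empty because row
    -- `0` is.
    rcases L with _ | L
    · rw [h.gt.zero]
      refine ⟨?_, fun b hb => by omega⟩
      rw [Nat.zero_sub, recordStep, hL 0 le_rfl]
      split_ifs <;> simp
    · exact recordStep_spec h L (by omega) a
  refine ⟨h.gt, h.stable, hμ, fun a b hb => ?_, fun a b hb i => (key a).2 b hb i⟩
  rw [rhoQ, List.getD_eq_default _ _ (by rw [(key a).1]; exact hb)]

end Recording

/-! ### Partitions and compositions -/

theorem lt_countP_iff {l : List ℕ} (h : l.Pairwise (· ≥ ·)) (r i : ℕ) :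
    i < l.countP (fun x => r < x) ↔ ∃ h : i < l.length, r < l[i] := by
  induction l generalizing i with
  | nil => simp
  | cons x l ih =>
    rw [List.pairwise_cons] at h
    rw [List.countP_cons]
    by_cases hx : r < x
    · rcases i with _ | i
      · simp [hx]
      · simp only [hx, decide_true, if_true, List.length_cons, List.getElem_cons_succ]
        rw [Nat.add_lt_add_iff_right, ih h.2]
        simp
    · have h0 : l.countP (fun x => r < x) = 0 := by
        rw [List.countP_eq_zero]
        intro y hy
        have := h.1 y hy
        simp; omega
      rw [h0]
      simp only [hx, decide_false, Bool.false_eq_true, if_false, add_zero]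
      constructor
      · intro h; omega
      · rintro ⟨h1, h2⟩
        rcases i with _ | i
        · exact absurd h2 hx
        · have := h.1 _ (List.getElem_mem (l := l) (n := i) (by simpa using h1))
          rw [List.getElem_cons_succ] at h2
          omega

theorem colLen_sortDiagram (l : List ℕ) (r : ℕ) :
    (sortDiagram l).colLen r = l.countP fun x => r < x := by
  refine eq_of_forall_lt_iff fun i => ?_
  rw [← YoungDiagram.mem_iff_lt_colLen, sortDiagram, YoungDiagram.mem_ofRowLens,
    ← (List.mergeSort_perm l (· ≥ ·)).countP_eq, lt_countP_iff]
  exact List.sortedGE_mergeSort.pairwise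

theorem diagram_ext {μ ν : YoungDiagram} (h : ∀ r, μ.colLen r = ν.colLen r) : μ = ν := by
  ext ⟨i, j⟩
  rw [YoungDiagram.mem_cells, YoungDiagram.mem_cells, YoungDiagram.mem_iff_lt_colLen,
    YoungDiagram.mem_iff_lt_colLen, h]

theorem rowLen_zero_le_iff {μ : YoungDiagram} {r : ℕ} : μ.rowLen 0 ≤ r ↔ μ.colLen r = 0 := by
  rw [← not_lt, ← YoungDiagram.mem_iff_lt_rowLen, YoungDiagram.mem_iff_lt_colLen]
  omega

theorem sortDiagram_compress {n : ℕ} (α : Fin n → ℕ) :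
    sortDiagram (compress α) = sortDiagram (List.ofFn α) := by
  refine diagram_ext fun r => ?_
  rw [colLen_sortDiagram, colLen_sortDiagram, compress, List.countP_filter]
  refine List.countP_congr fun x _ => ?_
  simp
  omega

theorem countP_ofFn {n : ℕ} (α : Fin n → ℕ) (k : ℕ) :
    (List.ofFn α).countP (fun x => k < x) = (Finset.univ.filter fun e => k < α e).card := by
  rw [List.ofFn_eq_map, List.countP_map, List.countP_eq_length_filter,
    ← List.toFinset_card_of_nodup ((List.nodup_finRange n).filter _)]
  congr 1
  ext e
  simp

/-! ### Types of multiline queues -/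

/-- Conditions on the rows of a multiline queue with at most `L` rows. -/
structure IsMLQ {n : ℕ} (L : ℕ) (M : GMLQ n) : Prop where
  card_le : ∀ r, (M (r + 1)).card ≤ (M r).card
  empty : ∀ r, L ≤ r → M r = ∅

theorem isMLQ_of_mem {n : ℕ} {lam : YoungDiagram} {M : GMLQ n} (h : M ∈ MLQ lam n) :
    IsMLQ (lam.rowLen 0) M where
  card_le r := by rw [h, h]; exact lam.colLen_anti r (r + 1) (by omega)
  empty r hr := Finset.card_eq_zero.1 ((h r).trans (rowLen_zero_le_iff.1 hr))

section types

variable {n L : ℕ} {M : GMLQ n}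

theorem toArr_empty {r : ℕ} (h : M r = ∅) : toArr M r = ∅ := by rw [toArr, h]; rfl

theorem IsMLQ.arr_empty (h : IsMLQ L M) (r : ℕ) (hr : L ≤ r) : toArr M r = ∅ :=
  toArr_empty (h.empty r hr)

theorem IsMLQ.arr_card_le (h : IsMLQ L M) (r : ℕ) : (toArr M (r + 1)).card ≤ (toArr M r).card := by
  rw [card_toArr, card_toArr]; exact h.card_le r

theorem IsMLQ.card_lab (h : IsMLQ L M) (k : ℕ) : (lab k (toArr M)).card = (M k).card := by
  rw [← labAt_zero, (labAt_isQueue (toArr_lt M) h.arr_card_le (Nat.zero_le k)).2.1, card_toArr]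

theorem IsMLQ.lab_lt (h : IsMLQ L M) (k : ℕ) : ∀ x ∈ lab k (toArr M), x < n := fun x hx =>
  toArr_lt M 0 x ((labAt_isQueue (toArr_lt M) h.arr_card_le (Nat.zero_le k)).1 hx)

theorem IsMLQ.lt_mlqType (h : IsMLQ L M) (k : ℕ) (e : Fin n) :
    k < mlqType L M e ↔ (e : ℕ) ∈ lab k (toArr M) := by
  rcases Nat.lt_or_ge k L with hk | hk
  · exact lt_fmLabel h.card_le h.empty (Nat.zero_le k) hk e
  · have h1 := fmLabel_le h.card_le h.empty (Nat.zero_le L) e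
    have h2 : lab k (toArr M) = ∅ := Finset.card_eq_zero.1 (by rw [h.card_lab, h.empty k hk]; rfl)
    rw [h2, mlqType]
    simp
    omega

theorem IsMLQ.support_mlqType (h : IsMLQ L M) (k : ℕ) :
    (Finset.univ.filter fun e => k < mlqType L M e).map Fin.valEmbedding = lab k (toArr M) := by
  simp only [h.lt_mlqType]
  exact map_subtype_val_eq (h.lab_lt k)

theorem IsMLQ.mlqType_eq {L' : ℕ} (h : IsMLQ L M) (h' : IsMLQ L' M) : mlqType L M = mlqType L' M := by
  funext e
  exact eq_of_forall_lt_iff fun k => by rw [h.lt_mlqType, h'.lt_mlqType]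

theorem IsMLQ.colLen_type (h : IsMLQ L M) (r : ℕ) :
    (sortDiagram (List.ofFn (mlqType L M))).colLen r = (M r).card := by
  rw [colLen_sortDiagram, countP_ofFn, ← h.card_lab, ← h.support_mlqType, Finset.card_map]

/-- The smallest threshold compares the whole of row `r + 1` with row `r`; larger thresholds involve
subsets of row `r + 1`, which are matched if the whole row is. -/
theorem IsMLQ.maj_eq_zero_iff (h : IsMLQ L M) : mlqMaj L M = 0 ↔ RowHigh (toArr M) := by
  rw [mlqMaj_eq h.card_le h.empty, majA]
  simp only [Finset.sum_eq_zero_iff, Finset.mem_range, Finset.mem_Ico]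
  constructor
  · intro h1 r
    by_cases hr : r + 1 < L
    · have := h1 r (by omega) (r + 1) ⟨le_rfl, hr⟩
      rwa [labAt_self] at this
    · rw [h.arr_empty (r + 1) (by omega), eps_eq_zero_iff]
      exact fun x => exc_nonpos_of_subset (Finset.empty_subset _) x
  · intro h1 r hr k hk
    have h2 := labAt_isQueue (toArr_lt M) h.arr_card_le (r := r + 1) (k := k) hk.1
    have h3 := eps_eq_zero_iff.1 (h1 r)
    rw [eps_eq_zero_iff]
    intro x
    rw [← exc_add_exc _ (toArr M (r + 1))]
    have h4 := exc_nonpos_of_subset h2.1 x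
    have h5 := h3 x
    omega

end types

/-! ### Compression and order isomorphisms -/

section compress

variable {n n' : ℕ}

/-- The columns with an entry larger than `k`. -/
def level (α : Fin n → ℕ) (k : ℕ) : Finset ℕ :=
  (Finset.univ.filter fun e => k < α e).map Fin.valEmbedding

theorem mem_level {α : Fin n → ℕ} {k : ℕ} {e : Fin n} : (e : ℕ) ∈ level α k ↔ k < α e := by
  simp [level, Fin.val_inj]

/-- The nonzero columns. -/
def supportList (α : Fin n → ℕ) : List (Fin n) := (List.finRange n).filter fun e => α e ≠ 0

theorem mem_supportList {α : Fin n → ℕ} {e : Fin n} : e ∈ supportList α ↔ α e ≠ 0 := by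
  simp [supportList]

theorem compress_eq (α : Fin n → ℕ) : compress α = (supportList α).map α := by
  rw [compress, List.ofFn_eq_map, List.filter_map, supportList]
  rfl

theorem supportList_pairwise (α : Fin n → ℕ) : (supportList α).Pairwise (· < ·) :=
  (List.pairwise_lt_finRange n).filter _

theorem level_zero_eq (α : Fin n → ℕ) :
    level α 0 = ((supportList α).map Fin.val).toFinset := by
  ext x
  simp only [level, Finset.mem_map, Finset.mem_filter, Finset.mem_univ, true_and,
    Fin.valEmbedding_apply, List.mem_toFinset, List.mem_map, mem_supportList, Nat.pos_iff_ne_zero]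

/-- The `i`-th nonzero column of `α` is sent to the `i`-th nonzero column of `α'`. -/
theorem exists_of_compress_eq {α : Fin n → ℕ} {α' : Fin n' → ℕ} (h : compress α = compress α') :
    ∃ f : ℕ → ℕ, StrictMonoOn f (level α 0 : Set ℕ) ∧ ∀ k, (level α k).image f = level α' k := by
  rw [compress_eq, compress_eq] at h
  set s := supportList α with hs
  set s' := supportList α' with hs'
  have hlen : s.length = s'.length := by simpa using congrArg List.length h
  have hval : ∀ i (h1 : i < s.length) (h2 : i < s'.length), α s[i] = α' s'[i] := by
    intro i h1 h2
    have : (s.map α)[i]'(by simpa) = (s'.map α')[i]'(by simpa) := by simp only [h]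
    simpa using this
  have hsp := supportList_pairwise α
  have hsp' := supportList_pairwise α'
  rw [← hs] at hsp
  rw [← hs'] at hsp'
  set sv := s.map Fin.val with hsv
  set sv' := s'.map Fin.val with hsv'
  have hnd : sv.Nodup := List.Nodup.map Fin.val_injective (hsp.imp fun h => h.ne)
  set f : ℕ → ℕ := fun x => sv'.getD (sv.idxOf x) 0 with hf
  have hfi : ∀ i (h1 : i < s.length) (h2 : i < s'.length), f (s[i] : ℕ) = (s'[i] : ℕ) := by
    intro i h1 h2
    have e1 : sv.idxOf (s[i] : ℕ) = i := by
      have := hnd.idxOf_getElem i (by simpa [hsv] using h1)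
      simpa [hsv] using this
    simp only [hf, e1]
    rw [List.getD_eq_getElem _ _ (by simpa [hsv'] using h2)]
    simp [hsv']
  have hmem : ∀ x ∈ level α 0, ∃ i, ∃ h1 : i < s.length, x = s[i] := by
    intro x hx
    rw [level_zero_eq, List.mem_toFinset, List.mem_map] at hx
    obtain ⟨e, he, rfl⟩ := hx
    obtain ⟨i, hi, rfl⟩ := List.getElem_of_mem he
    exact ⟨i, hi, rfl⟩
  refine ⟨f, ?_, fun k => ?_⟩
  · intro x hx y hy hxy
    obtain ⟨i, hi, rfl⟩ := hmem x hx
    obtain ⟨j, hj, rfl⟩ := hmem y hy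
    rw [hfi i hi (by omega), hfi j hj (by omega)]
    have hij : i < j := by
      by_contra hc
      rcases (not_lt.1 hc).eq_or_lt with rfl | hlt
      · omega
      · have := List.pairwise_iff_getElem.1 hsp j i hj hi hlt
        rw [Fin.lt_def] at this
        omega
    have := List.pairwise_iff_getElem.1 hsp' i j (by omega) (by omega) hij
    exact this
  · ext y
    rw [Finset.mem_image]
    constructor
    · rintro ⟨x, hx, rfl⟩
      obtain ⟨e, he, rfl⟩ := Finset.mem_map.1 hx
      rw [Finset.mem_filter] at he
      have hes : e ∈ s := mem_supportList.2 (by omega)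
      obtain ⟨i, hi, rfl⟩ := List.getElem_of_mem hes
      rw [Fin.valEmbedding_apply, hfi i hi (by omega), mem_level, ← hval i hi]
      exact he.2
    · intro hy
      obtain ⟨e, he, rfl⟩ := Finset.mem_map.1 hy
      rw [Finset.mem_filter] at he
      have hes : e ∈ s' := mem_supportList.2 (by omega)
      obtain ⟨i, hi, rfl⟩ := List.getElem_of_mem hes
      refine ⟨s[i], ?_, hfi i (by omega) hi⟩
      rw [mem_level, hval i (by omega) hi]
      exact he.2

theorem compress_eq_of_image {α : Fin n → ℕ} {α' : Fin n' → ℕ} {f : ℕ → ℕ}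
    (hf : StrictMonoOn f (level α 0 : Set ℕ)) (h : ∀ k, (level α k).image f = level α' k) :
    compress α = compress α' := by
  have h1 : ((supportList α).map fun e : Fin n => f e) = (supportList α').map Fin.val := by
    have p1 : ((supportList α).map fun e : Fin n => f e).Pairwise (· < ·) := by
      rw [List.pairwise_map]
      refine (supportList_pairwise α).imp_of_mem fun {a b} ha hb hab => ?_
      rw [mem_supportList] at ha hb
      exact hf (mem_level.2 (by omega)) (mem_level.2 (by omega)) hab
    have p2 : ((supportList α').map Fin.val).Pairwise (· < ·) := by
      rw [List.pairwise_map]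
      exact (supportList_pairwise α').imp fun h => h
    refine List.Perm.eq_of_pairwise' (r := (· < ·)) p1 p2 ?_
    rw [List.perm_ext_iff_of_nodup (p1.imp fun h => h.ne) (p2.imp fun h => h.ne)]
    intro x
    have := h 0
    rw [level_zero_eq, level_zero_eq] at this
    rw [← List.mem_toFinset (l := (supportList α').map Fin.val), ← this]
    simp
  have hinj := hf.injOn
  rw [compress_eq, compress_eq]
  have hlen : (supportList α).length = (supportList α').length := by
    simpa using congrArg List.length h1
  refine List.ext_getElem (by simpa using hlen) fun i h2 h3 => ?_
  rw [List.length_map] at h2 h3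
  have h4 : f ((supportList α)[i] : ℕ) = ((supportList α')[i] : ℕ) := by
    have : ((supportList α).map fun e : Fin n => f e)[i]'(by simpa) =
      ((supportList α').map Fin.val)[i]'(by simpa) := by simp only [h1]
    simpa using this
  rw [List.getElem_map, List.getElem_map]
  have h0 : ((supportList α)[i] : ℕ) ∈ level α 0 :=
    mem_level.2 (Nat.pos_of_ne_zero (mem_supportList.1 (List.getElem_mem _)))
  refine eq_of_forall_lt_iff fun k => ?_
  rw [← mem_level, ← mem_level, ← h4, ← h k, Finset.mem_image]
  constructor
  · intro hk; exact ⟨_, hk, rfl⟩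
  · rintro ⟨x, hx, hxe⟩
    have hx0 : x ∈ level α 0 := by
      obtain ⟨e, he, rfl⟩ := Finset.mem_map.1 hx
      rw [Finset.mem_filter] at he
      exact mem_level.2 (by omega)
    rw [← hinj hx0 h0 hxe]
    exact hx

end compress

/-- The strong type of a multiline queue depends only on the recording data and the strong type of
the collapsed queue. -/
theorem strType_eq_of_records {n n' L : ℕ} {M : GMLQ n} {M' : GMLQ n'} {m : ℕ → ℕ → ℕ}
    (hM : IsMLQ L M) (hM' : IsMLQ L M') (hr : Records L (toArr M) m)
    (hr' : Records L (toArr M') m)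
    (h : strType L (rhoN L M) = strType L (rhoN L M')) : strType L M = strType L M' := by
  obtain ⟨js, e, _, c1, c2, c3⟩ := hr.exists_fWord (toArr_lt M) hM.arr_empty
  obtain ⟨js', e', _⟩ := hr'.exists_fWord (toArr_lt M') hM'.arr_empty
  have key : ∀ {k : ℕ} {K : GMLQ k}, IsMLQ L K → Records L (toArr K) m → IsMLQ L (rhoN L K) := by
    intro k K hK hr
    obtain ⟨g1, g2, g3, g4⟩ := hr.rowHigh (toArr_lt K) hK.arr_empty
    rw [← toArr_collapseStep] at g1 g4
    refine ⟨fun r => ?_, fun r hr => ?_⟩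
    · have := g1.card_le r
      rwa [card_toArr, card_toArr] at this
    · exact Finset.map_eq_empty.1 (g4 r hr)
  have hN := key hM hr
  have hN' := key hM' hr'
  -- The order isomorphism of the occupied columns of the two collapsed queues; `image_lab` shows
  -- that it also matches the labels of `M` and `M'`.
  obtain ⟨f, hf, him⟩ := exists_of_compress_eq h
  have hlev : ∀ {k : ℕ} {K : GMLQ k}, IsMLQ L K → ∀ r, level (mlqType L K) r = lab r (toArr K) :=
    fun hK r => hK.support_mlqType r
  have eN : toArr (rhoN L M) = collA (toArr M) (L - 1) := toArr_collapseStep M _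
  have eN' : toArr (rhoN L M') = collA (toArr M') (L - 1) := toArr_collapseStep M' _
  rw [hlev hN, eN] at hf
  have hres := image_lab c1 c3 c2 js js' e e' hf
    (fun r hr => by rw [← eN, ← eN', ← hlev hN, ← hlev hN']; exact him r)
  refine compress_eq_of_image (f := f) ?_ fun k => ?_
  · rw [hlev hM]
    rcases Nat.eq_zero_or_pos L with hL | hL
    · have : lab 0 (toArr M) = ∅ :=
        Finset.card_eq_zero.1 (by rw [hM.card_lab, hM.empty 0 (by omega)]; rfl)
      rw [this]
      simp [StrictMonoOn]
    · exact hf.mono (by exact_mod_cast (hres 0 hL).1)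
  · rw [hlev hM, hlev hM']
    rcases Nat.lt_or_ge k L with hk | hk
    · exact (hres k hk).2
    · have e1 : lab k (toArr M) = ∅ :=
        Finset.card_eq_zero.1 (by rw [hM.card_lab, hM.empty k hk]; rfl)
      have e2 : lab k (toArr M') = ∅ :=
        Finset.card_eq_zero.1 (by rw [hM'.card_lab, hM'.empty k hk]; rfl)
      rw [e1, e2]; rfl

/-! ### Sizes and dominance -/

theorem sum_rowLen_eq (μ : YoungDiagram) (k : ℕ) {K : ℕ} (hK : μ.rowLen 0 ≤ K) :
    ∑ i ∈ Finset.range k, μ.rowLen i = ∑ r ∈ Finset.range K, min k (μ.colLen r) := by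
  have h1 : ∀ i, μ.rowLen i = ∑ r ∈ Finset.range K, if (i, r) ∈ μ then 1 else 0 := by
    intro i
    rw [← Finset.card_filter]
    have : (Finset.range K).filter (fun r => (i, r) ∈ μ) = Finset.range (μ.rowLen i) := by
      ext r
      rw [Finset.mem_filter, Finset.mem_range, Finset.mem_range, YoungDiagram.mem_iff_lt_rowLen]
      have := μ.rowLen_anti 0 i (Nat.zero_le i)
      omega
    rw [this, Finset.card_range]
  have h2 : ∀ r, min k (μ.colLen r) = ∑ i ∈ Finset.range k, if (i, r) ∈ μ then 1 else 0 := by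
    intro r
    rw [← Finset.card_filter]
    have : (Finset.range k).filter (fun i => (i, r) ∈ μ) = Finset.range (min k (μ.colLen r)) := by
      ext i
      rw [Finset.mem_filter, Finset.mem_range, Finset.mem_range, YoungDiagram.mem_iff_lt_colLen]
      omega
    rw [this, Finset.card_range]
  rw [Finset.sum_congr rfl fun i _ => h1 i, Finset.sum_congr rfl fun r _ => h2 r, Finset.sum_comm]

theorem card_eq_sum_colLen (μ : YoungDiagram) {K : ℕ} (hK : μ.rowLen 0 ≤ K) :
    μ.card = ∑ r ∈ Finset.range K, μ.colLen r := by
  have h := sum_rowLen_eq μ (μ.colLen 0) hK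
  rw [Finset.sum_congr rfl fun r _ => min_eq_right (μ.colLen_anti 0 r (Nat.zero_le r))] at h
  rw [← h, YoungDiagram.card, Finset.card_eq_sum_card_fiberwise (f := Prod.fst)
    (t := Finset.range (μ.colLen 0))]
  · refine Finset.sum_congr rfl fun i _ => ?_
    rw [YoungDiagram.rowLen_eq_card]
    rfl
  · rintro ⟨i, j⟩ hc
    rw [Finset.coe_range, Set.mem_Iio]
    exact YoungDiagram.mem_iff_lt_colLen.1 (μ.up_left_mem le_rfl (Nat.zero_le j) hc)

theorem sum_eq_sum_countP (l : List ℕ) {K : ℕ} (hK : ∀ x ∈ l, x ≤ K) :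
    l.sum = ∑ k ∈ Finset.range K, l.countP fun x => k < x := by
  induction l with
  | nil => simp
  | cons x l ih =>
    rw [List.sum_cons, ih fun y hy => hK y (List.mem_cons_of_mem _ hy)]
    simp only [List.countP_cons, decide_eq_true_eq, Finset.sum_add_distrib]
    rw [add_comm, add_right_inj, ← Finset.card_filter]
    have : (Finset.range K).filter (fun k => k < x) = Finset.range x := by
      ext k
      have := hK x List.mem_cons_self
      simp only [Finset.mem_filter, Finset.mem_range]
      omega
    rw [this, Finset.card_range]

theorem card_sortDiagram (l : List ℕ) : (sortDiagram l).card = l.sum := by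
  have hK : ∀ x ∈ l, x ≤ (sortDiagram l).rowLen 0 := by
    intro x hx
    by_contra hc
    have h1 := rowLen_zero_le_iff.1 (le_refl ((sortDiagram l).rowLen 0))
    rw [colLen_sortDiagram, List.countP_eq_zero] at h1
    have := h1 x hx
    simp at this
    omega
  rw [card_eq_sum_colLen _ le_rfl, sum_eq_sum_countP l hK]
  simp only [colLen_sortDiagram]

theorem compress_sum {n : ℕ} (α : Fin n → ℕ) : (compress α).sum = ∑ e, α e := by
  rw [← card_sortDiagram, sortDiagram_compress, card_sortDiagram, List.sum_ofFn]

theorem compress_pos {n : ℕ} (α : Fin n → ℕ) {x : ℕ} (hx : x ∈ compress α) : 0 < x := by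
  rw [compress, List.mem_filter] at hx
  simpa [Nat.pos_iff_ne_zero] using hx.2

/-- A letter occurs at most once in each of the first `k` columns; by interlacing, its occurrences
there, read from the last row up to the first, lie in successive disjoint intervals of columns. -/
theorem IsGT.sum_min_le {m : ℕ → ℕ → ℕ} (h : IsGT m) (k i c : ℕ) :
    (∑ a ∈ Finset.range (c + 1), (min k (m (i + 1) a) - min k (m i a))) + min k (m i c) ≤ k := by
  induction c with
  | zero =>
    rw [Finset.sum_range_one]
    have := h.le i 0
    omega
  | succ c ih =>
    rw [Finset.sum_range_succ]
    have h1 := h.strip i c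
    have h2 := h.le i (c + 1)
    omega

/-- The cells in the first `k` columns are counted letter by letter, each letter contributing at
most `k` and at most its multiplicity. This is the dominance of shape over content, stated for the
conjugate partitions. -/
theorem IsGT.sum_min_le_sum {m : ℕ → ℕ → ℕ} (h : IsGT m) (k K : ℕ) :
    ∑ a ∈ Finset.range K, min k (m K a) ≤
      ∑ i ∈ Finset.range K, min k (∑ a ∈ Finset.range (i + 1), (m (i + 1) a - m i a)) := by
  have h1 : ∀ a, min k (m K a) =
      ∑ i ∈ Finset.range K, (min k (m (i + 1) a) - min k (m i a)) := by
    intro a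
    have := Finset.sum_range_tsub (f := fun i => min k (m i a))
      (monotone_nat_of_le_succ fun i => min_le_min le_rfl (h.le i a)) K
    rw [this, h.zero]
    simp
  rw [Finset.sum_congr rfl fun a _ => h1 a, Finset.sum_comm]
  refine Finset.sum_le_sum fun i hi => ?_
  rw [Finset.mem_range] at hi
  have h2 : ∑ a ∈ Finset.range K, (min k (m (i + 1) a) - min k (m i a)) =
      ∑ a ∈ Finset.range (i + 1), (min k (m (i + 1) a) - min k (m i a)) := by
    refine (Finset.sum_subset (Finset.range_subset_range.2 (by omega)) fun a _ ha => ?_).symm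
    rw [Finset.mem_range] at ha
    rw [h.eq_zero (i := i + 1) (a := a) (by omega)]
    simp
  rw [h2]
  refine le_min ?_ (Finset.sum_le_sum fun a _ => ?_)
  · have := h.sum_min_le k i i
    omega
  · have := h.le i a
    omega

/-! ### Monomials -/

theorem mlqMonomial_eq (F : Type*) [CommSemiring F] {n : ℕ} (L : ℕ) (M : GMLQ n) :
    mlqMonomial F L M = ∏ b : Fin n, MvPolynomial.X b ^ (colSet L (toArr M) b).card := by
  have h1 : ∀ r, (∏ b ∈ M r, (MvPolynomial.X b : MvPolynomial (Fin n) F)) =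
      ∏ b : Fin n, if b ∈ M r then MvPolynomial.X b else 1 := fun r => by
    rw [Finset.prod_ite_mem, Finset.univ_inter]
  rw [mlqMonomial, Finset.prod_congr rfl fun r _ => h1 r, Finset.prod_comm]
  refine Finset.prod_congr rfl fun b _ => ?_
  rw [← Finset.prod_filter, Finset.prod_const]
  congr 2
  ext r
  rw [Finset.mem_filter, mem_colSet, mem_toArr, Finset.mem_range]

theorem mlqMonomial_of_le (F : Type*) [CommSemiring F] {n L L' : ℕ} {M : GMLQ n}
    (h : ∀ r, L ≤ r → M r = ∅) (hL : L ≤ L') : mlqMonomial F L M = mlqMonomial F L' M := by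
  refine Finset.prod_subset (Finset.range_subset_range.2 hL) fun r _ hr => ?_
  rw [Finset.mem_range] at hr
  rw [h r (by omega), Finset.prod_empty]

theorem card_colSet_collA {L k : ℕ} (hk : k = 0 ∨ k < L) (A : Arr) (b : ℕ) :
    (colSet L (collA A k) b).card = (colSet L A b).card := by
  have key : ∀ c, c = 0 ∨ c < L → ∀ A : Arr,
      (colSet L (chainD dropP 0 c A) b).card = (colSet L A b).card := by
    intro c
    induction c with
    | zero => intro _ A; rfl
    | succ c ih => intro hc A; rw [chainD, ih (by omega), card_colSet_dropP (by omega)]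
  induction k with
  | zero => rfl
  | succ k ih => rw [collA, key _ (by omega), ih (by omega)]

/-- Collapsing moves balls only within their columns. -/
theorem mlqMonomial_rhoN (F : Type*) [CommSemiring F] {n : ℕ} (L : ℕ) (M : GMLQ n) :
    mlqMonomial F L (rhoN L M) = mlqMonomial F L M := by
  rw [mlqMonomial_eq, mlqMonomial_eq]
  refine Finset.prod_congr rfl fun b _ => ?_
  rw [rhoN, toArr_collapseStep, card_colSet_collA (by omega)]

/-! ### The collapsing bijection -/

section rho

variable {n L : ℕ} {lam μ : YoungDiagram} {M M' N : GMLQ n}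

theorem exists_records_of_isMLQ (h : IsMLQ L M) : ∃ m, Records L (toArr M) m := by
  obtain ⟨m, _, h1, _⟩ := exists_records (toArr_lt M) h.arr_empty
  exact ⟨m, h1⟩

theorem Records.isMLQ_rhoN {m : ℕ → ℕ → ℕ} (hr : Records L (toArr M) m) (h : IsMLQ L M) :
    IsMLQ L (rhoN L M) ∧ RowHigh (toArr (rhoN L M)) ∧ ∀ r, (rhoN L M r).card = m L r := by
  obtain ⟨g1, g2, g3, g4⟩ := hr.rowHigh (toArr_lt M) h.arr_empty
  rw [← toArr_collapseStep] at g1 g4 g2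
  refine ⟨⟨fun r => ?_, fun r hr => Finset.map_eq_empty.1 (g4 r hr)⟩, g1, fun r => ?_⟩
  · have := g1.card_le r
    rwa [card_toArr, card_toArr] at this
  · rw [← g2, card_toArr]; rfl

/-- The shape of the collapsed queue. -/
noncomputable def rhoShape (L : ℕ) (M : GMLQ n) : YoungDiagram :=
  sortDiagram (List.ofFn (mlqType L (rhoN L M)))

theorem colLen_rhoShape (h : IsMLQ L M) (r : ℕ) :
    (rhoShape L M).colLen r = (rhoN L M r).card := by
  obtain ⟨m, hm⟩ := exists_records_of_isMLQ h
  exact (hm.isMLQ_rhoN h).1.colLen_type r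

theorem rowLen_rhoShape_le (h : IsMLQ L M) : (rhoShape L M).rowLen 0 ≤ L := by
  obtain ⟨m, hm⟩ := exists_records_of_isMLQ h
  rw [rowLen_zero_le_iff, colLen_rhoShape h, (hm.isMLQ_rhoN h).1.empty L le_rfl, Finset.card_empty]

theorem rhoN_mem (h : IsMLQ L M) : rhoN L M ∈ MLQ (rhoShape L M) n := fun r =>
  (colLen_rhoShape h r).symm

theorem rhoN_mem_NMLQ (h : IsMLQ L M) : rhoN L M ∈ NMLQ (mlqType L (rhoN L M)) := by
  obtain ⟨m, hm⟩ := exists_records_of_isMLQ h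
  obtain ⟨h1, h2, _⟩ := hm.isMLQ_rhoN h
  have h3 := isMLQ_of_mem (rhoN_mem h)
  exact ⟨rhoN_mem h, h3.maj_eq_zero_iff.2 h2, h3.mlqType_eq h1⟩

theorem isTab_of_isMLQ (h : IsMLQ L M) :
    ∃ m, Records L (toArr M) m ∧ IsTab L (rhoShape L M).transpose m (rhoQ L M) := by
  obtain ⟨m, hm⟩ := exists_records_of_isMLQ h
  refine ⟨m, hm, isTab_rhoQ hm h.empty fun a => ?_⟩
  rw [YoungDiagram.rowLen_transpose, colLen_rhoShape h, (hm.isMLQ_rhoN h).2.2]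

/-- Charge and major index meet in the column-highest array `arrId m`, whose triangular array is the
recording tableau. -/
theorem exists_rhoQ (h : M ∈ MLQ lam n) :
    ∃ Q ∈ SSYT (rhoShape (lam.rowLen 0) M).transpose lam.transpose,
      (∀ i j, Q i j = rhoQ (lam.rowLen 0) M i j) ∧ charge Q = mlqMaj (lam.rowLen 0) M := by
  have hM := isMLQ_of_mem h
  obtain ⟨m, hm, ht⟩ := isTab_of_isMLQ hM
  have hc := hm.card_row (toArr_lt M) hM.arr_empty
  refine ⟨ht.toSSYT, ?_, fun _ _ => rfl, ?_⟩
  · rw [SSYT, Set.Finite.mem_toFinset]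
    refine ht.toSSYT_mem fun k => ?_
    rw [YoungDiagram.rowLen_transpose, ← hc, card_toArr, h]
  · rw [charge, mlqMaj_eq hM.card_le hM.empty, majA_eq_of_records hm (toArr_lt M) hM.arr_empty]
    refine ht.charge_eq fun i => ?_
    rw [← hc, ← hc]
    exact hM.arr_card_le i

theorem dominated_rhoShape (h : M ∈ MLQ lam n) (k : ℕ) :
    ∑ i ∈ Finset.range k, (rhoShape (lam.rowLen 0) M).rowLen i ≤
      ∑ i ∈ Finset.range k, lam.rowLen i := by
  have hM := isMLQ_of_mem h
  obtain ⟨m, hm⟩ := exists_records_of_isMLQ hM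
  rw [sum_rowLen_eq _ k (rowLen_rhoShape_le hM), sum_rowLen_eq lam k le_rfl]
  refine le_trans (le_of_eq ?_) ((hm.gt.sum_min_le_sum k (lam.rowLen 0)).trans (le_of_eq ?_))
  · refine Finset.sum_congr rfl fun r _ => ?_
    rw [colLen_rhoShape hM, (hm.isMLQ_rhoN hM).2.2]
  · refine Finset.sum_congr rfl fun r _ => ?_
    rw [← hm.card_row (toArr_lt M) hM.arr_empty, card_toArr, h]

theorem sum_card_eq (L : ℕ) (A : Arr) {n : ℕ} (hA : ∀ r, ∀ x ∈ A r, x < n) :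
    ∑ r ∈ Finset.range L, (A r).card = ∑ b ∈ Finset.range n, (colSet L A b).card := by
  simp only [colSet, Finset.card_filter]
  rw [Finset.sum_comm]
  refine Finset.sum_congr rfl fun r _ => ?_
  rw [← Finset.card_filter]
  congr 1
  ext x
  rw [Finset.mem_filter, Finset.mem_range]
  exact ⟨fun h => ⟨hA r x h, h⟩, fun h => h.2⟩

theorem card_rhoShape (h : M ∈ MLQ lam n) : (rhoShape (lam.rowLen 0) M).card = lam.card := by
  have hM := isMLQ_of_mem h
  rw [card_eq_sum_colLen _ (rowLen_rhoShape_le hM), card_eq_sum_colLen lam le_rfl]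
  have h1 : ∀ r, (rhoShape (lam.rowLen 0) M).colLen r = (toArr (rhoN (lam.rowLen 0) M) r).card :=
    fun r => by rw [colLen_rhoShape hM, card_toArr]
  have h2 : ∀ r, lam.colLen r = (toArr M r).card := fun r => by rw [card_toArr, h]
  simp only [h1, h2]
  rw [sum_card_eq _ _ (toArr_lt _), sum_card_eq _ _ (toArr_lt M)]
  refine Finset.sum_congr rfl fun b _ => ?_
  rw [rhoN, toArr_collapseStep, card_colSet_collA (by omega)]

theorem rho_injective (h : M ∈ MLQ lam n) (h' : M' ∈ MLQ lam n)
    (hN : rhoN (lam.rowLen 0) M = rhoN (lam.rowLen 0) M')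
    (hQ : ∀ i j, rhoQ (lam.rowLen 0) M i j = rhoQ (lam.rowLen 0) M' i j) : M = M' := by
  have hM := isMLQ_of_mem h
  have hM' := isMLQ_of_mem h'
  obtain ⟨m, hm, ht⟩ := isTab_of_isMLQ hM
  obtain ⟨m', hm', ht'⟩ := isTab_of_isMLQ hM'
  rw [← show rhoQ (lam.rowLen 0) M = rhoQ (lam.rowLen 0) M' from funext fun i => funext (hQ i)] at ht'
  obtain rfl := ht.array_unique ht'
  refine toArr_injective (hm.eq_of_collA_eq hm' (toArr_lt M) hM.arr_empty (toArr_lt M')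
    hM'.arr_empty ?_)
  rw [← toArr_collapseStep, ← toArr_collapseStep]
  exact congrArg toArr hN

theorem exists_toArr {A : Arr} (hA : ∀ r, ∀ x ∈ A r, x < n) : ∃ M : GMLQ n, toArr M = A :=
  ⟨fun r => Finset.univ.filter fun c : Fin n => (c : ℕ) ∈ A r, funext fun r =>
    map_subtype_val_eq (hA r)⟩

theorem rho_surjective (hN : N ∈ MLQ μ n) (hNh : RowHigh (toArr N))
    {Q : SemistandardYoungTableau μ.transpose} (hQ : Q ∈ SSYT μ.transpose lam.transpose) :
    ∃ M ∈ MLQ lam n, rhoN (lam.rowLen 0) M = N ∧ ∀ i j, rhoQ (lam.rowLen 0) M i j = Q i j := by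
  rw [SSYT, Set.Finite.mem_toFinset] at hQ
  have ht := isTab_of_mem hQ
  rw [YoungDiagram.colLen_transpose] at ht
  set L := lam.rowLen 0
  set m := gtOf μ.transpose Q
  have hc : ∀ r, (toArr N r).card = m L r := fun r => by
    rw [card_toArr, hN, ← ht.shape, YoungDiagram.rowLen_transpose]
  obtain ⟨A, h1, h2, h3, h4⟩ := exists_of_rowHigh hNh (toArr_lt N) (fun r hr => by
    rw [← Finset.card_eq_zero, hc, ht.gt.eq_zero hr]) ht.gt ht.stable hc
  obtain ⟨M, rfl⟩ := exists_toArr h3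
  have hM : M ∈ MLQ lam n := fun r => by
    rw [← card_toArr, h1.card_row h3 h4, ← ht.card_cells, hQ.2, YoungDiagram.rowLen_transpose]
  refine ⟨M, hM, toArr_injective ?_, ?_⟩
  · rw [rhoN, toArr_collapseStep, h2]
  · have := isTab_rhoQ (μ := μ.transpose) h1 (fun r hr => Finset.map_eq_empty.1 (h4 r hr)) ht.shape
    rw [this.unique ht]
    exact fun _ _ => rfl

end rho

/-! ### Straight multiline queues -/

section straight

variable {N : ℕ} {τ : List ℕ}

theorem mem_straight {r : ℕ} {c : Fin N} : c ∈ straight N τ r ↔ r < τ.getD c 0 := by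
  simp [straight]

theorem ofFn_getD (h : τ.length ≤ N) :
    List.ofFn (fun c : Fin N => τ.getD c 0) = τ ++ List.replicate (N - τ.length) 0 := by
  refine List.ext_getElem (by simp; omega) fun i h1 h2 => ?_
  rw [List.getElem_ofFn]
  by_cases hi : i < τ.length
  · rw [List.getElem_append_left hi, List.getD_eq_getElem _ _ hi]
  · rw [List.getElem_append_right (by omega), List.getElem_replicate,
      List.getD_eq_default _ _ (by simpa using hi)]

theorem compress_getD (h : τ.length ≤ N) (hpos : ∀ x ∈ τ, 0 < x) :
    compress (fun c : Fin N => τ.getD c 0) = τ := by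
  rw [compress, ofFn_getD h, List.filter_append, List.filter_eq_self.2, List.filter_eq_nil_iff.2,
    List.append_nil]
  · intro x hx
    rw [(List.mem_replicate.1 hx).2]
    simp
  · intro x hx
    have := hpos x hx
    simp
    omega

theorem straight_anti {r s : ℕ} (h : r ≤ s) : toArr (straight N τ) s ⊆ toArr (straight N τ) r := by
  intro x hx
  obtain ⟨c, hc, rfl⟩ := Finset.mem_map.1 hx
  rw [mem_straight] at hc
  exact mem_toArr.2 (mem_straight.2 (by omega))

theorem rowHigh_straight : RowHigh (toArr (straight N τ)) := fun r =>
  eps_eq_zero_iff.2 fun x => exc_nonpos_of_subset (straight_anti (by omega)) x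

theorem straight_mem (h : τ.length ≤ N) : straight N τ ∈ MLQ (sortDiagram τ) N := by
  intro r
  rw [colLen_sortDiagram, straight, ← countP_ofFn (fun c : Fin N => τ.getD c 0), ofFn_getD h,
    List.countP_append, List.countP_replicate]
  simp

/-- The rows are nested, so exchanges carry row `k` unchanged to the bottom: a ball is paired
straight down. -/
theorem mlqType_straight {L : ℕ} (h : IsMLQ L (straight N τ)) :
    mlqType L (straight N τ) = fun c : Fin N => τ.getD c 0 := by
  funext c
  refine eq_of_forall_lt_iff fun k => ?_
  rw [h.lt_mlqType, lab, chainD_swapP_of_subset fun a ha => straight_anti (by omega), if_pos rfl,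
    Nat.zero_add, mem_toArr, mem_straight]

theorem strType_straight {L : ℕ} (h : IsMLQ L (straight N τ)) (hN : τ.length ≤ N)
    (hpos : ∀ x ∈ τ, 0 < x) : strType L (straight N τ) = τ := by
  rw [strType, mlqType_straight h, compress_getD hN hpos]

end straight

/-! ### Queues given by arcs -/

/-- The arc going right from the site `u` to the site `d`, cyclically, passes the boundary between
the sites `x - 1` and `x`. -/
def Cov (u d x : ℕ) : Prop := if u ≤ d then u < x ∧ x ≤ d else u < x ∨ x ≤ d

/-- The site `x` lies on the arc from `u` to `d`, the end `d` excluded. -/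
def Bet (u d x : ℕ) : Prop := if u ≤ d then u ≤ x ∧ x < d else u ≤ x ∨ x < d

instance (u d x : ℕ) : Decidable (Cov u d x) := by unfold Cov; infer_instance

theorem not_cov_end (u d : ℕ) : ¬ Cov u d (d + 1) := by
  unfold Cov; split_ifs <;> omega

/-- If the arc from `u` passed the boundary just after `d₀` without passing `z`, it would start on
the arc from `u₀` between `z` and `d₀` and leave `d₀` behind; this crossing is what the last
hypothesis forbids. -/
theorem not_cov_of_cov {u d u₀ d₀ z : ℕ} (h1 : Cov u₀ d₀ z) (h2 : ¬ Cov u d z)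
    (h3 : ¬ Cov u₀ d₀ u ∨ ¬ Bet u d d₀) : ¬ Cov u d (d₀ + 1) := by
  unfold Cov Bet at *
  split_ifs at * <;> omega

theorem not_cov_of_not_bet {u d x : ℕ} (h : ¬ Bet u d x) (hd : x ≠ d) : ¬ Cov u d x ∧ x ≠ u := by
  unfold Cov; unfold Bet at h
  split_ifs at * <;> omega

theorem not_bet_of_not_cov {u d x : ℕ} (h : ¬ Cov u d x) (hu : x ≠ u) : ¬ Bet u d x := by
  unfold Bet; unfold Cov at h
  split_ifs at * <;> omega

section arcs

variable {ι : Type*} {I : Finset ι} {u d : ι → ℕ} {n : ℕ}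

/-- The number of arcs passing a boundary. -/
def arcCount (I : Finset ι) (u d : ι → ℕ) (x : ℕ) : ℕ := (I.filter fun i => Cov (u i) (d i) x).card

theorem arcCount_eq_zero {x : ℕ} : arcCount I u d x = 0 ↔ ∀ i ∈ I, ¬ Cov (u i) (d i) x := by
  rw [arcCount, Finset.card_eq_zero, Finset.filter_eq_empty_iff]

theorem arcCount_step (hu : Set.InjOn u I) (hd : Set.InjOn d I) (x : ℕ) :
    arcCount I u d (x + 1) + (if x ∈ I.image d then 1 else 0) =
      arcCount I u d x + if x ∈ I.image u then 1 else 0 := by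
  classical
  induction I using Finset.induction_on with
  | empty => simp [arcCount]
  | insert i I hi ih =>
    have h1 := ih (hu.mono (by simp)) (hd.mono (by simp))
    have hui : ∀ j ∈ I, u j ≠ u i := fun j hj e =>
      hi (hu (by simp [hj]) (by simp) e ▸ hj)
    have hdi : ∀ j ∈ I, d j ≠ d i := fun j hj e =>
      hi (hd (by simp [hj]) (by simp) e ▸ hj)
    have key : ∀ y, arcCount (insert i I) u d y =
        arcCount I u d y + if Cov (u i) (d i) y then 1 else 0 := by
      intro y
      unfold arcCount
      rw [Finset.filter_insert]
      split_ifs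
      · rw [Finset.card_insert_of_notMem (by simp [hi])]
      · rfl
    have kd : (if x ∈ (insert i I).image d then 1 else 0) =
        (if x ∈ I.image d then 1 else 0) + if x = d i then 1 else 0 := by
      rw [Finset.image_insert]
      simp only [Finset.mem_insert]
      by_cases hx : x = d i
      · have : x ∉ I.image d := by
          rw [Finset.mem_image]
          rintro ⟨j, hj, e⟩
          exact hdi j hj (e.trans hx)
        simp [hx] at this ⊢
        exact this
      · simp [hx]
    have ku : (if x ∈ (insert i I).image u then 1 else 0) =
        (if x ∈ I.image u then 1 else 0) + if x = u i then 1 else 0 := by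
      rw [Finset.image_insert]
      simp only [Finset.mem_insert]
      by_cases hx : x = u i
      · have : x ∉ I.image u := by
          rw [Finset.mem_image]
          rintro ⟨j, hj, e⟩
          exact hui j hj (e.trans hx)
        simp [hx] at this ⊢
        exact this
      · simp [hx]
    have kc : (if Cov (u i) (d i) (x + 1) then 1 else 0) + (if x = d i then 1 else 0) =
        (if Cov (u i) (d i) x then 1 else 0) + if x = u i then 1 else 0 := by
      unfold Cov
      split_ifs <;> omega
    rw [key, key, kd, ku]
    omega

theorem arcCount_zero_eq (x : ℕ) (hx : ∀ i ∈ I, u i < x ∧ d i < x) :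
    arcCount I u d x = (I.filter fun i => d i < u i).card := by
  unfold arcCount
  congr 1
  refine Finset.filter_congr fun i hi => ?_
  have := hx i hi
  unfold Cov
  split_ifs <;> omega

theorem arcCount_zero_eq' : arcCount I u d 0 = (I.filter fun i => d i < u i).card := by
  unfold arcCount
  congr 1
  refine Finset.filter_congr fun i hi => ?_
  unfold Cov
  split_ifs <;> omega

variable [LinearOrder ι]

/-- The arcs are added from the largest index down. If a new arc passes the boundary found so far,
the boundary just after its end does the job, since by `not_cov_of_cov` none of the other arcs
passes it. -/
theorem exists_arcCount_zero (hn : ∀ i ∈ I, d i < n)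
    (hpair : ∀ i ∈ I, ∀ j ∈ I, i < j → ¬ Cov (u i) (d i) (u j) ∨ ¬ Bet (u j) (d j) (d i)) :
    ∃ x ≤ n, arcCount I u d x = 0 := by
  induction I using Finset.induction_on_min with
  | empty => exact ⟨0, by omega, by simp [arcCount]⟩
  | insert i I hi ih =>
    have hiI : i ∉ I := fun h => lt_irrefl _ (hi i h)
    obtain ⟨z, hz, h0⟩ := ih
      (fun j hj => hn j (by simp [hj]))
      fun a ha b hb => hpair a (by simp [ha]) b (by simp [hb])
    rw [arcCount_eq_zero] at h0
    by_cases hc : Cov (u i) (d i) z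
    · refine ⟨d i + 1, hn i (by simp), ?_⟩
      rw [arcCount_eq_zero]
      intro j hj
      rcases Finset.mem_insert.1 hj with rfl | hj
      · exact not_cov_end _ _
      · exact not_cov_of_cov hc (h0 j hj) (hpair i (by simp) j (by simp [hj]) (hi j hj))
    · refine ⟨z, hz, ?_⟩
      rw [arcCount_eq_zero]
      intro j hj
      rcases Finset.mem_insert.1 hj with rfl | hj
      · exact hc
      · exact h0 j hj

/-- The queue length is the number of arcs passing a boundary. The arcs need not come from the
pairing procedure: it is enough that they avoid the idle sites and that the whole circle is not
covered. -/
theorem isQueue_of_arcs {V : Finset ℕ} (hu : Set.InjOn u I) (hd : Set.InjOn d I)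
    (hun : ∀ i ∈ I, u i < n) (hV : ∀ x ∈ V, x < n) (hdV : ∀ i ∈ I, d i ∈ V)
    (hidle : ∀ x ∈ V, x ∉ I.image d → ∀ i ∈ I, ¬ Bet (u i) (d i) x)
    (hpair : ∀ i ∈ I, ∀ j ∈ I, i < j → ¬ Cov (u i) (d i) (u j) ∨ ¬ Bet (u j) (d j) (d i)) :
    IsQueue n (I.image u) V (I.image d) (I.filter fun i => d i < u i).card (arcCount I u d) where
  ltU := by
    intro x hx
    obtain ⟨i, hi, rfl⟩ := Finset.mem_image.1 hx
    exact hun i hi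
  ltV := hV
  sub := by
    intro x hx
    obtain ⟨i, hi, rfl⟩ := Finset.mem_image.1 hx
    exact hdV i hi
  start := arcCount_zero_eq'
  last_eq := arcCount_zero_eq n fun i hi => ⟨hun i hi, hV _ (hdV i hi)⟩
  step x _ := arcCount_step hu hd x
  idle := by
    intro x hx hxD
    have h1 : ∀ i ∈ I, ¬ Cov (u i) (d i) x ∧ x ≠ u i := fun i hi =>
      not_cov_of_not_bet (hidle x hx hxD i hi) fun e =>
        hxD (Finset.mem_image.2 ⟨i, hi, e.symm⟩)
    refine ⟨arcCount_eq_zero.2 fun i hi => (h1 i hi).1, fun hxU => ?_⟩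
    obtain ⟨i, hi, e⟩ := Finset.mem_image.1 hxU
    exact (h1 i hi).2 e.symm
  zero := exists_arcCount_zero (fun i hi => hV _ (hdV i hi)) hpair

/-- Arcs which connect the arrivals and the used services of a queue without crossings as in
`exists_arcCount_zero` avoid the unused services. -/
theorem IsQueue.not_bet {V : Finset ℕ} {w : ℕ} {q : ℕ → ℕ}
    (h : IsQueue n (I.image u) V (I.image d) w q) (hu : Set.InjOn u I) (hd : Set.InjOn d I)
    (hpair : ∀ i ∈ I, ∀ j ∈ I, i < j → ¬ Cov (u i) (d i) (u j) ∨ ¬ Bet (u j) (d j) (d i))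
    {x : ℕ} (hx : x ∈ V) (hxD : x ∉ I.image d) {i : ι} (hi : i ∈ I) : ¬ Bet (u i) (d i) x := by
  -- The arc count and the queue length obey the same recursion, so they differ by a constant. Since
  -- the arc count vanishes somewhere, it is at most the queue length, hence zero wherever the queue
  -- is empty.
  have hconst : ∀ y, y ≤ n → arcCount I u d y + q 0 = q y + arcCount I u d 0 := by
    intro y hy
    induction y with
    | zero => omega
    | succ y ih =>
      have h1 := ih (by omega)
      have h2 := arcCount_step hu hd y
      have h3 := h.step y (by omega)
      omega
  obtain ⟨z, hz, hz0⟩ := exists_arcCount_zero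
    (fun i hi => h.ltV _ (h.sub (Finset.mem_image_of_mem d hi))) hpair
  obtain ⟨i1, i2⟩ := h.idle x hx hxD
  have h1 := hconst z hz
  have h2 := hconst x (h.ltV x hx).le
  rw [hz0] at h1
  rw [i1] at h2
  have h3 : arcCount I u d x = 0 := by omega
  exact not_bet_of_not_cov (arcCount_eq_zero.1 h3 i hi) fun e =>
    i2 (Finset.mem_image.2 ⟨i, hi, e.symm⟩)

theorem exists_nearest {U : Finset ℕ} (hU : U.Nonempty) (d : ℕ) :
    ∃ x ∈ U, ∀ y ∈ U, ¬ Cov x d y := by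
  by_cases h : ∃ x ∈ U, x ≤ d
  · obtain ⟨x0, hx0, hxd⟩ := h
    have hne : (U.filter fun x => x ≤ d).Nonempty := ⟨x0, by simp [hx0, hxd]⟩
    obtain ⟨h1, h2⟩ := Finset.mem_filter.1 (Finset.max'_mem _ hne)
    refine ⟨_, h1, fun y hy => ?_⟩
    unfold Cov
    rw [if_pos h2]
    rintro ⟨h3, h4⟩
    have := Finset.le_max' (U.filter fun x => x ≤ d) y (by simp [hy, h4])
    omega
  · refine ⟨_, U.max'_mem hU, fun y hy => ?_⟩
    have h1 := U.le_max' y hy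
    have h2 : d < U.max' hU := by
      by_contra hc
      exact h ⟨_, U.max'_mem hU, by omega⟩
    have h3 : d < y := by
      by_contra hc
      exact h ⟨y, hy, by omega⟩
    unfold Cov
    rw [if_neg (by omega)]
    omega

/-- Greedy choice of the arcs ending at given sites. -/
theorem exists_arcs (d : ι → ℕ) {U : Finset ℕ} (h : U.card = I.card) :
    ∃ u : ι → ℕ, I.image u = U ∧ ∀ i ∈ I, ∀ j ∈ I, i < j → ¬ Cov (u i) (d i) (u j) := by
  induction I using Finset.induction_on_min generalizing U with
  | empty => exact ⟨fun _ => 0, by simpa using (Finset.card_eq_zero.1 h).symm, by simp⟩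
  | insert i I hi ih =>
    have hiI : i ∉ I := fun h => lt_irrefl _ (hi i h)
    rw [Finset.card_insert_of_notMem hiI] at h
    obtain ⟨x, hx, hx'⟩ := exists_nearest (U := U) (Finset.card_pos.1 (by omega)) (d i)
    obtain ⟨u, h1, h2⟩ := ih (U := U.erase x) (by rw [Finset.card_erase_of_mem hx]; omega)
    have hne : ∀ j ∈ I, j ≠ i := fun j hj e => hiI (e ▸ hj)
    have himg : I.image (Function.update u i x) = U.erase x := by
      rw [← h1]
      exact Finset.image_congr fun j hj => Function.update_of_ne (hne j hj) _ _
    refine ⟨Function.update u i x, ?_, ?_⟩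
    · rw [Finset.image_insert, himg, Function.update_self, Finset.insert_erase hx]
    · intro a ha b hb hab
      rcases Finset.mem_insert.1 hb with rfl | hb'
      · rcases Finset.mem_insert.1 ha with rfl | ha'
        · exact absurd hab (lt_irrefl _)
        · exact absurd hab (hi a ha').asymm
      · rw [Function.update_of_ne (hne b hb')]
        rcases Finset.mem_insert.1 ha with rfl | ha'
        · rw [Function.update_self]
          refine hx' _ ?_
          have : u b ∈ U.erase x := h1 ▸ Finset.mem_image_of_mem u hb'
          exact Finset.mem_of_mem_erase this
        · rw [Function.update_of_ne (hne a ha')]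
          exact h2 a ha' b hb' hab

/-- Greedy arcs are unique. -/
theorem arcs_unique {u' : ι → ℕ} (hu : Set.InjOn u I) (hu' : Set.InjOn u' I)
    (himg : I.image u = I.image u')
    (h : ∀ i ∈ I, ∀ j ∈ I, i < j → ¬ Cov (u i) (d i) (u j))
    (h' : ∀ i ∈ I, ∀ j ∈ I, i < j → ¬ Cov (u' i) (d i) (u' j)) : ∀ i ∈ I, u i = u' i := by
  induction I using Finset.induction_on_min with
  | empty => simp
  | insert i I hi ih =>
    have hiI : i ∉ I := fun h => lt_irrefl _ (hi i h)
    have key : u i = u' i := by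
      by_contra hne
      have e1 : ¬ Cov (u i) (d i) (u' i) := by
        have : u' i ∈ (insert i I).image u := himg ▸ Finset.mem_image_of_mem u' (by simp)
        obtain ⟨j, hj, e⟩ := Finset.mem_image.1 this
        rw [← e]
        rcases Finset.mem_insert.1 hj with rfl | hj
        · exact absurd e hne
        · exact h i (by simp) j (by simp [hj]) (hi j hj)
      have e2 : ¬ Cov (u' i) (d i) (u i) := by
        have : u i ∈ (insert i I).image u' := himg ▸ Finset.mem_image_of_mem u (by simp)
        obtain ⟨j, hj, e⟩ := Finset.mem_image.1 this
        rw [← e]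
        rcases Finset.mem_insert.1 hj with rfl | hj
        · exact absurd e.symm hne
        · exact h' i (by simp) j (by simp [hj]) (hi j hj)
      unfold Cov at e1 e2
      split_ifs at e1 e2 <;> omega
    have hrest : I.image u = I.image u' := by
      have a1 : u i ∉ I.image u := fun hm => by
        obtain ⟨j, hj, e⟩ := Finset.mem_image.1 hm
        exact hiI (hu (by simp [hj]) (by simp) e ▸ hj)
      have a2 : u' i ∉ I.image u' := fun hm => by
        obtain ⟨j, hj, e⟩ := Finset.mem_image.1 hm
        exact hiI (hu' (by simp [hj]) (by simp) e ▸ hj)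
      rw [← Finset.erase_insert a1, ← Finset.erase_insert a2, ← Finset.image_insert,
        ← Finset.image_insert, himg, key]
    intro j hj
    rcases Finset.mem_insert.1 hj with rfl | hj
    · exact key
    · exact ih (hu.mono (by simp)) (hu'.mono (by simp)) hrest
        (fun a ha b hb => h a (by simp [ha]) b (by simp [hb]))
        (fun a ha b hb => h' a (by simp [ha]) b (by simp [hb])) j hj

end arcs

/-! ### Fillings at `t = 0` -/

section Rows

variable {n : ℕ} {μ : Fin n → ℕ} {σ : Equiv.Perm (Fin n)}

/-- The columns with more than `k` boxes. -/
def longCols (μ : Fin n → ℕ) (k : ℕ) : Finset (Fin n) := Finset.univ.filter fun i => k < μ i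

theorem mem_longCols {k : ℕ} {i : Fin n} : i ∈ longCols μ k ↔ k < μ i := by simp [longCols]

/-- The rows `g 0, g 1, …` form a non-attacking filling without coinversions. -/
structure RowsGood (μ : Fin n → ℕ) (σ : Equiv.Perm (Fin n)) (g : ℕ → Fin n → Fin n) : Prop where
  base : ∀ i, 0 < μ i → g 0 i = σ i
  inj : ∀ r i i', r < μ i → r < μ i' → g r i = g r i' → i = i'
  same : ∀ r i i', i < i' → r + 1 < μ i → μ i = μ i' → ¬ Cov (g (r + 1) i) (g r i) (g (r + 1) i')
  diff : ∀ r i i', i < i' → r < μ i → μ i < μ i' → ¬ Bet (g (r + 1) i') (g r i') (g r i)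

theorem not_cov_of_not_cyc {a b c : Fin n} (h : ¬ Cyc a b c) (h2 : b ≠ c) : ¬ Cov a c b := by
  unfold Cyc at h
  unfold Cov
  rw [Ne, Fin.ext_iff] at h2
  simp only [Fin.lt_def] at h
  split_ifs <;> omega

theorem not_cyc_of_not_cov {a b c : Fin n} (h : ¬ Cov a c b) : ¬ Cyc a b c := by
  unfold Cyc
  unfold Cov at h
  simp only [Fin.lt_def]
  split_ifs at h <;> omega

theorem not_bet_of_not_cyc {a b c : Fin n} (h : ¬ Cyc a b c) (h1 : b ≠ a) (h2 : b ≠ c) :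
    ¬ Bet a c b := by
  unfold Cyc at h
  unfold Bet
  rw [Ne, Fin.ext_iff] at h1 h2
  simp only [Fin.lt_def] at h
  split_ifs <;> omega

theorem not_cyc_of_not_bet {a b c : Fin n} (h : ¬ Bet a c b) : ¬ Cyc a b c := by
  unfold Cyc
  unfold Bet at h
  simp only [Fin.lt_def]
  split_ifs at h <;> omega

theorem not_cyc_self (a b : Fin n) : ¬ Cyc a b a := by
  unfold Cyc
  simp only [Fin.lt_def]
  omega

theorem coinv_eq_zero_iff {f : Filling μ} : coinv σ f = 0 ↔ ∀ i j, j < μ i →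
    (∀ i', i < i' → j < μ i' → μ i' ≤ μ i →
      ¬ Cyc (augmented σ f i (j + 1)) (augmented σ f i' (j + 1)) (augmented σ f i j)) ∧
    ∀ i', i' < i → j ≤ μ i' → μ i' < μ i →
      ¬ Cyc (augmented σ f i (j + 1)) (augmented σ f i' j) (augmented σ f i j) := by
  simp only [coinv, Finset.sum_eq_zero_iff, Finset.mem_univ, true_implies, Finset.mem_range,
    Nat.add_eq_zero_iff, Finset.card_eq_zero, Finset.filter_eq_empty_iff, armRight, armLeft,
    Finset.mem_filter, true_and, and_imp]

/-- As `μ` increases, the arm in the same row consists of columns of equal height and gives the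
condition on `Cov`, while the arm in the row below consists of shorter columns and gives the one on
`Bet`. Conversely these two conditions imply the non-attacking condition for adjacent rows. -/
theorem rowsGood_iff (hμ : Monotone μ) {f : Filling μ} :
    NonAttacking σ f ∧ coinv σ f = 0 ↔ RowsGood μ σ fun r i => augmented σ f i (r + 1) := by
  rw [coinv_eq_zero_iff]
  constructor
  · rintro ⟨⟨h1, h2⟩, h3⟩
    -- From the rightmost column to the left: the basement entries of the columns before `i` are
    -- attacked from row `1`, and those of the columns after `i` are already used in row `1`.
    have hbase : ∀ i, 0 < μ i → augmented σ f i 1 = σ i := by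
      intro i
      induction hk : n - (i : ℕ) using Nat.strong_induction_on generalizing i with
      | _ k ih =>
        intro hi
        obtain ⟨i₀, hi₀⟩ := σ.surjective (augmented σ f i 1)
        rcases lt_trichotomy i₀ i with h | h | h
        · exact absurd hi₀.symm (h2 i₀ i h 0 hi (Nat.zero_le _))
        · rw [← hi₀, h]
        · have hm := hμ h.le
          have := ih (n - i₀) (by rw [Fin.lt_def] at h; have := i₀.2; omega) i₀ rfl (by omega)
          exact absurd (hi₀.symm.trans this.symm) (h1 i i₀ h.ne 0 hi (by omega))
    refine ⟨hbase, ?_, ?_, ?_⟩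
    · intro r i i' hi hi' e
      by_contra hne
      exact h1 i i' hne r hi hi' e
    · intro r i i' hii hi he
      exact not_cov_of_not_cyc ((h3 i (r + 1) hi).1 i' hii (by omega) (by omega))
        (h2 i i' hii (r + 1) (by omega) (by omega))
    · intro r i i' hii hi he
      refine not_bet_of_not_cyc ((h3 i' (r + 1) (by omega)).2 i hii (by omega) (by omega)) ?_ ?_
      · exact fun e => h2 i i' hii (r + 1) (by omega) (by omega) e.symm
      · exact h1 i i' hii.ne r (by omega) (by omega)
  · intro h
    refine ⟨⟨fun i i' hne j hj hj' e => hne (h.inj j i i' hj hj' e), ?_⟩, ?_⟩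
    · intro i' i hii j hj hj' e
      rcases j with _ | r
      · have h1 : augmented σ f i (0 + 1) = σ i := h.base i hj
        rw [h1] at e
        exact hii.ne (σ.injective e).symm
      · rcases (hμ hii.le).eq_or_lt with he | he
        · have h1 := h.same r i' i hii (by omega) he
          rw [e] at h1
          have h2 : augmented σ f i' (r + 1 + 1) ≠ augmented σ f i' (r + 1) := fun e' => by
            have := h.inj (r + 1) i i' hj (by omega) (e.trans e'.symm)
            exact hii.ne this.symm
          rw [Ne, Fin.ext_iff] at h2
          unfold Cov at h1
          split_ifs at h1 <;> omega
        · have h1 := h.diff r i' i hii (by omega) he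
          rw [e] at h1
          have h2 : augmented σ f i' (r + 1) ≠ augmented σ f i (r + 1) := fun e' =>
            hii.ne (h.inj r i' i (by omega) (by omega) e')
          rw [Ne, Fin.ext_iff] at h2
          unfold Bet at h1
          split_ifs at h1 <;> omega
    · intro i j hj
      rcases j with _ | r
      · have h1 : augmented σ f i (0 + 1) = augmented σ f i 0 := h.base i hj
        rw [h1]
        exact ⟨fun _ _ _ _ => not_cyc_self _ _, fun _ _ _ _ => not_cyc_self _ _⟩
      · refine ⟨fun i' hii hj' hle => ?_, fun i' hii hj' hlt => ?_⟩
        · exact not_cyc_of_not_cov (h.same r i i' hii hj (le_antisymm (hμ hii.le) hle))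
        · exact not_cyc_of_not_bet (h.diff r i' i hii (by omega) hlt)

/-- The multiline queue with the given rows. -/
def rowsMLQ (μ : Fin n → ℕ) (g : ℕ → Fin n → Fin n) : GMLQ n := fun r => (longCols μ r).image (g r)

/-- The columns of the entries of row `r` in the columns with more than `k` boxes. -/
def rowCols (μ : Fin n → ℕ) (g : ℕ → Fin n → Fin n) (k r : ℕ) : Finset ℕ :=
  (longCols μ k).image fun i => (g r i : ℕ)

theorem toArr_rowsMLQ (g : ℕ → Fin n → Fin n) (r : ℕ) :
    toArr (rowsMLQ μ g) r = rowCols μ g r r := by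
  rw [toArr, rowsMLQ, rowCols, Finset.map_eq_image, Finset.image_image]
  rfl

variable {g g' : ℕ → Fin n → Fin n}

theorem RowsGood.injOn (h : RowsGood μ σ g) {r k : ℕ} (hr : r ≤ k) :
    Set.InjOn (fun i => (g r i : ℕ)) (longCols μ k : Set (Fin n)) := by
  intro i hi i' hi' e
  rw [Finset.mem_coe, mem_longCols] at hi hi'
  exact h.inj r i i' (by omega) (by omega) (Fin.val_injective e)

theorem RowsGood.card_row (h : RowsGood μ σ g) (r : ℕ) :
    (rowsMLQ μ g r).card = (longCols μ r).card := by
  rw [← card_toArr, toArr_rowsMLQ, rowCols, Finset.card_image_of_injOn (h.injOn le_rfl)]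

/-- The arcs join vertically adjacent entries of the columns with more than `k` boxes. The idle
balls belong to shorter columns, which stand to the left and are avoided by `diff`; `same` and
`diff` together exclude the crossings. -/
theorem RowsGood.isQueue (h : RowsGood μ σ g) (hμ : Monotone μ) {k r : ℕ} (hr : r < k) :
    IsQueue n (rowCols μ g k (r + 1)) (rowCols μ g r r) (rowCols μ g k r)
      ((longCols μ k).filter fun i => (g r i : ℕ) < g (r + 1) i).card
      (arcCount (longCols μ k) (fun i => (g (r + 1) i : ℕ)) fun i => (g r i : ℕ)) := by
  refine isQueue_of_arcs (h.injOn (by omega)) (h.injOn (by omega)) (fun i _ => (g (r + 1) i).2)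
    ?_ ?_ ?_ ?_
  · intro x hx
    obtain ⟨i, _, rfl⟩ := Finset.mem_image.1 hx
    exact (g r i).2
  · intro i hi
    rw [mem_longCols] at hi
    exact Finset.mem_image.2 ⟨i, mem_longCols.2 (by omega), rfl⟩
  · intro x hx hxD i hi
    obtain ⟨i', hi', rfl⟩ := Finset.mem_image.1 hx
    rw [mem_longCols] at hi hi'
    have hk : μ i' ≤ k := by
      by_contra hc
      exact hxD (Finset.mem_image.2 ⟨i', mem_longCols.2 (by omega), rfl⟩)
    have hii : i' < i := by
      by_contra hc
      have := hμ (not_lt.1 hc)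
      omega
    exact h.diff r i' i hii hi' (by omega)
  · intro i hi j hj hij
    rw [mem_longCols] at hi hj
    rcases (hμ hij.le).eq_or_lt with he | he
    · exact Or.inl (h.same r i j hij (by omega) he)
    · exact Or.inr (h.diff r i j hij (by omega) he)

theorem RowsGood.labAt_eq (h : RowsGood μ σ g) (hμ : Monotone μ) {k r : ℕ} (hr : r ≤ k) :
    labAt (toArr (rowsMLQ μ g)) k r = rowCols μ g k r := by
  induction hr using Nat.decreasingInduction with
  | self => rw [labAt_self, toArr_rowsMLQ]
  | of_succ r hr ih => rw [labAt_of_lt _ hr, ih, toArr_rowsMLQ, (h.isQueue hμ hr).swapP_eq]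

theorem RowsGood.isMLQ (h : RowsGood μ σ g) {L : ℕ} (hL : ∀ i, μ i ≤ L) :
    IsMLQ L (rowsMLQ μ g) where
  card_le r := by
    rw [h.card_row, h.card_row]
    refine Finset.card_le_card fun i hi => ?_
    rw [mem_longCols] at hi ⊢
    omega
  empty r hr := by
    rw [← Finset.card_eq_zero, h.card_row, Finset.card_eq_zero, Finset.eq_empty_iff_forall_notMem]
    intro i hi
    rw [mem_longCols] at hi
    have := hL i
    omega

theorem RowsGood.mlqType_eq (h : RowsGood μ σ g) (hμ : Monotone μ) {L : ℕ} (hL : ∀ i, μ i ≤ L)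
    (i : Fin n) : mlqType L (rowsMLQ μ g) (σ i) = μ i := by
  refine eq_of_forall_lt_iff fun k => ?_
  rw [(h.isMLQ hL).lt_mlqType, ← labAt_zero, h.labAt_eq hμ (Nat.zero_le k), rowCols, Finset.mem_image]
  constructor
  · rintro ⟨j, hj, e⟩
    rw [mem_longCols] at hj
    rw [h.base j (by omega)] at e
    rwa [← σ.injective (Fin.val_injective e)]
  · intro hi
    exact ⟨i, mem_longCols.2 hi, by rw [h.base i (by omega)]⟩

theorem RowsGood.mlqMaj_eq (h : RowsGood μ σ g) (hμ : Monotone μ) {L : ℕ} (hL : ∀ i, μ i ≤ L) :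
    mlqMaj L (rowsMLQ μ g) = ∑ i, ∑ r ∈ Finset.range (μ i - 1),
      if g r i < g (r + 1) i then μ i - (r + 1) else 0 := by
  have hM := h.isMLQ hL
  rw [QuasiMac.mlqMaj_eq hM.card_le hM.empty, majA]
  have h1 : ∀ r ∈ Finset.range (L - 1), ∑ k ∈ Finset.Ico (r + 1) L,
      eps (labAt (toArr (rowsMLQ μ g)) k (r + 1)) (toArr (rowsMLQ μ g) r) =
      ∑ i, if g r i < g (r + 1) i then μ i - (r + 1) else 0 := by
    intro r _
    have h2 : ∀ k ∈ Finset.Ico (r + 1) L,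
        eps (labAt (toArr (rowsMLQ μ g)) k (r + 1)) (toArr (rowsMLQ μ g) r) =
        ∑ i, if k < μ i ∧ g r i < g (r + 1) i then 1 else 0 := by
      intro k hk
      rw [Finset.mem_Ico] at hk
      rw [h.labAt_eq hμ (by omega), toArr_rowsMLQ, (h.isQueue hμ (by omega)).eps_eq, longCols,
        Finset.filter_filter, Finset.card_filter]
      rfl
    rw [Finset.sum_congr rfl h2, Finset.sum_comm]
    refine Finset.sum_congr rfl fun i _ => ?_
    rw [← Finset.card_filter]
    split_ifs with hd
    · have : (Finset.Ico (r + 1) L).filter (fun k => k < μ i ∧ g r i < g (r + 1) i) =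
          Finset.Ico (r + 1) (μ i) := by
        ext k
        have := hL i
        simp only [Finset.mem_filter, Finset.mem_Ico, hd, and_true]
        omega
      rw [this, Nat.card_Ico]
    · rw [Finset.filter_false_of_mem fun k _ hk => hd hk.2, Finset.card_empty]
  rw [Finset.sum_congr rfl h1, Finset.sum_comm]
  refine Finset.sum_congr rfl fun i _ => ?_
  refine (Finset.sum_subset (Finset.range_subset_range.2 (by have := hL i; omega))
    fun r _ hr => ?_).symm
  rw [Finset.mem_range] at hr
  split_ifs <;> omega

/-- Row `1` repeats the basement and has no descents, so the sum may start with the second row, as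
it does for wrappings. -/
theorem RowsGood.fillMaj_eq {f : Filling μ} (h : RowsGood μ σ fun r i => augmented σ f i (r + 1)) :
    fillMaj σ f = ∑ i, ∑ r ∈ Finset.range (μ i - 1),
      if augmented σ f i (r + 1) < augmented σ f i (r + 1 + 1) then μ i - (r + 1) else 0 := by
  refine Finset.sum_congr rfl fun i _ => ?_
  rcases Nat.eq_zero_or_pos (μ i) with h0 | h0
  · rw [h0]; rfl
  · obtain ⟨c, hc⟩ : ∃ c, μ i = c + 1 := ⟨μ i - 1, by omega⟩
    have hb : augmented σ f i (0 + 1) = augmented σ f i 0 := h.base i h0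
    rw [show Finset.range (μ i) = Finset.range (c + 1) by rw [hc], Finset.sum_range_succ', hb,
      if_neg (lt_irrefl _), add_zero, show μ i - 1 = c by omega]
    refine Finset.sum_congr rfl fun r hr => ?_
    rw [Finset.mem_range] at hr
    split_ifs
    · rw [leg]; omega
    · rfl

/-- A good sequence of rows is determined by its multiline queue. -/
theorem RowsGood.eq_of_rowsMLQ_eq (h : RowsGood μ σ g) (h' : RowsGood μ σ g') (hμ : Monotone μ)
    (e : rowsMLQ μ g = rowsMLQ μ g') (r : ℕ) : ∀ i, r < μ i → g r i = g' r i := by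
  induction r with
  | zero => intro i hi; rw [h.base i hi, h'.base i hi]
  | succ r ih =>
    intro i hi
    -- Within a block of columns of equal height the set of entries is given by two label sets of
    -- the queue, and `arcs_unique` distributes them over the columns.
    set I : Finset (Fin n) := Finset.univ.filter fun j => μ j = μ i with hI
    have hmem : ∀ j, j ∈ I ↔ μ j = μ i := fun j => by simp [hI]
    have hsub : ∀ {G : ℕ → Fin n → Fin n}, RowsGood μ σ G →
        Set.InjOn (fun i => (G (r + 1) i : ℕ)) (I : Set (Fin n)) := by
      intro G hG
      refine (hG.injOn (le_refl (r + 1))).mono fun j hj => ?_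
      rw [Finset.mem_coe, hmem] at hj
      exact Finset.mem_coe.2 (mem_longCols.2 (by omega))
    have himg : ∀ {G : ℕ → Fin n → Fin n}, RowsGood μ σ G → ∀ x,
        x ∈ I.image (fun i => (G (r + 1) i : ℕ)) ↔
          x ∈ labAt (toArr (rowsMLQ μ G)) (μ i - 1) (r + 1) ∧
            x ∉ labAt (toArr (rowsMLQ μ G)) (μ i) (r + 1) := by
      intro G hG x
      rw [hG.labAt_eq hμ (by omega), hG.labAt_eq hμ (by omega), rowCols, rowCols]
      simp only [Finset.mem_image, hmem, mem_longCols]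
      constructor
      · rintro ⟨j, hj, rfl⟩
        refine ⟨⟨j, by omega, rfl⟩, ?_⟩
        rintro ⟨j', hj', e⟩
        have := hG.inj (r + 1) j' j (by omega) (by omega) (Fin.val_injective e)
        subst this
        omega
      · rintro ⟨⟨j, hj, rfl⟩, h2⟩
        refine ⟨j, ?_, rfl⟩
        by_contra hne
        exact h2 ⟨j, by omega, rfl⟩
    have hd : ∀ a ∈ I, (g' r a : ℕ) = g r a := fun a ha => by
      rw [hmem] at ha
      rw [ih a (by omega)]
    have := arcs_unique (d := fun i => (g r i : ℕ)) (hsub h) (hsub h')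
      (by ext x; rw [himg h, himg h', e])
      (fun a ha b hb hab => by
        rw [hmem] at ha hb
        exact h.same r a b hab (by omega) (by omega))
      (fun a ha b hb hab => by
        rw [← hd a ha]
        rw [hmem] at ha hb
        exact h'.same r a b hab (by omega) (by omega)) i ((hmem i).2 rfl)
    exact Fin.val_injective this

end Rows

/-! ### Every multiline queue comes from a filling. -/

section Surjective

variable {n L : ℕ} {μ : Fin n → ℕ} {σ : Equiv.Perm (Fin n)} {M : GMLQ n}

theorem IsMLQ.labAt_eq_empty (h : IsMLQ L M) {k r : ℕ} (hr : r ≤ k) (hk : L ≤ k) :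
    labAt (toArr M) k r = ∅ := by
  rw [← Finset.card_eq_zero, (labAt_isQueue (toArr_lt M) h.arr_card_le hr).2.1, card_toArr,
    h.empty k hk, Finset.card_empty]

theorem IsMLQ.mem_labAt (h : IsMLQ L M) {k r : ℕ} (hr : r ≤ k) (hrL : r ≤ L) (e : Fin n) :
    (e : ℕ) ∈ labAt (toArr M) k r ↔ k < fmLabel L M r e := by
  rcases Nat.lt_or_ge k L with hk | hk
  · exact (lt_fmLabel h.card_le h.empty hr hk e).symm
  · have := fmLabel_le h.card_le h.empty hrL e
    rw [h.labAt_eq_empty hr hk]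
    simp
    omega

theorem IsMLQ.labAt_lt (h : IsMLQ L M) {k r : ℕ} (hr : r ≤ k) : ∀ x ∈ labAt (toArr M) k r, x < n :=
  fun x hx => toArr_lt M r x ((labAt_isQueue (toArr_lt M) h.arr_card_le hr).1 hx)

theorem IsMLQ.labAt_anti (h : IsMLQ L M) {k l r : ℕ} (hr : r ≤ k) (hkl : k ≤ l) :
    labAt (toArr M) l r ⊆ labAt (toArr M) k r := by
  intro x hx
  rcases Nat.lt_or_ge L r with hL | hL
  · rw [h.labAt_eq_empty (by omega) (by omega)] at hx
    simp at hx
  · have hxn := h.labAt_lt (by omega) x hx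
    have := (h.mem_labAt (k := l) (r := r) (by omega) hL ⟨x, hxn⟩).1 hx
    exact (h.mem_labAt hr hL ⟨x, hxn⟩).2 (by omega)

/-- The entries of a row lie in the sites with the right labels. -/
def RowFits (μ : Fin n → ℕ) (M : GMLQ n) (r : ℕ) (d : Fin n → Fin n) : Prop :=
  ∀ k, r ≤ k → (longCols μ k).image (fun i => (d i : ℕ)) = labAt (toArr M) k r

theorem RowFits.injOn (h : IsMLQ L M) (hc : ∀ r, (M r).card = (longCols μ r).card) {r : ℕ}
    {d : Fin n → Fin n} (hd : RowFits μ M r d) {k : ℕ} (hk : r ≤ k) :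
    Set.InjOn (fun i => (d i : ℕ)) (longCols μ k : Set (Fin n)) := by
  rw [← Finset.card_image_iff, hd k hk,
    (labAt_isQueue (toArr_lt M) h.arr_card_le hk).2.1, card_toArr, hc]

/-- Within each block of columns of equal height the entries are distributed by the greedy arcs of
`exists_arcs`, which settles the first condition. The second one is proved by descending induction
on the threshold `k`: the arcs of columns with more than `k` boxes do not cross, so by
`IsQueue.not_bet` they avoid the balls of row `r` that are not paired with them, among them those of
the shorter columns. -/
theorem exists_next_row (h : IsMLQ L M) (hμ : Monotone μ)
    (hc : ∀ r, (M r).card = (longCols μ r).card) {r : ℕ} {d : Fin n → Fin n}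
    (hd : RowFits μ M r d) : ∃ u : Fin n → Fin n, RowFits μ M (r + 1) u ∧
      (∀ i i', i < i' → r + 1 < μ i → μ i = μ i' → ¬ Cov (u i) (d i) (u i')) ∧
      ∀ i i', i < i' → r < μ i → μ i < μ i' → ¬ Bet (u i') (d i') (d i) := by
  have hμL : ∀ i, μ i ≤ L := by
    intro i
    by_contra hi
    have h1 := hc L
    rw [h.empty L le_rfl, Finset.card_empty] at h1
    have := Finset.card_eq_zero.1 h1.symm
    have hm : i ∈ longCols μ L := mem_longCols.2 (by omega)
    rw [this] at hm
    simp at hm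
  have hcl : ∀ k s, s ≤ k → (labAt (toArr M) k s).card = (longCols μ k).card := fun k s hs => by
    rw [(labAt_isQueue (toArr_lt M) h.arr_card_le hs).2.1, card_toArr, hc]
  have hex : ∀ l, ∃ u : Fin n → ℕ, r + 1 < l →
      (Finset.univ.filter fun j => μ j = l).image u =
        labAt (toArr M) (l - 1) (r + 1) \ labAt (toArr M) l (r + 1) ∧
      ∀ i i', μ i = l → μ i' = l → i < i' → ¬ Cov (u i) (d i) (u i') := by
    intro l
    by_cases hl : r + 1 < l
    · obtain ⟨u, h1, h2⟩ := exists_arcs (I := Finset.univ.filter fun j => μ j = l)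
        (fun i => (d i : ℕ))
        (U := labAt (toArr M) (l - 1) (r + 1) \ labAt (toArr M) l (r + 1)) (by
          rw [Finset.card_sdiff_of_subset (h.labAt_anti (by omega) (by omega)),
            hcl _ _ (by omega), hcl _ _ (by omega)]
          have hsplit : (Finset.univ.filter fun j => μ j = l) =
              longCols μ (l - 1) \ longCols μ l := by
            ext j
            simp only [Finset.mem_filter, Finset.mem_univ, true_and, Finset.mem_sdiff, mem_longCols]
            omega
          rw [hsplit, Finset.card_sdiff_of_subset]
          intro j hj
          rw [mem_longCols] at hj ⊢
          omega)
      exact ⟨u, fun _ => ⟨h1, fun i i' hi hi' => h2 i (by simpa using hi) i' (by simpa using hi')⟩⟩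
    · exact ⟨fun _ => 0, fun h => absurd h hl⟩
  choose U hU using hex
  have hUmem : ∀ i, r + 1 < μ i → U (μ i) i ∈ labAt (toArr M) (μ i - 1) (r + 1) ∧
      U (μ i) i ∉ labAt (toArr M) (μ i) (r + 1) := by
    intro i hi
    rw [← Finset.mem_sdiff, ← (hU _ hi).1]
    exact Finset.mem_image_of_mem _ (by simp)
  set u : Fin n → Fin n := fun i => if hi : r + 1 < μ i then
    ⟨U (μ i) i, h.labAt_lt (by omega) _ (hUmem i hi).1⟩ else d i with hu
  have huv : ∀ i, r + 1 < μ i → (u i : ℕ) = U (μ i) i := fun i hi => by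
    simp only [hu]; rw [dif_pos hi]
  have hfit : RowFits μ M (r + 1) u := by
    intro k hk
    ext x
    rw [Finset.mem_image]
    constructor
    · rintro ⟨i, hi, rfl⟩
      rw [mem_longCols] at hi
      rw [huv i (by omega)]
      exact h.labAt_anti hk (by omega) (hUmem i (by omega)).1
    · intro hx
      have hrL : r + 1 ≤ L := by
        by_contra hL
        rw [h.labAt_eq_empty hk (by omega)] at hx
        simp at hx
      have hxn := h.labAt_lt hk x hx
      have hlab : ∀ l, r + 1 ≤ l → (x ∈ labAt (toArr M) l (r + 1) ↔
          l < fmLabel L M (r + 1) ⟨x, hxn⟩) := fun l hl => h.mem_labAt hl hrL ⟨x, hxn⟩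
      set l := fmLabel L M (r + 1) ⟨x, hxn⟩ with hl
      have hkl := (hlab k hk).1 hx
      have hxU : x ∈ (Finset.univ.filter fun j => μ j = l).image (U l) := by
        rw [(hU l (by omega)).1, Finset.mem_sdiff, hlab _ (by omega), hlab _ (by omega)]
        omega
      obtain ⟨i, hi, e⟩ := Finset.mem_image.1 hxU
      have hi : μ i = l := by simpa using hi
      refine ⟨i, mem_longCols.2 (by omega), ?_⟩
      rw [huv i (by omega), hi, e]
  have hsame : ∀ i i', i < i' → r + 1 < μ i → μ i = μ i' → ¬ Cov (u i) (d i) (u i') := by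
    intro i i' hii hi he
    rw [huv i hi, huv i' (by omega), ← he]
    exact (hU _ hi).2 i i' rfl he.symm hii
  have hdi := fun {k} => RowFits.injOn (k := k) h hc hd
  have hui := fun {k} => RowFits.injOn (k := k) h hc hfit
  have hrow : ∀ i, r < μ i → (d i : ℕ) ∈ toArr M r := fun i hi => by
    rw [← labAt_self (toArr M), ← hd r le_rfl]
    exact Finset.mem_image.2 ⟨i, mem_longCols.2 hi, rfl⟩
  have hnot : ∀ i k, r < μ i → r ≤ k → μ i ≤ k →
      (d i : ℕ) ∉ (longCols μ k).image fun i => (d i : ℕ) := by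
    intro i k hi hk hik hm
    obtain ⟨j, hj, e⟩ := Finset.mem_image.1 hm
    rw [mem_longCols] at hj
    have := hdi le_rfl (Finset.mem_coe.2 (mem_longCols.2 (by omega)))
      (Finset.mem_coe.2 (mem_longCols.2 hi)) e
    subst this
    omega
  have key : ∀ k, r + 1 ≤ k → ∀ x ∈ toArr M r, x ∉ (longCols μ k).image (fun i => (d i : ℕ)) →
      ∀ i, k < μ i → ¬ Bet (u i) (d i) x := by
    intro k
    induction hm : L - k using Nat.strong_induction_on generalizing k with
    | _ c ih =>
      intro hk x hx hxD i hi
      obtain ⟨q, hq⟩ := (labAt_isQueue (toArr_lt M) h.arr_card_le hk).2.2 r rfl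
      rw [← hfit k hk, ← hd k (by omega)] at hq
      refine hq.not_bet (hui hk) (hdi (by omega)) ?_ hx hxD (mem_longCols.2 hi)
      intro a ha b hb hab
      rw [mem_longCols] at ha hb
      rcases (hμ hab.le).eq_or_lt with he | he
      · exact Or.inl (hsame a b hab (by omega) he)
      · have hbL := hμL b
        exact Or.inr (ih (L - (μ b - 1)) (by omega) (μ b - 1) rfl (by omega) _ (hrow a (by omega))
          (hnot a _ (by omega) (by omega) (by omega)) b (by omega))
  refine ⟨u, hfit, hsame, fun i i' hii hi hlt => ?_⟩
  exact key (μ i' - 1) (by omega) _ (hrow i hi) (hnot i _ hi (by omega) (by omega)) i' (by omega)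

/-- Every multiline queue whose type is given by `μ` and `σ` comes from a good sequence of rows. -/
theorem exists_rowsGood (h : IsMLQ L M) (hμ : Monotone μ)
    (hc : ∀ r, (M r).card = (longCols μ r).card) (ht : ∀ i, mlqType L M (σ i) = μ i) :
    ∃ g, RowsGood μ σ g ∧ rowsMLQ μ g = M := by
  have h0 : RowFits μ M 0 σ := by
    intro k _
    rw [labAt_zero, ← h.support_mlqType]
    ext x
    simp only [Finset.mem_image, Finset.mem_map, Finset.mem_filter, Finset.mem_univ, true_and,
      mem_longCols, Fin.valEmbedding_apply]
    constructor
    · rintro ⟨i, hi, rfl⟩; exact ⟨σ i, by rwa [ht], rfl⟩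
    · rintro ⟨e, he, rfl⟩
      obtain ⟨i, rfl⟩ := σ.surjective e
      exact ⟨i, by rwa [← ht], rfl⟩
  choose next hnext using fun (r : ℕ) (d : {d // RowFits μ M r d}) =>
    exists_next_row h hμ hc d.2
  let G : (r : ℕ) → {d // RowFits μ M r d} := fun r =>
    Nat.rec ⟨σ, h0⟩ (fun r d => ⟨next r d, (hnext r d).1⟩) r
  have hG0 : (G 0).1 = σ := rfl
  have hGs : ∀ r, (G (r + 1)).1 = next r (G r) := fun r => rfl
  refine ⟨fun r => (G r).1, ⟨fun i _ => by rw [hG0], ?_, ?_, ?_⟩, ?_⟩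
  · intro r i i' hi hi' e
    exact RowFits.injOn h hc (G r).2 le_rfl (Finset.mem_coe.2 (mem_longCols.2 hi))
      (Finset.mem_coe.2 (mem_longCols.2 hi')) (congrArg Fin.val e)
  · intro r i i' hii hi he
    rw [hGs]
    exact (hnext r (G r)).2.1 i i' hii hi he
  · intro r i i' hii hi hlt
    rw [hGs]
    exact (hnext r (G r)).2.2 i i' hii hi hlt
  · refine toArr_injective (funext fun r => ?_)
    rw [toArr_rowsMLQ, ← labAt_self (toArr M), ← (G r).2 r le_rfl]
    rfl

end Surjective

/-! ### The polynomials at `t = 0` -/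

section Poly

variable {F : Type*} [Field F] {n : ℕ}

theorem fillWeight_zero (q : F) {μ : Fin n → ℕ} (σ : Equiv.Perm (Fin n)) (f : Filling μ) :
    fillWeight q 0 σ f = if coinv σ f = 0 then q ^ fillMaj σ f else 0 := by
  unfold fillWeight
  have : ∀ i : Fin n, ∀ j ∈ Finset.range (μ i),
      (if augmented σ f i (j + 1) ≠ augmented σ f i j then
        (1 - (0 : F)) / (1 - q ^ (leg μ i j + 1) * 0 ^ (arm μ i j + 1)) else 1) = 1 := by
    intro i j _
    simp
  rw [Finset.prod_eq_one fun i _ => Finset.prod_eq_one (this i), mul_one]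
  split_ifs with h
  · rw [h, pow_zero, mul_one]
  · rw [zero_pow h, mul_zero]

theorem augmented_succ {μ : Fin n → ℕ} {σ : Equiv.Perm (Fin n)} (f : Filling μ) {i : Fin n} {j : ℕ}
    (h : j < μ i) : augmented σ f i (j + 1) = f i ⟨j, h⟩ := by
  rw [augmented, dif_pos h]

theorem mlqMonomial_rowsMLQ {μ : Fin n → ℕ} {σ : Equiv.Perm (Fin n)} {f : Filling μ}
    (h : RowsGood μ σ fun r i => augmented σ f i (r + 1)) {L : ℕ} (hL : ∀ i, μ i ≤ L) :
    mlqMonomial F L (rowsMLQ μ fun r i => augmented σ f i (r + 1)) =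
      ∏ i : Fin n, ∏ j : Fin (μ i), MvPolynomial.X (f i j) := by
  have h1 : ∀ r ∈ Finset.range L,
      ∏ b ∈ rowsMLQ μ (fun r i => augmented σ f i (r + 1)) r, (MvPolynomial.X b : MvPolynomial _ F) =
      ∏ i, if r < μ i then MvPolynomial.X (augmented σ f i (r + 1)) else 1 := by
    intro r _
    rw [rowsMLQ, Finset.prod_image, longCols, Finset.prod_filter]
    intro i hi i' hi' e
    rw [Finset.mem_coe, mem_longCols] at hi hi'
    exact h.inj r i i' hi hi' e
  rw [mlqMonomial, Finset.prod_congr rfl h1, Finset.prod_comm]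
  refine Finset.prod_congr rfl fun i _ => ?_
  rw [← Finset.prod_filter]
  have h2 : (Finset.range L).filter (fun r => r < μ i) = Finset.range (μ i) := by
    ext r
    have := hL i
    simp only [Finset.mem_filter, Finset.mem_range]
    omega
  rw [h2, Finset.prod_range]
  refine Finset.prod_congr rfl fun j _ => ?_
  rw [augmented_succ f j.2]

open Classical in
/-- The ASEP polynomial at `t = 0` as a sum over multiline queues. -/
theorem asepPoly_zero (q : F) (α : Fin n → ℕ) {L : ℕ} {lam : YoungDiagram}
    (hlam : sortDiagram (List.ofFn α) = lam) (hL : lam.rowLen 0 = L) :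
    asepPoly q 0 α = ∑ M ∈ (MLQ_finite lam n).toFinset with mlqType L M = α,
      MvPolynomial.C (q ^ mlqMaj L M) * mlqMonomial F L M := by
  subst hL
  set σ := Tuple.sort α with hσ
  set μ := α ∘ σ with hμdef
  have hμ : Monotone μ := Tuple.monotone_sort α
  have hαμ : ∀ i, α (σ i) = μ i := fun i => rfl
  have hcol : ∀ r, lam.colLen r = (longCols μ r).card := by
    intro r
    rw [← hlam, colLen_sortDiagram, countP_ofFn]
    refine (Finset.card_bij (fun i _ => σ i) ?_ ?_ ?_).symm
    · intro i hi
      rw [mem_longCols] at hi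
      rw [Finset.mem_filter]
      exact ⟨Finset.mem_univ _, hi⟩
    · intro i _ j _ e
      exact σ.injective e
    · intro e he
      obtain ⟨i, rfl⟩ := σ.surjective e
      exact ⟨i, mem_longCols.2 (Finset.mem_filter.1 he).2, rfl⟩
  have hμL : ∀ i, μ i ≤ lam.rowLen 0 := by
    intro i
    by_contra hi
    have h1 := rowLen_zero_le_iff.1 (le_refl (lam.rowLen 0))
    rw [hcol, Finset.card_eq_zero] at h1
    have hm : i ∈ longCols μ (lam.rowLen 0) := mem_longCols.2 (by omega)
    rw [h1] at hm
    simp at hm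
  rw [asepPoly, permutedBasement]
  simp only [fillWeight_zero]
  have hsum : ∑ f : Filling μ with NonAttacking σ f,
      MvPolynomial.C (if coinv σ f = 0 then q ^ fillMaj σ f else 0) *
        ∏ i : Fin n, ∏ j : Fin (μ i), MvPolynomial.X (f i j) =
      ∑ f : Filling μ with NonAttacking σ f ∧ coinv σ f = 0,
        (MvPolynomial.C (q ^ fillMaj σ f) *
          ∏ i : Fin n, ∏ j : Fin (μ i), MvPolynomial.X (f i j) : MvPolynomial (Fin n) F) := by
    rw [← Finset.filter_filter, Finset.sum_filter (fun f => coinv σ f = 0)]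
    refine Finset.sum_congr rfl fun f _ => ?_
    split_ifs
    · rfl
    · rw [map_zero, zero_mul]
  refine hsum.trans ?_
  refine Finset.sum_bij (fun f _ => rowsMLQ μ fun r i => augmented σ f i (r + 1)) ?_ ?_ ?_ ?_
  · intro f hf
    have hg := (rowsGood_iff hμ).1 (Finset.mem_filter.1 hf).2
    rw [Finset.mem_filter, Set.Finite.mem_toFinset]
    refine ⟨fun r => by rw [hg.card_row, hcol], funext fun e => ?_⟩
    obtain ⟨i, rfl⟩ := σ.surjective e
    rw [hg.mlqType_eq hμ hμL, hαμ]
  · intro f hf f' hf' e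
    have hg := (rowsGood_iff hμ).1 (Finset.mem_filter.1 hf).2
    have hg' := (rowsGood_iff hμ).1 (Finset.mem_filter.1 hf').2
    funext i j
    have := hg.eq_of_rowsMLQ_eq hg' hμ e j i j.2
    rwa [augmented_succ f j.2, augmented_succ f' j.2] at this
  · intro M hM
    rw [Finset.mem_filter, Set.Finite.mem_toFinset] at hM
    obtain ⟨g, hg, hgM⟩ := exists_rowsGood (σ := σ) (isMLQ_of_mem hM.1) hμ
      (fun r => by rw [hM.1, hcol]) (fun i => by rw [hM.2, hαμ])
    have hent : ∀ r i, r < μ i →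
        augmented σ (fun i j => g j i : Filling μ) i (r + 1) = g r i := fun r i hi => by
      rw [augmented_succ _ hi]
    have hgood : RowsGood μ σ fun r i => augmented σ (fun i j => g j i : Filling μ) i (r + 1) := by
      refine ⟨fun i hi => ?_, fun r i i' hi hi' e => ?_, fun r i i' hii hi he => ?_,
        fun r i i' hii hi he => ?_⟩
      · rw [hent 0 i hi]; exact hg.base i hi
      · rw [hent r i hi, hent r i' hi'] at e
        exact hg.inj r i i' hi hi' e
      · rw [hent r i (by omega), hent (r + 1) i hi, hent (r + 1) i' (by omega)]
        exact hg.same r i i' hii hi he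
      · rw [hent r i hi, hent r i' (by omega), hent (r + 1) i' (by omega)]
        exact hg.diff r i i' hii hi he
    refine ⟨fun i j => g j i, ?_, ?_⟩
    · rw [Finset.mem_filter]
      exact ⟨Finset.mem_univ _, (rowsGood_iff hμ).2 hgood⟩
    · rw [← hgM]
      funext r
      refine Finset.image_congr fun i hi => ?_
      rw [Finset.mem_coe, mem_longCols] at hi
      exact hent r i hi
  · intro f hf
    have hg := (rowsGood_iff hμ).1 (Finset.mem_filter.1 hf).2
    rw [mlqMonomial_rowsMLQ hg hμL, hg.mlqMaj_eq hμ hμL, hg.fillMaj_eq]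

end Poly

/-! ### Expansion in quasisymmetric Schur functions. -/

section Expansion

variable {F : Type*} {n d : ℕ}

theorem sortDiagram_of_mem_weakLifts {γ : Composition d} {α : Fin n → ℕ} (h : α ∈ weakLifts n γ) :
    sortDiagram (List.ofFn α) = sortDiagram γ.blocks := by
  rw [← sortDiagram_compress, (Finset.mem_filter.1 h).2]

theorem mem_weakLifts {γ : Composition d} {α : Fin n → ℕ} :
    α ∈ weakLifts n γ ↔ compress α = γ.blocks := by
  refine ⟨fun h => (Finset.mem_filter.1 h).2, fun h => Finset.mem_filter.2 ⟨?_, h⟩⟩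
  rw [Finset.mem_piAntidiag]
  refine ⟨?_, fun i _ => Finset.mem_univ i⟩
  rw [← γ.blocks_sum, ← h, compress_sum]

open Classical in
/-- The quasisymmetric Macdonald polynomial at `t = 0` as a sum over multiline queues. -/
theorem quasiMacdonald_zero [Field F] (q : F) (n : ℕ) (γ : Composition d) {lam : YoungDiagram}
    (hlam : sortDiagram γ.blocks = lam) :
    quasiMacdonald q 0 n γ =
      ∑ M ∈ (MLQ_finite lam n).toFinset with strType (lam.rowLen 0) M = γ.blocks,
        MvPolynomial.C (q ^ mlqMaj (lam.rowLen 0) M) * mlqMonomial F (lam.rowLen 0) M := by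
  have hmaps : ∀ M ∈ (MLQ_finite lam n).toFinset.filter
      (fun M => strType (lam.rowLen 0) M = γ.blocks),
      mlqType (lam.rowLen 0) M ∈ weakLifts n γ := fun M hM =>
    mem_weakLifts.2 (Finset.mem_filter.1 hM).2
  rw [quasiMacdonald, ← Finset.sum_fiberwise_of_maps_to hmaps]
  refine Finset.sum_congr rfl fun α hα => ?_
  rw [asepPoly_zero q α ((sortDiagram_of_mem_weakLifts hα).trans hlam) rfl]
  refine Finset.sum_congr ?_ fun _ _ => rfl
  ext M
  simp only [Finset.mem_filter]
  refine ⟨fun h => ⟨⟨h.1, ?_⟩, h.2⟩, fun h => ⟨h.1.1, h.2⟩⟩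
  rw [strType, h.2, mem_weakLifts.1 hα]

open Classical in
/-- The quasisymmetric Schur function as a sum over nonwrapping multiline queues. -/
theorem quasiSchur_eq [CommSemiring F] (n : ℕ) (τ : Composition d) {μ : YoungDiagram}
    (hμ : sortDiagram τ.blocks = μ) :
    quasiSchur F n τ =
      ∑ M ∈ (MLQ_finite μ n).toFinset with
          mlqMaj (μ.rowLen 0) M = 0 ∧ strType (μ.rowLen 0) M = τ.blocks,
        mlqMonomial F (μ.rowLen 0) M := by
  have hmaps : ∀ M ∈ (MLQ_finite μ n).toFinset.filter
      (fun M => mlqMaj (μ.rowLen 0) M = 0 ∧ strType (μ.rowLen 0) M = τ.blocks),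
      mlqType (μ.rowLen 0) M ∈ weakLifts n τ := fun M hM =>
    mem_weakLifts.2 (Finset.mem_filter.1 hM).2.2
  rw [quasiSchur, ← Finset.sum_fiberwise_of_maps_to hmaps]
  refine Finset.sum_congr rfl fun α hα => ?_
  have he := (sortDiagram_of_mem_weakLifts hα).trans hμ
  rw [demazureAtom, he]
  refine Finset.sum_congr ?_ fun _ _ => rfl
  ext M
  simp only [Finset.mem_filter, Set.Finite.mem_toFinset, NMLQ, Set.mem_ofPred_eq, he]
  refine ⟨fun h => ⟨⟨h.1, h.2.1, ?_⟩, h.2.2⟩, fun h => ⟨h.1.1, h.1.2.1, h.2⟩⟩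
  rw [strType, h.2.2, mem_weakLifts.1 hα]

theorem strType_eq_of_rhoQ_eq {n n' L : ℕ} {M : GMLQ n} {M' : GMLQ n'} (hM : IsMLQ L M)
    (hM' : IsMLQ L M') (hQ : ∀ i j, rhoQ L M i j = rhoQ L M' i j)
    (h : strType L (rhoN L M) = strType L (rhoN L M')) : strType L M = strType L M' := by
  obtain ⟨m, hr, ht⟩ := isTab_of_isMLQ hM
  obtain ⟨m', hr', ht'⟩ := isTab_of_isMLQ hM'
  have hQ' : rhoQ L M = rhoQ L M' := funext fun i => funext fun j => hQ i j
  rw [hQ'] at ht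
  obtain rfl := ht.array_unique ht'
  exact strType_eq_of_records hM hM' hr hr' h

-- The bijection `M ↦ (Q, N)` sorted by the strong type `τ` of `N`. The condition on `Q` is tested
-- on another queue, the preimage of `(M_τ, Q)` on `N` columns; as the two collapsed queues have the
-- same strong type and the recording tableaux agree, the original queues have the same strong type
-- by `strType_eq_of_rhoQ_eq`.
open Classical in
theorem C_quasiKostka_mul_quasiSchur [CommSemiring F] (q : F) (n : ℕ) {N : ℕ}
    (γ τ : Composition d) (hN : τ.length ≤ N) {lam : YoungDiagram}
    (hlam : sortDiagram γ.blocks = lam) :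
    MvPolynomial.C ((quasiKostka N γ τ).eval₂ (Nat.castRingHom F) q) * quasiSchur F n τ =
      ∑ M ∈ (MLQ_finite lam n).toFinset with strType (lam.rowLen 0) M = γ.blocks ∧
          strType (lam.rowLen 0) (rhoN (lam.rowLen 0) M) = τ.blocks,
        MvPolynomial.C (q ^ mlqMaj (lam.rowLen 0) M) * mlqMonomial F (lam.rowLen 0) M := by
  obtain ⟨μ, hμ⟩ : ∃ μ, sortDiagram τ.blocks = μ := ⟨_, rfl⟩
  rw [quasiSchur_eq n τ hμ, quasiKostka, Polynomial.eval₂_finsetSum, map_sum, hlam]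
  set L := lam.rowLen 0 with hL
  have hst : straight N τ.blocks ∈ MLQ μ N := hμ ▸ straight_mem hN
  have hex : ∀ M : GMLQ n, M ∈ MLQ lam n → strType L (rhoN L M) = τ.blocks →
      rhoShape L M = μ := by
    intro M _ hs
    rw [rhoShape, ← sortDiagram_compress, ← hμ, ← hs, strType]
  have hstr : ∀ {M' : GMLQ N}, M' ∈ MLQ lam N → rhoN L M' = straight N τ.blocks →
      strType L (rhoN L M') = τ.blocks := by
    intro M' hM' e
    obtain ⟨m, hr, -⟩ := isTab_of_isMLQ (isMLQ_of_mem hM')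
    have h1 := (hr.isMLQ_rhoN (isMLQ_of_mem hM')).1
    rw [e] at h1 ⊢
    exact strType_straight h1 hN fun i hi => τ.blocks_pos hi
  subst hμ
  rw [Finset.sum_mul_sum, ← Finset.sum_product']
  symm
  have hQex : ∀ M ∈ (MLQ_finite lam n).toFinset.filter (fun M => strType L M = γ.blocks ∧
      strType L (rhoN L M) = τ.blocks),
      ∃ Q ∈ SSYT (sortDiagram τ.blocks).transpose lam.transpose,
        (∀ i j, Q i j = rhoQ L M i j) ∧ charge Q = mlqMaj L M := by
    intro M hM
    rw [Finset.mem_filter, Set.Finite.mem_toFinset] at hM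
    have h := exists_rhoQ hM.1
    rwa [← hL, hex M hM.1 hM.2.2] at h
  choose! Q hQ hQr hQc using hQex
  have hshape : ∀ M ∈ (MLQ_finite lam n).toFinset.filter (fun M => strType L M = γ.blocks ∧
      strType L (rhoN L M) = τ.blocks), rhoN L M ∈ NMLQ (mlqType L (rhoN L M)) ∧
      sortDiagram (List.ofFn (mlqType L (rhoN L M))) = sortDiagram τ.blocks := by
    intro M hM
    rw [Finset.mem_filter, Set.Finite.mem_toFinset] at hM
    exact ⟨rhoN_mem_NMLQ (isMLQ_of_mem hM.1), hex M hM.1 hM.2.2⟩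
  refine Finset.sum_bij (fun M _ => (Q M, rhoN L M)) ?_ ?_ ?_ ?_
  · intro M hM
    obtain ⟨hNM, hs⟩ := hshape M hM
    have hQ1 := hQ M hM
    have hQ2 := hQr M hM
    rw [Finset.mem_filter, Set.Finite.mem_toFinset] at hM
    obtain ⟨hM, hγ, hτ⟩ := hM
    rw [Finset.mem_product, Finset.mem_filter, Finset.mem_filter, Set.Finite.mem_toFinset]
    simp only [NMLQ, Set.mem_ofPred_eq, hs] at hNM
    refine ⟨⟨hQ1, ?_⟩, hNM.1, hNM.2.1, ?_⟩
    · obtain ⟨M', hM', hN', hQ'⟩ := rho_surjective hst rowHigh_straight hQ1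
      refine ⟨M', hM', hN', hQ', ?_⟩
      rw [← hγ]
      refine strType_eq_of_rhoQ_eq (isMLQ_of_mem hM') (isMLQ_of_mem hM)
        (fun i j => (hQ' i j).trans (hQ2 i j)) ?_
      rw [hτ, hstr hM' hN']
    · rw [strType, hNM.2.2]
      exact hτ
  · intro M hM M' hM' e
    rw [Prod.mk.injEq] at e
    have h1 := hQr M hM
    have h2 := hQr M' hM'
    rw [Finset.mem_filter, Set.Finite.mem_toFinset] at hM hM'
    exact rho_injective hM.1 hM'.1 e.2 fun i j => by rw [← hL, ← h1, ← h2, e.1]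
  · rintro ⟨T, K⟩ h
    rw [Finset.mem_product, Finset.mem_filter, Finset.mem_filter, Set.Finite.mem_toFinset] at h
    obtain ⟨⟨hT, M', hM', hN', hQ', hs'⟩, hK, hK0, hKs⟩ := h
    have hKM := isMLQ_of_mem hK
    obtain ⟨M, hM, hMN, hMQ⟩ := rho_surjective hK (hKM.maj_eq_zero_iff.1 hK0) hT
    obtain ⟨m, hr, -⟩ := isTab_of_isMLQ (isMLQ_of_mem hM)
    have h1 := (hr.isMLQ_rhoN (isMLQ_of_mem hM)).1
    have hMs : strType L (rhoN L M) = τ.blocks := by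
      rw [hMN] at h1
      rw [hL, hMN, strType, h1.mlqType_eq hKM]
      exact hKs
    have hmem : M ∈ (MLQ_finite lam n).toFinset.filter (fun M => strType L M = γ.blocks ∧
        strType L (rhoN L M) = τ.blocks) := by
      rw [Finset.mem_filter, Set.Finite.mem_toFinset]
      refine ⟨hM, ?_, hMs⟩
      rw [← hs']
      refine strType_eq_of_rhoQ_eq (isMLQ_of_mem hM) (isMLQ_of_mem hM')
        (fun i j => (hMQ i j).trans (hQ' i j).symm) ?_
      rw [hMs, hstr hM' hN']
    refine ⟨M, hmem, Prod.ext ?_ hMN⟩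
    ext i j
    rw [hQr M hmem, ← hMQ]
  · intro M hM
    obtain ⟨hNM, hs⟩ := hshape M hM
    simp only [NMLQ, Set.mem_ofPred_eq, hs] at hNM
    have hc := hQc M hM
    rw [Finset.mem_filter, Set.Finite.mem_toFinset] at hM
    -- The collapsed queue may have fewer nonempty rows than `M`; the additional empty rows do not
    -- affect its monomial.
    have hle : (sortDiagram τ.blocks).rowLen 0 ≤ L := by
      rw [← hs]
      exact rowLen_rhoShape_le (isMLQ_of_mem hM.1)
    simp only [Polynomial.eval₂_pow, Polynomial.eval₂_X, hc]
    rw [mlqMonomial_of_le F (isMLQ_of_mem hNM.1).empty hle, mlqMonomial_rhoN]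

/-- The composition with a given list of positive parts. -/
theorem exists_composition {l : List ℕ} (hpos : ∀ i ∈ l, 0 < i) (hsum : l.sum = d) :
    ∃ τ : Composition d, τ.blocks = l :=
  ⟨⟨l, fun {i} hi => hpos i hi, hsum⟩, rfl⟩

theorem exists_composition_rhoN {γ : Composition d} {M : GMLQ n} {lam : YoungDiagram}
    (hlam : sortDiagram γ.blocks = lam) (hM : M ∈ MLQ lam n) :
    ∃ τ : Composition d, Dominated (sortDiagram τ.blocks) lam ∧
      strType (lam.rowLen 0) (rhoN (lam.rowLen 0) M) = τ.blocks := by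
  have hs : sortDiagram (strType (lam.rowLen 0) (rhoN (lam.rowLen 0) M)) =
      rhoShape (lam.rowLen 0) M := sortDiagram_compress _
  obtain ⟨τ, hτ⟩ := exists_composition (d := d)
    (l := strType (lam.rowLen 0) (rhoN (lam.rowLen 0) M)) (fun i hi => compress_pos _ hi) (by
      rw [← card_sortDiagram, hs, card_rhoShape hM, ← hlam, card_sortDiagram, γ.blocks_sum])
  refine ⟨τ, ?_, hτ.symm⟩
  rw [hτ, hs]
  exact ⟨card_rhoShape hM, dominated_rhoShape hM⟩

end Expansion

end QuasiMac

open Classical in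
theorem mainTheorem2 {F : Type*} [Field F] (q : F) {d : ℕ} (γ : Composition d)
    (N : Composition d → ℕ) (hN : ∀ τ : Composition d, τ.length ≤ N τ) (n : ℕ) :
    QuasiMac.quasiMacdonald q 0 n γ =
      ∑ τ : Composition d with
          QuasiMac.Dominated (QuasiMac.sortDiagram τ.blocks) (QuasiMac.sortDiagram γ.blocks),
        MvPolynomial.C ((QuasiMac.quasiKostka (N τ) γ τ).eval₂ (Nat.castRingHom F) q) *
          QuasiMac.quasiSchur F n τ := by
  rw [QuasiMac.quasiMacdonald_zero q n γ rfl,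
    Finset.sum_congr rfl fun τ _ =>
      QuasiMac.C_quasiKostka_mul_quasiSchur q n γ τ (hN τ) rfl]
  set lam := QuasiMac.sortDiagram γ.blocks with hlam
  -- Each queue `M` of strong type `γ` is counted for exactly one `τ`, the strong type of its
  -- collapse; dominance holds automatically for this `τ`, so restricting the sum loses nothing.
  rw [Finset.sum_comm' (s' := fun M => Finset.univ.filter fun τ : Composition d =>
      QuasiMac.strType (lam.rowLen 0) (QuasiMac.rhoN (lam.rowLen 0) M) = τ.blocks)
    (t' := (QuasiMac.MLQ_finite lam n).toFinset.filter fun M =>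
      QuasiMac.strType (lam.rowLen 0) M = γ.blocks)]
  · refine Finset.sum_congr rfl fun M hM => ?_
    rw [Finset.mem_filter, Set.Finite.mem_toFinset] at hM
    obtain ⟨τ, -, hτ⟩ := QuasiMac.exists_composition_rhoN hlam.symm hM.1
    rw [Finset.sum_eq_single_of_mem τ (Finset.mem_filter.2 ⟨Finset.mem_univ _, hτ⟩)]
    intro τ' hτ' hne
    exact absurd (Composition.ext ((Finset.mem_filter.1 hτ').2.symm.trans hτ)) hne
  · intro τ M
    simp only [Finset.mem_filter, Finset.mem_univ, true_and, Set.Finite.mem_toFinset]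
    refine ⟨fun h => ⟨h.2.2.2, h.2.1, h.2.2.1⟩, fun h => ⟨?_, h.2.1, h.2.2, h.1⟩⟩
    obtain ⟨τ', hd, hτ⟩ := QuasiMac.exists_composition_rhoN hlam.symm h.2.1
    rwa [Composition.ext (h.1.symm.trans hτ)]
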